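/- **Theorem (short-edge jump residual terms).** Let $\Omega=(0,1)^2$, $0<\varepsilon\le 1$, and let $f=f(x,y;s)$ be continuous on $\Omega\times\mathbb R$ with $f(\cdot;s)$ bounded on $\Omega$ for every $s\in\mathbb R$, and satisfy, for some constants $C_f\ge 0$ and $L$ with $C_f+\varepsilon^2\ge 1$, $$f(x,y;s)-f(x,y;t)\ge C_f(s-t)\quad (s\ge t),\qquad |f(x,y;s)-f(x,y;t)|\le L|s-t|\qquad\text{on }\Omega .$$ Let $u\in H^1_0(\Omega)$ be the weak solution of $-\varepsilon^2\Delta u+f(x,y;u)=0$ in $\Omega$, $u=0$ on $\partial\Omega$. *Mesh.* Let $0=x_0<x_1<\dots<x_n=1$, and let $\mathcal T$ be a conforming triangulation of $\bar\Omega$ such that each $T\in\mathcal T$, for some $k$, has its shortest edge on the line $x=x_k$ and its remaining vertex on $x=x_{k+1}$ or $x=x_{k-1}$. Let $H_T$ be the maximum edge length of $T$ and $h_T:=2|T|/H_T$. For each node $z$, let $\omega_z$ be the union of the elements having $z$ as a vertex, $H_z:=\operatorname{diam}\omega_z$ and $h_z:=\max_{T\subset\omega_z}h_T$. With fixed constants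 $\lambda_0<\pi$, $N_0$, $c_0$, $\kappa$, $\lambda_1$, assume that all angles of all elements are at most $\lambda_0$ and that, for every node $z$ (including those on $\partial\Omega$): * at most $N_0$ elements contain $z$; * $z$ is anisotropic: $h_z<c_0H_z$, and $h_z\le\kappa h_T$, $H_z\le\kappa H_T$ for all $T\subset\omega_z$; * ($\mathcal A1_{\rm ani}$) the angles at $z$ of the elements $T\subset\omega_z$ are at most $\frac\pi2+\lambda_1\frac{h_z}{H_z}$. *Discretization.* Let $S_h$ be the space of continuous functions on $\bar\Omega$ that are affine on each $T\in\mathcal T$ and vanish on $\partial\Omega$, and let $u_h\in S_h$ satisfy, with $f_h:=f(\cdot;u_h)$, $$\varepsilon^2\langle\nabla u_h,\nabla v_h\rangle+\langle f_h,v_h\rangle_h=0\qquad\forall v_h\in S_h ,$$ where $\langle\cdot,\cdot\rangle$ is the $L_2(\Omega)$ inner product and $\langle f_h,\cdot\rangle_h$ is an approximation of $\langle f_h,\cdot\rangle$. Fix $1\le i\le n-1$, put $\Omega_i:=(x_{i-1},x_{i+1})\times(0,1)$, and suppose that one of the following holds: 1. (no quadrature in $\Omega_i$) $\langle f_h,v_h\rangle_h=\langle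 f_h,v_h\rangle$ for all $v_h\in S_h$ that vanish outside $\Omega_i$; 2. $f$ is continuous on $\bar\Omega\times\mathbb R$ and, for some set $\mathcal T^*$ of elements, $$\langle f_h,v_h\rangle_h=\sum_{T\in\mathcal T\setminus\mathcal T^*}\tfrac13|T|\sum_{j=1}^3 (f_hv_h)(z_j)+\sum_{T\in\mathcal T^*}\tfrac12|T|\,\bar f_{h;T}\,\bigl(v_h(z_1)+v_h(z_2)\bigr),\qquad \bar f_{h;T}:=\tfrac13\sum_{j=1}^3f_h(z_j),$$ where $z_1,z_2,z_3$ are the vertices of $T$, $z_1,z_2$ being the endpoints of its shortest edge; and either all elements $T\subset\bar\Omega_i$ belong to $\mathcal T^*$, or none of them does. *Conclusion.* Then $$\sum_{S\subset\{x=x_i\}}\min\{\varepsilon|S|,|\omega_S|\}\,(\varepsilon J_S)^2\;\le\; C\Bigl(\varepsilon^2\|\nabla(u_h-u)\|_{L_2(\Omega_i)}^2+C_f\|u_h-u\|_{L_2(\Omega_i)}^2+\sum_{T\subset\bar\Omega_i}|T|\,\bigl(\lambda_T\operatorname{osc}(f_h;T)\bigr)^2\Bigr).$$ Here the left-hand sum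 is over the edges $S$ of $\mathcal T$ lying on the line $x=x_i$; $\omega_S$ is the union of the two elements sharing $S$; $J_S$ is the sum over these two elements of the outward normal derivatives of $u_h$ on $S$; $\lambda_T:=\min\{1,H_T\varepsilon^{-1}\}$; and $\operatorname{osc}(f_h;T):=\sup_{T\cap\Omega} f_h-\inf_{T\cap\Omega} f_h$. The constant $C>0$ depends only on $\lambda_0,N_0,c_0,\kappa,\lambda_1$ and $L$; in particular, it is independent of $\varepsilon$, of $i$, and of the diameters and aspect ratios of the mesh elements. -/

import Mathlib

open MeasureTheory Filter Topology
open scoped ContDiff InnerProductSpace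

noncomputable section

namespace AnisoFEM

/-- Points of the Euclidean plane; `p 0` is the `x`-coordinate, `p 1` the `y`-coordinate. -/
abbrev Pt : Type := EuclideanSpace ℝ (Fin 2)

/-- The open unit square `(0,1)²`. -/
def unitSquare : Set Pt := {p | 0 < p 0 ∧ p 0 < 1 ∧ 0 < p 1 ∧ p 1 < 1}

/-! ### Triangles -/

/-- The closed triangle with vertex set `T`. -/
def hull (T : Finset Pt) : Set Pt := convexHull ℝ (T : Set Pt)

/-- `|T|`. -/
def area (T : Finset Pt) : ℝ := volume.real (hull T)

/-- Length of the edge with endpoint set `S`. -/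
def edgeLength (S : Finset Pt) : ℝ := Metric.diam (S : Set Pt)

/-- `H_T`, the maximal edge length of a triangle. -/
def maxEdge (T : Finset Pt) : ℝ := Metric.diam (T : Set Pt)

/-- `h_T = 2 |T| / H_T`, the minimal altitude. -/
def altitude (T : Finset Pt) : ℝ := 2 * area T / maxEdge T

/-- `a` is the vertex of `T` opposite a shortest edge of `T`. -/
def IsShortEdgeApex (T : Finset Pt) (a : Pt) : Prop :=
  a ∈ T ∧ ∀ p ∈ T, ∀ q ∈ T, p ≠ a → q ≠ a → p ≠ q →
    ∀ r ∈ T, ∀ s ∈ T, r ≠ s → dist p q ≤ dist r s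

/-- `ν` is the outward unit normal of the triangle `T` on its edge `S`. -/
def IsOutwardNormal (T S : Finset Pt) (ν : Pt) : Prop :=
  ‖ν‖ = 1 ∧ (∀ p ∈ S, ∀ q ∈ S, ⟪ν, q - p⟫_ℝ = 0) ∧
    ∀ p ∈ S, ∀ q ∈ T, q ∉ S → ⟪ν, q - p⟫_ℝ < 0

open Classical in
/-- The outward unit normal of the triangle `T` on its edge `S`. -/
def outwardNormal (T S : Finset Pt) : Pt :=
  if h : ∃ ν, IsOutwardNormal T S ν then h.choose else 0

/-- Oscillation of `v` over `D`. -/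
def osc (v : Pt → ℝ) (D : Set Pt) : ℝ := sSup (v '' D) - sInf (v '' D)

/-! ### Triangulations -/

/-- A conforming triangulation of `closure Ω`; an element is given by its set of three
vertices. -/
structure Triangulation (Ω : Set Pt) where
  elems : Finset (Finset Pt)
  card_eq : ∀ T ∈ elems, T.card = 3
  nondegenerate : ∀ T ∈ elems, AffineIndependent ℝ (fun p : T => (p : Pt))
  cover : (⋃ T ∈ elems, hull T) = closure Ω
  conforming : ∀ T ∈ elems, ∀ T' ∈ elems,
    hull T ∩ hull T' = convexHull ℝ ((T : Set Pt) ∩ (T' : Set Pt))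

namespace Triangulation

variable {Ω : Set Pt} (𝒯 : Triangulation Ω)

open Classical in
/-- The elements having the node `z` as a vertex. -/
def elemsAt (z : Pt) : Finset (Finset Pt) := 𝒯.elems.filter (fun T => z ∈ T)

open Classical in
/-- The set of nodes. -/
def nodes : Finset Pt := 𝒯.elems.biUnion id

open Classical in
/-- The set of edges, an edge being given by its two endpoints. -/
def edges : Finset (Finset Pt) := 𝒯.elems.biUnion (fun T => T.powersetCard 2)

open Classical in
/-- The edges that lie on the vertical line `x = t`. -/
def edgesOn (t : ℝ) : Finset (Finset Pt) := 𝒯.edges.filter (fun S => ∀ p ∈ S, p 0 = t)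

open Classical in
/-- The (one or two) elements having `S` as an edge; their union is `ω_S`. -/
def elemsAtEdge (S : Finset Pt) : Finset (Finset Pt) := 𝒯.elems.filter (fun T => S ⊆ T)

open Classical in
/-- The elements contained in (the closure of) `D`. -/
def elemsIn (D : Set Pt) : Finset (Finset Pt) := 𝒯.elems.filter (fun T => hull T ⊆ closure D)

/-- `|ω_S|`. -/
def edgePatchArea (S : Finset Pt) : ℝ := ∑ T ∈ 𝒯.elemsAtEdge S, area T

/-- `H_z = diam ω_z`. -/
def nodeDiam (z : Pt) : ℝ := Metric.diam (⋃ T ∈ 𝒯.elemsAt z, hull T)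

/-- `h_z`, the maximum of `h_T` over the elements at `z`. -/
def nodeAltitude (z : Pt) : ℝ := sSup (altitude '' (𝒯.elemsAt z : Set (Finset Pt)))

/-- All interior angles are at most `lam0`. -/
def MaxAngle (lam0 : ℝ) : Prop :=
  ∀ T ∈ 𝒯.elems, ∀ p ∈ T, ∀ q ∈ T, ∀ r ∈ T, p ≠ q → r ≠ q → p ≠ r →
    EuclideanGeometry.angle p q r ≤ lam0

/-- `z` is an anisotropic node: `h_z ≪ H_z` (with threshold `c₀`), and `h_T ∼ h_z`, `H_T ∼ H_z`
(with constant `κ`) for all elements `T` at `z`. The inequalities `h_T ≤ h_z` and `H_T ≤ H_z`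
hold by definition. -/
def IsAnisotropicNode (c₀ κ : ℝ) (z : Pt) : Prop :=
  𝒯.nodeAltitude z < c₀ * 𝒯.nodeDiam z ∧
    ∀ T ∈ 𝒯.elemsAt z, 𝒯.nodeAltitude z ≤ κ * altitude T ∧ 𝒯.nodeDiam z ≤ κ * maxEdge T

/-- All triangle angles at `z` are at most `π / 2 + lam1 * h_z / H_z`. -/
def QuasiNonObtuseAt (lam1 : ℝ) (z : Pt) : Prop :=
  ∀ T ∈ 𝒯.elemsAt z, ∀ p ∈ T, ∀ q ∈ T, p ≠ z → q ≠ z → p ≠ q →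
    EuclideanGeometry.angle p z q ≤ Real.pi / 2 + lam1 * (𝒯.nodeAltitude z / 𝒯.nodeDiam z)

/-- Alignment in the `x`-direction along the grid `x 0 < ⋯ < x n`: each element has its shortest
edge (the one opposite the vertex `apex T`) on a line `x = x k`, and its remaining vertex on one
of the two neighbouring lines. -/
def IsAligned (n : ℕ) (x : ℕ → ℝ) (apex : Finset Pt → Pt) : Prop :=
  ∀ T ∈ 𝒯.elems, IsShortEdgeApex T (apex T) ∧
    ∃ k ≤ n, (∀ p ∈ T, p ≠ apex T → p 0 = x k) ∧
      ∃ m ≤ n, (m = k + 1 ∨ m + 1 = k) ∧ (apex T) 0 = x m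

/-- The finite element space `S_h`: continuous piecewise affine functions vanishing on `∂Ω`
(only the values on `closure Ω` matter). -/
def IsFE (v : Pt → ℝ) : Prop :=
  ContinuousOn v (closure Ω) ∧
    (∀ T ∈ 𝒯.elems, ∃ (g : Pt) (c : ℝ), ∀ p ∈ hull T, v p = ⟪g, p⟫_ℝ + c) ∧
    ∀ p ∈ frontier Ω, v p = 0

/-- The gradient of a piecewise affine function on the element `T` (taken at the barycentre). -/
def gradOn (v : Pt → ℝ) (T : Finset Pt) : Pt := gradient v ((3 : ℝ)⁻¹ • ∑ p ∈ T, p)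

/-- `J_S = [∂_ν u_h]_S`, the sum over the elements at `S` of the outward normal derivatives. -/
def jump (v : Pt → ℝ) (S : Finset Pt) : ℝ :=
  ∑ T ∈ 𝒯.elemsAtEdge S, ⟪gradOn v T, outwardNormal T S⟫_ℝ

open Classical in
/-- The quadrature form `⟨f_h, v_h⟩_h` which uses the anisotropic formula, with nodes at the two
endpoints of the shortest edge, on the elements in `Tstar`, and the vertex formula on the other
elements; on the elements in `Tstar`, `f_h` is replaced by its average over the vertices. -/
def quadForm (apex : Finset Pt → Pt) (Tstar : Finset (Finset Pt)) (fh v : Pt → ℝ) : ℝ :=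
  ∑ T ∈ 𝒯.elems,
    if T ∈ Tstar then
      area T / 2 * ∑ z ∈ T.erase (apex T), ((∑ y ∈ T, fh y) / 3) * v z
    else area T / 3 * ∑ z ∈ T, fh z * v z

end Triangulation

/-! ### The boundary value problem -/

/-- `u ∈ H¹₀(Ω)` with (weak) gradient `g`: limit in `H¹(Ω)` of smooth functions with compact
support in `Ω`. -/
def IsH10 (Ω : Set Pt) (u : Pt → ℝ) (g : Pt → Pt) : Prop :=
  MemLp u 2 (volume.restrict Ω) ∧ MemLp g 2 (volume.restrict Ω) ∧
    ∃ φ : ℕ → Pt → ℝ,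
      (∀ k, ContDiff ℝ ∞ (φ k) ∧ HasCompactSupport (φ k) ∧ tsupport (φ k) ⊆ Ω) ∧
      Tendsto (fun k => eLpNorm (fun p => φ k p - u p) 2 (volume.restrict Ω)) atTop (𝓝 0) ∧
      Tendsto (fun k => eLpNorm (fun p => gradient (φ k) p - g p) 2 (volume.restrict Ω))
        atTop (𝓝 0)

/-- Assumptions on `f = f(x,y;s)`: continuous on `Ω × ℝ`, `f(·;s)` bounded on `Ω`, one-sided
Lipschitz condition with constant `Cf ≥ 0`, and Lipschitz condition with constant `L`. -/
structure IsAdmissible (Ω : Set Pt) (f : Pt → ℝ → ℝ) (Cf L : ℝ) : Prop where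
  continuousOn : ContinuousOn (fun q : Pt × ℝ => f q.1 q.2) (Ω ×ˢ Set.univ)
  bounded : ∀ s : ℝ, ∃ M : ℝ, ∀ p ∈ Ω, |f p s| ≤ M
  nonneg : 0 ≤ Cf
  monotone : ∀ p ∈ Ω, ∀ s t : ℝ, s ≤ t → Cf * (t - s) ≤ f p t - f p s
  lipschitz : ∀ p ∈ Ω, ∀ s t : ℝ, |f p t - f p s| ≤ L * |t - s|

/-- `u` (with gradient `gu`) is the weak solution of `-ε² Δu + f(x,y;u) = 0` in `Ω`, `u = 0` on
`∂Ω`. -/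
def IsWeakSolution (Ω : Set Pt) (ε : ℝ) (f : Pt → ℝ → ℝ) (u : Pt → ℝ) (gu : Pt → Pt) : Prop :=
  IsH10 Ω u gu ∧ ∀ (w : Pt → ℝ) (gw : Pt → Pt), IsH10 Ω w gw →
    ε ^ 2 * (∫ p in Ω, ⟪gu p, gw p⟫_ℝ) + ∫ p in Ω, f p (u p) * w p = 0

/-- `u_h ∈ S_h` solves `ε² ⟨∇u_h, ∇v_h⟩ + ⟨f_h, v_h⟩_h = 0` for all `v_h ∈ S_h`, where
`Qh v_h` stands for `⟨f_h, v_h⟩_h`. -/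
def IsDiscreteSolution {Ω : Set Pt} (𝒯 : Triangulation Ω) (ε : ℝ) (Qh : (Pt → ℝ) → ℝ)
    (uh : Pt → ℝ) : Prop :=
  𝒯.IsFE uh ∧ ∀ vh : Pt → ℝ, 𝒯.IsFE vh →
    ε ^ 2 * (∫ p in Ω, ⟪gradient uh p, gradient vh p⟫_ℝ) + Qh vh = 0

/-- The squared energy norm `ε² ‖∇e‖² + C_f ‖e‖²` over `D` of a function `e` with gradient `g`. -/
def energySq (ε Cf : ℝ) (D : Set Pt) (e : Pt → ℝ) (g : Pt → Pt) : ℝ :=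
  ε ^ 2 * (∫ p in D, ‖g p‖ ^ 2) + Cf * ∫ p in D, e p ^ 2

/-- `Ω_i = (x_{i-1}, x_{i+1}) × (0,1)` (for `1 ≤ i`). -/
def strip (x : ℕ → ℝ) (i : ℕ) : Set Pt :=
  {p | x (i - 1) < p 0 ∧ p 0 < x (i + 1) ∧ 0 < p 1 ∧ p 1 < 1}

/-- No quadrature in `D`: `⟨f_h, v_h⟩_h = ⟨f_h, v_h⟩` for all `v_h ∈ S_h` with support in `D`. -/
def NoQuadratureIn {Ω : Set Pt} (𝒯 : Triangulation Ω) (D : Set Pt) (Qh : (Pt → ℝ) → ℝ)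
    (fh : Pt → ℝ) : Prop :=
  ∀ vh : Pt → ℝ, 𝒯.IsFE vh → (∀ p ∈ Ω, p ∉ D → vh p = 0) → Qh vh = ∫ p in Ω, fh p * vh p

end AnisoFEM

end

open AnisoFEM

/-! The estimate is a local lower bound obtained by testing the weak equation for `u` with functions
that live in thin layers and have zero mean on every element. For `w` in `H¹₀` the equation gives
ε²⟨∇u_h,∇w⟩ = ε²⟨∇(u_h-u),∇w⟩ + ⟨f_h-f(·;u),w⟩ - ⟨f_h,w⟩. If `w` has zero mean on each `T`, a
constant may be subtracted from `f_h` there and the last term sees only osc(f_h;T). As ∇u_h is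
piecewise constant, the left side is a sum of ε² g_T · ∫_T ∇w, hence a combination of jumps of u_h
across edges. `Sol.abs_residual_le` bounds this sum by local errors `errT` times elementwise weights
of `w`; a layer of thickness about min(ε, local size) gives weights of the right order, including
the factor λ_T. The rest of the proof is the choice of `w`.

Long edges. A bubble λ_z λ_z' times a profile of zero mean, in a layer along the edge zz', isolates
the jump of ∇u_h across zz' (`long_edge_jump_le`). This jump is normal to the edge, and long edges
have slope at most about h/H, so the jump of ∂_x u_h is smaller by the factor h/H than that of ∂_y
u_h (`step_le`).

Nodes. Turning around a node z on one side of x = x_i crosses a bounded number of long edges, so ∂_x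
u_h hardly changes between the two vertical edges at z (`side_chain`). On y = 0 and y = 1 the turn
ends at a boundary edge where u_h = 0, hence ∂_x u_h = 0 in the last element (`side_boundary`). Thus
the jumps J_S at the edges S containing z agree with one number V(z), which is 0 at boundary nodes,
up to controlled terms (`jump_sub_nodeVal`).

Short edges. The test function for the whole line is the interpolant of V times a profile of
thickness at most min(ε, X₀)/2 around x = x_i, where X₀ is the width of a column. The profile `mM`
has vanishing moments of order 0 and 1. This gives zero mean both on elements with an edge on the
line and on those with a single vertex there, and removes all fluxes except those through the short
edges. The residual becomes Σ ε² |S| J_S · (mean of V on S), essentially the sum to be bounded.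
Differences of V, which carry the large gradient 1/h, are paid for by the node comparison; values of
V are absorbed into the left side by Young's inequality (`sum_edgeSq_le`).

Two further ingredients. The local errors contain the full L² norm of u_h-u; a Poincaré inequality
on vertical lines and C_f + ε² ≥ 1 turn it into the energy norm on the strip (`poincare`,
`Sol.sum_errT_le`). Admissibility of the piecewise C¹ test functions requires approximation by
smooth compactly supported functions, done by dilation about the centre and mollification
(`isH10_of_lipschitz`). The geometric input, comparable sizes around a node and the slope bound,
follows from the shortest-edge property and the angle condition at nodes (`Mesh.reg`). -/

open scoped Convolution

noncomputable section

namespace AnisoFEM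

/-! ### Barycentric coordinates -/

/-- The two-dimensional cross product. -/
def cr (u v : Pt) : ℝ := u 0 * v 1 - u 1 * v 0

/-- The barycentric coordinate belonging to `r` of the point `x` in the triangle `p q r`. -/
def bc (p q r x : Pt) : ℝ := cr (q - p) (x - p) / cr (q - p) (r - p)

/-- The gradient of `bc p q r`. -/
def gbc (p q r : Pt) : Pt :=
  WithLp.toLp 2 ![-((q - p) 1) / cr (q - p) (r - p), (q - p) 0 / cr (q - p) (r - p)]

lemma inner_eq (u v : Pt) : ⟪u, v⟫_ℝ = u 0 * v 0 + u 1 * v 1 := by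
  simp [PiLp.inner_apply, Fin.sum_univ_two, mul_comm]

lemma pt_ext {u v : Pt} (h0 : u 0 = v 0) (h1 : u 1 = v 1) : u = v := by
  ext i; fin_cases i <;> simpa

lemma norm_sq_eq (u : Pt) : ‖u‖ ^ 2 = u 0 ^ 2 + u 1 ^ 2 := by
  rw [← real_inner_self_eq_norm_sq, inner_eq]; ring

lemma cr_rot (p q r : Pt) : cr (r - q) (p - q) = cr (q - p) (r - p) := by
  simp only [cr, PiLp.sub_apply]; ring

lemma cr_swap (p q r : Pt) : cr (p - q) (r - q) = -cr (q - p) (r - p) := by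
  simp only [cr, PiLp.sub_apply]; ring

lemma bc_swap (p q r x : Pt) : bc q p r x = bc p q r x := by
  rw [bc, bc, cr_swap p q x, cr_swap p q r, neg_div_neg_eq]

lemma bc_affine (p q r x y : Pt) : bc p q r x - bc p q r y = ⟪gbc p q r, x - y⟫_ℝ := by
  simp only [bc, gbc, inner_eq, cr, PiLp.sub_apply]
  simp
  ring

lemma bc_eq (p q r x : Pt) : bc p q r x = ⟪gbc p q r, x⟫_ℝ + (bc p q r 0) := by
  have := bc_affine p q r x 0
  simp only [sub_zero] at this
  linarith

section
variable {p q r : Pt} (hD : cr (q - p) (r - p) ≠ 0)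
include hD

lemma bc_self : bc p q r r = 1 := div_self hD

omit hD in
lemma bc_left : bc p q r p = 0 := by simp [bc, cr]

omit hD in
lemma bc_right : bc p q r q = 0 := by
  have : cr (q - p) (q - p) = 0 := by simp only [cr]; ring
  simp [bc, this]

lemma bc_sum (x : Pt) : bc q r p x + bc r p q x + bc p q r x = 1 := by
  rw [bc, bc, bc, cr_rot p q r]
  have h2 : cr (p - r) (q - r) = cr (q - p) (r - p) := by
    simp only [cr, PiLp.sub_apply]; ring
  rw [h2, ← add_div, ← add_div, div_eq_one_iff_eq hD]
  simp only [cr, PiLp.sub_apply]; ring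

lemma bc_combo (x : Pt) : bc q r p x • p + bc r p q x • q + bc p q r x • r = x := by
  have h2 : cr (p - r) (q - r) = cr (q - p) (r - p) := by
    simp only [cr, PiLp.sub_apply]; ring
  rw [bc, bc, bc, cr_rot p q r, h2]
  apply pt_ext <;>
  · simp only [PiLp.add_apply, PiLp.smul_apply, smul_eq_mul]
    field_simp
    simp only [cr, PiLp.sub_apply]; ring

lemma gbc_sum : gbc q r p + gbc r p q + gbc p q r = 0 := by
  have h2 : cr (p - r) (q - r) = cr (q - p) (r - p) := by
    simp only [cr, PiLp.sub_apply]; ring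
  rw [gbc, gbc, gbc, cr_rot p q r, h2]
  apply pt_ext <;>
  · simp
    field_simp
    ring

lemma cr_rot_ne : cr (r - q) (p - q) ≠ 0 := by rwa [cr_rot]

lemma cr_rot_ne' : cr (p - r) (q - r) ≠ 0 := by
  have h2 : cr (p - r) (q - r) = cr (q - p) (r - p) := by
    simp only [cr, PiLp.sub_apply]; ring
  rwa [h2]

lemma cr_swap_ne : cr (p - q) (r - q) ≠ 0 := by rw [cr_swap]; exact neg_ne_zero.2 hD

end

/-- Half-planes containing the vertices are convex, which gives one direction; for the other the
coordinates themselves are the convex weights. -/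
lemma hull_nonneg_iff {p q r : Pt} (hD : cr (q - p) (r - p) ≠ 0) (x : Pt) :
    x ∈ hull {p, q, r} ↔ 0 ≤ bc q r p x ∧ 0 ≤ bc r p q x ∧ 0 ≤ bc p q r x := by
  constructor
  · intro hx
    have aux : ∀ a b c : Pt, cr (b - a) (c - a) ≠ 0 → (∀ y ∈ ({p, q, r} : Finset Pt), 0 ≤ bc a b c y) →
        0 ≤ bc a b c x := by
      intro a b c _ h
      have hc : Convex ℝ {y | 0 ≤ bc a b c y} := by
        intro y hy z hz s t hs ht hst
        simp only [Set.mem_ofPred_eq] at *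
        rw [bc_eq] at hy hz ⊢
        rw [inner_add_right, inner_smul_right, inner_smul_right]
        have : s * (⟪gbc a b c, y⟫_ℝ + bc a b c 0) + t * (⟪gbc a b c, z⟫_ℝ + bc a b c 0) =
          s * ⟪gbc a b c, y⟫_ℝ + t * ⟪gbc a b c, z⟫_ℝ + bc a b c 0 := by
          have : t = 1 - s := by linarith
          subst this; ring
        rw [← this]
        positivity
      exact convexHull_min (fun y hy => h y hy) hc hx
    have h1 := bc_self hD
    have h2 := bc_self (cr_rot_ne hD)
    have h3 := bc_self (cr_rot_ne' hD)
    refine ⟨aux _ _ _ (cr_rot_ne hD) ?_, aux _ _ _ (cr_rot_ne' hD) ?_, aux _ _ _ hD ?_⟩ <;>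
    · intro y hy
      simp only [Finset.mem_insert, Finset.mem_singleton] at hy
      rcases hy with rfl | rfl | rfl <;> simp [bc_left, bc_right, *]
  · rintro ⟨h1, h2, h3⟩
    have hs := bc_sum hD x
    rw [← bc_combo hD x]
    have hc := convex_convexHull ℝ (({p, q, r} : Finset Pt) : Set Pt)
    have hm : ∀ y ∈ ({p, q, r} : Finset Pt), y ∈ convexHull ℝ (({p, q, r} : Finset Pt) : Set Pt) :=
      fun y hy => subset_convexHull ℝ _ hy
    have := hc.sum_mem (t := (Finset.univ : Finset (Fin 3)))
      (w := ![bc q r p x, bc r p q x, bc p q r x]) (z := ![p, q, r])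
      (by intro i _; fin_cases i <;> simpa) (by simp [Fin.sum_univ_three, hs])
      (by intro i _; apply hm; fin_cases i <;> simp)
    simpa [Fin.sum_univ_three, hull] using this

@[fun_prop]
lemma contDiff_bc (p q r : Pt) {n : ℕ∞ω} : ContDiff ℝ n (bc p q r) := by
  have : bc p q r = fun x => ⟪gbc p q r, x⟫_ℝ + bc p q r 0 := funext fun x => bc_eq p q r x
  rw [this]
  exact (contDiff_const.inner ℝ contDiff_id).add contDiff_const

@[fun_prop]
lemma continuous_bc (p q r : Pt) : Continuous (bc p q r) := (contDiff_bc p q r (n := 0)).continuous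

lemma hasGradientAt_bc (p q r x : Pt) : HasGradientAt (bc p q r) (gbc p q r) x := by
  have : bc p q r = fun x => ⟪gbc p q r, x⟫_ℝ + bc p q r 0 := funext fun x => bc_eq p q r x
  rw [this]
  have h := ((InnerProductSpace.toDual ℝ Pt (gbc p q r)).hasFDerivAt (x := x)).add_const (bc p q r 0)
  rw [hasGradientAt_iff_hasFDerivAt]
  exact h

lemma mem_interior_of_pos {p q r : Pt} (hD : cr (q - p) (r - p) ≠ 0) {x : Pt}
    (h1 : 0 < bc q r p x) (h2 : 0 < bc r p q x) (h3 : 0 < bc p q r x) :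
    x ∈ interior (hull {p, q, r}) := by
  rw [mem_interior]
  refine ⟨{x | 0 < bc q r p x ∧ 0 < bc r p q x ∧ 0 < bc p q r x}, ?_, ?_, h1, h2, h3⟩
  · intro y hy
    exact (hull_nonneg_iff hD y).2 ⟨hy.1.le, hy.2.1.le, hy.2.2.le⟩
  · exact (isOpen_lt continuous_const (continuous_bc _ _ _)).inter
      ((isOpen_lt continuous_const (continuous_bc _ _ _)).inter
        (isOpen_lt continuous_const (continuous_bc _ _ _)))

lemma isCompact_hull (T : Finset Pt) : IsCompact (hull T) := T.finite_toSet.isCompact_convexHull ℝ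

lemma isClosed_hull (T : Finset Pt) : IsClosed (hull T) := (isCompact_hull T).isClosed

lemma measurableSet_hull (T : Finset Pt) : MeasurableSet (hull T) := (isClosed_hull T).measurableSet

lemma convex_hull (T : Finset Pt) : Convex ℝ (hull T) := convex_convexHull ℝ _

lemma volume_hull_lt_top (T : Finset Pt) : volume (hull T) < ⊤ := (isCompact_hull T).measure_lt_top

/-- The frontier of a convex set is null, so the gradient of a piecewise smooth function matters
only in the interiors of the elements. -/
lemma interior_ae (T : Finset Pt) : ∀ᵐ x ∂(volume.restrict (hull T)), x ∈ interior (hull T) := by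
  rw [ae_restrict_iff' (measurableSet_hull T)]
  have h := (convex_hull T).addHaar_frontier (μ := volume)
  rw [measure_eq_zero_iff_ae_notMem] at h
  filter_upwards [h] with x hx hxT
  by_contra hc
  exact hx ⟨subset_closure hxT, hc⟩

/-! ### Integration over a triangle -/

/-- The reference triangle. -/
def refTri : Set Pt := {σ | 0 ≤ σ 0 ∧ 0 ≤ σ 1 ∧ σ 0 + σ 1 ≤ 1}

lemma isClosed_refTri : IsClosed refTri := by
  have e0 : Continuous fun σ : Pt => σ 0 := by fun_prop
  have e1 : Continuous fun σ : Pt => σ 1 := by fun_prop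
  exact (isClosed_le continuous_const e0).inter ((isClosed_le continuous_const e1).inter
    (isClosed_le (e0.add e1) continuous_const))

/-- Linear map with columns `u`, `v`. -/
def colMap (u v : Pt) : Pt →L[ℝ] Pt :=
  LinearMap.toContinuousLinearMap
    { toFun := fun σ => σ 0 • u + σ 1 • v
      map_add' := by intro a b; simp only [PiLp.add_apply]; module
      map_smul' := by intro a b; simp only [PiLp.smul_apply, smul_eq_mul, RingHom.id_apply]; module }

lemma colMap_apply (u v σ : Pt) : colMap u v σ = σ 0 • u + σ 1 • v := rfl

lemma colMap_det (u v : Pt) : (colMap u v).det = cr u v := by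
  have : (colMap u v).det = LinearMap.det (colMap u v : Pt →ₗ[ℝ] Pt) := rfl
  rw [this, ← LinearMap.det_toMatrix (EuclideanSpace.basisFun (Fin 2) ℝ).toBasis, Matrix.det_fin_two]
  simp [LinearMap.toMatrix_apply, colMap_apply, cr]
  ring

/-- The column `r - p` comes first so that the first reference coordinate is the weight of `r`, that
is, the relative distance from the side `p q` along which layers are placed. -/
lemma image_refTri {p q r : Pt} (hD : cr (q - p) (r - p) ≠ 0) :
    (fun σ => p + colMap (r - p) (q - p) σ) '' refTri = hull {p, q, r} := by
  ext x
  rw [hull_nonneg_iff hD]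
  have hs := bc_sum hD x
  constructor
  · rintro ⟨σ, ⟨h0, h1, h2⟩, rfl⟩
    have e3 : bc p q r (p + colMap (r - p) (q - p) σ) = σ 0 := by
      rw [bc, div_eq_iff hD]
      simp only [colMap_apply, cr, PiLp.sub_apply, PiLp.add_apply, PiLp.smul_apply, smul_eq_mul]; ring
    have e2 : bc r p q (p + colMap (r - p) (q - p) σ) = σ 1 := by
      rw [bc, div_eq_iff (cr_rot_ne' hD)]
      simp only [colMap_apply, cr, PiLp.sub_apply, PiLp.add_apply, PiLp.smul_apply, smul_eq_mul]; ring
    dsimp only at hs ⊢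
    rw [e2, e3] at hs ⊢
    exact ⟨by linarith, h1, h0⟩
  · rintro ⟨h1, h2, h3⟩
    refine ⟨WithLp.toLp 2 ![bc p q r x, bc r p q x], ⟨by simpa, by simpa, ?_⟩, ?_⟩
    · simp; linarith
    · have := bc_combo hD x
      conv_rhs => rw [← this]
      simp only [colMap_apply]
      have e : bc q r p x = 1 - bc r p q x - bc p q r x := by linarith
      rw [e]
      simp
      module

lemma integral_refTri (F : Pt → ℝ) :
    ∫ x in refTri, F x = ∫ z in {z : ℝ × ℝ | 0 ≤ z.1 ∧ 0 ≤ z.2 ∧ z.1 + z.2 ≤ 1},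
      F (WithLp.toLp 2 ![z.1, z.2]) := by
  let e : Pt ≃ᵐ ℝ × ℝ := (MeasurableEquiv.toLp 2 (Fin 2 → ℝ)).symm.trans MeasurableEquiv.finTwoArrow
  have he : MeasurePreserving e volume volume :=
    (EuclideanSpace.volume_preserving_symm_measurableEquiv_toLp (Fin 2)).trans
      (volume_preserving_finTwoArrow ℝ)
  have h := he.setIntegral_preimage_emb e.measurableEmbedding
    (fun z => F (WithLp.toLp 2 ![z.1, z.2])) {z : ℝ × ℝ | 0 ≤ z.1 ∧ 0 ≤ z.2 ∧ z.1 + z.2 ≤ 1}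
  rw [← h]
  have hz : ∀ x : Pt, WithLp.toLp 2 ![(e x).1, (e x).2] = x := by
    intro x; apply pt_ext <;> simp [e, MeasurableEquiv.finTwoArrow]
  simp only [hz]
  congr 1

/-- Affine change of variables and Fubini, with the weight of `r` as outer variable: integrands that
are polynomial in the other weights collapse to one-dimensional integrals of a profile. -/
lemma integral_triangle {p q r : Pt} (hD : cr (q - p) (r - p) ≠ 0) {G : ℝ → ℝ → ℝ}
    (hG : Continuous fun z : ℝ × ℝ => G z.1 z.2) :
    ∫ x in hull {p, q, r}, G (bc p q r x) (bc r p q x) =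
      |cr (q - p) (r - p)| * ∫ s in (0 : ℝ)..1, ∫ t in (0 : ℝ)..(1 - s), G s t := by
  rw [← image_refTri hD, integral_image_eq_integral_abs_det_fderiv_smul volume
    isClosed_refTri.measurableSet
    (f' := fun _ => colMap (r - p) (q - p))]
  rotate_left
  · intro x _
    exact ((colMap (r - p) (q - p)).hasFDerivAt.const_add p).hasFDerivWithinAt
  · intro x _ y _ hxy
    have e3 : ∀ σ, bc p q r (p + colMap (r - p) (q - p) σ) = σ 0 := fun σ => by
      rw [bc, div_eq_iff hD]
      simp only [colMap_apply, cr, PiLp.sub_apply, PiLp.add_apply, PiLp.smul_apply, smul_eq_mul]; ring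
    have e2 : ∀ σ, bc r p q (p + colMap (r - p) (q - p) σ) = σ 1 := fun σ => by
      rw [bc, div_eq_iff (cr_rot_ne' hD)]
      simp only [colMap_apply, cr, PiLp.sub_apply, PiLp.add_apply, PiLp.smul_apply, smul_eq_mul]; ring
    dsimp only at hxy
    exact pt_ext (by rw [← e3, hxy, e3]) (by rw [← e2, hxy, e2])
  have e3 : ∀ σ, bc p q r (p + colMap (r - p) (q - p) σ) = σ 0 := fun σ => by
    rw [bc, div_eq_iff hD]
    simp only [colMap_apply, cr, PiLp.sub_apply, PiLp.add_apply, PiLp.smul_apply, smul_eq_mul]; ring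
  have e2 : ∀ σ, bc r p q (p + colMap (r - p) (q - p) σ) = σ 1 := fun σ => by
    rw [bc, div_eq_iff (cr_rot_ne' hD)]
    simp only [colMap_apply, cr, PiLp.sub_apply, PiLp.add_apply, PiLp.smul_apply, smul_eq_mul]; ring
  have hcr : |(colMap (r - p) (q - p)).det| = |cr (q - p) (r - p)| := by
    rw [colMap_det, ← abs_neg]; congr 1; simp only [cr]; ring
  simp only [e2, e3, hcr, smul_eq_mul]
  rw [integral_const_mul, integral_refTri]
  congr 1
  set R : Set (ℝ × ℝ) := {z : ℝ × ℝ | 0 ≤ z.1 ∧ 0 ≤ z.2 ∧ z.1 + z.2 ≤ 1}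
  have hRc : IsClosed R := (isClosed_le continuous_const continuous_fst).inter
    ((isClosed_le continuous_const continuous_snd).inter
      (isClosed_le (continuous_fst.add continuous_snd) continuous_const))
  have hRs : R ⊆ Set.Icc 0 1 ×ˢ Set.Icc 0 1 := by
    rintro ⟨a, b⟩ ⟨h1, h2, h3⟩
    simp only at h1 h2 h3
    exact ⟨⟨h1, by simp; linarith⟩, ⟨h2, by simp; linarith⟩⟩
  have hRk : IsCompact R := (isCompact_Icc.prod isCompact_Icc).of_isClosed_subset hRc hRs
  have hint : Integrable (R.indicator fun z : ℝ × ℝ => G z.1 z.2) (volume.prod volume) :=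
    (hG.continuousOn.integrableOn_compact hRk).integrable_indicator hRc.measurableSet
  have hsimp : ∫ z in R, G ((WithLp.toLp 2 ![z.1, z.2] : Pt) 0) ((WithLp.toLp 2 ![z.1, z.2] : Pt) 1)
      = ∫ z : ℝ × ℝ, R.indicator (fun z : ℝ × ℝ => G z.1 z.2) z := by
    rw [integral_indicator hRc.measurableSet]; simp
  rw [hsimp, Measure.volume_eq_prod, integral_prod _ hint, intervalIntegral.integral_of_le zero_le_one,
    ← integral_Icc_eq_integral_Ioc, ← integral_indicator measurableSet_Icc]
  congr 1
  ext s
  by_cases hs : s ∈ Set.Icc (0 : ℝ) 1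
  · rw [Set.indicator_of_mem hs, intervalIntegral.integral_of_le (by linarith [hs.2]),
      ← integral_Icc_eq_integral_Ioc, ← integral_indicator measurableSet_Icc]
    congr 1
    ext t
    by_cases ht : t ∈ Set.Icc (0 : ℝ) (1 - s)
    · rw [Set.indicator_of_mem ht, Set.indicator_of_mem]
      exact ⟨hs.1, ht.1, by have := ht.2; simp; linarith⟩
    · rw [Set.indicator_of_notMem ht, Set.indicator_of_notMem]
      rintro ⟨_, h2, h3⟩
      exact ht ⟨h2, by simp at h3; linarith⟩
  · rw [Set.indicator_of_notMem hs]
    have : (fun t => R.indicator (fun z : ℝ × ℝ => G z.1 z.2) (s, t)) = fun _ => 0 := by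
      ext t
      rw [Set.indicator_of_notMem]
      intro h
      exact hs (hRs h).1
    rw [this, integral_zero]

section
variable {p q r : Pt} (hD : cr (q - p) (r - p) ≠ 0)
include hD

/-- The section at level `s` has relative length `1 - s`. One or two further barycentric factors
replace this weight by a square or a cube, which decides which moments of a profile have to vanish.
-/
lemma integral_triangle_one {k : ℝ → ℝ} (hk : Continuous k) :
    ∫ x in hull {p, q, r}, k (bc p q r x) =
      |cr (q - p) (r - p)| * ∫ s in (0 : ℝ)..1, k s * (1 - s) := by
  rw [integral_triangle hD (G := fun s _ => k s) (by fun_prop)]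
  congr 2; ext s; simp; ring

lemma integral_triangle_right {k : ℝ → ℝ} (hk : Continuous k) :
    ∫ x in hull {p, q, r}, k (bc p q r x) * bc r p q x =
      |cr (q - p) (r - p)| * ∫ s in (0 : ℝ)..1, k s * (1 - s) ^ 2 / 2 := by
  rw [integral_triangle hD (G := fun s t => k s * t) (by fun_prop)]
  congr 2; ext s
  rw [intervalIntegral.integral_const_mul, integral_id]; ring

lemma integral_triangle_left {k : ℝ → ℝ} (hk : Continuous k) :
    ∫ x in hull {p, q, r}, k (bc p q r x) * bc q r p x =
      |cr (q - p) (r - p)| * ∫ s in (0 : ℝ)..1, k s * (1 - s) ^ 2 / 2 := by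
  have h := integral_triangle_right (cr_swap_ne hD) hk
  rw [cr_swap, abs_neg, Finset.insert_comm] at h
  rw [← h]
  congr 1
  ext x
  rw [bc_swap, bc_swap r q]

lemma integral_triangle_mul {k : ℝ → ℝ} (hk : Continuous k) :
    ∫ x in hull {p, q, r}, k (bc p q r x) * (bc r p q x * bc q r p x) =
      |cr (q - p) (r - p)| * ∫ s in (0 : ℝ)..1, k s * (1 - s) ^ 3 / 6 := by
  have h : ∀ x, k (bc p q r x) * (bc r p q x * bc q r p x) =
      (fun s t => k s * (t * (1 - s - t))) (bc p q r x) (bc r p q x) := by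
    intro x
    have := bc_sum hD x
    have e : bc q r p x = 1 - bc p q r x - bc r p q x := by linarith
    rw [e]
  simp only [h]
  rw [integral_triangle hD (G := fun s t => k s * (t * (1 - s - t))) (by fun_prop)]
  congr 2; ext s
  rw [intervalIntegral.integral_const_mul]
  have : ∀ t, t * (1 - s - t) = (1 - s) * t - t ^ 2 := fun t => by ring
  simp only [this]
  rw [intervalIntegral.integral_sub (by apply Continuous.intervalIntegrable; fun_prop)
    (by apply Continuous.intervalIntegrable; fun_prop), intervalIntegral.integral_const_mul, integral_id,
    integral_pow]
  norm_num
  ring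

lemma area_eq : area {p, q, r} = |cr (q - p) (r - p)| / 2 := by
  have h := integral_triangle_one hD (k := fun _ => 1) continuous_const
  simp only [setIntegral_const, one_mul, smul_eq_mul, mul_one] at h
  rw [area, h, intervalIntegral.integral_sub (by simp) (by simp)]
  simp
  ring

lemma area_pos : 0 < area {p, q, r} := by
  rw [area_eq hD]; have := abs_pos.2 hD; linarith

/-- The part of a triangle near the side opposite to `r` has area at most `2 σ |T|`. -/
lemma volume_strip_le {τ : ℝ} (hτ : 0 ≤ τ) :
    volume.real {x ∈ hull {p, q, r} | bc p q r x < τ} ≤ 4 * τ * area {p, q, r} := by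
  have hm : MeasurableSet {x ∈ hull {p, q, r} | bc p q r x < τ} :=
    (measurableSet_hull _).inter (isOpen_lt (continuous_bc p q r) continuous_const).measurableSet
  rcases hτ.eq_or_lt with rfl | hτ
  · have : {x ∈ hull {p, q, r} | bc p q r x < 0} = ∅ := by
      ext x
      simp only [Set.mem_ofPred_eq, Set.mem_empty_iff_false, iff_false, not_and, not_lt]
      exact fun hx => ((hull_nonneg_iff hD x).1 hx).2.2
    rw [this]; simp
  -- The cut-off `k` is at least 1/2 on the strip and its integral over [0,1] is at most τ. Half the
  -- measure of the strip is therefore at most |cr| τ = 2 τ |T|, whence the factor 4.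
  let k : ℝ → ℝ := fun s => max (1 - s / (2 * τ)) 0
  have hk : Continuous k := by fun_prop
  have h := integral_triangle_one hD hk
  have h1 : 1 / 2 * volume.real {x ∈ hull {p, q, r} | bc p q r x < τ} ≤
      ∫ x in hull {p, q, r}, k (bc p q r x) := by
    have hkc : Continuous fun x => k (bc p q r x) := hk.comp (continuous_bc p q r)
    have hi : IntegrableOn (fun x => k (bc p q r x)) (hull {p, q, r}) :=
      hkc.continuousOn.integrableOn_compact (isCompact_hull _)
    calc 1 / 2 * volume.real {x ∈ hull {p, q, r} | bc p q r x < τ}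
        = ∫ x in {x ∈ hull {p, q, r} | bc p q r x < τ}, (1 / 2 : ℝ) := by simp [mul_comm]
      _ ≤ ∫ x in {x ∈ hull {p, q, r} | bc p q r x < τ}, k (bc p q r x) := by
          apply setIntegral_mono_on _ (hi.mono_set fun x hx => hx.1) hm
          · rintro x ⟨-, hx⟩
            apply le_max_of_le_left
            have : bc p q r x / (2 * τ) ≤ 1 / 2 := by
              rw [div_le_iff₀ (by positivity)]; linarith
            linarith
          · refine integrableOn_const ?_
            exact ((measure_mono fun x hx => hx.1).trans_lt (volume_hull_lt_top {p, q, r})).ne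
      _ ≤ _ := setIntegral_mono_set hi (ae_of_all _ fun x => le_max_right _ _)
          (ae_of_all _ fun x hx => hx.1)
  have h2 : ∫ s in (0 : ℝ)..1, k s * (1 - s) ≤ τ := by
    let K : ℝ → ℝ := fun s => -τ * (max (1 - s / (2 * τ)) 0) ^ 2
    have hle : ∫ s in (0 : ℝ)..1, k s * (1 - s) ≤ ∫ s in (0 : ℝ)..1, k s := by
      apply intervalIntegral.integral_mono_on zero_le_one
      · apply Continuous.intervalIntegrable; fun_prop
      · apply Continuous.intervalIntegrable; fun_prop
      · intro s hs
        have : 0 ≤ k s := le_max_right _ _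
        nlinarith [hs.1]
    refine hle.trans ?_
    rcases le_total (2 * τ) 1 with h1 | h1
    · have e1 : ∫ s in (0 : ℝ)..1, k s = (∫ s in (0 : ℝ)..(2 * τ), k s) + ∫ s in (2 * τ)..1, k s :=
        (intervalIntegral.integral_add_adjacent_intervals (hk.intervalIntegrable _ _)
          (hk.intervalIntegrable _ _)).symm
      have e2 : ∫ s in (2 * τ)..1, k s = 0 := by
        rw [intervalIntegral.integral_congr (g := fun _ => 0)]
        · simp
        · intro s hs
          rw [Set.uIcc_of_le h1] at hs
          apply max_eq_right
          have : 1 ≤ s / (2 * τ) := by rw [le_div_iff₀ (by positivity)]; linarith [hs.1]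
          linarith
      have e3 : ∫ s in (0 : ℝ)..(2 * τ), k s = τ := by
        rw [intervalIntegral.integral_congr (g := fun s => 1 - s / (2 * τ))]
        · rw [intervalIntegral.integral_sub (by simp) (by apply Continuous.intervalIntegrable; fun_prop),
            intervalIntegral.integral_div, integral_id]
          simp; field_simp; ring
        · intro s hs
          rw [Set.uIcc_of_le (by positivity)] at hs
          apply max_eq_left
          have : s / (2 * τ) ≤ 1 := by rw [div_le_iff₀ (by positivity)]; linarith [hs.2]
          linarith
      rw [e1, e2, e3, add_zero]
    · rw [intervalIntegral.integral_congr (g := fun s => 1 - s / (2 * τ))]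
      · rw [intervalIntegral.integral_sub (by simp) (by apply Continuous.intervalIntegrable; fun_prop),
          intervalIntegral.integral_div, integral_id]
        have : 1 / (4 * τ) ≥ 1 - τ := by
          rw [ge_iff_le, le_div_iff₀ (by positivity)]; nlinarith [sq_nonneg (2 * τ - 1)]
        have e : (1 ^ 2 - 0 ^ 2) / 2 / (2 * τ) = 1 / (4 * τ) := by field_simp; ring
        rw [e]
        simp
        simp at this
        linarith
      · intro s hs
        rw [Set.uIcc_of_le zero_le_one] at hs
        apply max_eq_left
        have : s / (2 * τ) ≤ 1 := by rw [div_le_iff₀ (by positivity)]; linarith [hs.2]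
        linarith
  rw [h] at h1
  rw [area_eq hD]
  have := abs_pos.2 hD
  nlinarith [mul_le_mul_of_nonneg_left h2 this.le]

end

/-! ### Lipschitz functions from closed covers -/

/-- Continuity induction on [0,1]. To the right of a point `x` the finitely many pieces cover
everything, so one of them accumulates at `x`; being closed it also contains `x`, and its own
Lipschitz bound carries the estimate a little further. -/
lemma dist_le_of_finite_closed_cover {ι : Type*} [Finite ι] {g : ℝ → ℝ} {K : ℝ} {P : ι → Set ℝ}
    (hP : ∀ i, IsClosed (P i)) (hcov : ∀ t ∈ Set.Icc (0 : ℝ) 1, ∃ i, t ∈ P i)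
    (hg : ∀ i, ∀ s ∈ P i, ∀ t ∈ P i, |g s - g t| ≤ K * |s - t|) (hc : ContinuousOn g (Set.Icc 0 1)) :
    |g 1 - g 0| ≤ K := by
  have key : Set.Icc (0 : ℝ) 1 ⊆ {t | |g t - g 0| ≤ K * t} := by
    apply IsClosed.Icc_subset_of_forall_exists_gt
    · have h : ContinuousOn (fun t => K * t - |g t - g 0|) (Set.Icc 0 1) := by fun_prop
      have := h.preimage_isClosed_of_isClosed isClosed_Icc (isClosed_Ici (a := 0))
      convert this using 1
      ext t; simp [and_comm]
    · simp
    · rintro x ⟨hx, hx0, hx1⟩ y hy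
      -- a sequence decreasing to `x` stays frequently in one of the pieces
      have hfreq : ∃ i, ∃ᶠ t in 𝓝[>] x, t ∈ P i ∧ t < min y 1 := by
        by_contra hcon
        rw [not_exists] at hcon
        have hall : ∀ᶠ t in 𝓝[>] x, ∀ i, ¬(t ∈ P i ∧ t < min y 1) := by
          rw [eventually_all]
          intro i
          exact not_frequently.1 (hcon i)
        have hlt : ∀ᶠ t in 𝓝[>] x, t ∈ Set.Ioo x (min y 1) :=
          Ioo_mem_nhdsGT (lt_min hy hx1)
        obtain ⟨t, h1, h2⟩ := (hall.and hlt).exists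
        obtain ⟨i, hi⟩ := hcov t ⟨by linarith [h2.1], (h2.2.trans_le (min_le_right _ _)).le⟩
        exact h1 i ⟨hi, h2.2⟩
      obtain ⟨i, hi⟩ := hfreq
      have hxi : x ∈ P i := by
        have h2 : ∃ᶠ t in 𝓝 x, t ∈ P i :=
          (hi.mono fun t ht => ht.1).filter_mono nhdsWithin_le_nhds
        rw [← (hP i).closure_eq]
        exact mem_closure_iff_frequently.2 h2
      obtain ⟨t, ⟨ht, hty⟩, htx⟩ := (hi.and_eventually self_mem_nhdsWithin).exists
      refine ⟨t, ?_, htx, (hty.trans_le (min_le_left _ _)).le⟩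
      have h1 := hg i t ht x hxi
      have htx' : x < t := htx
      rw [abs_of_pos (sub_pos.2 htx')] at h1
      have h3 : |g t - g 0| ≤ |g t - g x| + |g x - g 0| := abs_sub_le _ _ _
      have h4 : |g x - g 0| ≤ K * x := hx
      change |g t - g 0| ≤ K * t
      linarith
  simpa using key ⟨zero_le_one, le_rfl⟩

/-- Restriction to segments reduces this to the line. A segment may cross the pieces in any manner,
so they need not be convex; the sum of their constants serves for all. -/
lemma lipschitzWith_of_finite_closed_cover {ι : Type*} [Finite ι] {w : Pt → ℝ} {P : ι → Set Pt}
    (hP : ∀ i, IsClosed (P i)) (hcov : ∀ p, ∃ i, p ∈ P i)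
    (hw : ∀ i, ∃ K, LipschitzOnWith K w (P i)) : ∃ K, LipschitzWith K w := by
  choose K hK using hw
  have := Fintype.ofFinite ι
  let K₀ := ∑ i, K i
  have hKi : ∀ i, K i ≤ K₀ := fun i => Finset.single_le_sum (f := K) (fun _ _ => zero_le) (Finset.mem_univ i)
  have hcont : Continuous w :=
    (locallyFinite_of_finite P).continuous (Set.eq_univ_of_forall fun p => by simpa using hcov p) hP
      fun i => (hK i).continuousOn
  refine ⟨K₀, LipschitzWith.of_dist_le_mul fun a b => ?_⟩
  let γ : ℝ → Pt := fun t => b + t • (a - b)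
  have hγ : Continuous γ := by fun_prop
  have h := dist_le_of_finite_closed_cover (g := w ∘ γ) (K := K₀ * dist a b)
    (P := fun i => γ ⁻¹' P i) (fun i => (hP i).preimage hγ) (fun t _ => hcov _)
    (fun i s hs t ht => ?_) (hcont.comp hγ).continuousOn
  · simpa [γ, Real.dist_eq] using h
  · have h1 := (hK i).dist_le_mul _ hs _ ht
    rw [Real.dist_eq] at h1
    refine h1.trans ?_
    have h2 : dist (γ s) (γ t) = |s - t| * dist a b := by
      have : γ s - γ t = (s - t) • (a - b) := by simp only [γ]; module
      rw [dist_eq_norm, this, norm_smul, dist_eq_norm, Real.norm_eq_abs]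
    rw [h2]
    have h3 : (K i : ℝ) ≤ K₀ := by exact_mod_cast hKi i
    calc (K i : ℝ) * (|s - t| * dist a b) ≤ K₀ * (|s - t| * dist a b) := by gcongr
      _ = _ := by ring

/-! ### Mollification -/

lemma tendsto_eLpNorm_two_of_bounded {α E : Type*} [MeasurableSpace α] [NormedAddCommGroup E]
    {μ : Measure α} [IsFiniteMeasure μ] {F : ℕ → α → E} {B : ℝ}
    (hF : ∀ k, AEStronglyMeasurable (F k) μ) (hB : ∀ k, ∀ᵐ x ∂μ, ‖F k x‖ ≤ B)
    (h0 : ∀ᵐ x ∂μ, Tendsto (fun k => F k x) atTop (𝓝 0)) :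
    Tendsto (fun k => eLpNorm (F k) 2 μ) atTop (𝓝 0) := by
  have h : Tendsto (fun k => ∫⁻ x, ‖F k x‖ₑ ^ (2 : ℝ) ∂μ) atTop (𝓝 (∫⁻ _, 0 ∂μ)) := by
    apply tendsto_lintegral_of_dominated_convergence' (fun _ => ENNReal.ofReal B ^ (2 : ℝ))
    · intro k; exact (hF k).enorm.pow_const _
    · intro k
      filter_upwards [hB k] with x hx
      gcongr
      rw [← ofReal_norm]
      exact ENNReal.ofReal_le_ofReal hx
    · rw [lintegral_const]
      exact ENNReal.mul_ne_top (ENNReal.rpow_ne_top_of_nonneg (by norm_num) ENNReal.ofReal_ne_top)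
        (measure_ne_top _ _)
    · filter_upwards [h0] with x hx
      have h1 : Tendsto (fun k => ‖F k x‖ₑ) atTop (𝓝 0) := by
        have := hx.enorm; simpa using this
      have := (ENNReal.continuous_rpow_const (y := 2)).tendsto 0 |>.comp h1
      simpa [Function.comp_def] using this
  rw [lintegral_zero] at h
  have h2 := (ENNReal.continuous_rpow_const (y := 1 / 2)).tendsto 0 |>.comp h
  simp only [ENNReal.zero_rpow_of_pos (show (0 : ℝ) < 1 / 2 by norm_num)] at h2
  refine h2.congr fun k => ?_
  rw [eLpNorm_eq_lintegral_rpow_enorm_toReal (by norm_num) (by norm_num)]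
  simp

lemma measurable_gradient (w : Pt → ℝ) : Measurable (gradient w) := by
  unfold gradient
  exact (LinearIsometryEquiv.continuous _).measurable.comp (measurable_fderiv ℝ w)

lemma norm_gradient (w : Pt → ℝ) (p : Pt) : ‖gradient w p‖ = ‖fderiv ℝ w p‖ := by
  simp [gradient]

lemma gradient_sub_eq (v w : Pt → ℝ) (p : Pt) :
    ‖gradient v p - gradient w p‖ = ‖fderiv ℝ v p - fderiv ℝ w p‖ := by
  rw [gradient, gradient, ← map_sub, LinearIsometryEquiv.norm_map]

lemma isOpen_unitSquare : IsOpen unitSquare := by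
  have e0 : Continuous fun σ : Pt => σ 0 := by fun_prop
  have e1 : Continuous fun σ : Pt => σ 1 := by fun_prop
  exact (isOpen_lt continuous_const e0).inter ((isOpen_lt e0 continuous_const).inter
    ((isOpen_lt continuous_const e1).inter (isOpen_lt e1 continuous_const)))

lemma abs_coord_le (u : Pt) (i : Fin 2) : |u i| ≤ ‖u‖ := by
  have := EuclideanSpace.norm_eq u
  have h := norm_sq_eq u
  apply abs_le_of_sq_le_sq _ (norm_nonneg _)
  rw [h]
  fin_cases i <;> simp <;> positivity

lemma norm_le_abs_add (u : Pt) : ‖u‖ ≤ |u 0| + |u 1| := by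
  apply le_of_sq_le_sq _ (by positivity)
  rw [norm_sq_eq]
  nlinarith [sq_abs (u 0), sq_abs (u 1), mul_nonneg (abs_nonneg (u 0)) (abs_nonneg (u 1))]

lemma isBounded_unitSquare : Bornology.IsBounded unitSquare := by
  rw [isBounded_iff_forall_norm_le]
  refine ⟨2, fun p hp => (norm_le_abs_add p).trans ?_⟩
  obtain ⟨h1, h2, h3, h4⟩ := hp
  rw [abs_of_pos h1, abs_of_pos h3]
  linarith

instance : IsFiniteMeasure (volume.restrict unitSquare) :=
  ⟨by rw [Measure.restrict_apply_univ]; exact isBounded_unitSquare.measure_lt_top⟩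

/-- If `W` is close to the linear map `D` on a ball, then so are its mollifications. -/
lemma conv_close (b : ContDiffBump (0 : Pt)) {W : Pt → ℝ} (hW : Continuous W) {D : Pt →L[ℝ] ℝ}
    {p : Pt} {ρ m : ℝ}
    (h : ∀ x ∈ Metric.ball p ρ, ∀ y ∈ Metric.ball p ρ, |W x - W y - D (x - y)| ≤ m * ‖x - y‖) :
    ∀ x ∈ Metric.ball p (ρ - b.rOut), ∀ y ∈ Metric.ball p (ρ - b.rOut),
      |(b.normed volume ⋆[ContinuousLinearMap.lsmul ℝ ℝ, volume] W) x -
        (b.normed volume ⋆[ContinuousLinearMap.lsmul ℝ ℝ, volume] W) y - D (x - y)| ≤ m * ‖x - y‖ := by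
  intro x hx y hy
  have hcs := b.hasCompactSupport_normed (μ := volume)
  have hcont := b.continuous_normed (μ := volume)
  have hint : ∀ z, Integrable (fun t => b.normed volume t * W (z - t)) := fun z =>
    (hcont.mul (hW.comp (continuous_const.sub continuous_id))).integrable_of_hasCompactSupport
      hcs.mul_right
  have hbi : Integrable (b.normed volume) volume := hcont.integrable_of_hasCompactSupport hcs
  simp only [convolution, ContinuousLinearMap.lsmul_apply, smul_eq_mul]
  have e1 : D (x - y) = ∫ t, b.normed volume t * D (x - y) := by
    rw [integral_mul_const, b.integral_normed, one_mul]
  have e2 := integral_sub ((hint x).sub (hint y)) (hbi.mul_const (D (x - y)))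
  simp only [Pi.sub_apply] at e2
  rw [e1, ← integral_sub (hint x) (hint y), ← e2]
  calc |∫ t, (b.normed volume t * W (x - t) - b.normed volume t * W (y - t) -
        b.normed volume t * D (x - y))|
      ≤ ∫ t, b.normed volume t * (m * ‖x - y‖) := by
        rw [← Real.norm_eq_abs]
        apply norm_integral_le_of_norm_le (hbi.mul_const _)
        refine ae_of_all _ fun t => ?_
        rw [Real.norm_eq_abs, show b.normed volume t * W (x - t) - b.normed volume t * W (y - t) -
          b.normed volume t * D (x - y) = b.normed volume t * (W (x - t) - W (y - t) - D (x - y)) by ring,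
          abs_mul, abs_of_nonneg (b.nonneg_normed t)]
        by_cases ht : t ∈ Metric.ball (0 : Pt) b.rOut
        · apply mul_le_mul_of_nonneg_left _ (b.nonneg_normed t)
          have hb : ∀ z ∈ Metric.ball p (ρ - b.rOut), z - t ∈ Metric.ball p ρ := by
            intro z hz
            rw [mem_ball_iff_norm] at hz ht ⊢
            rw [sub_zero] at ht
            calc ‖z - t - p‖ = ‖(z - p) - t‖ := by congr 1; abel
              _ ≤ ‖z - p‖ + ‖t‖ := norm_sub_le _ _
              _ < ρ := by linarith
          have := h _ (hb x hx) _ (hb y hy)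
          rwa [sub_sub_sub_cancel_right] at this
        · have : b.normed volume t = 0 := by
            rw [← Function.notMem_support, b.support_normed_eq]; exact ht
          simp [this]
    _ = _ := by rw [integral_mul_const, b.integral_normed, one_mul]

/-- Two-point closeness to a linear map is what averaging preserves; this turns it back into
closeness of derivatives. -/
lemma norm_fderiv_sub_le_of_close {φ : Pt → ℝ} {D : Pt →L[ℝ] ℝ} {p : Pt} {ρ m : ℝ} (hρ : 0 < ρ)
    (hm : 0 ≤ m) (hφ : DifferentiableAt ℝ φ p)
    (h : ∀ x ∈ Metric.ball p ρ, ∀ y ∈ Metric.ball p ρ, |φ x - φ y - D (x - y)| ≤ m * ‖x - y‖) :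
    ‖fderiv ℝ φ p - D‖ ≤ m := by
  have h1 : fderiv ℝ φ p - D = fderiv ℝ (fun x => φ x - D x) p := by
    rw [fderiv_fun_sub hφ D.differentiableAt, D.fderiv]
  rw [h1]
  apply norm_fderiv_le_of_lip' ℝ hm
  filter_upwards [Metric.ball_mem_nhds p hρ] with x hx
  have := h x hx p (Metric.mem_ball_self hρ)
  rw [map_sub] at this
  rw [Real.norm_eq_abs]
  convert this using 2
  ring

/-- Radius and dilation parameters of the `k`-th approximation. -/
def dl (k : ℕ) : ℝ := 1 / ((k : ℝ) + 1)

lemma dl_pos (k : ℕ) : 0 < dl k := by unfold dl; positivity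

lemma dl_le (k : ℕ) : dl k ≤ 1 := by
  unfold dl; rw [div_le_one (by positivity)]; linarith [Nat.cast_nonneg (α := ℝ) k]

lemma tendsto_dl : Tendsto dl atTop (𝓝 0) := tendsto_one_div_add_atTop_nhds_zero_nat

/-- The bump function used in the `k`-th approximation. -/
def bmp (k : ℕ) : ContDiffBump (0 : Pt) :=
  ⟨dl k / 16, dl k / 8, by have := dl_pos k; positivity, by have := dl_pos k; linarith⟩

/-- The centre of the unit square. -/
def ctr : Pt := WithLp.toLp 2 ![1 / 2, 1 / 2]

/-- The dilation about the centre of the unit square. -/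
def dil (k : ℕ) (p : Pt) : Pt := ctr + (1 + dl k) • (p - ctr)

/-- The `k`-th smooth approximation of `w`. -/
def moll (w : Pt → ℝ) (k : ℕ) : Pt → ℝ :=
  (bmp k).normed volume ⋆[ContinuousLinearMap.lsmul ℝ ℝ, volume] fun p => w (dil k p)

lemma continuous_dil (k : ℕ) : Continuous (dil k) := by unfold dil; fun_prop

lemma dil_sub (k : ℕ) (x y : Pt) : dil k x - dil k y = (1 + dl k) • (x - y) := by
  unfold dil; module

lemma contDiff_moll {w : Pt → ℝ} (hw : Continuous w) (k : ℕ) : ContDiff ℝ ∞ (moll w k) :=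
  HasCompactSupport.contDiff_convolution_left _ (bmp k).hasCompactSupport_normed
    (bmp k).contDiff_normed (hw.comp (continuous_dil k)).locallyIntegrable

/-- With δ = `dl k` ≤ 1 the dilation moves the support at least δ/4 away from the sides, because
1/(2(1+δ)) ≤ 1/2 - δ/4. The kernel of radius δ/8 uses up only half of this margin. -/
lemma tsupport_moll {w : Pt → ℝ} (h0 : ∀ p ∉ unitSquare, w p = 0) (k : ℕ) :
    tsupport (moll w k) ⊆ unitSquare ∧ HasCompactSupport (moll w k) := by
  have hpos := dl_pos k
  have hle := dl_le k
  set Z : Set Pt := {p | |p 0 - 1 / 2| ≤ 1 / 2 - dl k / 8 ∧ |p 1 - 1 / 2| ≤ 1 / 2 - dl k / 8}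
  have hZc : IsClosed Z := by
    have e0 : Continuous fun σ : Pt => |σ 0 - 1 / 2| := by fun_prop
    have e1 : Continuous fun σ : Pt => |σ 1 - 1 / 2| := by fun_prop
    exact (isClosed_le e0 continuous_const).inter (isClosed_le e1 continuous_const)
  have hZ : Z ⊆ unitSquare := by
    rintro p ⟨h1, h2⟩
    rw [abs_le] at h1 h2
    refine ⟨?_, ?_, ?_, ?_⟩ <;> linarith
  have hs : Function.support (moll w k) ⊆ Z := by
    intro p hp
    have hp' := support_convolution_subset_swap _ hp
    obtain ⟨a, ha, b, hb, rfl⟩ := hp'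
    rw [(bmp k).support_normed_eq, mem_ball_zero_iff] at hb
    have hb' : ‖b‖ < dl k / 8 := hb
    have ha' : dil k a ∈ unitSquare := by
      by_contra hc
      exact ha (h0 _ hc)
    obtain ⟨h1, h2, h3, h4⟩ := ha'
    simp only [dil, ctr, PiLp.add_apply, PiLp.smul_apply, PiLp.sub_apply, smul_eq_mul] at h1 h2 h3 h4
    simp at h1 h2 h3 h4
    have key : ∀ s : ℝ, 0 < 2⁻¹ + (1 + dl k) * (s - 2⁻¹) → 2⁻¹ + (1 + dl k) * (s - 2⁻¹) < 1 →
        |s - 1 / 2| ≤ 1 / 2 - dl k / 4 := by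
      intro s hs1 hs2
      rw [abs_le]
      constructor <;> by_contra hc <;> push Not at hc <;> nlinarith
    have k0 := key _ h1 h2
    have k1 := key _ h3 h4
    have b0 := abs_coord_le b 0
    have b1 := abs_coord_le b 1
    have add_le : ∀ s t : ℝ, |s - 1 / 2| ≤ 1 / 2 - dl k / 4 → |t| ≤ dl k / 8 →
        |s + t - 1 / 2| ≤ 1 / 2 - dl k / 8 := by
      intro s t hs ht
      rw [abs_le] at *
      constructor <;> linarith
    exact ⟨add_le _ _ k0 (b0.trans hb'.le), add_le _ _ k1 (b1.trans hb'.le)⟩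
  have ht : tsupport (moll w k) ⊆ Z := closure_minimal hs hZc
  refine ⟨ht.trans hZ, ?_⟩
  exact (Metric.isCompact_of_isClosed_isBounded hZc (isBounded_unitSquare.subset hZ)).of_isClosed_subset
    (isClosed_tsupport _) ht

lemma tendsto_dil (p : Pt) : Tendsto (fun k => dil k p) atTop (𝓝 p) := by
  have h : Tendsto (fun k => ctr + (1 + dl k) • (p - ctr)) atTop (𝓝 (ctr + (1 + (0 : ℝ)) • (p - ctr))) :=
    tendsto_const_nhds.add ((tendsto_const_nhds.add tendsto_dl).smul tendsto_const_nhds)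
  simpa [dil] using h

/-! ### Convergence of the mollifications of a Lipschitz function -/

section
variable {w : Pt → ℝ} {K : NNReal} (hw : LipschitzWith K w)
include hw

lemma dil_lip (k : ℕ) (x y : Pt) : |w (dil k x) - w (dil k y)| ≤ 2 * K * ‖x - y‖ := by
  have h := hw.dist_le_mul (dil k x) (dil k y)
  rw [Real.dist_eq, dist_eq_norm, dil_sub, norm_smul] at h
  refine h.trans ?_
  have h1 : ‖1 + dl k‖ ≤ 2 := by
    rw [Real.norm_eq_abs, abs_of_pos (by linarith [dl_pos k])]; linarith [dl_le k]
  calc (K : ℝ) * (‖1 + dl k‖ * ‖x - y‖) ≤ K * (2 * ‖x - y‖) := by gcongr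
    _ = _ := by ring

lemma norm_fderiv_moll_le (k : ℕ) (p : Pt) : ‖fderiv ℝ (moll w k) p‖ ≤ 2 * K := by
  have hc : Continuous fun p => w (dil k p) := hw.continuous.comp (continuous_dil k)
  have h := conv_close (bmp k) hc (D := 0) (p := p) (ρ := (bmp k).rOut + 1) (m := 2 * K)
    (fun x _ y _ => by simpa using dil_lip hw k x y)
  have h2 := norm_fderiv_sub_le_of_close (by linarith) (by positivity)
    ((contDiff_moll hw.continuous k).differentiable (by simp) p) h
  simpa using h2

lemma tendsto_moll (p : Pt) : Tendsto (fun k => moll w k p) atTop (𝓝 (w p)) := by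
  have h1 : Tendsto (fun k => w (dil k p)) atTop (𝓝 (w p)) :=
    (hw.continuous.tendsto p).comp (tendsto_dil p)
  have h2 : ∀ k, dist (moll w k p) (w (dil k p)) ≤ 2 * K * (dl k / 8) := by
    intro k
    refine ContDiffBump.dist_normed_convolution_le (g := fun p => w (dil k p))
      (hw.continuous.comp (continuous_dil k)).aestronglyMeasurable fun x hx => ?_
    rw [Real.dist_eq]
    refine (dil_lip hw k x p).trans ?_
    rw [mem_ball_iff_norm] at hx
    have : ‖x - p‖ ≤ dl k / 8 := hx.le
    gcongr
  have h3 : Tendsto (fun k => 2 * K * (dl k / 8)) atTop (𝓝 0) := by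
    have := (tendsto_dl.div_const 8).const_mul (2 * (K : ℝ))
    simpa using this
  exact (tendsto_iff_of_dist (squeeze_zero (fun _ => dist_nonneg) h2 h3)).2 h1

/-- Strict differentiability compares `w` with `D` for any two points near `p`, so the comparison
survives averaging; differentiability at the single point `p` would not suffice. -/
lemma tendsto_fderiv_moll {p : Pt} {D : Pt →L[ℝ] ℝ} (hD : HasStrictFDerivAt w D p) :
    Tendsto (fun k => fderiv ℝ (moll w k) p) atTop (𝓝 D) := by
  rw [Metric.tendsto_atTop]
  intro m hm
  -- Budget for `m`: the dilation at most doubles m/6 to m/3, the term `dl k * D` costs another m/6,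
  -- and the total m/2 is strictly below `m`.
  have hst := hD.isLittleO.bound (c := m / 6) (by positivity)
  rw [nhds_prod_eq, eventually_iff, Metric.nhds_basis_ball.prod_self.mem_iff] at hst
  obtain ⟨ρ, hρ, hst⟩ := hst
  have hst' : ∀ x ∈ Metric.ball p ρ, ∀ y ∈ Metric.ball p ρ, |w x - w y - D (x - y)| ≤ m / 6 * ‖x - y‖ :=
    fun x hx y hy => hst (Set.mk_mem_prod hx hy)
  have e1 : ∀ᶠ k in atTop, dil k p ∈ Metric.ball p (ρ / 2) :=
    (tendsto_dil p) (Metric.ball_mem_nhds p (by positivity))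
  have e2 : ∀ᶠ k in atTop, dl k * ‖D‖ < m / 6 := by
    have := tendsto_dl.mul_const ‖D‖
    rw [zero_mul] at this
    exact this (Iio_mem_nhds (by positivity))
  have e3 : ∀ᶠ k in atTop, dl k < ρ / 4 := tendsto_dl (Iio_mem_nhds (by positivity))
  obtain ⟨N, hN⟩ := eventually_atTop.1 (e1.and (e2.and e3))
  refine ⟨N, fun k hk => ?_⟩
  obtain ⟨h1, h2, h3⟩ := hN k hk
  have hr : (bmp k).rOut = dl k / 8 := rfl
  have hc : Continuous fun p => w (dil k p) := hw.continuous.comp (continuous_dil k)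
  have hball : ∀ x ∈ Metric.ball p (ρ / 4), dil k x ∈ Metric.ball p ρ := by
    intro x hx
    rw [mem_ball_iff_norm] at *
    have e : dil k x - p = (dil k p - p) + (1 + dl k) • (x - p) := by unfold dil; module
    rw [e]
    refine (norm_add_le _ _).trans_lt ?_
    rw [norm_smul, Real.norm_eq_abs, abs_of_pos (by linarith [dl_pos k])]
    nlinarith [dl_le k, norm_nonneg (x - p)]
  have h := conv_close (bmp k) hc (D := D) (p := p) (ρ := ρ / 4) (m := m / 2)
    (fun x hx y hy => by
      have g1 := hst' _ (hball x hx) _ (hball y hy)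
      have hp1 : 0 < 1 + dl k := by linarith [dl_pos k]
      rw [dil_sub, map_smul, norm_smul, Real.norm_eq_abs, abs_of_pos hp1, smul_eq_mul] at g1
      have g2 : |D (x - y)| ≤ ‖D‖ * ‖x - y‖ := D.le_opNorm _
      have g3 : |dl k * D (x - y)| ≤ m / 6 * ‖x - y‖ := by
        rw [abs_mul, abs_of_pos (dl_pos k)]
        calc dl k * |D (x - y)| ≤ dl k * (‖D‖ * ‖x - y‖) := by
              gcongr
              exact (dl_pos k).le
          _ = dl k * ‖D‖ * ‖x - y‖ := by ring
          _ ≤ _ := by gcongr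
      have g4 : m / 6 * ((1 + dl k) * ‖x - y‖) ≤ m / 3 * ‖x - y‖ := by
        have := dl_le k
        have : m / 6 * ((1 + dl k) * ‖x - y‖) = m / 6 * (1 + dl k) * ‖x - y‖ := by ring
        rw [this]
        gcongr
        nlinarith
      calc |w (dil k x) - w (dil k y) - D (x - y)|
          = |(w (dil k x) - w (dil k y) - (1 + dl k) * D (x - y)) + dl k * D (x - y)| := by
            congr 1; ring
        _ ≤ _ := abs_add_le _ _
        _ ≤ m / 2 * ‖x - y‖ := by linarith)
  have h5 := norm_fderiv_sub_le_of_close (by rw [hr]; linarith [dl_pos k]) (by positivity)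
    ((contDiff_moll hw.continuous k).differentiable (by simp) p) h
  rw [dist_eq_norm]
  exact h5.trans_lt (by linarith)

/-- The mollifications and their gradients are bounded uniformly on the square and converge almost
everywhere, so dominated convergence gives convergence in L². -/
lemma isH10_of_lipschitz (h0 : ∀ p ∉ unitSquare, w p = 0)
    (hs : ∀ᵐ p ∂(volume.restrict unitSquare), HasStrictFDerivAt w (fderiv ℝ w p) p) :
    IsH10 unitSquare w (gradient w) := by
  have hgl : ∀ p, ‖gradient w p‖ ≤ K := fun p => by
    rw [norm_gradient]; exact norm_fderiv_le_of_lipschitz ℝ hw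
  have hbd : ∀ p, |w p| ≤ |w 0| + K * ‖p‖ := by
    intro p
    have h1 := hw.dist_le_mul p 0
    rw [Real.dist_eq, dist_zero_right] at h1
    have := abs_sub_abs_le_abs_sub (w p) (w 0)
    linarith
  obtain ⟨R, hR⟩ := isBounded_iff_forall_norm_le.1 isBounded_unitSquare
  have hmem : ∀ᵐ p ∂(volume.restrict unitSquare), p ∈ unitSquare :=
    ae_restrict_mem isOpen_unitSquare.measurableSet
  have hgm := measurable_gradient w
  refine ⟨?_, ?_, moll w, fun k => ⟨contDiff_moll hw.continuous k, (tsupport_moll h0 k).2,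
    (tsupport_moll h0 k).1⟩, ?_, ?_⟩
  · refine MemLp.of_bound hw.continuous.aestronglyMeasurable (|w 0| + K * R) ?_
    filter_upwards [hmem] with p hp
    exact (hbd p).trans (by have := hR p hp; gcongr)
  · exact MemLp.of_bound hgm.aestronglyMeasurable K (ae_of_all _ hgl)
  · apply tendsto_eLpNorm_two_of_bounded (B := 2 * K * 1 + K * (2 * R + 2))
    · intro k
      exact ((contDiff_moll hw.continuous k).continuous.sub hw.continuous).aestronglyMeasurable
    · intro k
      filter_upwards [hmem] with p hp
      have h1 : dist (moll w k p) (w (dil k p)) ≤ 2 * K * 1 := by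
        refine ContDiffBump.dist_normed_convolution_le (g := fun p => w (dil k p))
          (hw.continuous.comp (continuous_dil k)).aestronglyMeasurable fun x hx => ?_
        rw [Real.dist_eq]
        refine (dil_lip hw k x p).trans ?_
        rw [mem_ball_iff_norm] at hx
        have h3 : ‖x - p‖ ≤ dl k / 8 := hx.le
        have : ‖x - p‖ ≤ 1 := by linarith [dl_le k]
        gcongr
      have h2 := hw.dist_le_mul (dil k p) p
      have h3 : dist (dil k p) p ≤ 2 * R + 2 := by
        have e : dil k p - p = dl k • (p - ctr) := by unfold dil; module
        rw [dist_eq_norm, e, norm_smul, Real.norm_eq_abs, abs_of_pos (dl_pos k)]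
        have hc : ‖ctr‖ ≤ 1 := by
          refine (norm_le_abs_add _).trans ?_
          simp [ctr]; norm_num [abs_of_pos]
        have h4 : ‖p - ctr‖ ≤ R + 1 := (norm_sub_le _ _).trans (add_le_add (hR p hp) hc)
        have := dl_le k
        have := dl_pos k
        have := norm_nonneg (p - ctr)
        nlinarith
      rw [Real.dist_eq] at h1 h2
      rw [Real.norm_eq_abs]
      calc |moll w k p - w p| ≤ |moll w k p - w (dil k p)| + |w (dil k p) - w p| := abs_sub_le _ _ _
        _ ≤ _ := add_le_add h1 (h2.trans (by gcongr))
    · refine ae_of_all _ fun p => ?_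
      have := (tendsto_moll hw p).sub_const (w p)
      simpa using this
  · apply tendsto_eLpNorm_two_of_bounded (B := 2 * K + K)
    · intro k
      exact ((measurable_gradient _).sub hgm).aestronglyMeasurable
    · intro k
      refine ae_of_all _ fun p => (norm_sub_le _ _).trans (add_le_add ?_ (hgl p))
      rw [norm_gradient]; exact norm_fderiv_moll_le hw k p
    · filter_upwards [hs] with p hp
      rw [tendsto_zero_iff_norm_tendsto_zero]
      simp only [gradient_sub_eq]
      have := (tendsto_fderiv_moll hw hp).sub_const (fderiv ℝ w p)
      rw [sub_self] at this
      exact tendsto_zero_iff_norm_tendsto_zero.1 this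

end

/-! ### Poincaré inequality -/

lemma isH10_sub {Ω : Set Pt} {v w : Pt → ℝ} {gv gw : Pt → Pt} (hv : IsH10 Ω v gv) (hw : IsH10 Ω w gw) :
    IsH10 Ω (fun p => v p - w p) (fun p => gv p - gw p) := by
  obtain ⟨hv1, hv2, φ, hφ, hφ1, hφ2⟩ := hv
  obtain ⟨hw1, hw2, ψ, hψ, hψ1, hψ2⟩ := hw
  have hgr : ∀ k p, gradient (fun p => φ k p - ψ k p) p = gradient (φ k) p - gradient (ψ k) p := by
    intro k p
    rw [gradient, gradient, gradient, ← map_sub, fderiv_fun_sub]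
    · exact (hφ k).1.differentiable (by simp) p
    · exact (hψ k).1.differentiable (by simp) p
  refine ⟨hv1.sub hw1, hv2.sub hw2, fun k p => φ k p - ψ k p, fun k => ⟨(hφ k).1.sub (hψ k).1, ?_, ?_⟩, ?_, ?_⟩
  · exact (hφ k).2.1.sub (hψ k).2.1
  · exact (tsupport_sub (φ k) (ψ k)).trans (Set.union_subset (hφ k).2.2 (hψ k).2.2)
  · have := hφ1.add hψ1
    rw [add_zero] at this
    refine tendsto_of_tendsto_of_tendsto_of_le_of_le tendsto_const_nhds this (fun _ => zero_le) fun k => ?_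
    have e : (fun p => φ k p - ψ k p - (v p - w p)) =
        (fun p => φ k p - v p) - (fun p => ψ k p - w p) := by ext p; simp; ring
    dsimp only
    rw [e]
    exact eLpNorm_sub_le ((hφ k).1.continuous.aestronglyMeasurable.sub hv1.1)
      ((hψ k).1.continuous.aestronglyMeasurable.sub hw1.1) (by norm_num)
  · have := hφ2.add hψ2
    rw [add_zero] at this
    refine tendsto_of_tendsto_of_tendsto_of_le_of_le tendsto_const_nhds this (fun _ => zero_le) fun k => ?_
    have e : (fun p => gradient (fun p => φ k p - ψ k p) p - (gv p - gw p)) =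
        (fun p => gradient (φ k) p - gv p) - (fun p => gradient (ψ k) p - gw p) := by
      ext1 p; rw [hgr]; simp only [Pi.sub_apply]; abel
    dsimp only
    rw [e]
    exact eLpNorm_sub_le ((measurable_gradient _).aestronglyMeasurable.sub hv2.1)
      ((measurable_gradient _).aestronglyMeasurable.sub hw2.1) (by norm_num)

lemma eLpNorm_two_le_iff {α E F : Type*} [MeasurableSpace α] [NormedAddCommGroup E]
    [NormedAddCommGroup F] {μ : Measure α} {f : α → E} {g : α → F} (hf : MemLp f 2 μ) (hg : MemLp g 2 μ) :
    eLpNorm f 2 μ ≤ eLpNorm g 2 μ ↔ ∫ x, ‖f x‖ ^ 2 ∂μ ≤ ∫ x, ‖g x‖ ^ 2 ∂μ := by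
  rw [hf.eLpNorm_eq_integral_rpow_norm (by norm_num) (by norm_num),
    hg.eLpNorm_eq_integral_rpow_norm (by norm_num) (by norm_num)]
  simp only [ENNReal.toReal_ofNat, Real.rpow_two]
  have h1 : 0 ≤ ∫ x, ‖f x‖ ^ 2 ∂μ := integral_nonneg fun _ => by positivity
  have h2 : 0 ≤ ∫ x, ‖g x‖ ^ 2 ∂μ := integral_nonneg fun _ => by positivity
  rw [ENNReal.ofReal_le_ofReal_iff (by positivity)]
  exact Real.rpow_le_rpow_iff h1 h2 (by norm_num)

/-- Cauchy–Schwarz in the form ∫(h - I)² ≥ 0 over [0,y], which reads (2 - y) I² ≤ ∫ h²; here 2 - y ≥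
1. -/
lemma sq_intervalIntegral_le {h : ℝ → ℝ} (hh : Continuous h) {y : ℝ} (h0 : 0 ≤ y) (h1 : y ≤ 1) :
    (∫ t in (0 : ℝ)..y, h t) ^ 2 ≤ ∫ t in (0 : ℝ)..1, h t ^ 2 := by
  set I := ∫ t in (0 : ℝ)..y, h t
  have e : ∫ t in (0 : ℝ)..y, (h t - I) ^ 2 = (∫ t in (0 : ℝ)..y, h t ^ 2) - 2 * I * I + y * I ^ 2 := by
    have : ∀ t, (h t - I) ^ 2 = h t ^ 2 - 2 * I * h t + I ^ 2 := fun t => by ring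
    simp only [this]
    rw [intervalIntegral.integral_add (by apply Continuous.intervalIntegrable; fun_prop) (by simp),
      intervalIntegral.integral_sub (by apply Continuous.intervalIntegrable; fun_prop)
        (by apply Continuous.intervalIntegrable; fun_prop), intervalIntegral.integral_const_mul]
    simp [I]
  have e2 : 0 ≤ ∫ t in (0 : ℝ)..y, (h t - I) ^ 2 :=
    intervalIntegral.integral_nonneg h0 fun _ _ => by positivity
  have e3 : ∫ t in (0 : ℝ)..y, h t ^ 2 ≤ ∫ t in (0 : ℝ)..1, h t ^ 2 :=
    intervalIntegral.integral_mono_interval le_rfl h0 h1 (ae_of_all _ fun _ => by positivity)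
      (by apply Continuous.intervalIntegrable; fun_prop)
  nlinarith [sq_nonneg I]

/-- The vertical strip `(a,b) × (0,1)`. -/
def vstrip (a b : ℝ) : Set Pt := {p | a < p 0 ∧ p 0 < b ∧ 0 < p 1 ∧ p 1 < 1}

lemma integral_vstrip {F : Pt → ℝ} (hF : Continuous F) (a b : ℝ) :
    ∫ p in vstrip a b, F p = ∫ s in Set.Ioo a b, ∫ t in (0 : ℝ)..1, F (WithLp.toLp 2 ![s, t]) := by
  let e : Pt ≃ᵐ ℝ × ℝ := (MeasurableEquiv.toLp 2 (Fin 2 → ℝ)).symm.trans MeasurableEquiv.finTwoArrow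
  have he : MeasurePreserving e volume volume :=
    (EuclideanSpace.volume_preserving_symm_measurableEquiv_toLp (Fin 2)).trans
      (volume_preserving_finTwoArrow ℝ)
  have h := he.setIntegral_preimage_emb e.measurableEmbedding
    (fun z => F (WithLp.toLp 2 ![z.1, z.2])) (Set.Ioo a b ×ˢ Set.Ioo 0 1)
  have hz : ∀ x : Pt, WithLp.toLp 2 ![(e x).1, (e x).2] = x := by
    intro x; apply pt_ext <;> simp [e, MeasurableEquiv.finTwoArrow]
  simp only [hz] at h
  have hs : e ⁻¹' (Set.Ioo a b ×ˢ Set.Ioo 0 1) = vstrip a b := by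
    ext p
    simp [e, vstrip, MeasurableEquiv.finTwoArrow, and_assoc]
  have hc : Continuous fun z : ℝ × ℝ => F (WithLp.toLp 2 ![z.1, z.2]) := by
    apply hF.comp
    apply (PiLp.continuous_toLp 2 _).comp
    rw [continuous_pi_iff]
    intro i; fin_cases i
    · exact continuous_fst
    · exact continuous_snd
  rw [hs] at h
  rw [h, Measure.volume_eq_prod, setIntegral_prod]
  · congr 1; ext s
    rw [intervalIntegral.integral_of_le zero_le_one, integral_Ioc_eq_integral_Ioo]
  · exact (hc.continuousOn.integrableOn_compact (isCompact_Icc.prod isCompact_Icc)).mono_set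
      (Set.prod_mono (Set.Ioo_subset_Icc_self (a := a) (b := b)) (Set.Ioo_subset_Icc_self (a := 0) (b := 1)))

/-- Integrate ∂_y φ upwards from the bottom side, where φ vanishes. Only vertical lines are used, so
the inequality localizes to every vertical strip, with constant 1 whatever its width. -/
lemma smooth_poincare {φ : Pt → ℝ} (hφ : ContDiff ℝ ∞ φ) (hs : tsupport φ ⊆ unitSquare) (a b : ℝ) :
    ∫ p in vstrip a b, φ p ^ 2 ≤ ∫ p in vstrip a b, ‖gradient φ p‖ ^ 2 := by
  have hgc : Continuous (gradient φ) := by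
    unfold gradient
    exact (LinearIsometryEquiv.continuous _).comp (hφ.continuous_fderiv (by simp))
  have hpc : ∀ s : ℝ, Continuous fun t : ℝ => (WithLp.toLp 2 ![s, t] : Pt) := by
    intro s
    apply (PiLp.continuous_toLp 2 _).comp
    rw [continuous_pi_iff]
    intro i; fin_cases i
    · exact continuous_const
    · exact continuous_id
  have hpc2 : Continuous fun z : ℝ × ℝ => (WithLp.toLp 2 ![z.1, z.2] : Pt) := by
    apply (PiLp.continuous_toLp 2 _).comp
    rw [continuous_pi_iff]
    intro i; fin_cases i
    · exact continuous_fst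
    · exact continuous_snd
  have main : ∀ s y : ℝ, y ∈ Set.Icc (0 : ℝ) 1 →
      φ (WithLp.toLp 2 ![s, y]) ^ 2 ≤ ∫ t in (0 : ℝ)..1, ‖gradient φ (WithLp.toLp 2 ![s, t])‖ ^ 2 := by
    intro s y hy
    let e1 : Pt := WithLp.toLp 2 ![0, 1]
    have hd : ∀ t : ℝ, HasDerivAt (fun t : ℝ => φ (WithLp.toLp 2 ![s, t]))
        (fderiv ℝ φ (WithLp.toLp 2 ![s, t]) e1) t := by
      intro t
      have h1 : HasDerivAt (fun t : ℝ => (WithLp.toLp 2 ![s, 0] : Pt) + t • e1) e1 t := by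
        simpa using ((hasDerivAt_id t).smul_const e1).const_add (WithLp.toLp 2 ![s, 0] : Pt)
      have h2 : ∀ t : ℝ, (WithLp.toLp 2 ![s, 0] : Pt) + t • e1 = WithLp.toLp 2 ![s, t] := by
        intro t; apply pt_ext <;> simp [e1]
      simp only [h2] at h1
      exact ((hφ.differentiable (by simp) _).hasFDerivAt).comp_hasDerivAt t h1
    have hcont : Continuous fun t : ℝ => fderiv ℝ φ (WithLp.toLp 2 ![s, t]) e1 :=
      ((hφ.continuous_fderiv (by simp)).comp (hpc s)).clm_apply continuous_const
    have h0 : φ (WithLp.toLp 2 ![s, 0]) = 0 := by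
      apply image_eq_zero_of_notMem_tsupport
      intro h
      have := (hs h).2.2.1
      simp at this
    have hftc := intervalIntegral.integral_eq_sub_of_hasDerivAt (a := 0) (b := y) (fun t _ => hd t)
      (hcont.intervalIntegrable _ _)
    rw [h0, sub_zero] at hftc
    rw [← hftc]
    refine (sq_intervalIntegral_le hcont hy.1 hy.2).trans ?_
    apply intervalIntegral.integral_mono_on zero_le_one
    · apply Continuous.intervalIntegrable; exact hcont.pow 2
    · apply Continuous.intervalIntegrable; exact ((hgc.comp (hpc s)).norm.pow 2)
    · intro t _
      rw [norm_gradient, ← sq_abs]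
      have h1 : |fderiv ℝ φ (WithLp.toLp 2 ![s, t]) e1| ≤ ‖fderiv ℝ φ (WithLp.toLp 2 ![s, t])‖ * ‖e1‖ :=
        (fderiv ℝ φ (WithLp.toLp 2 ![s, t])).le_opNorm e1
      have h2 : ‖e1‖ = 1 := by
        simp [e1, EuclideanSpace.norm_eq]
      rw [h2, mul_one] at h1
      gcongr
  rw [integral_vstrip (F := fun p => φ p ^ 2) (hφ.continuous.pow 2),
    integral_vstrip (F := fun p => ‖gradient φ p‖ ^ 2) (hgc.norm.pow 2)]
  have hint : ∀ F : Pt → ℝ, Continuous F → IntegrableOn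
      (fun s => ∫ t in (0 : ℝ)..1, F (WithLp.toLp 2 ![s, t])) (Set.Ioo a b) := by
    intro F hF
    have hc : Continuous fun s : ℝ => ∫ t in (0 : ℝ)..1, F (WithLp.toLp 2 ![s, t]) :=
      intervalIntegral.continuous_parametric_intervalIntegral_of_continuous'
        (f := fun s t => F (WithLp.toLp 2 ![s, t])) (hF.comp hpc2) 0 1
    exact (hc.continuousOn.integrableOn_compact isCompact_Icc).mono_set Set.Ioo_subset_Icc_self
  apply setIntegral_mono_on (hint _ (hφ.continuous.pow 2)) (hint _ (hgc.norm.pow 2)) measurableSet_Ioo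
  intro s _
  calc ∫ t in (0 : ℝ)..1, φ (WithLp.toLp 2 ![s, t]) ^ 2
      ≤ ∫ t in (0 : ℝ)..1, ∫ t in (0 : ℝ)..1, ‖gradient φ (WithLp.toLp 2 ![s, t])‖ ^ 2 := by
        apply intervalIntegral.integral_mono_on zero_le_one
        · apply Continuous.intervalIntegrable; exact (hφ.continuous.comp (hpc s)).pow 2
        · simp
        · intro t ht; exact main s t ht
    _ = _ := by simp

/-- Only L² norms pass to the limit; on the strip the approximation errors are dominated by those on
the whole square. -/
lemma poincare {w : Pt → ℝ} {g : Pt → Pt} (h : IsH10 unitSquare w g) {a b : ℝ}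
    (hab : vstrip a b ⊆ unitSquare) :
    ∫ p in vstrip a b, w p ^ 2 ≤ ∫ p in vstrip a b, ‖g p‖ ^ 2 := by
  obtain ⟨hw, hg, φ, hφ, h1, h2⟩ := h
  have hle : volume.restrict (vstrip a b) ≤ volume.restrict unitSquare := Measure.restrict_mono hab le_rfl
  have hw' := hw.mono_measure hle
  have hg' := hg.mono_measure hle
  have hfin : IsFiniteMeasure (volume.restrict (vstrip a b)) := isFiniteMeasure_of_le _ hle
  have hφm : ∀ k, MemLp (φ k) 2 (volume.restrict (vstrip a b)) := fun k =>
    ((hφ k).1.continuous.memLp_of_hasCompactSupport (hφ k).2.1).mono_measure Measure.restrict_le_self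
  have hgm : ∀ k, MemLp (gradient (φ k)) 2 (volume.restrict (vstrip a b)) := fun k => by
    have hgc : Continuous (gradient (φ k)) := by
      unfold gradient
      exact (LinearIsometryEquiv.continuous _).comp ((hφ k).1.continuous_fderiv (by simp))
    have hcs : HasCompactSupport (gradient (φ k)) := by
      have := (hφ k).2.1.fderiv (𝕜 := ℝ)
      exact this.comp_left (g := (InnerProductSpace.toDual ℝ Pt).symm) (map_zero _)
    exact (hgc.memLp_of_hasCompactSupport hcs).mono_measure Measure.restrict_le_self
  have key : eLpNorm w 2 (volume.restrict (vstrip a b)) ≤ eLpNorm g 2 (volume.restrict (vstrip a b)) := by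
    have hk : ∀ k, eLpNorm w 2 (volume.restrict (vstrip a b)) ≤
        eLpNorm g 2 (volume.restrict (vstrip a b)) +
        (eLpNorm (fun p => gradient (φ k) p - g p) 2 (volume.restrict unitSquare) +
          eLpNorm (fun p => φ k p - w p) 2 (volume.restrict unitSquare)) := by
      intro k
      have s1 : eLpNorm w 2 (volume.restrict (vstrip a b)) ≤ eLpNorm (φ k) 2 (volume.restrict (vstrip a b)) +
          eLpNorm (fun p => φ k p - w p) 2 (volume.restrict (vstrip a b)) := by
        have e : w = φ k - fun p => φ k p - w p := by ext p; simp
        conv_lhs => rw [e]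
        exact eLpNorm_sub_le (hφm k).1 ((hφm k).1.sub hw'.1) (by norm_num)
      have s2 : eLpNorm (gradient (φ k)) 2 (volume.restrict (vstrip a b)) ≤
          eLpNorm g 2 (volume.restrict (vstrip a b)) +
          eLpNorm (fun p => gradient (φ k) p - g p) 2 (volume.restrict (vstrip a b)) := by
        have e : gradient (φ k) = g + fun p => gradient (φ k) p - g p := by ext1 p; simp
        conv_lhs => rw [e]
        exact eLpNorm_add_le hg'.1 ((hgm k).1.sub hg'.1) (by norm_num)
      have s3 : eLpNorm (φ k) 2 (volume.restrict (vstrip a b)) ≤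
          eLpNorm (gradient (φ k)) 2 (volume.restrict (vstrip a b)) := by
        rw [eLpNorm_two_le_iff (hφm k) (hgm k)]
        simpa using smooth_poincare (hφ k).1 (hφ k).2.2 a b
      have s4 := eLpNorm_mono_measure (p := 2) (fun p => φ k p - w p) hle
      have s5 := eLpNorm_mono_measure (p := 2) (fun p => gradient (φ k) p - g p) hle
      calc _ ≤ _ := s1
        _ ≤ (eLpNorm g 2 (volume.restrict (vstrip a b)) +
          eLpNorm (fun p => gradient (φ k) p - g p) 2 (volume.restrict unitSquare)) +
          eLpNorm (fun p => φ k p - w p) 2 (volume.restrict unitSquare) :=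
            add_le_add ((s3.trans s2).trans (add_le_add le_rfl s5)) s4
        _ = _ := add_assoc _ _ _
    have ht := (tendsto_const_nhds (x := eLpNorm g 2 (volume.restrict (vstrip a b)))).add (h2.add h1)
    rw [add_zero, add_zero] at ht
    exact ge_of_tendsto' ht hk
  rw [eLpNorm_two_le_iff hw' hg'] at key
  simpa using key

/-! ### Combinatorics of aligned triangulations -/

/-- The consequences of alignment, with the vertices of each element named. -/
structure Mesh (𝒯 : Triangulation unitSquare) (n : ℕ) (x : ℕ → ℝ) : Prop where
  x_zero : x 0 = 0
  x_last : x n = 1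
  x_mono : ∀ k < n, x k < x (k + 1)
  elem : ∀ T ∈ 𝒯.elems, ∃ z₁ z₂ a : Pt, ∃ k m : ℕ, T = {z₁, z₂, a} ∧ k ≤ n ∧ m ≤ n ∧
    (m = k + 1 ∨ m + 1 = k) ∧ z₁ 0 = x k ∧ z₂ 0 = x k ∧ a 0 = x m ∧ z₁ 1 < z₂ 1 ∧
    dist z₁ z₂ ≤ dist z₁ a ∧ dist z₁ z₂ ≤ dist z₂ a

lemma Mesh.of_isAligned {𝒯 : Triangulation unitSquare} {n : ℕ} {x : ℕ → ℝ} {apex : Finset Pt → Pt}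
    (h0 : x 0 = 0) (hn : x n = 1) (hm : ∀ k < n, x k < x (k + 1)) (h : 𝒯.IsAligned n x apex) :
    Mesh 𝒯 n x := by
  refine ⟨h0, hn, hm, fun T hT => ?_⟩
  obtain ⟨⟨haT, hsh⟩, k, hk, hz, m, hmn, hkm, ha⟩ := h T hT
  generalize apex T = a at *
  have hc := 𝒯.card_eq T hT
  have hc2 : (T.erase a).card = 2 := by rw [Finset.card_erase_of_mem haT, hc]
  obtain ⟨z₁, z₂, hne, hz12⟩ := Finset.card_eq_two.1 hc2
  have hTe : T = {z₁, z₂, a} := by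
    rw [← Finset.insert_erase haT, hz12]
    ext y
    simp only [Finset.mem_insert, Finset.mem_singleton]
    tauto
  have m1 : z₁ ∈ T ∧ z₁ ≠ a := by
    have : z₁ ∈ T.erase a := by rw [hz12]; simp
    exact ⟨Finset.mem_of_mem_erase this, Finset.ne_of_mem_erase this⟩
  have m2 : z₂ ∈ T ∧ z₂ ≠ a := by
    have : z₂ ∈ T.erase a := by rw [hz12]; simp
    exact ⟨Finset.mem_of_mem_erase this, Finset.ne_of_mem_erase this⟩
  have e1 := hz z₁ m1.1 m1.2
  have e2 := hz z₂ m2.1 m2.2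
  have d1 := hsh z₁ m1.1 z₂ m2.1 m1.2 m2.2 hne z₁ m1.1 a haT m1.2
  have d2 := hsh z₁ m1.1 z₂ m2.1 m1.2 m2.2 hne z₂ m2.1 a haT m2.2
  have hne1 : z₁ 1 ≠ z₂ 1 := fun h => hne (pt_ext (by rw [e1, e2]) h)
  rcases hne1.lt_or_gt with hlt | hlt
  · exact ⟨z₁, z₂, a, k, m, hTe, hk, hmn, hkm, e1, e2, ha, hlt, d1, d2⟩
  · refine ⟨z₂, z₁, a, k, m, ?_, hk, hmn, hkm, e2, e1, ha, hlt, ?_, ?_⟩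
    · rw [hTe, Finset.insert_comm]
    · rwa [dist_comm z₂ z₁]
    · rwa [dist_comm z₂ z₁]

lemma convex_affine_eq (g : Pt) (c d : ℝ) : Convex ℝ {y : Pt | ⟪g, y⟫_ℝ + c = d} := by
  intro y hy z hz s t hs ht hst
  simp only [Set.mem_ofPred_eq] at *
  rw [inner_add_right, inner_smul_right, inner_smul_right]
  have : t = 1 - s := by linarith
  subst this
  linear_combination s * hy + (1 - s) * hz

lemma bc_eq_zero_of_mem {p q r : Pt} {S : Set Pt} (h : ∀ y ∈ S, bc p q r y = 0) {x : Pt}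
    (hx : x ∈ convexHull ℝ S) : bc p q r x = 0 := by
  rw [bc_eq]
  exact convexHull_min (fun y hy => by have := h y hy; rwa [bc_eq] at this)
    (convex_affine_eq (gbc p q r) (bc p q r 0) 0) hx

lemma bc_eq_bc_of_mem {p q p' q' r r' : Pt} {S : Set Pt} (h : ∀ y ∈ S, bc p q r y = bc p' q' r' y) {x : Pt}
    (hx : x ∈ convexHull ℝ S) : bc p q r x = bc p' q' r' x := by
  have := convexHull_min (fun y hy => by
    have := h y hy
    rw [bc_eq p q, bc_eq p' q'] at this
    change ⟪gbc p q r - gbc p' q' r', y⟫_ℝ + 0 = bc p' q' r' 0 - bc p q r 0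
    rw [inner_sub_left]; linarith)
    (convex_affine_eq (gbc p q r - gbc p' q' r') 0 (bc p' q' r' 0 - bc p q r 0)) hx
  change ⟪gbc p q r - gbc p' q' r', x⟫_ℝ + 0 = bc p' q' r' 0 - bc p q r 0 at this
  rw [inner_sub_left] at this
  rw [bc_eq p q, bc_eq p' q']; linarith

lemma closure_unitSquare_subset {p : Pt} (hp : p ∈ closure unitSquare) :
    (0 ≤ p 0 ∧ p 0 ≤ 1) ∧ 0 ≤ p 1 ∧ p 1 ≤ 1 := by
  have e0 : Continuous fun σ : Pt => σ 0 := by fun_prop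
  have e1 : Continuous fun σ : Pt => σ 1 := by fun_prop
  have hc : IsClosed {p : Pt | (0 ≤ p 0 ∧ p 0 ≤ 1) ∧ 0 ≤ p 1 ∧ p 1 ≤ 1} :=
    ((isClosed_le continuous_const e0).inter (isClosed_le e0 continuous_const)).inter
      ((isClosed_le continuous_const e1).inter (isClosed_le e1 continuous_const))
  have hs : unitSquare ⊆ {p : Pt | (0 ≤ p 0 ∧ p 0 ≤ 1) ∧ 0 ≤ p 1 ∧ p 1 ≤ 1} := by
    rintro q ⟨h1, h2, h3, h4⟩
    exact ⟨⟨h1.le, h2.le⟩, h3.le, h4.le⟩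
  exact closure_minimal hs hc hp

/-- The hat function of the node `z`. -/
def hat (𝒯 : Triangulation unitSquare) (z x : Pt) : ℝ :=
  open Classical in
  if h : ∃ p q : Pt, ({p, q, z} : Finset Pt) ∈ 𝒯.elems ∧ x ∈ hull {p, q, z} then
    bc h.choose h.choose_spec.choose z x else 0

namespace Mesh

variable {𝒯 : Triangulation unitSquare} {n : ℕ} {x : ℕ → ℝ} (M : Mesh 𝒯 n x)
include M

lemma strictMono {j k : ℕ} (hjk : j < k) (hk : k ≤ n) : x j < x k := by
  induction k, hjk using Nat.le_induction with
  | base => exact M.x_mono j (by omega)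
  | succ k hk' ih => exact (ih (by omega)).trans (M.x_mono k (by omega))

lemma injOn {j k : ℕ} (hj : j ≤ n) (hk : k ≤ n) (h : x j = x k) : j = k := by
  rcases lt_trichotomy j k with hl | hl | hl
  · have := M.strictMono hl hk; linarith
  · exact hl
  · have := M.strictMono hl hj; linarith

lemma x_pos {i : ℕ} (hi : 0 < i) (hin : i < n) : 0 < x i := by
  have := M.strictMono hi hin.le; rwa [M.x_zero] at this

lemma x_lt_one {i : ℕ} (hin : i < n) : x i < 1 := by
  have := M.strictMono hin le_rfl; rwa [M.x_last] at this

omit M in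
lemma ne_of_elem {p q r : Pt} (h : ({p, q, r} : Finset Pt) ∈ 𝒯.elems) : p ≠ q ∧ p ≠ r ∧ q ≠ r := by
  have hc := 𝒯.card_eq _ h
  refine ⟨?_, ?_, ?_⟩ <;> rintro rfl
  · have h2 := Finset.card_le_two (a := p) (b := r)
    simp only [Finset.insert_idem] at hc; omega
  · have h2 := Finset.card_le_two (a := q) (b := p)
    rw [Finset.insert_comm] at hc; simp only [Finset.pair_eq_singleton] at hc; omega
  · have h2 := Finset.card_le_two (a := p) (b := q)
    simp only [Finset.pair_eq_singleton] at hc; omega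

/-- Nondegeneracy can be read off the alignment: two distinct vertices lie on one mesh line and the
third lies off it. The other orderings only change the sign of the determinant. -/
lemma cr_ne {p q r : Pt} (h : ({p, q, r} : Finset Pt) ∈ 𝒯.elems) : cr (q - p) (r - p) ≠ 0 := by
  obtain ⟨hpq, hpr, hqr⟩ := ne_of_elem h
  obtain ⟨z₁, z₂, a, k, m, hT, hk, hm, hkm, e1, e2, e3, hlt, -, -⟩ := M.elem _ h
  have hkm' : x k ≠ x m := fun h => by have := M.injOn hk hm h; omega
  have h0 : cr (z₂ - z₁) (a - z₁) ≠ 0 := by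
    simp only [cr, PiLp.sub_apply, e1, e2, e3, sub_self, zero_mul, zero_sub]
    exact neg_ne_zero.2 (mul_ne_zero (sub_ne_zero.2 hlt.ne') (sub_ne_zero.2 hkm'.symm))
  have hp : p ∈ ({z₁, z₂, a} : Finset Pt) := by rw [← hT]; simp
  have hq : q ∈ ({z₁, z₂, a} : Finset Pt) := by rw [← hT]; simp
  have hr : r ∈ ({z₁, z₂, a} : Finset Pt) := by rw [← hT]; simp
  simp only [Finset.mem_insert, Finset.mem_singleton] at hp hq hr
  have h1 := cr_rot_ne h0
  have h2 := cr_rot_ne' h0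
  have h3 := cr_swap_ne h0
  have h4 := cr_swap_ne h1
  have h5 := cr_swap_ne h2
  rcases hp with rfl | rfl | rfl <;> rcases hq with rfl | rfl | rfl <;>
    rcases hr with rfl | rfl | rfl <;> first | exact absurd rfl ‹_› | assumption

omit M in
/-- A vertex of `T` with positive weight at a common point of `T` and `T'` is a vertex of `T'`. -/
lemma face {p q r y : Pt} {T' : Finset Pt} (hT : ({p, q, r} : Finset Pt) ∈ 𝒯.elems) (hT' : T' ∈ 𝒯.elems)
    (hy : y ∈ hull {p, q, r}) (hy' : y ∈ hull T') (hpos : 0 < bc p q r y) : r ∈ T' := by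
  by_contra hr
  have h := 𝒯.conforming _ hT _ hT'
  have hm : y ∈ convexHull ℝ ((({p, q, r} : Finset Pt) : Set Pt) ∩ (T' : Set Pt)) := by
    rw [← h]; exact ⟨hy, hy'⟩
  have := bc_eq_zero_of_mem (p := p) (q := q) (r := r) (fun w hw => ?_) hm
  · linarith
  · obtain ⟨hw1, hw2⟩ := hw
    simp only [Finset.coe_insert, Finset.coe_singleton, Set.mem_insert_iff, Set.mem_singleton_iff] at hw1
    rcases hw1 with rfl | rfl | rfl
    · exact bc_left
    · exact bc_right
    · exact absurd hw2 hr

omit M in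
lemma vertex_mem_closure {T : Finset Pt} (hT : T ∈ 𝒯.elems) : hull T ⊆ closure unitSquare := by
  rw [← 𝒯.cover]
  exact Set.subset_biUnion_of_mem (u := fun T => hull T) hT

omit M in
lemma mem_hull {T : Finset Pt} {p : Pt} (hp : p ∈ T) : p ∈ hull T := subset_convexHull ℝ _ hp

omit M in
lemma vertex_bounds {T : Finset Pt} (hT : T ∈ 𝒯.elems) {p : Pt} (hp : p ∈ T) :
    (0 ≤ p 0 ∧ p 0 ≤ 1) ∧ 0 ≤ p 1 ∧ p 1 ≤ 1 :=
  closure_unitSquare_subset (vertex_mem_closure hT (mem_hull hp))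

/-! #### Hat functions -/

/-- Makes the choice in the definition of `hat` immaterial. Two elements containing `y` meet in the
hull of their common vertices, and on these vertices both barycentric coordinates equal 1 at `r` and
0 elsewhere. -/
lemma hat_eq {p q r y : Pt} (hT : ({p, q, r} : Finset Pt) ∈ 𝒯.elems) (hy : y ∈ hull {p, q, r}) :
    hat 𝒯 r y = bc p q r y := by
  have hex : ∃ p q : Pt, ({p, q, r} : Finset Pt) ∈ 𝒯.elems ∧ y ∈ hull {p, q, r} := ⟨p, q, hT, hy⟩
  rw [hat, dif_pos hex]
  obtain ⟨h1, h2⟩ := hex.choose_spec.choose_spec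
  generalize hex.choose_spec.choose = q' at *
  generalize hex.choose = p' at *
  have h := 𝒯.conforming _ h1 _ hT
  have hm : y ∈ convexHull ℝ ((({p', q', r} : Finset Pt) : Set Pt) ∩ (({p, q, r} : Finset Pt) : Set Pt)) := by
    rw [← h]; exact ⟨h2, hy⟩
  refine bc_eq_bc_of_mem (fun w hw => ?_) hm
  obtain ⟨hw1, hw2⟩ := hw
  simp only [Finset.coe_insert, Finset.coe_singleton, Set.mem_insert_iff, Set.mem_singleton_iff] at hw1 hw2
  have n1 := ne_of_elem h1
  have n2 := ne_of_elem hT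
  by_cases hwr : w = r
  · subst hwr; rw [bc_self (M.cr_ne h1), bc_self (M.cr_ne hT)]
  · have a1 : bc p' q' r w = 0 := by
      rcases hw1 with rfl | rfl | rfl
      · exact bc_left
      · exact bc_right
      · exact absurd rfl hwr
    have a2 : bc p q r w = 0 := by
      rcases hw2 with rfl | rfl | rfl
      · exact bc_left
      · exact bc_right
      · exact absurd rfl hwr
    rw [a1, a2]

lemma hat_eq_zero {T : Finset Pt} {z y : Pt} (hT : T ∈ 𝒯.elems) (hy : y ∈ hull T) (hz : z ∉ T) :
    hat 𝒯 z y = 0 := by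
  rw [hat]
  split_ifs with hex
  · obtain ⟨h1, h2⟩ := hex.choose_spec.choose_spec
    generalize hex.choose_spec.choose = q' at *
    generalize hex.choose = p' at *
    by_contra hne
    have hpos : 0 < bc p' q' z y :=
      lt_of_le_of_ne ((hull_nonneg_iff (M.cr_ne h1) y).1 h2).2.2 (Ne.symm hne)
    exact hz (face h1 hT h2 hy hpos)
  · rfl

/-! #### Neighbouring elements -/

omit M in
lemma exists_third {T : Finset Pt} (hT : T ∈ 𝒯.elems) {p q : Pt} (hp : p ∈ T) (hq : q ∈ T) (hpq : p ≠ q) :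
    ∃ r, T = {p, q, r} := by
  have hc := 𝒯.card_eq T hT
  have h2 : ((T.erase p).erase q).card = 1 := by
    rw [Finset.card_erase_of_mem (Finset.mem_erase.2 ⟨hpq.symm, hq⟩), Finset.card_erase_of_mem hp, hc]
  obtain ⟨r, hr⟩ := Finset.card_eq_one.1 h2
  refine ⟨r, ?_⟩
  rw [← Finset.insert_erase hp, ← Finset.insert_erase (Finset.mem_erase.2 ⟨hpq.symm, hq⟩), hr]

omit M in
lemma bc_midpoint (p q r : Pt) : bc p q r ((1 / 2 : ℝ) • p + (1 / 2 : ℝ) • q) = 0 := by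
  rw [bc]
  have : cr (q - p) ((1 / 2 : ℝ) • p + (1 / 2 : ℝ) • q - p) = 0 := by
    simp only [cr, PiLp.sub_apply, PiLp.add_apply, PiLp.smul_apply, smul_eq_mul]; ring
  rw [this, zero_div]

omit M in
lemma bc_midpoint_left {p q r : Pt} (hD : cr (q - p) (r - p) ≠ 0) :
    bc q r p ((1 / 2 : ℝ) • p + (1 / 2 : ℝ) • q) = 1 / 2 := by
  rw [bc, div_eq_iff (cr_rot_ne hD)]
  simp only [cr, PiLp.sub_apply, PiLp.add_apply, PiLp.smul_apply, smul_eq_mul]; ring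

omit M in
lemma bc_midpoint_right {p q r : Pt} (hD : cr (q - p) (r - p) ≠ 0) :
    bc r p q ((1 / 2 : ℝ) • p + (1 / 2 : ℝ) • q) = 1 / 2 := by
  rw [bc, div_eq_iff (cr_rot_ne' hD)]
  simp only [cr, PiLp.sub_apply, PiLp.add_apply, PiLp.smul_apply, smul_eq_mul]; ring

/-- Approach the midpoint of the edge from outside the element. One of the finitely many elements
contains infinitely many of these points, hence the midpoint; by `face` it has both endpoints as
vertices, and a point with negative weight in the old element puts it on the other side. -/
lemma exists_neighbour {p q r : Pt} (hT : ({p, q, r} : Finset Pt) ∈ 𝒯.elems)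
    (hmid : (1 / 2 : ℝ) • p + (1 / 2 : ℝ) • q ∈ unitSquare) :
    ∃ r', ({p, q, r'} : Finset Pt) ∈ 𝒯.elems ∧ cr (q - p) (r' - p) * cr (q - p) (r - p) < 0 := by
  have hD := M.cr_ne hT
  set m : Pt := (1 / 2 : ℝ) • p + (1 / 2 : ℝ) • q with hm
  let y : ℕ → Pt := fun k => m + dl k • (m - r)
  have hy : Tendsto y atTop (𝓝 m) := by
    have : Tendsto (fun k => m + dl k • (m - r)) atTop (𝓝 (m + (0 : ℝ) • (m - r))) :=
      tendsto_const_nhds.add (tendsto_dl.smul tendsto_const_nhds)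
    simpa using this
  have hyΩ : ∀ᶠ k in atTop, y k ∈ unitSquare := hy (isOpen_unitSquare.mem_nhds hmid)
  have hbr : ∀ k, bc p q r (y k) < 0 := by
    intro k
    have h1 := bc_affine p q r (y k) m
    have h2 := bc_affine p q r m r
    have e : y k - m = dl k • (m - r) := by simp only [y]; module
    rw [e, inner_smul_right, ← h2, hm, bc_midpoint, bc_self hD] at h1
    have := dl_pos k
    linarith
  have hfreq : ∃ T' ∈ 𝒯.elems, ∃ᶠ k in atTop, y k ∈ hull T' := by
    by_contra hcon
    have hall : ∀ᶠ k in atTop, ∀ T' ∈ 𝒯.elems, ¬ y k ∈ hull T' := by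
      rw [Filter.eventually_all_finset]
      intro T' hT'
      exact not_frequently.1 fun h => hcon ⟨T', hT', h⟩
    obtain ⟨k, h1, h2⟩ := (hall.and hyΩ).exists
    have h3 : y k ∈ ⋃ T ∈ 𝒯.elems, hull T := by rw [𝒯.cover]; exact subset_closure h2
    simp only [Set.mem_iUnion] at h3
    obtain ⟨T', hT', h4⟩ := h3
    exact h1 T' hT' h4
  obtain ⟨T', hT', hf⟩ := hfreq
  have hmT' : m ∈ hull T' := by
    rw [← (isClosed_hull T').closure_eq]
    exact mem_closure_iff_frequently.2 (hy.frequently hf)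
  have hmT : m ∈ hull {p, q, r} := by
    rw [hull_nonneg_iff hD, bc_midpoint, bc_midpoint_left hD, bc_midpoint_right hD]; norm_num
  have hrot1 : ({q, r, p} : Finset Pt) = {p, q, r} := by ext; simp; tauto
  have hrot2 : ({r, p, q} : Finset Pt) = {p, q, r} := by ext; simp; tauto
  have hp : p ∈ T' := face (p := q) (q := r) (by rwa [hrot1]) hT' (by rwa [hrot1]) hmT'
    (by rw [bc_midpoint_left hD]; norm_num)
  have hq : q ∈ T' := face (p := r) (q := p) (by rwa [hrot2]) hT' (by rwa [hrot2]) hmT'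
    (by rw [bc_midpoint_right hD]; norm_num)
  obtain ⟨r', rfl⟩ := exists_third hT' hp hq (ne_of_elem hT).1
  refine ⟨r', hT', ?_⟩
  obtain ⟨k, hk⟩ := hf.exists
  have hD' := M.cr_ne hT'
  have hw := (hull_nonneg_iff hD' _).1 hk
  have e : bc p q r (y k) = bc p q r' (y k) * (cr (q - p) (r' - p) / cr (q - p) (r - p)) := by
    rw [bc, bc]; field_simp
  have hneg := hbr k
  rw [e] at hneg
  have h1 : cr (q - p) (r' - p) / cr (q - p) (r - p) < 0 := by
    by_contra hc
    push Not at hc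
    have := mul_nonneg hw.2.2 hc
    linarith
  rw [div_neg_iff] at h1
  rcases h1 with ⟨h1, h2⟩ | ⟨h1, h2⟩
  · exact mul_neg_of_pos_of_neg h1 h2
  · exact mul_neg_of_neg_of_pos h1 h2

/-- Points slightly inside the second element near the midpoint of the edge also lie in the first.
There `r'` has positive weight, so `face` makes it a vertex of the first element. -/
lemma neighbour_unique {p q r r' : Pt} (hT : ({p, q, r} : Finset Pt) ∈ 𝒯.elems)
    (hT' : ({p, q, r'} : Finset Pt) ∈ 𝒯.elems)
    (hside : 0 < cr (q - p) (r' - p) * cr (q - p) (r - p)) : r' = r := by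
  have hD := M.cr_ne hT
  have hD' := M.cr_ne hT'
  set m : Pt := (1 / 2 : ℝ) • p + (1 / 2 : ℝ) • q with hm
  let y : ℕ → Pt := fun k => m + dl k • (r' - m)
  have hy : Tendsto y atTop (𝓝 m) := by
    have : Tendsto (fun k => m + dl k • (r' - m)) atTop (𝓝 (m + (0 : ℝ) • (r' - m))) :=
      tendsto_const_nhds.add (tendsto_dl.smul tendsto_const_nhds)
    simpa using this
  have hmT' : m ∈ hull {p, q, r'} := by
    rw [hull_nonneg_iff hD', bc_midpoint, bc_midpoint_left hD', bc_midpoint_right hD']; norm_num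
  have h1 : ∀ᶠ k in atTop, 0 < bc q r p (y k) := by
    have := ((continuous_bc q r p).tendsto m).comp hy
    rw [hm, bc_midpoint_left hD] at this
    exact this (Ioi_mem_nhds (by norm_num))
  have h2 : ∀ᶠ k in atTop, 0 < bc r p q (y k) := by
    have := ((continuous_bc r p q).tendsto m).comp hy
    rw [hm, bc_midpoint_right hD] at this
    exact this (Ioi_mem_nhds (by norm_num))
  obtain ⟨k, hk1, hk2⟩ := (h1.and h2).exists
  have haff : ∀ a b c, bc a b c (y k) = bc a b c m + dl k * (bc a b c r' - bc a b c m) := by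
    intro a b c
    have g1 := bc_affine a b c (y k) m
    have g2 := bc_affine a b c r' m
    have e : y k - m = dl k • (r' - m) := by simp only [y]; module
    rw [e, inner_smul_right, ← g2] at g1
    linarith
  have hpos : ∀ s : Pt, 0 < bc p q s r' → 0 < bc p q s (y k) := by
    intro s hs
    rw [haff, hm, bc_midpoint, zero_add, sub_zero]
    exact mul_pos (dl_pos k) hs
  have hyT' : y k ∈ hull {p, q, r'} := by
    have : y k = (1 - dl k) • m + dl k • r' := by simp only [y]; module
    rw [this]
    exact convex_hull _ hmT' (mem_hull (by simp)) (by linarith [dl_le k]) (dl_pos k).le (by ring)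
  have hyT : y k ∈ hull {p, q, r} := by
    rw [hull_nonneg_iff hD]
    refine ⟨hk1.le, hk2.le, (hpos r ?_).le⟩
    rw [bc]
    rcases mul_pos_iff.1 hside with ⟨a1, a2⟩ | ⟨a1, a2⟩
    · exact div_pos a1 a2
    · exact div_pos_of_neg_of_neg a1 a2
  have hr' := face hT' hT hyT' hyT (hpos r' (by rw [bc_self hD']; norm_num))
  simp only [Finset.mem_insert, Finset.mem_singleton] at hr'
  have hne := ne_of_elem hT'
  rcases hr' with h | h | h
  · exact absurd h.symm hne.2.1
  · exact absurd h.symm hne.2.2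
  · exact h

/-- Vertical edges starting at `z` in the same direction coincide. -/
lemma vertical_unique {z a b q r : Pt} (hT : ({z, a, q} : Finset Pt) ∈ 𝒯.elems)
    (hT' : ({z, b, r} : Finset Pt) ∈ 𝒯.elems) (hq : q 0 = z 0) (hr : r 0 = z 0) (ha : a 0 ≠ z 0)
    (hb : b 0 ≠ z 0) (hdir : 0 < (q 1 - z 1) * (r 1 - z 1)) : q = r := by
  -- By symmetry `r` is the nearer endpoint. Then it lies on the edge from `z` to `q` with positive
  -- weight at `q`, and `face` forces `q` to be a vertex of the other element.
  have aux : ∀ {a b q r : Pt}, ({z, a, q} : Finset Pt) ∈ 𝒯.elems → ({z, b, r} : Finset Pt) ∈ 𝒯.elems →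
      q 0 = z 0 → r 0 = z 0 → b 0 ≠ z 0 → 0 < (q 1 - z 1) * (r 1 - z 1) →
      |r 1 - z 1| ≤ |q 1 - z 1| → q = r := by
    clear hT hT' hq hr ha hb hdir a b q r
    intro a b q r hT hT' hq hr hb hdir hle
    have hD := M.cr_ne hT
    have hqz : q 1 - z 1 ≠ 0 := fun h => by rw [h] at hdir; simp at hdir
    set t := (r 1 - z 1) / (q 1 - z 1) with ht
    have htpos : 0 < t := by
      rw [ht]
      rcases mul_pos_iff.1 hdir with ⟨a1, a2⟩ | ⟨a1, a2⟩
      · exact div_pos a2 a1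
      · exact div_pos_of_neg_of_neg a2 a1
    have htle : t ≤ 1 := by
      have : |t| ≤ 1 := by rw [ht, abs_div, div_le_one (abs_pos.2 hqz)]; exact hle
      exact (le_abs_self t).trans this
    have hre : r = (1 - t) • z + t • q := by
      apply pt_ext
      · simp only [PiLp.add_apply, PiLp.smul_apply, smul_eq_mul, hr, hq]
        ring
      · simp only [PiLp.add_apply, PiLp.smul_apply, smul_eq_mul, ht]
        field_simp
        ring
    have hrT : r ∈ hull {z, a, q} := by
      rw [hre]
      exact convex_hull _ (mem_hull (by simp)) (mem_hull (by simp)) (by linarith) htpos.le (by ring)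
    have hbc : bc z a q r = t := by
      have g := bc_affine z a q r z
      have g2 := bc_affine z a q q z
      have e : r - z = t • (q - z) := by rw [hre]; module
      rw [e, inner_smul_right, ← g2, bc_self hD, bc_left] at g
      linarith
    have hmem := face hT hT' hrT (mem_hull (by simp)) (by rw [hbc]; exact htpos)
    simp only [Finset.mem_insert, Finset.mem_singleton] at hmem
    rcases hmem with h | h | h
    · rw [h] at hqz; simp at hqz
    · rw [← h] at hb; exact absurd hq hb
    · exact h
  rcases le_total |r 1 - z 1| |q 1 - z 1| with h | h
  · exact aux hT hT' hq hr hb hdir h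
  · exact (aux hT' hT hr hq ha (by linarith) h).symm

/-- In an element with one vertex on each of two different mesh lines, the third vertex lies on
one of them. -/
lemma third_mem {p q r : Pt} (hT : ({p, q, r} : Finset Pt) ∈ 𝒯.elems) (hpq : p 0 ≠ q 0) :
    r 0 = p 0 ∨ r 0 = q 0 := by
  obtain ⟨z₁, z₂, a, k, m, hTe, hk, hm, hkm, e1, e2, e3, hlt, -, -⟩ := M.elem _ hT
  obtain ⟨n1, n2, n3⟩ := ne_of_elem hT
  have hp : p ∈ ({z₁, z₂, a} : Finset Pt) := by rw [← hTe]; simp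
  have hq : q ∈ ({z₁, z₂, a} : Finset Pt) := by rw [← hTe]; simp
  have hr : r ∈ ({z₁, z₂, a} : Finset Pt) := by rw [← hTe]; simp
  simp only [Finset.mem_insert, Finset.mem_singleton] at hp hq hr
  have e12 : z₁ 0 = z₂ 0 := by rw [e1, e2]
  rcases hp with rfl | rfl | rfl <;> rcases hq with rfl | rfl | rfl <;>
    rcases hr with rfl | rfl | rfl <;> simp_all

end Mesh

lemma mul_pos_of_mul_neg {s a b : ℝ} (h1 : s * a < 0) (h2 : b * a < 0) : 0 < s * b := by
  have h3 : 0 < s * b * a ^ 2 := by have := mul_pos_of_neg_of_neg h1 h2; linarith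
  exact pos_of_mul_pos_left h3 (sq_nonneg a)

namespace Mesh

/-- An edge joining two different mesh lines can lie in the boundary of the square only along y = 0
or y = 1; otherwise its midpoint is interior. -/
lemma mid_mem {p q : Pt} (hp : (0 ≤ p 0 ∧ p 0 ≤ 1) ∧ 0 ≤ p 1 ∧ p 1 ≤ 1)
    (hq : (0 ≤ q 0 ∧ q 0 ≤ 1) ∧ 0 ≤ q 1 ∧ q 1 ≤ 1) (hpq : p 0 ≠ q 0)
    (h : ¬ (p 1 = q 1 ∧ (p 1 = 0 ∨ p 1 = 1))) :
    (1 / 2 : ℝ) • p + (1 / 2 : ℝ) • q ∈ unitSquare := by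
  obtain ⟨⟨a1, a2⟩, a3, a4⟩ := hp
  obtain ⟨⟨b1, b2⟩, b3, b4⟩ := hq
  have key : ∀ s t : ℝ, 0 ≤ s → s ≤ 1 → 0 ≤ t → t ≤ 1 → ¬(s = t ∧ (s = 0 ∨ s = 1)) →
      0 < 1 / 2 * s + 1 / 2 * t ∧ 1 / 2 * s + 1 / 2 * t < 1 := by
    intro s t h1 h2 h3 h4 h5
    constructor <;> by_contra hc <;> push Not at hc <;> apply h5
    · exact ⟨by linarith, Or.inl (by linarith)⟩
    · exact ⟨by linarith, Or.inr (by linarith)⟩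
  have k0 := key _ _ a1 a2 b1 b2 (fun h => hpq h.1)
  have k1 := key _ _ a3 a4 b3 b4 h
  refine ⟨?_, ?_, ?_, ?_⟩ <;> simp only [PiLp.add_apply, PiLp.smul_apply, smul_eq_mul]
  exacts [k0.1, k0.2, k1.1, k1.2]

variable {𝒯 : Triangulation unitSquare} {n : ℕ} {x : ℕ → ℝ} (M : Mesh 𝒯 n x)
include M

omit M in
lemma mem_elemsAt {T : Finset Pt} {z : Pt} : T ∈ 𝒯.elemsAt z ↔ T ∈ 𝒯.elems ∧ z ∈ T := by
  classical
  simp [Triangulation.elemsAt]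

/-- Turning around the node `z` inside a column of the mesh, from the element `{z, z', r}` across
its long edge `{z, z'}` until either the boundary or a vertical edge at `z` is reached. -/
lemma walk {z : Pt} {ξ s β : ℝ} (hz : z 0 ≠ ξ) (hβ : 0 ≤ β) (F : Finset Pt → Pt → ℝ)
    (hstep : ∀ z' r r', ({z, z', r} : Finset Pt) ∈ 𝒯.elems → ({z, z', r'} : Finset Pt) ∈ 𝒯.elems →
      z' 0 = ξ → r' 0 = ξ → cr (z' - z) (r' - z) * cr (z' - z) (r - z) < 0 →
      |F {z, z', r'} r' - F {z, z', r} z'| ≤ β)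
    {z' r : Pt} (hT : ({z, z', r} : Finset Pt) ∈ 𝒯.elems) (hz' : z' 0 = ξ)
    (hs : s * cr (z' - z) (r - z) < 0) :
    ∃ z₁ r₁, ({z, z₁, r₁} : Finset Pt) ∈ 𝒯.elems ∧ z₁ 0 = ξ ∧ s * cr (z₁ - z) (r₁ - z) < 0 ∧
      |F {z, z₁, r₁} z₁ - F {z, z', r} z'| ≤ β * (3 * (𝒯.elemsAt z).card) ∧
      ((z 1 = z₁ 1 ∧ (z 1 = 0 ∨ z 1 = 1)) ∨
        ∃ r', ({z, z₁, r'} : Finset Pt) ∈ 𝒯.elems ∧ r' 0 = z 0 ∧ 0 < s * (ξ - z 0) * (r' 1 - z 1) ∧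
          cr (z₁ - z) (r' - z) * cr (z₁ - z) (r₁ - z) < 0) := by
  classical
  -- Termination: every crossing moves the far endpoint strictly upwards with respect to the signed
  -- height `κ`, and all far endpoints belong to the finite set `W` of vertices of elements at `z`.
  let W : Finset Pt := (𝒯.elemsAt z).biUnion id
  let κ : Pt → ℝ := fun w => s * (ξ - z 0) * w 1
  have hW : W.card ≤ (𝒯.elemsAt z).card * 3 := by
    apply Finset.card_biUnion_le_card_mul
    intro T hT
    exact (𝒯.card_eq T (mem_elemsAt.1 hT).1).le
  have main : ∀ N : ℕ, ∀ z' r, ({z, z', r} : Finset Pt) ∈ 𝒯.elems → z' 0 = ξ →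
      s * cr (z' - z) (r - z) < 0 → (W.filter fun w => κ z' < κ w).card ≤ N →
      ∃ z₁ r₁, ({z, z₁, r₁} : Finset Pt) ∈ 𝒯.elems ∧ z₁ 0 = ξ ∧ s * cr (z₁ - z) (r₁ - z) < 0 ∧
      |F {z, z₁, r₁} z₁ - F {z, z', r} z'| ≤ β * N ∧
      ((z 1 = z₁ 1 ∧ (z 1 = 0 ∨ z 1 = 1)) ∨
        ∃ r', ({z, z₁, r'} : Finset Pt) ∈ 𝒯.elems ∧ r' 0 = z 0 ∧ 0 < s * (ξ - z 0) * (r' 1 - z 1) ∧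
          cr (z₁ - z) (r' - z) * cr (z₁ - z) (r₁ - z) < 0) := by
    intro N
    induction N with
    | zero =>
      intro z' r hT hz' hs hcard
      refine ⟨z', r, hT, hz', hs, by simp, ?_⟩
      by_cases hb : z 1 = z' 1 ∧ (z 1 = 0 ∨ z 1 = 1)
      · exact Or.inl hb
      right
      obtain ⟨r', hT', hside⟩ := M.exists_neighbour hT (mid_mem (vertex_bounds hT (by simp))
        (vertex_bounds hT (by simp)) (by rw [hz']; exact hz) hb)
      have hpos : 0 < s * cr (z' - z) (r' - z) := mul_pos_of_mul_neg hs hside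
      rcases M.third_mem hT' (by rw [hz']; exact hz) with h | h
      · refine ⟨r', hT', h, ?_, hside⟩
        simp only [cr, PiLp.sub_apply, h, hz', sub_self, mul_zero, sub_zero] at hpos
        linarith
      · exfalso
        -- A third vertex on the far line would be strictly higher than `z'`, but no higher vertex
        -- is left.
        have hmem : r' ∈ W.filter fun w => κ z' < κ w := by
          rw [Finset.mem_filter]
          refine ⟨Finset.mem_biUnion.2 ⟨_, mem_elemsAt.2 ⟨hT', by simp⟩, by simp⟩, ?_⟩
          simp only [cr, PiLp.sub_apply, h, hz'] at hpos
          simp only [κ]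
          linarith
        have := Finset.card_pos.2 ⟨_, hmem⟩
        omega
    | succ N ih =>
      intro z' r hT hz' hs hcard
      by_cases hb : z 1 = z' 1 ∧ (z 1 = 0 ∨ z 1 = 1)
      · exact ⟨z', r, hT, hz', hs, by simp; positivity, Or.inl hb⟩
      obtain ⟨r', hT', hside⟩ := M.exists_neighbour hT (mid_mem (vertex_bounds hT (by simp))
        (vertex_bounds hT (by simp)) (by rw [hz']; exact hz) hb)
      have hpos : 0 < s * cr (z' - z) (r' - z) := mul_pos_of_mul_neg hs hside
      rcases M.third_mem hT' (by rw [hz']; exact hz) with h | h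
      · refine ⟨z', r, hT, hz', hs, by simp; positivity, Or.inr ⟨r', hT', h, ?_, hside⟩⟩
        simp only [cr, PiLp.sub_apply, h, hz', sub_self, mul_zero, sub_zero] at hpos
        linarith
      · rw [hz'] at h
        have hκ : κ z' < κ r' := by
          simp only [cr, PiLp.sub_apply, h, hz'] at hpos
          simp only [κ]
          linarith
        have hmem : r' ∈ W.filter fun w => κ z' < κ w := by
          rw [Finset.mem_filter]
          exact ⟨Finset.mem_biUnion.2 ⟨_, mem_elemsAt.2 ⟨hT', by simp⟩, by simp⟩, hκ⟩
        have hlt : (W.filter fun w => κ r' < κ w).card < (W.filter fun w => κ z' < κ w).card := by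
          apply Finset.card_lt_card
          refine ⟨fun w hw => ?_, fun hsub => ?_⟩
          · rw [Finset.mem_filter] at hw ⊢
            exact ⟨hw.1, hκ.trans hw.2⟩
          · have := hsub hmem
            rw [Finset.mem_filter] at this
            exact lt_irrefl _ this.2
        have hset : ({z, r', z'} : Finset Pt) = {z, z', r'} := by ext; simp; tauto
        have hs' : s * cr (r' - z) (z' - z) < 0 := by
          have : cr (r' - z) (z' - z) = - cr (z' - z) (r' - z) := by simp only [cr]; ring
          rw [this]; linarith
        -- The next long edge is `z r'`, and the old endpoint `z'` becomes the vertex behind it.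
        obtain ⟨z₁, r₁, h1, h2, h3, h4, h5⟩ := ih r' z' (by rwa [hset]) h hs' (by omega)
        refine ⟨z₁, r₁, h1, h2, h3, ?_, h5⟩
        rw [hset] at h4
        have h6 := hstep z' r r' hT hT' hz' h hside
        have h7 := abs_sub_le (F {z, z₁, r₁} z₁) (F {z, z', r'} r') (F {z, z', r} z')
        push_cast
        linarith
  obtain ⟨z₁, r₁, h1, h2, h3, h4, h5⟩ := main _ z' r hT hz' hs le_rfl
  refine ⟨z₁, r₁, h1, h2, h3, h4.trans ?_, h5⟩
  apply mul_le_mul_of_nonneg_left _ hβ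
  have h6 : (W.filter fun w => κ z' < κ w).card ≤ (𝒯.elemsAt z).card * 3 :=
    (Finset.card_filter_le _ _).trans hW
  have : ((W.filter fun w => κ z' < κ w).card : ℝ) ≤ ((𝒯.elemsAt z).card * 3 : ℕ) := by exact_mod_cast h6
  push_cast at this
  linarith

end Mesh

/-! ### Sizes of elements -/

/-- The width of an element in the `x`-direction. -/
def wd (T : Finset Pt) : ℝ := Metric.diam ((fun p : Pt => p 0) '' (T : Set Pt))

/-- The length of the vertical edge of an element. -/
def se (T : Finset Pt) : ℝ := 2 * area T / wd T

section
variable {z₁ z₂ a : Pt}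

lemma wd_eq (h : z₁ 0 = z₂ 0) : wd {z₁, z₂, a} = |a 0 - z₁ 0| := by
  have : (fun p : Pt => p 0) '' (({z₁, z₂, a} : Finset Pt) : Set Pt) = {a 0, z₁ 0} := by
    ext t; simp [← h]; tauto
  rw [wd, this, Metric.diam_pair, Real.dist_eq]

lemma area_vertical (h : z₁ 0 = z₂ 0) (h12 : z₁ 1 ≠ z₂ 1) (ha : a 0 ≠ z₁ 0) :
    area {z₁, z₂, a} = |a 0 - z₁ 0| * |z₂ 1 - z₁ 1| / 2 := by
  have e : cr (z₂ - z₁) (a - z₁) = -((a 0 - z₁ 0) * (z₂ 1 - z₁ 1)) := by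
    simp only [cr, PiLp.sub_apply, ← h]; ring
  have hD : cr (z₂ - z₁) (a - z₁) ≠ 0 := by
    rw [e]; exact neg_ne_zero.2 (mul_ne_zero (sub_ne_zero.2 ha) (sub_ne_zero.2 h12.symm))
  rw [area_eq hD, e, abs_neg, abs_mul]

lemma se_eq (h : z₁ 0 = z₂ 0) (h12 : z₁ 1 ≠ z₂ 1) (ha : a 0 ≠ z₁ 0) :
    se {z₁, z₂, a} = |z₂ 1 - z₁ 1| := by
  have : |a 0 - z₁ 0| ≠ 0 := abs_ne_zero.2 (sub_ne_zero.2 ha)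
  rw [se, area_vertical h h12 ha, wd_eq h]
  field_simp

end

lemma dist_le_maxEdge {T : Finset Pt} {p q : Pt} (hp : p ∈ T) (hq : q ∈ T) : dist p q ≤ maxEdge T :=
  Metric.dist_le_diam_of_mem T.finite_toSet.isBounded hp hq

lemma abs_coord_sub_le_dist (p q : Pt) (i : Fin 2) : |p i - q i| ≤ dist p q := by
  rw [dist_eq_norm]; simpa using abs_coord_le (p - q) i

lemma dist_le_abs_add (p q : Pt) : dist p q ≤ |p 0 - q 0| + |p 1 - q 1| := by
  rw [dist_eq_norm]; simpa using norm_le_abs_add (p - q)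

/-- If the angle between two vectors is at most `π / 2 + δ`, their inner product is at least
`-|δ| ‖u‖ ‖v‖`. -/
lemma inner_ge_of_angle_le {u v : Pt} {δ : ℝ} (h : InnerProductGeometry.angle u v ≤ Real.pi / 2 + δ) :
    -(|δ| * (‖u‖ * ‖v‖)) ≤ ⟪u, v⟫_ℝ := by
  rw [← InnerProductGeometry.cos_angle_mul_norm_mul_norm u v, ← neg_mul]
  apply mul_le_mul_of_nonneg_right _ (by positivity)
  have h1 := InnerProductGeometry.angle_nonneg u v
  have h2 := InnerProductGeometry.angle_le_pi u v
  have h3 : Real.cos (InnerProductGeometry.angle u v) =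
      -Real.sin (InnerProductGeometry.angle u v - Real.pi / 2) := by
    rw [Real.sin_sub_pi_div_two, neg_neg]
  rw [h3, neg_le_neg_iff]
  rcases le_total 0 (InnerProductGeometry.angle u v - Real.pi / 2) with h4 | h4
  · calc Real.sin _ ≤ InnerProductGeometry.angle u v - Real.pi / 2 := Real.sin_le h4
      _ ≤ δ := by linarith
      _ ≤ |δ| := le_abs_self δ
  · exact (Real.sin_nonpos_of_nonpos_of_neg_pi_le h4 (by linarith)).trans (abs_nonneg δ)

/-- Consequences of the assumptions on the shape of the elements around a node. -/
structure Shape (𝒯 : Triangulation unitSquare) (N κ Λ : ℝ) : Prop where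
  card_le : ∀ z, ((𝒯.elemsAt z).card : ℝ) ≤ N
  altitude_le : ∀ z, ∀ T ∈ 𝒯.elemsAt z, ∀ T' ∈ 𝒯.elemsAt z, altitude T ≤ κ * altitude T'
  maxEdge_le : ∀ z, ∀ T ∈ 𝒯.elemsAt z, ∀ T' ∈ 𝒯.elemsAt z, maxEdge T ≤ κ * maxEdge T'
  vert : ∀ z p q : Pt, ({z, p, q} : Finset Pt) ∈ 𝒯.elems → p 0 = z 0 →
    -(Λ * altitude {z, p, q} * |p 1 - z 1|) ≤ (p 1 - z 1) * (q 1 - z 1)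

lemma altitude_nonneg (T : Finset Pt) : 0 ≤ altitude T :=
  div_nonneg (mul_nonneg zero_le_two measureReal_nonneg) Metric.diam_nonneg

/-- In the angle condition the excess lam1 · h_z/H_z is multiplied by |q - z| ≤ H_z. What remains is
at most |lam1| h_z, hence at most |lam1| κ h_T, which is the source of the third constant. -/
lemma Shape.of_hyps {𝒯 : Triangulation unitSquare} {N₀ : ℕ} {c₀ κ lam1 : ℝ}
    (hN : ∀ z ∈ 𝒯.nodes, (𝒯.elemsAt z).card ≤ N₀)
    (hA : ∀ z ∈ 𝒯.nodes, 𝒯.IsAnisotropicNode c₀ κ z)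
    (hQ : ∀ z ∈ 𝒯.nodes, 𝒯.QuasiNonObtuseAt lam1 z) :
    Shape 𝒯 N₀ κ (|lam1| * κ) := by
  classical
  have hnode : ∀ {z T}, T ∈ 𝒯.elemsAt z → z ∈ 𝒯.nodes := by
    intro z T hT
    obtain ⟨h1, h2⟩ := Mesh.mem_elemsAt.1 hT
    simp only [Triangulation.nodes, Finset.mem_biUnion, id]
    exact ⟨T, h1, h2⟩
  have halt : ∀ {z T}, T ∈ 𝒯.elemsAt z → altitude T ≤ 𝒯.nodeAltitude z := by
    intro z T hT
    exact le_csSup ((𝒯.elemsAt z).finite_toSet.image _).bddAbove (Set.mem_image_of_mem _ hT)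
  have hmax : ∀ {z T}, T ∈ 𝒯.elemsAt z → maxEdge T ≤ 𝒯.nodeDiam z := by
    intro z T hT
    apply Metric.diam_mono
    · exact (subset_convexHull ℝ _).trans
        (Set.subset_biUnion_of_mem (u := fun T => hull T) (show T ∈ (𝒯.elemsAt z : Set (Finset Pt)) from hT))
    · exact (Bornology.isBounded_biUnion_finset _).2 fun T _ => (isCompact_hull T).isBounded
  refine ⟨fun z => ?_, fun z T hT T' hT' => ?_, fun z T hT T' hT' => ?_, fun z p q hT hp => ?_⟩
  · by_cases hz : z ∈ 𝒯.nodes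
    · exact_mod_cast hN z hz
    · have : 𝒯.elemsAt z = ∅ := Finset.eq_empty_of_forall_notMem fun T hT => hz (hnode hT)
      rw [this]; simp
  · exact (halt hT).trans ((hA z (hnode hT)).2 T' hT').1
  · exact (hmax hT).trans ((hA z (hnode hT)).2 T' hT').2
  · have hTz : ({z, p, q} : Finset Pt) ∈ 𝒯.elemsAt z := Mesh.mem_elemsAt.2 ⟨hT, by simp⟩
    obtain ⟨n1, n2, n3⟩ := Mesh.ne_of_elem hT
    have hang := hQ z (hnode hTz) _ hTz p (by simp) q (by simp) n1.symm n2.symm n3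
    have hin := inner_ge_of_angle_le hang
    rw [inner_eq] at hin
    simp only [vsub_eq_sub, PiLp.sub_apply, hp, sub_self, zero_mul, zero_add] at hin
    refine le_trans ?_ hin
    rw [neg_le_neg_iff]
    have hnp : ‖p - z‖ = |p 1 - z 1| := by
      rw [← Real.sqrt_sq (norm_nonneg (p - z)), norm_sq_eq]
      simp [hp, Real.sqrt_sq_eq_abs]
    have hq : ‖q - z‖ ≤ maxEdge {z, p, q} := by
      rw [← dist_eq_norm]; exact dist_le_maxEdge (by simp) (by simp)
    have h1 := halt hTz
    have h2 := hmax hTz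
    obtain ⟨h3, h4⟩ := (hA z (hnode hTz)).2 _ hTz
    have hmpos : 0 < maxEdge {z, p, q} := (norm_pos_iff.2 (sub_ne_zero.2 n2.symm)).trans_le hq
    have hdpos : 0 < 𝒯.nodeDiam z := hmpos.trans_le h2
    have hapos : 0 ≤ 𝒯.nodeAltitude z := (altitude_nonneg _).trans h1
    rw [hnp, abs_mul, abs_div, abs_of_pos hdpos, abs_of_nonneg hapos]
    have key : 𝒯.nodeAltitude z / 𝒯.nodeDiam z * ‖q - z‖ ≤ κ * altitude {z, p, q} := by
      rw [div_mul_eq_mul_div, div_le_iff₀ hdpos]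
      exact mul_le_mul h3 (hq.trans h2) (norm_nonneg _) (hapos.trans h3)
    calc |lam1| * (𝒯.nodeAltitude z / 𝒯.nodeDiam z) * (|p 1 - z 1| * ‖q - z‖)
        = |lam1| * |p 1 - z 1| * (𝒯.nodeAltitude z / 𝒯.nodeDiam z * ‖q - z‖) := by ring
      _ ≤ |lam1| * |p 1 - z 1| * (κ * altitude {z, p, q}) := by gcongr
      _ = _ := by ring

/-- All size relations used later, with a single constant. -/
structure Reg (𝒯 : Triangulation unitSquare) (C : ℝ) : Prop where
  one_le : 1 ≤ C
  card_le : ∀ z, ((𝒯.elemsAt z).card : ℝ) ≤ C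
  se_le_wd : ∀ T ∈ 𝒯.elems, se T ≤ C * wd T
  maxEdge_le_wd : ∀ T ∈ 𝒯.elems, maxEdge T ≤ C * wd T
  se_le : ∀ z, ∀ T ∈ 𝒯.elemsAt z, ∀ T' ∈ 𝒯.elemsAt z, se T ≤ C * se T'
  wd_le : ∀ z, ∀ T ∈ 𝒯.elemsAt z, ∀ T' ∈ 𝒯.elemsAt z, wd T ≤ C * wd T'
  slope : ∀ z z' r : Pt, ({z, z', r} : Finset Pt) ∈ 𝒯.elems → z' 0 ≠ z 0 →
    |z' 1 - z 1| ≤ C * se {z, z', r}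

/-! ### Comparable sizes and bounded slopes around a node -/

namespace Mesh
variable {𝒯 : Triangulation unitSquare} {n : ℕ} {x : ℕ → ℝ} (M : Mesh 𝒯 n x)
include M

/-- The named vertices of an element, without reference to the mesh lines. -/
lemma elem' {T : Finset Pt} (hT : T ∈ 𝒯.elems) : ∃ z₁ z₂ a : Pt, T = {z₁, z₂, a} ∧
    z₁ 0 = z₂ 0 ∧ a 0 ≠ z₁ 0 ∧ z₁ 1 < z₂ 1 ∧ dist z₁ z₂ ≤ dist z₁ a ∧ dist z₁ z₂ ≤ dist z₂ a := by
  obtain ⟨z₁, z₂, a, k, m, hT, hk, hm, hkm, e1, e2, e3, hlt, d1, d2⟩ := M.elem _ hT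
  refine ⟨z₁, z₂, a, hT, by rw [e1, e2], fun h => ?_, hlt, d1, d2⟩
  have := M.injOn hm hk (by rw [← e3, ← e1, h])
  omega

lemma wd_pos {T : Finset Pt} (hT : T ∈ 𝒯.elems) : 0 < wd T := by
  obtain ⟨z₁, z₂, a, rfl, h12, ha, hlt, -, -⟩ := M.elem' hT
  rw [wd_eq h12]; exact abs_pos.2 (sub_ne_zero.2 ha)

lemma se_pos {T : Finset Pt} (hT : T ∈ 𝒯.elems) : 0 < se T := by
  obtain ⟨z₁, z₂, a, rfl, h12, ha, hlt, -, -⟩ := M.elem' hT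
  rw [se_eq h12 hlt.ne ha]; exact abs_pos.2 (sub_ne_zero.2 hlt.ne')

lemma area_eq_wd_se {T : Finset Pt} (hT : T ∈ 𝒯.elems) : area T = wd T * se T / 2 := by
  have := (M.wd_pos hT).ne'
  rw [se]; field_simp

lemma wd_le_maxEdge {T : Finset Pt} (hT : T ∈ 𝒯.elems) : wd T ≤ maxEdge T := by
  obtain ⟨z₁, z₂, a, rfl, h12, ha, hlt, -, -⟩ := M.elem' hT
  rw [wd_eq h12]
  exact (abs_coord_sub_le_dist a z₁ 0).trans (dist_le_maxEdge (by simp) (by simp))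

lemma se_le_maxEdge {T : Finset Pt} (hT : T ∈ 𝒯.elems) : se T ≤ maxEdge T := by
  obtain ⟨z₁, z₂, a, rfl, h12, ha, hlt, -, -⟩ := M.elem' hT
  rw [se_eq h12 hlt.ne ha]
  exact (abs_coord_sub_le_dist z₂ z₁ 1).trans (dist_le_maxEdge (by simp) (by simp))

lemma altitude_eq {T : Finset Pt} (hT : T ∈ 𝒯.elems) : altitude T = wd T * se T / maxEdge T := by
  rw [altitude, M.area_eq_wd_se hT]; ring

lemma altitude_le_se {T : Finset Pt} (hT : T ∈ 𝒯.elems) : altitude T ≤ se T := by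
  have h1 := M.wd_le_maxEdge hT
  have h2 := M.wd_pos hT
  rw [M.altitude_eq hT, div_le_iff₀ (h2.trans_le h1), mul_comm]
  exact mul_le_mul_of_nonneg_left h1 (M.se_pos hT).le

lemma altitude_le_wd {T : Finset Pt} (hT : T ∈ 𝒯.elems) : altitude T ≤ wd T := by
  have h1 := M.se_le_maxEdge hT
  have h2 := M.se_pos hT
  rw [M.altitude_eq hT, div_le_iff₀ (h2.trans_le h1)]
  exact mul_le_mul_of_nonneg_left h1 (M.wd_pos hT).le

omit M in
-- Here `s` is the vertical edge, split by the height of the apex into `a + b`, and `X` is the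
-- width. Adding the two shortest-edge inequalities gives s² + 2ab ≤ 2X², while the one-sided bounds
-- give ab ≥ -ΛX(s + ΛX); a large ratio s/X contradicts this.
lemma size_aux {a b s X Λ : ℝ} (hΛ : 0 ≤ Λ) (hX : 0 < X) (hab : a + b = s) (hs : 0 < s)
    (ha : -(Λ * X) ≤ a) (hb : -(Λ * X) ≤ b) (h1 : s ^ 2 ≤ X ^ 2 + a ^ 2) (h2 : s ^ 2 ≤ X ^ 2 + b ^ 2) :
    s ≤ (2 + 4 * Λ) * X := by
  by_contra hc
  push Not at hc
  have hΛX : 0 ≤ Λ * X := by positivity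
  have e1 : s ^ 2 + 2 * (a * b) ≤ 2 * X ^ 2 := by subst hab; nlinarith
  have e2 : -(Λ * X) * (s + Λ * X) ≤ a * b := by
    rcases le_total 0 a with h | h
    · rcases le_total 0 b with h' | h'
      · nlinarith [mul_nonneg h h']
      · have : a ≤ s + Λ * X := by linarith
        nlinarith
    · have : b ≤ s + Λ * X := by linarith
      have hb' : 0 ≤ b := by linarith
      nlinarith
  have e3 : (2 + 4 * Λ) * X * s < s ^ 2 := by nlinarith
  nlinarith [mul_nonneg hΛ (sq_nonneg X), mul_nonneg (mul_nonneg hΛ hΛ) (sq_nonneg X), mul_pos hX hX,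
    mul_lt_mul_of_pos_left hc hX, mul_le_mul_of_nonneg_left hc.le hΛX]

section
variable {N κ Λ : ℝ} (S : Shape 𝒯 N κ Λ) (hΛ : 0 ≤ Λ)
include S hΛ

/-- The angle condition at both ends of the vertical edge keeps the apex from lying above or below
that edge by more than Λ times the width. Together with the shortest-edge property this bounds all
edges by the width. -/
lemma size_elem {T : Finset Pt} (hT : T ∈ 𝒯.elems) :
    se T ≤ (2 + 4 * Λ) * wd T ∧ maxEdge T ≤ (5 + 9 * Λ) * wd T := by
  have hX := M.wd_pos hT
  have hs := M.se_pos hT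
  have hal := M.altitude_le_wd hT
  have hal0 := altitude_nonneg T
  obtain ⟨z₁, z₂, a, rfl, h12, ha, hlt, d1, d2⟩ := M.elem' hT
  have hset : ({z₂, z₁, a} : Finset Pt) = {z₁, z₂, a} := Finset.insert_comm _ _ _
  have v1 := S.vert z₁ z₂ a hT h12.symm
  have v2 := S.vert z₂ z₁ a (by rwa [hset]) h12
  rw [hset] at v2
  have hse := se_eq h12 hlt.ne ha
  have hwd := wd_eq (a := a) h12
  have hpos : 0 < z₂ 1 - z₁ 1 := sub_pos.2 hlt
  rw [abs_of_pos hpos] at hse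
  have hA : -(Λ * wd {z₁, z₂, a}) ≤ a 1 - z₁ 1 := by
    rw [abs_of_pos hpos] at v1
    have : -(Λ * altitude {z₁, z₂, a}) ≤ a 1 - z₁ 1 := by
      by_contra hc; push Not at hc; nlinarith
    nlinarith
  have hB : -(Λ * wd {z₁, z₂, a}) ≤ z₂ 1 - a 1 := by
    rw [abs_sub_comm, abs_of_pos hpos] at v2
    have : -(Λ * altitude {z₁, z₂, a}) ≤ z₂ 1 - a 1 := by
      by_contra hc; push Not at hc; nlinarith
    nlinarith
  have dsq : ∀ p q : Pt, dist p q ^ 2 = (p 0 - q 0) ^ 2 + (p 1 - q 1) ^ 2 := by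
    intro p q; rw [dist_eq_norm, norm_sq_eq]; simp
  have d0 : dist z₁ z₂ ^ 2 = (z₂ 1 - z₁ 1) ^ 2 := by rw [dsq, h12]; ring
  have q1 : (z₂ 1 - z₁ 1) ^ 2 ≤ wd {z₁, z₂, a} ^ 2 + (a 1 - z₁ 1) ^ 2 := by
    rw [← d0, hwd, sq_abs]
    have : dist z₁ z₂ ^ 2 ≤ dist z₁ a ^ 2 := by gcongr
    rw [dsq z₁ a] at this; linarith [this]
  have q2 : (z₂ 1 - z₁ 1) ^ 2 ≤ wd {z₁, z₂, a} ^ 2 + (z₂ 1 - a 1) ^ 2 := by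
    rw [← d0, hwd, sq_abs, h12]
    have : dist z₁ z₂ ^ 2 ≤ dist z₂ a ^ 2 := by gcongr
    rw [dsq z₂ a] at this; linarith [this]
  have hfin := size_aux hΛ hX (a := a 1 - z₁ 1) (b := z₂ 1 - a 1) (by ring) hpos hA hB q1 q2
  rw [← hse] at hfin
  refine ⟨hfin, ?_⟩
  have hΛX : 0 ≤ Λ * wd {z₁, z₂, a} := by positivity
  have b1 : |a 1 - z₁ 1| ≤ (2 + 5 * Λ) * wd {z₁, z₂, a} := by
    rw [abs_le]; constructor <;> nlinarith
  have b2 : |a 1 - z₂ 1| ≤ (2 + 5 * Λ) * wd {z₁, z₂, a} := by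
    rw [abs_le]; constructor <;> nlinarith
  have c1 : dist z₁ a ≤ (5 + 9 * Λ) * wd {z₁, z₂, a} := by
    rw [dist_comm]
    refine (dist_le_abs_add a z₁).trans ?_
    rw [← hwd]; nlinarith
  have c2 : dist z₂ a ≤ (5 + 9 * Λ) * wd {z₁, z₂, a} := by
    rw [dist_comm]
    refine (dist_le_abs_add a z₂).trans ?_
    rw [← h12, ← hwd]; nlinarith
  have c3 : dist z₁ z₂ ≤ (5 + 9 * Λ) * wd {z₁, z₂, a} := d1.trans c1
  have c4 : 0 ≤ (5 + 9 * Λ) * wd {z₁, z₂, a} := by positivity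
  apply Metric.diam_le_of_forall_dist_le c4
  intro p hp q hq
  simp only [Finset.coe_insert, Finset.coe_singleton, Set.mem_insert_iff, Set.mem_singleton_iff] at hp hq
  rcases hp with rfl | rfl | rfl <;> rcases hq with rfl | rfl | rfl <;>
    first
    | rw [dist_self]; exact c4
    | assumption
    | rw [dist_comm]; assumption

/-- The altitude is `wd * se / maxEdge` and `maxEdge` is at most a multiple of `wd`, so altitude and
vertical edge are comparable; comparability of altitudes at a node passes to the vertical edges. -/
lemma se_node {z : Pt} {T T' : Finset Pt} (hκ : 0 ≤ κ) (hT : T ∈ 𝒯.elemsAt z) (hT' : T' ∈ 𝒯.elemsAt z) :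
    se T ≤ (5 + 9 * Λ) * κ * se T' := by
  have h1 := (mem_elemsAt.1 hT).1
  have h2 := (mem_elemsAt.1 hT').1
  have hm := (M.size_elem S hΛ h1).2
  have ha := S.altitude_le z T hT T' hT'
  have hse : se T ≤ (5 + 9 * Λ) * altitude T := by
    have hw := M.wd_pos h1
    have hs := M.se_pos h1
    have hmp : 0 < maxEdge T := hw.trans_le (M.wd_le_maxEdge h1)
    rw [M.altitude_eq h1, mul_div_assoc', le_div_iff₀ hmp]
    nlinarith
  calc se T ≤ (5 + 9 * Λ) * altitude T := hse
    _ ≤ (5 + 9 * Λ) * (κ * altitude T') := by gcongr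
    _ ≤ (5 + 9 * Λ) * (κ * se T') := by gcongr; exact M.altitude_le_se h2
    _ = _ := by ring

lemma wd_node {z : Pt} {T T' : Finset Pt} (hκ : 0 ≤ κ) (hT : T ∈ 𝒯.elemsAt z) (hT' : T' ∈ 𝒯.elemsAt z) :
    wd T ≤ (5 + 9 * Λ) * κ * wd T' := by
  have h1 := (mem_elemsAt.1 hT).1
  have h2 := (mem_elemsAt.1 hT').1
  calc wd T ≤ maxEdge T := M.wd_le_maxEdge h1
    _ ≤ κ * maxEdge T' := S.maxEdge_le z T hT T' hT'
    _ ≤ κ * ((5 + 9 * Λ) * wd T') := by gcongr; exact (M.size_elem S hΛ h2).2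
    _ = _ := by ring

/-- Turn around `z` from the long edge `z z'` in the vertical direction `σ` until a vertical edge or
the boundary appears. There the angle condition, or the boundary, prevents the last long edge from
sloping backwards by more than a multiple of the short edge. The boundedly many crossings before it
each change the height of the far endpoint by the length of one short edge at `z`. -/
lemma slope_one_side {z z' r : Pt} (hκ : 0 ≤ κ) (hT : ({z, z', r} : Finset Pt) ∈ 𝒯.elems) (hz : z' 0 ≠ z 0)
    {σ : ℝ} (hσ : σ = 1 ∨ σ = -1) :
    -((5 + 9 * Λ) * κ * (3 * N + Λ) * se {z, z', r}) ≤ σ * (z' 1 - z 1) := by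
  have hN : 0 ≤ N := (Nat.cast_nonneg _).trans (S.card_le z)
  have hs0 := M.se_pos hT
  have hTz : ({z, z', r} : Finset Pt) ∈ 𝒯.elemsAt z := mem_elemsAt.2 ⟨hT, by simp⟩
  by_cases hb : z 1 = z' 1 ∧ (z 1 = 0 ∨ z 1 = 1)
  · rw [hb.1, sub_self, mul_zero, neg_nonpos]; positivity
  have hσ0 : σ ≠ 0 := by rcases hσ with rfl | rfl <;> norm_num
  set s := σ * (z' 0 - z 0) with hs
  have hsne : s ≠ 0 := mul_ne_zero hσ0 (sub_ne_zero.2 hz)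
  -- The walk needs an element behind the edge with respect to its direction; if the given element
  -- lies ahead, its neighbour across the edge is used.
  obtain ⟨r₀, hT₀, hs₀⟩ : ∃ r₀, ({z, z', r₀} : Finset Pt) ∈ 𝒯.elems ∧ s * cr (z' - z) (r₀ - z) < 0 := by
    have hne : s * cr (z' - z) (r - z) ≠ 0 := mul_ne_zero hsne (M.cr_ne hT)
    rcases hne.lt_or_gt with h | h
    · exact ⟨r, hT, h⟩
    · obtain ⟨r', hT', hside⟩ := M.exists_neighbour hT (mid_mem (vertex_bounds hT (by simp))
        (vertex_bounds hT (by simp)) hz.symm hb)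
      refine ⟨r', hT', ?_⟩
      have := mul_pos_of_mul_neg (s := -s) (by linarith) hside
      linarith
  have hβ : 0 ≤ (5 + 9 * Λ) * κ * se {z, z', r} := by positivity
  obtain ⟨z₁, r₁, g1, g2, g3, g4, g5⟩ := M.walk hz.symm hβ (fun _ p => p 1) (s := s) (fun w q q' hw hw' hwz hq' _ => by
    have hmem : ({z, w, q'} : Finset Pt) ∈ 𝒯.elemsAt z := mem_elemsAt.2 ⟨hw', by simp⟩
    refine le_trans (le_of_eq ?_) (M.se_node S hΛ hκ hmem hTz)
    have hset : ({z, w, q'} : Finset Pt) = {w, q', z} := by ext; simp; tauto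
    have hn := ne_of_elem hw'
    have h1 : w 1 ≠ q' 1 := fun h => hn.2.2 (pt_ext (by rw [hwz, hq']) h)
    rw [hset, se_eq (by rw [hwz, hq']) h1 (by rw [hwz]; exact hz.symm)]) hT₀ rfl hs₀
  have g4' : |z₁ 1 - z' 1| ≤ (5 + 9 * Λ) * κ * se {z, z', r} * (3 * N) := by
    refine g4.trans ?_
    have := S.card_le z
    gcongr
  have g6 : -(Λ * ((5 + 9 * Λ) * κ * se {z, z', r})) ≤ σ * (z₁ 1 - z 1) := by
    rcases g5 with ⟨h, -⟩ | ⟨r', h1, h2, h3, -⟩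
    · rw [h, sub_self, mul_zero, neg_nonpos]; positivity
    · have hset : ({z, z₁, r'} : Finset Pt) = {z, r', z₁} := by ext; simp; tauto
      rw [hset] at h1
      have hv := S.vert z r' z₁ h1 h2
      have hmem : ({z, r', z₁} : Finset Pt) ∈ 𝒯.elemsAt z := mem_elemsAt.2 ⟨h1, by simp⟩
      have hal : altitude {z, r', z₁} ≤ (5 + 9 * Λ) * κ * se {z, z', r} :=
        (M.altitude_le_se h1).trans (M.se_node S hΛ hκ hmem hTz)
      have h4 : 0 < σ * (r' 1 - z 1) := by
        have e : s * (z' 0 - z 0) * (r' 1 - z 1) = (z' 0 - z 0) ^ 2 * (σ * (r' 1 - z 1)) := by rw [hs]; ring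
        rw [e] at h3
        exact pos_of_mul_pos_right h3 (sq_nonneg _)
      have hσ2 : σ * σ = 1 := by rcases hσ with rfl | rfl <;> norm_num
      have h5 : |r' 1 - z 1| = σ * (r' 1 - z 1) := by
        rcases hσ with rfl | rfl
        · rw [one_mul] at h4 ⊢; exact abs_of_pos h4
        · rw [abs_of_neg (by linarith)]; ring
      rw [h5] at hv
      have e2 : (r' 1 - z 1) * (z₁ 1 - z 1) = σ * (r' 1 - z 1) * (σ * (z₁ 1 - z 1)) := by
        linear_combination (-(r' 1 - z 1) * (z₁ 1 - z 1)) * hσ2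
      rw [e2] at hv
      have h6 : -(Λ * altitude {z, r', z₁}) ≤ σ * (z₁ 1 - z 1) := by
        by_contra hc; push Not at hc
        nlinarith
      have h7 : Λ * altitude {z, r', z₁} ≤ Λ * ((5 + 9 * Λ) * κ * se {z, z', r}) := by gcongr
      linarith
  have g7 : σ * (z₁ 1 - z 1) - σ * (z' 1 - z 1) ≤ |z₁ 1 - z' 1| := by
    rcases hσ with rfl | rfl
    · have := le_abs_self (z₁ 1 - z' 1); linarith
    · have := neg_abs_le (z₁ 1 - z' 1); linarith
  linarith

lemma reg (hκ : 0 ≤ κ) : ∃ C, C = 5 + 9 * Λ + (5 + 9 * Λ) * κ + (5 + 9 * Λ) * κ * (3 * N + Λ) + N ∧ Reg 𝒯 C := by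
  have hN : 0 ≤ N := (Nat.cast_nonneg _).trans (S.card_le 0)
  have p1 : 0 ≤ (5 + 9 * Λ) * κ := by positivity
  have p2 : 0 ≤ (5 + 9 * Λ) * κ * (3 * N + Λ) := by positivity
  refine ⟨_, rfl, ⟨by linarith, fun z => by linarith [S.card_le z], fun T hT => ?_, fun T hT => ?_,
    fun z T hT T' hT' => ?_, fun z T hT T' hT' => ?_, fun z z' r hT hz => ?_⟩⟩
  · refine (M.size_elem S hΛ hT).1.trans (mul_le_mul_of_nonneg_right ?_ (M.wd_pos hT).le); linarith
  · refine (M.size_elem S hΛ hT).2.trans (mul_le_mul_of_nonneg_right ?_ (M.wd_pos hT).le); linarith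
  · refine (M.se_node S hΛ hκ hT hT').trans
      (mul_le_mul_of_nonneg_right ?_ (M.se_pos (mem_elemsAt.1 hT').1).le); linarith
  · refine (M.wd_node S hΛ hκ hT hT').trans
      (mul_le_mul_of_nonneg_right ?_ (M.wd_pos (mem_elemsAt.1 hT').1).le); linarith
  · have h1 := M.slope_one_side S hΛ hκ hT hz (Or.inl rfl)
    have h2 := M.slope_one_side S hΛ hκ hT hz (Or.inr rfl)
    have h3 : |z' 1 - z 1| ≤ (5 + 9 * Λ) * κ * (3 * N + Λ) * se {z, z', r} := by
      rw [abs_le]; constructor <;> linarith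
    refine h3.trans (mul_le_mul_of_nonneg_right ?_ (M.se_pos hT).le); linarith

end

end Mesh

/-! ### One-dimensional profiles -/

lemma hasDerivAt_of_eq {f g : ℝ → ℝ} {f' g' t : ℝ} (h : HasDerivAt f f' t) (hg : ∀ y, g y = f y)
    (hg' : g' = f') : HasDerivAt g g' t := by
  rw [hg', funext hg]; exact h

lemma hasDerivAt_max_pow (n : ℕ) (t : ℝ) :
    HasDerivAt (fun t : ℝ => max t 0 ^ (n + 2)) ((n + 2) * max t 0 ^ (n + 1)) t := by
  rcases lt_trichotomy t 0 with h | rfl | h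
  · have e : (fun t : ℝ => max t 0 ^ (n + 2)) =ᶠ[𝓝 t] fun _ => 0 := by
      filter_upwards [Iio_mem_nhds h] with s hs
      rw [max_eq_right (le_of_lt hs)]; simp
    rw [max_eq_right h.le]
    simpa using (hasDerivAt_const t (0 : ℝ)).congr_of_eventuallyEq e
  · rw [hasDerivAt_iff_isLittleO]
    simp only [max_self, ne_eq, Nat.add_eq_zero_iff, one_ne_zero, and_false, not_false_eq_true, zero_pow,
      mul_zero, sub_zero, smul_zero, OfNat.ofNat_ne_zero]
    have h1 : (fun t : ℝ => max t 0 ^ (n + 2)) =O[𝓝 0] fun t : ℝ => t ^ (n + 2) := by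
      apply Asymptotics.IsBigO.of_bound 1
      refine Eventually.of_forall fun s => ?_
      rw [one_mul, norm_pow, norm_pow]
      apply pow_le_pow_left₀ (norm_nonneg _)
      rw [Real.norm_eq_abs, Real.norm_eq_abs, abs_of_nonneg (le_max_right _ _)]
      exact max_le (le_abs_self s) (abs_nonneg s)
    refine h1.trans_isLittleO ?_
    simpa using Asymptotics.isLittleO_pow_pow (𝕜 := ℝ) (show 1 < n + 2 by omega)
  · have e : (fun t : ℝ => max t 0 ^ (n + 2)) =ᶠ[𝓝 t] fun t => t ^ (n + 2) := by
      filter_upwards [Ioi_mem_nhds h] with s hs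
      rw [max_eq_left (le_of_lt hs)]
    rw [max_eq_left h.le]
    have := (hasDerivAt_pow (n + 2) t).congr_of_eventuallyEq e
    simpa using this

/-- The positive part of `1 - r`. -/
def cc (r : ℝ) : ℝ := max (1 - r) 0

lemma hasDerivAt_cc (n : ℕ) (r : ℝ) :
    HasDerivAt (fun r => cc r ^ (n + 2)) (-((n + 2) * cc r ^ (n + 1))) r := by
  have h := (hasDerivAt_max_pow n (1 - r)).comp r ((hasDerivAt_id r).const_sub 1)
  simpa [Function.comp_def, cc] using h

@[fun_prop]
lemma continuous_cc : Continuous cc := by unfold cc; fun_prop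

lemma cc_of_one_le {r : ℝ} (h : 1 ≤ r) : cc r = 0 := max_eq_right (by linarith)

lemma cc_of_le_one {r : ℝ} (h : r ≤ 1) : cc r = 1 - r := max_eq_left (by linarith)

@[simp] lemma cc_zero : cc 0 = 1 := by simp [cc]

/-- The profile of the strip test function: its moments of order `0` and `1` vanish. -/
def mM (r : ℝ) : ℝ := cc r ^ 2 * (1 - 10 * r + 15 * r ^ 2)

/-- The derivative of `mM`. -/
def mM' (r : ℝ) : ℝ := -(2 * cc r) * (1 - 10 * r + 15 * r ^ 2) + cc r ^ 2 * (-10 + 30 * r)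

/-- The profile of the edge bubble: its moment of order `0` vanishes. -/
def mq (r : ℝ) : ℝ := cc r ^ 2 * (1 - 4 * r)

/-- The derivative of `mq`. -/
def mq' (r : ℝ) : ℝ := -(2 * cc r) * (1 - 4 * r) + cc r ^ 2 * (-4)

lemma hasDerivAt_mM (r : ℝ) : HasDerivAt mM (mM' r) r := by
  have h1 : HasDerivAt (fun r : ℝ => 1 - 10 * r + 15 * r ^ 2) (-10 + 30 * r) r := by
    have := (((hasDerivAt_id r).const_mul 10).const_sub 1).add (((hasDerivAt_pow 2 r)).const_mul 15)
    exact hasDerivAt_of_eq this (fun y => by simp) (by simp; ring)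
  exact hasDerivAt_of_eq ((hasDerivAt_cc 0 r).mul h1) (fun y => rfl) (by simp [mM'])

lemma hasDerivAt_mq (r : ℝ) : HasDerivAt mq (mq' r) r := by
  have h1 : HasDerivAt (fun r : ℝ => 1 - 4 * r) (-4) r := by
    have := ((hasDerivAt_id r).const_mul 4).const_sub 1
    exact hasDerivAt_of_eq this (fun y => by simp) (by simp)
  exact hasDerivAt_of_eq ((hasDerivAt_cc 0 r).mul h1) (fun y => rfl) (by simp [mq'])

/-- A profile: a differentiable function `m`, with derivative `m'`, bounded by `B` on `[0, ∞)` and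
vanishing on `[1, ∞)`. -/
structure Prof (m m' : ℝ → ℝ) (B : ℝ) : Prop where
  nonneg : 0 ≤ B
  deriv : ∀ r, HasDerivAt m (m' r) r
  cont : Continuous m'
  zero : ∀ r, 1 ≤ r → m r = 0 ∧ m' r = 0
  bound : ∀ r, 0 ≤ r → |m r| ≤ B ∧ |m' r| ≤ B
  at_zero : m 0 = 1
  int : ∀ τ : ℝ, 0 < τ → τ ≤ 1 → ∫ s in (0 : ℝ)..1, m (s / τ) = 0

lemma hasDerivAt_scale {f : ℝ → ℝ} {f' τ s : ℝ} (hf : HasDerivAt f f' (s / τ)) :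
    HasDerivAt (fun s => f (s / τ)) (f' / τ) s := by
  exact hasDerivAt_of_eq (hf.comp s ((hasDerivAt_id s).div_const τ)) (fun _ => rfl) (by ring)

/-- The zeroth moment vanishes because of the antiderivative (1-r)³ r (1-3r), which is 0 at both
ends of [0,1]. -/
lemma prof_mM : Prof mM mM' 100 := by
  refine ⟨by norm_num, hasDerivAt_mM, by unfold mM'; fun_prop, fun r hr => ?_, fun r hr => ?_, by simp [mM],
    fun τ h0 h1 => ?_⟩
  · simp [mM, mM', cc_of_one_le hr]
  · rcases le_total r 1 with h | h
    · rw [mM, mM', cc_of_le_one h, abs_le, abs_le]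
      have e0 : 0 ≤ 1 - r := by linarith
      have e1 : (1 - r) ^ 2 ≤ 1 := by nlinarith
      have e2 : |1 - 10 * r + 15 * r ^ 2| ≤ 26 := by rw [abs_le]; constructor <;> nlinarith
      have e3 : |-10 + 30 * r| ≤ 30 := by rw [abs_le]; constructor <;> linarith
      rw [← abs_le, ← abs_le]
      constructor
      · rw [abs_mul, abs_of_nonneg (sq_nonneg (1 - r))]
        nlinarith [abs_nonneg (1 - 10 * r + 15 * r ^ 2)]
      · refine (abs_add_le _ _).trans ?_
        rw [abs_mul, abs_mul, abs_of_nonneg (sq_nonneg (1 - r)), abs_neg, abs_of_nonneg (by linarith)]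
        nlinarith [abs_nonneg (1 - 10 * r + 15 * r ^ 2), abs_nonneg (-10 + 30 * r)]
    · simp [mM, mM', cc_of_one_le h]
  · have hd : ∀ s ∈ Set.uIcc (0 : ℝ) 1, HasDerivAt (fun s => τ * (cc (s / τ) ^ 3 * (s / τ * (1 - 3 * (s / τ)))))
        (mM (s / τ)) s := by
      intro s _
      have h1 : ∀ r, HasDerivAt (fun r => cc r ^ 3 * (r * (1 - 3 * r))) (mM r) r := by
        intro r
        have g := (hasDerivAt_cc 1 r).mul ((hasDerivAt_id r).mul (((hasDerivAt_id r).const_mul 3).const_sub 1))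
        refine hasDerivAt_of_eq g (fun y => by simp) ?_
        rcases le_total r 1 with h | h
        · simp [mM, cc_of_le_one h]; ring
        · simp [mM, cc_of_one_le h]
      have := (hasDerivAt_scale (h1 (s / τ))).const_mul τ
      exact hasDerivAt_of_eq this (fun _ => rfl) (by field_simp)
    have hc : Continuous fun s => mM (s / τ) := by unfold mM; fun_prop
    rw [intervalIntegral.integral_eq_sub_of_hasDerivAt hd (hc.intervalIntegrable _ _),
      cc_of_one_le (by rwa [one_le_div h0])]
    simp

/-- Integration by parts: the antiderivative (1-r)³ r (1-3r) of the profile has in turn the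
antiderivative (1-r)⁴ r²/2, and both boundary terms vanish. -/
lemma int_mM_mul {τ : ℝ} (h0 : 0 < τ) (h1 : τ ≤ 1) : ∫ s in (0 : ℝ)..1, mM (s / τ) * s = 0 := by
  have hd : ∀ s ∈ Set.uIcc (0 : ℝ) 1, HasDerivAt
      (fun s => τ ^ 2 * (cc (s / τ) ^ 3 * ((s / τ) ^ 2 * (1 - 3 * (s / τ))) - cc (s / τ) ^ 4 * ((s / τ) ^ 2 / 2)))
      (mM (s / τ) * s) s := by
    intro s _
    have h1 : ∀ r, HasDerivAt (fun r => cc r ^ 3 * (r ^ 2 * (1 - 3 * r)) - cc r ^ 4 * (r ^ 2 / 2)) (mM r * r) r := by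
      intro r
      have g := ((hasDerivAt_cc 1 r).mul ((hasDerivAt_pow 2 r).mul
        (((hasDerivAt_id r).const_mul 3).const_sub 1))).sub
        ((hasDerivAt_cc 2 r).mul ((hasDerivAt_pow 2 r).div_const 2))
      refine hasDerivAt_of_eq g (fun y => by simp) ?_
      rcases le_total r 1 with h | h
      · simp [mM, cc_of_le_one h]; ring
      · simp [mM, cc_of_one_le h]
    have := (hasDerivAt_scale (h1 (s / τ))).const_mul (τ ^ 2)
    exact hasDerivAt_of_eq this (fun _ => rfl) (by field_simp)
  have hc : Continuous fun s => mM (s / τ) * s := by unfold mM; fun_prop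
  rw [intervalIntegral.integral_eq_sub_of_hasDerivAt hd (hc.intervalIntegrable _ _),
    cc_of_one_le (by rwa [one_le_div h0])]
  simp

lemma prof_mq : Prof mq mq' 100 := by
  refine ⟨by norm_num, hasDerivAt_mq, by unfold mq'; fun_prop, fun r hr => ?_, fun r hr => ?_, by simp [mq],
    fun τ h0 h1 => ?_⟩
  · simp [mq, mq', cc_of_one_le hr]
  · rcases le_total r 1 with h | h
    · rw [mq, mq', cc_of_le_one h]
      have e0 : 0 ≤ 1 - r := by linarith
      have e1 : (1 - r) ^ 2 ≤ 1 := by nlinarith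
      have e2 : |1 - 4 * r| ≤ 5 := by rw [abs_le]; constructor <;> nlinarith
      constructor
      · rw [abs_mul, abs_of_nonneg (sq_nonneg (1 - r))]
        nlinarith [abs_nonneg (1 - 4 * r)]
      · refine (abs_add_le _ _).trans ?_
        rw [abs_mul, abs_mul, abs_of_nonneg (sq_nonneg (1 - r)), abs_neg, abs_of_nonneg (by linarith)]
        norm_num
        nlinarith [abs_nonneg (1 - 4 * r)]
    · simp [mq, mq', cc_of_one_le h]
  · have hd : ∀ s ∈ Set.uIcc (0 : ℝ) 1, HasDerivAt (fun s => τ * (cc (s / τ) ^ 3 * (s / τ)))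
        (mq (s / τ)) s := by
      intro s _
      have h1 : ∀ r, HasDerivAt (fun r => cc r ^ 3 * r) (mq r) r := by
        intro r
        have g := (hasDerivAt_cc 1 r).mul (hasDerivAt_id r)
        refine hasDerivAt_of_eq g (fun y => by simp) ?_
        rcases le_total r 1 with h | h
        · simp [mq, cc_of_le_one h]; ring
        · simp [mq, cc_of_one_le h]
      have := (hasDerivAt_scale (h1 (s / τ))).const_mul τ
      exact hasDerivAt_of_eq this (fun _ => rfl) (by field_simp)
    have hc : Continuous fun s => mq (s / τ) := by unfold mq; fun_prop
    rw [intervalIntegral.integral_eq_sub_of_hasDerivAt hd (hc.intervalIntegrable _ _),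
      cc_of_one_le (by rwa [one_le_div h0])]
    simp

/-- The scaled profile `m (s / τ)` divided by `(1 - s) ^ k`. -/
def pE (m : ℝ → ℝ) (τ : ℝ) (k : ℕ) (s : ℝ) : ℝ := m (s / τ) / max (1 - s) (1 / 4) ^ k

/-- The derivative of `pE`. -/
def pD (m m' : ℝ → ℝ) (τ : ℝ) (k : ℕ) (s : ℝ) : ℝ :=
  m' (s / τ) / τ / max (1 - s) (1 / 4) ^ k + k * m (s / τ) / max (1 - s) (1 / 4) ^ (k + 1)

/-! ### Scaled profiles divided by powers of the barycentric weight -/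

section
variable {m m' : ℝ → ℝ} {B τ : ℝ} (P : Prof m m' B) (h0 : 0 < τ) (h1 : τ ≤ 1 / 2)
include P

lemma Prof.cont_scale : Continuous fun s => m (s / τ) := by
  have := continuous_iff_continuousAt.2 fun r => (P.deriv r).continuousAt
  fun_prop

include h0

lemma Prof.zero_of_le {s : ℝ} (hs : τ ≤ s) : m (s / τ) = 0 ∧ m' (s / τ) = 0 :=
  P.zero _ (by rwa [one_le_div h0])

lemma pE_zero_of_le (k : ℕ) {s : ℝ} (hs : τ ≤ s) : pE m τ k s = 0 := by
  simp [pE, (P.zero_of_le h0 hs).1]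

lemma pD_zero_of_le (k : ℕ) {s : ℝ} (hs : τ ≤ s) : pD m m' τ k s = 0 := by
  simp [pD, (P.zero_of_le h0 hs).1, (P.zero_of_le h0 hs).2]

omit h0 in
lemma pE_at_zero (k : ℕ) : pE m τ k 0 = 1 := by
  simp [pE, P.at_zero]; norm_num

omit h0 in
lemma continuous_pE (k : ℕ) : Continuous (pE m τ k) := by
  have hm := P.cont_scale (τ := τ)
  unfold pE
  apply hm.div (by fun_prop)
  intro s
  have : 0 < max (1 - s) (1 / 4) := lt_max_of_lt_right (by norm_num)
  positivity

omit h0 in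
lemma continuous_pD (k : ℕ) : Continuous (pD m m' τ k) := by
  have hm := P.cont_scale (τ := τ)
  have hm' := P.cont
  have hp : ∀ s : ℝ, 0 < max (1 - s) (1 / 4) := fun s => lt_max_of_lt_right (by norm_num)
  unfold pD
  apply Continuous.add
  · apply Continuous.div (by fun_prop) (by fun_prop)
    intro s; have := hp s; positivity
  · apply Continuous.div (hm.const_mul _) (by fun_prop)
    intro s; have := hp s; positivity

lemma pE_bound (k : ℕ) {s : ℝ} (hs : 0 ≤ s) : |pE m τ k s| ≤ 4 ^ k * B := by
  have hp : 1 / 4 ≤ max (1 - s) (1 / 4) := le_max_right _ _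
  have hb := (P.bound (s / τ) (by positivity)).1
  have hpow : 0 < max (1 - s) (1 / 4) ^ k := by positivity
  rw [pE, abs_div, abs_of_pos hpow, div_le_iff₀ hpow]
  have : (1 / 4 : ℝ) ^ k ≤ max (1 - s) (1 / 4) ^ k := pow_le_pow_left₀ (by norm_num) hp k
  calc |m (s / τ)| ≤ B := hb
    _ = 4 ^ k * B * (1 / 4) ^ k := by rw [one_div, inv_pow]; field_simp
    _ ≤ _ := by have := P.nonneg; gcongr

include h1

/-- The truncation at 1/4 only keeps the denominator away from zero: the profile vanishes for s ≥ τ,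
and 1 - s ≥ 1/2 where it does not. -/
lemma pE_mul (k : ℕ) (s : ℝ) : pE m τ k s * (1 - s) ^ k = m (s / τ) := by
  rcases le_total s (1 / 2) with h | h
  · rw [pE, max_eq_left (by linarith), div_mul_cancel₀]
    have : 0 < 1 - s := by linarith
    positivity
  · simp [pE, (P.zero_of_le h0 (h1.trans h)).1]

lemma pD_bound (k : ℕ) {s : ℝ} (hs : 0 ≤ s) : |pD m m' τ k s| ≤ (4 ^ k + k * 4 ^ (k + 1)) * B / τ := by
  have hp : 1 / 4 ≤ max (1 - s) (1 / 4) := le_max_right _ _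
  obtain ⟨hb, hb'⟩ := P.bound (s / τ) (by positivity)
  have hB := P.nonneg
  have h4 : ∀ j : ℕ, ∀ y : ℝ, |y / max (1 - s) (1 / 4) ^ j| ≤ 4 ^ j * |y| := by
    intro j y
    have hpow : 0 < max (1 - s) (1 / 4) ^ j := by positivity
    rw [abs_div, abs_of_pos hpow, div_le_iff₀ hpow]
    have : (1 / 4 : ℝ) ^ j ≤ max (1 - s) (1 / 4) ^ j := pow_le_pow_left₀ (by norm_num) hp j
    calc |y| = 4 ^ j * |y| * (1 / 4) ^ j := by rw [one_div, inv_pow]; field_simp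
      _ ≤ _ := by gcongr
  refine (abs_add_le _ _).trans ((add_le_add (h4 _ _) (h4 _ _)).trans ?_)
  rw [abs_div, abs_mul, abs_of_pos h0, Nat.abs_cast]
  have e1 : B ≤ B / τ := by rw [le_div_iff₀ h0]; nlinarith
  calc 4 ^ k * (|m' (s / τ)| / τ) + 4 ^ (k + 1) * (k * |m (s / τ)|)
      ≤ 4 ^ k * (B / τ) + 4 ^ (k + 1) * (k * (B / τ)) := by
        have := hb.trans e1
        gcongr
    _ = _ := by ring

lemma hasDerivAt_pE (k : ℕ) (s : ℝ) : HasDerivAt (pE m τ k) (pD m m' τ k s) s := by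
  rcases lt_or_ge (1 / 2) s with h | h
  · have e : pE m τ k =ᶠ[𝓝 s] fun _ => 0 := by
      filter_upwards [Ioi_mem_nhds h] with t ht
      exact pE_zero_of_le P h0 k (h1.trans (le_of_lt ht))
    rw [pD_zero_of_le P h0 k (h1.trans h.le)]
    exact (hasDerivAt_const s (0 : ℝ)).congr_of_eventuallyEq e
  · have hs : (0 : ℝ) < 1 - s := by linarith
    have e : pE m τ k =ᶠ[𝓝 s] fun s => m (s / τ) / (1 - s) ^ k := by
      filter_upwards [Iio_mem_nhds (show s < 3 / 4 by linarith)] with t ht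
      rw [pE, max_eq_left (by have : t < 3 / 4 := ht; linarith)]
    refine HasDerivAt.congr_of_eventuallyEq ?_ e
    have g1 := hasDerivAt_scale (P.deriv (s / τ))
    have g2 : HasDerivAt (fun s : ℝ => (1 - s) ^ k) (-(k * (1 - s) ^ (k - 1))) s := by
      have := ((hasDerivAt_id s).const_sub 1).pow k
      exact hasDerivAt_of_eq this (fun _ => by simp) (by simp)
    have g3 := g1.div g2 (by positivity)
    refine hasDerivAt_of_eq g3 (fun _ => rfl) ?_
    rw [pD, max_eq_left (by linarith)]
    rcases k with _ | k
    · simp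
    · simp only [Nat.add_sub_cancel]
      field_simp
      push_cast
      ring

lemma contDiff_pE (k : ℕ) : ContDiff ℝ 1 (pE m τ k) := by
  rw [contDiff_one_iff_deriv]
  refine ⟨fun s => (hasDerivAt_pE P h0 h1 k s).differentiableAt, ?_⟩
  have : deriv (pE m τ k) = pD m m' τ k := funext fun s => (hasDerivAt_pE P h0 h1 k s).deriv
  rw [this]
  exact continuous_pD P k

end

/-! ### Piecewise smooth functions -/

lemma convex_unitSquare : Convex ℝ unitSquare := by
  have e : unitSquare = ((fun p : Pt => p 0) ⁻¹' Set.Ioo 0 1) ∩ ((fun p : Pt => p 1) ⁻¹' Set.Ioo 0 1) := by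
    ext p; simp [unitSquare, and_assoc]
  rw [e]
  exact ((convex_Ioo 0 1).linear_preimage (EuclideanSpace.proj (𝕜 := ℝ) (0 : Fin 2)).toLinearMap).inter
    ((convex_Ioo 0 1).linear_preimage (EuclideanSpace.proj (𝕜 := ℝ) (1 : Fin 2)).toLinearMap)

lemma convex_vstrip (a b : ℝ) : Convex ℝ (vstrip a b) := by
  have e : vstrip a b = ((fun p : Pt => p 0) ⁻¹' Set.Ioo a b) ∩ ((fun p : Pt => p 1) ⁻¹' Set.Ioo 0 1) := by
    ext p; simp [vstrip, and_assoc]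
  rw [e]
  exact ((convex_Ioo a b).linear_preimage (EuclideanSpace.proj (𝕜 := ℝ) (0 : Fin 2)).toLinearMap).inter
    ((convex_Ioo 0 1).linear_preimage (EuclideanSpace.proj (𝕜 := ℝ) (1 : Fin 2)).toLinearMap)

lemma closure_ae_eq {D : Set Pt} (hD : Convex ℝ D) : (closure D : Set Pt) =ᵐ[volume] D := by
  have h := hD.addHaar_frontier volume
  refine (ae_le_set.2 ?_).antisymm subset_closure.eventuallyLE
  have hsub : closure D \ D ⊆ frontier D := fun x hx => ⟨hx.1, fun h => hx.2 (interior_subset h)⟩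
  exact measure_mono_null hsub h

/-- `w` vanishes off the unit square and coincides on each element `T` with a `C¹` function `F T`. -/
structure PW (𝒯 : Triangulation unitSquare) (w : Pt → ℝ) (F : Finset Pt → Pt → ℝ) : Prop where
  zero : ∀ p ∉ unitSquare, w p = 0
  smooth : ∀ T ∈ 𝒯.elems, ContDiff ℝ 1 (F T)
  eq : ∀ T ∈ 𝒯.elems, ∀ p ∈ hull T, w p = F T p

section
variable {𝒯 : Triangulation unitSquare}

lemma exists_elem {p : Pt} (hp : p ∈ closure unitSquare) : ∃ T ∈ 𝒯.elems, p ∈ hull T := by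
  rw [← 𝒯.cover] at hp
  simpa using hp

lemma ae_mem_interior : ∀ᵐ p ∂(volume : Measure Pt), ∀ T ∈ 𝒯.elems, p ∈ hull T → p ∈ interior (hull T) := by
  have h : ∀ T : Finset Pt, ∀ᵐ p ∂(volume : Measure Pt), p ∈ hull T → p ∈ interior (hull T) := fun T =>
    (ae_restrict_iff' (measurableSet_hull T)).1 (interior_ae T)
  exact (ae_ball_iff (Finset.countable_toSet 𝒯.elems)).2 fun T _ => h T

namespace PW
variable {w : Pt → ℝ} {F : Finset Pt → Pt → ℝ} (hw : PW 𝒯 w F)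
include hw

lemma hasStrictFDerivAt {T : Finset Pt} (hT : T ∈ 𝒯.elems) {p : Pt} (hp : p ∈ interior (hull T)) :
    HasStrictFDerivAt w (fderiv ℝ (F T) p) p := by
  have e : F T =ᶠ[𝓝 p] w := by
    filter_upwards [isOpen_interior.mem_nhds hp] with y hy
    exact (hw.eq T hT y (interior_subset hy)).symm
  exact ((hw.smooth T hT).contDiffAt.hasStrictFDerivAt (by norm_num)).congr_of_eventuallyEq e

lemma gradient_eq {T : Finset Pt} (hT : T ∈ 𝒯.elems) {p : Pt} (hp : p ∈ interior (hull T)) :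
    gradient w p = gradient (F T) p := by
  rw [gradient, gradient, (hw.hasStrictFDerivAt hT hp).hasFDerivAt.fderiv]

/-- The closed pieces are the elements, compact and convex with a C¹ function on each, and the
complement of the square, where `w` is 0. -/
lemma exists_lipschitz : ∃ K, LipschitzWith K w := by
  refine lipschitzWith_of_finite_closed_cover (ι := Option 𝒯.elems)
    (P := fun i => i.elim unitSquareᶜ fun T => hull T) ?_ ?_ ?_
  · rintro (_ | T)
    · exact isOpen_unitSquare.isClosed_compl
    · exact isClosed_hull T
  · intro p
    by_cases hp : p ∈ unitSquare
    · obtain ⟨T, hT, h⟩ := exists_elem (𝒯 := 𝒯) (subset_closure hp)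
      exact ⟨some ⟨T, hT⟩, h⟩
    · exact ⟨none, hp⟩
  · rintro (_ | ⟨T, hT⟩)
    · refine ⟨0, fun p hp q hq => ?_⟩
      rw [hw.zero p hp, hw.zero q hq]; simp
    · obtain ⟨K, hK⟩ := (hw.smooth T hT).contDiffOn.exists_lipschitzOnWith one_ne_zero (convex_hull T)
        (isCompact_hull T)
      refine ⟨K, fun p hp q hq => ?_⟩
      rw [hw.eq T hT p hp, hw.eq T hT q hq]
      exact hK hp hq

lemma isH10 : IsH10 unitSquare w (gradient w) := by
  obtain ⟨K, hK⟩ := hw.exists_lipschitz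
  refine isH10_of_lipschitz hK hw.zero ?_
  refine (ae_restrict_iff' isOpen_unitSquare.measurableSet).2 ?_
  filter_upwards [ae_mem_interior (𝒯 := 𝒯)] with p hp hpΩ
  obtain ⟨T, hT, h⟩ := exists_elem (𝒯 := 𝒯) (subset_closure hpΩ)
  have := hw.hasStrictFDerivAt hT (hp T hT h)
  rwa [this.hasFDerivAt.fderiv]

lemma integral_eq {T : Finset Pt} (hT : T ∈ 𝒯.elems) (Φ : Pt → ℝ → Pt → ℝ) :
    ∫ p in hull T, Φ p (w p) (gradient w p) = ∫ p in hull T, Φ p (F T p) (gradient (F T) p) := by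
  refine integral_congr_ae ?_
  filter_upwards [interior_ae T] with p hp
  rw [hw.gradient_eq hT hp, hw.eq T hT p (interior_subset hp)]

end PW

/-! ### Splitting integrals into elements -/

omit 𝒯 in
-- The side is contained in strips of arbitrarily small relative width, whose area is bounded by
-- `volume_strip_le`.
lemma volume_bc_zero {p q r : Pt} (hD : cr (q - p) (r - p) ≠ 0) :
    volume {x ∈ hull {p, q, r} | bc p q r x = 0} = 0 := by
  have hfin : volume {x ∈ hull {p, q, r} | bc p q r x = 0} ≠ ⊤ :=
    ((measure_mono (Set.sep_subset _ _)).trans_lt (volume_hull_lt_top _)).ne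
  have h : ∀ τ : ℝ, 0 < τ → volume.real {x ∈ hull {p, q, r} | bc p q r x = 0} ≤ 4 * τ * area {p, q, r} := by
    intro τ hτ
    have hsub : {x ∈ hull {p, q, r} | bc p q r x = 0} ⊆ {x ∈ hull {p, q, r} | bc p q r x < τ} :=
      fun x hx => ⟨hx.1, by rw [hx.2]; exact hτ⟩
    refine le_trans (measureReal_mono hsub
      ((measure_mono (Set.sep_subset _ _)).trans_lt (volume_hull_lt_top _)).ne) (volume_strip_le hD hτ.le)
  rw [← measureReal_eq_zero_iff hfin]
  refine le_antisymm (le_of_forall_pos_le_add fun δ hδ => ?_) measureReal_nonneg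
  have ha := area_pos hD
  refine (h (δ / (4 * area {p, q, r})) (by positivity)).trans (le_of_eq ?_)
  rw [zero_add]
  field_simp

/-- Some vertex `r` of `T` is missing from `T'`. By conformity the common part lies in the hull of
the remaining vertices, where the weight of `r` is zero. -/
lemma aedisjoint_hull {n : ℕ} {x : ℕ → ℝ} (M : Mesh 𝒯 n x) {T T' : Finset Pt} (hT : T ∈ 𝒯.elems)
    (hT' : T' ∈ 𝒯.elems) (hne : T ≠ T') : AEDisjoint volume (hull T) (hull T') := by
  obtain ⟨r, hr, hr'⟩ : ∃ r ∈ T, r ∉ T' := by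
    by_contra! h
    exact hne (Finset.eq_of_subset_of_card_le h (by rw [𝒯.card_eq T hT, 𝒯.card_eq T' hT']))
  obtain ⟨p, hp, hpr⟩ : ∃ p ∈ T, p ≠ r := by
    by_contra! h
    have : T ⊆ {r} := fun p hp => by simpa using h p hp
    have := Finset.card_le_card this
    rw [𝒯.card_eq T hT] at this
    simp at this
  obtain ⟨q, rfl⟩ := Mesh.exists_third hT hr hp hpr.symm
  have e : ({r, p, q} : Finset Pt) = {p, q, r} := by ext; simp; tauto
  rw [e] at hT ⊢
  have hD := M.cr_ne hT
  have hsub : hull {p, q, r} ∩ hull T' ⊆ {x ∈ hull {p, q, r} | bc p q r x = 0} := fun y hy => ⟨hy.1, by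
    rw [𝒯.conforming _ hT _ hT'] at hy
    refine bc_eq_zero_of_mem (fun z hz => ?_) hy
    simp only [Finset.coe_insert, Finset.coe_singleton, Set.mem_inter_iff, Set.mem_insert_iff,
      Set.mem_singleton_iff, Finset.mem_coe] at hz
    rcases hz with ⟨rfl | rfl | rfl, h⟩
    · exact bc_left
    · exact bc_right
    · exact absurd h hr'⟩
  exact measure_mono_null hsub (volume_bc_zero hD)

variable {n : ℕ} {x : ℕ → ℝ} (M : Mesh 𝒯 n x)
include M

lemma integral_biUnion_hull {𝒮 : Finset (Finset Pt)} (hS : 𝒮 ⊆ 𝒯.elems) {F : Pt → ℝ}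
    (hF : IntegrableOn F unitSquare) :
    ∫ p in ⋃ T ∈ 𝒮, hull T, F p = ∑ T ∈ 𝒮, ∫ p in hull T, F p := by
  have hU : (⋃ T ∈ 𝒮, hull T) = ⋃ T : 𝒮, hull T := by ext; simp
  have hFc : IntegrableOn F (closure unitSquare) := hF.congr_set_ae (closure_ae_eq convex_unitSquare)
  rw [hU, integral_iUnion_ae (fun T => (measurableSet_hull _).nullMeasurableSet), tsum_fintype,
    Finset.sum_coe_sort 𝒮 fun T => ∫ p in hull T, F p]
  · intro T T' hne
    exact aedisjoint_hull M (hS T.2) (hS T'.2) fun h => hne (Subtype.ext h)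
  · refine hFc.mono_set ?_
    rw [← hU]
    exact Set.iUnion₂_subset fun T hT => Mesh.vertex_mem_closure (hS hT)

lemma integral_unitSquare {F : Pt → ℝ} (hF : IntegrableOn F unitSquare) :
    ∫ p in unitSquare, F p = ∑ T ∈ 𝒯.elems, ∫ p in hull T, F p := by
  rw [← integral_biUnion_hull M subset_rfl hF, 𝒯.cover]
  exact setIntegral_congr_set (closure_ae_eq convex_unitSquare).symm

omit M in
lemma mem_elemsIn {D : Set Pt} {T : Finset Pt} : T ∈ 𝒯.elemsIn D ↔ T ∈ 𝒯.elems ∧ hull T ⊆ closure D := by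
  simp [Triangulation.elemsIn]

lemma sum_integral_le {D : Set Pt} (hD : Convex ℝ D) (hDΩ : D ⊆ unitSquare)
    {F : Pt → ℝ} (hF : IntegrableOn F unitSquare) (h0 : ∀ p, 0 ≤ F p) :
    ∑ T ∈ 𝒯.elemsIn D, ∫ p in hull T, F p ≤ ∫ p in D, F p := by
  rw [← integral_biUnion_hull M (fun T hT => (mem_elemsIn.1 hT).1) hF,
    ← setIntegral_congr_set (closure_ae_eq hD)]
  refine setIntegral_mono_set ((hF.mono_set hDΩ).congr_set_ae (closure_ae_eq hD))
    (Eventually.of_forall h0) ?_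
  exact (Set.iUnion₂_subset fun T hT => (mem_elemsIn.1 hT).2).eventuallyLE

end

/-- The extension by zero of a finite element function. -/
lemma pw_of_isFE {𝒯 : Triangulation unitSquare} {v : Pt → ℝ} (hv : 𝒯.IsFE v) :
    ∃ (g : Finset Pt → Pt) (c : Finset Pt → ℝ),
      (∀ T ∈ 𝒯.elems, ∀ p ∈ hull T, v p = ⟪g T, p⟫_ℝ + c T) ∧
      PW 𝒯 (unitSquare.indicator v) (fun T p => ⟪g T, p⟫_ℝ + c T) ∧
      (∀ p ∈ unitSquare, gradient v p = gradient (unitSquare.indicator v) p) ∧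
      ∀ T ∈ 𝒯.elems, ∀ p ∈ interior (hull T), gradient v p = g T := by
  choose! g c hgc using hv.2.1
  have hg : ∀ a : Pt, ∀ b : ℝ, ∀ p, HasGradientAt (fun p : Pt => ⟪a, p⟫_ℝ + b) a p := by
    intro a b p
    rw [hasGradientAt_iff_hasFDerivAt]
    exact ((InnerProductSpace.toDual ℝ Pt a).hasFDerivAt).add_const b
  refine ⟨g, c, hgc, ⟨fun p hp => Set.indicator_of_notMem hp _, fun T _ => (contDiff_const.inner ℝ contDiff_id).add contDiff_const, fun T hT p hp => ?_⟩,
    fun p hp => ?_, fun T hT p hp => ?_⟩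
  · by_cases hpΩ : p ∈ unitSquare
    · rw [Set.indicator_of_mem hpΩ, hgc T hT p hp]
    · rw [Set.indicator_of_notMem hpΩ, ← hgc T hT p hp, hv.2.2 p]
      exact ⟨Mesh.vertex_mem_closure hT hp, fun h => hpΩ (interior_subset h)⟩
  · have e : v =ᶠ[𝓝 p] unitSquare.indicator v := by
      filter_upwards [isOpen_unitSquare.mem_nhds hp] with y hy
      rw [Set.indicator_of_mem hy]
    rw [gradient, gradient, e.fderiv_eq]
  · have e : v =ᶠ[𝓝 p] fun p => ⟪g T, p⟫_ℝ + c T := by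
      filter_upwards [isOpen_interior.mem_nhds hp] with y hy
      exact hgc T hT y (interior_subset hy)
    rw [gradient, e.fderiv_eq]
    exact (hg (g T) (c T) p).gradient

/-! ### The residual -/

lemma integral_norm_mul_norm_le {α E G : Type*} [MeasurableSpace α] [NormedAddCommGroup E]
    [NormedAddCommGroup G] {μ : Measure α} {f : α → E} {g : α → G} (hf : MemLp f 2 μ) (hg : MemLp g 2 μ) :
    ∫ x, ‖f x‖ * ‖g x‖ ∂μ ≤ √(∫ x, ‖f x‖ ^ 2 ∂μ) * √(∫ x, ‖g x‖ ^ 2 ∂μ) := by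
  have h := integral_mul_norm_le_Lp_mul_Lq (μ := μ) (f := fun x => ‖f x‖) (g := fun x => ‖g x‖)
    Real.HolderConjugate.two_two (by simpa using hf.norm) (by simpa using hg.norm)
  simpa [Real.sqrt_eq_rpow] using h

lemma integrable_mul_of_memLp {α : Type*} [MeasurableSpace α] {μ : Measure α} {f g : α → ℝ}
    (hf : MemLp f 2 μ) (hg : MemLp g 2 μ) : Integrable (fun x => f x * g x) μ :=
  hf.integrable_mul hg

lemma integrable_inner_of_memLp {α : Type*} [MeasurableSpace α] {μ : Measure α} {f g : α → Pt}
    (hf : MemLp f 2 μ) (hg : MemLp g 2 μ) : Integrable (fun x => ⟪f x, g x⟫_ℝ) μ := by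
  refine (hf.norm.integrable_mul hg.norm).mono' (hf.1.inner hg.1) (Eventually.of_forall fun x => ?_)
  simpa using norm_inner_le_norm (𝕜 := ℝ) (f x) (g x)

lemma memLp_hull {𝒯 : Triangulation unitSquare} {E : Type*} [NormedAddCommGroup E] {h : Pt → E}
    (hh : MemLp h 2 (volume.restrict unitSquare)) {T : Finset Pt} (hT : T ∈ 𝒯.elems) :
    MemLp h 2 (volume.restrict (hull T)) := by
  rw [← Measure.restrict_congr_set (closure_ae_eq convex_unitSquare)] at hh
  exact hh.mono_measure (Measure.restrict_mono (Mesh.vertex_mem_closure hT) le_rfl)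

/-- The data of the discretized problem that enter the residual. -/
structure Sol (𝒯 : Triangulation unitSquare) (ε Cf L : ℝ) (f : Pt → ℝ → ℝ) (u : Pt → ℝ) (gu : Pt → Pt)
    (uh : Pt → ℝ) : Prop where
  pos : 0 < ε
  one_le : 1 ≤ Cf + ε ^ 2
  adm : IsAdmissible unitSquare f Cf L
  weak : IsWeakSolution unitSquare ε f u gu
  fe : 𝒯.IsFE uh

/-- The local error indicator together with the local energy error. -/
def errT (ε : ℝ) (f : Pt → ℝ → ℝ) (u : Pt → ℝ) (gu : Pt → Pt) (uh : Pt → ℝ) (T : Finset Pt) : ℝ :=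
  ε ^ 2 * (∫ p in hull T, ‖gradient uh p - gu p‖ ^ 2) + (∫ p in hull T, (uh p - u p) ^ 2) +
    area T * (min 1 (maxEdge T / ε) * osc (fun p => f p (uh p)) (hull T ∩ unitSquare)) ^ 2

lemma errT_nonneg {ε : ℝ} {f : Pt → ℝ → ℝ} {u : Pt → ℝ} {gu : Pt → Pt} {uh : Pt → ℝ} {T : Finset Pt} :
    0 ≤ errT ε f u gu uh T := by
  have : 0 ≤ area T := measureReal_nonneg
  have h1 : 0 ≤ ∫ p in hull T, ‖gradient uh p - gu p‖ ^ 2 := integral_nonneg fun _ => sq_nonneg _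
  have h2 : 0 ≤ ∫ p in hull T, (uh p - u p) ^ 2 := integral_nonneg fun _ => sq_nonneg _
  unfold errT
  positivity

lemma IsAdmissible.lip_nonneg {f : Pt → ℝ → ℝ} {Cf L : ℝ} (h : IsAdmissible unitSquare f Cf L) : Cf ≤ L := by
  have hp : (WithLp.toLp 2 ![1 / 2, 1 / 2] : Pt) ∈ unitSquare := by
    simp [unitSquare]; norm_num
  have h1 := h.monotone _ hp 0 1 (by norm_num)
  have h2 := h.lipschitz _ hp 0 1
  have h3 := le_abs_self (f (WithLp.toLp 2 ![1 / 2, 1 / 2]) 1 - f (WithLp.toLp 2 ![1 / 2, 1 / 2]) 0)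
  simp only [sub_zero, mul_one, abs_one] at h1 h2
  linarith

/-- Boundedness at s = 0 and the Lipschitz condition give growth at most B + L|v|; measurability
comes from extending `f` by zero outside the square. -/
lemma IsAdmissible.memLp {f : Pt → ℝ → ℝ} {Cf L : ℝ} (h : IsAdmissible unitSquare f Cf L) {v : Pt → ℝ}
    (hv : MemLp v 2 (volume.restrict unitSquare)) :
    MemLp (fun p => f p (v p)) 2 (volume.restrict unitSquare) := by
  classical
  have hm : MeasurableSet (unitSquare ×ˢ Set.univ : Set (Pt × ℝ)) :=
    isOpen_unitSquare.measurableSet.prod MeasurableSet.univ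
  have hmeas : Measurable ((unitSquare ×ˢ Set.univ : Set (Pt × ℝ)).piecewise
      (fun q : Pt × ℝ => f q.1 q.2) fun _ => 0) :=
    h.continuousOn.measurable_piecewise continuousOn_const hm
  have hΩ : ∀ᵐ p ∂(volume.restrict unitSquare), p ∈ unitSquare :=
    ae_restrict_mem isOpen_unitSquare.measurableSet
  have hae : AEStronglyMeasurable (fun p => f p (v p)) (volume.restrict unitSquare) := by
    have h1 := hmeas.comp_aemeasurable (aemeasurable_id.prodMk hv.1.aemeasurable)
    refine h1.aestronglyMeasurable.congr ?_
    filter_upwards [hΩ] with p hp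
    simp [Set.piecewise, hp]
  obtain ⟨B, hB⟩ := h.bounded 0
  have hdom : MemLp (fun p => B + L * |v p|) 2 (volume.restrict unitSquare) :=
    (memLp_const B).add (hv.abs.const_mul L)
  refine hdom.mono hae ?_
  filter_upwards [hΩ] with p hp
  have h1 := hB p hp
  have h2 := h.lipschitz p hp 0 (v p)
  rw [sub_zero] at h2
  rw [Real.norm_eq_abs, Real.norm_eq_abs]
  calc |f p (v p)| = |f p 0 + (f p (v p) - f p 0)| := by ring_nf
    _ ≤ |f p 0| + |f p (v p) - f p 0| := abs_add_le _ _
    _ ≤ B + L * |v p| := add_le_add h1 h2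
    _ ≤ _ := le_abs_self _

/-- The weight `N` controls the contribution of `F` on `T` to the residual. -/
structure Wts (ε : ℝ) (T : Finset Pt) (F : Pt → ℝ) (N : ℝ) : Prop where
  nonneg : 0 ≤ N
  grad : ε ^ 2 * (∫ x in hull T, ‖gradient F x‖ ^ 2) ≤ N ^ 2
  sq : ∫ x in hull T, F x ^ 2 ≤ N ^ 2
  abs : ∫ x in hull T, |F x| ≤ N * (√(area T) * min 1 (maxEdge T / ε))

lemma Wts.zero (ε : ℝ) (T : Finset Pt) : Wts ε T (fun _ => 0) 0 := by
  refine ⟨le_rfl, ?_, ?_, ?_⟩ <;> simp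

namespace Sol
variable {𝒯 : Triangulation unitSquare} {ε Cf L : ℝ} {f : Pt → ℝ → ℝ} {u : Pt → ℝ} {gu : Pt → Pt}
  {uh : Pt → ℝ} (S : Sol 𝒯 ε Cf L f u gu uh)
include S

lemma isH10_err : IsH10 unitSquare (fun p => unitSquare.indicator uh p - u p)
    (fun p => gradient (unitSquare.indicator uh) p - gu p) := by
  obtain ⟨g, c, -, hpw, -, -⟩ := pw_of_isFE S.fe
  exact isH10_sub hpw.isH10 S.weak.1

lemma ae_eq : (∀ᵐ p ∂(volume.restrict unitSquare), unitSquare.indicator uh p = uh p ∧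
    gradient (unitSquare.indicator uh) p = gradient uh p) := by
  obtain ⟨g, c, -, hpw, h, -⟩ := pw_of_isFE S.fe
  filter_upwards [ae_restrict_mem isOpen_unitSquare.measurableSet] with p hp
  exact ⟨Set.indicator_of_mem hp _, (h p hp).symm⟩

lemma memLp_uh : MemLp uh 2 (volume.restrict unitSquare) := by
  obtain ⟨g, c, -, hpw, h, -⟩ := pw_of_isFE S.fe
  exact hpw.isH10.1.ae_eq (S.ae_eq.mono fun p hp => hp.1)

lemma memLp_grad : MemLp (gradient uh) 2 (volume.restrict unitSquare) := by
  obtain ⟨g, c, -, hpw, h, -⟩ := pw_of_isFE S.fe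
  exact hpw.isH10.2.1.ae_eq (S.ae_eq.mono fun p hp => hp.2)

lemma memLp_err : MemLp (fun p => uh p - u p) 2 (volume.restrict unitSquare) := S.memLp_uh.sub S.weak.1.1

lemma memLp_grad_err : MemLp (fun p => gradient uh p - gu p) 2 (volume.restrict unitSquare) :=
  S.memLp_grad.sub S.weak.1.2.1

/-- The supremum and infimum in `osc` are meaningful only for a bounded set of values. The extension
of `uh` by zero is Lipschitz and vanishes at the origin, which bounds `uh` on the square and then `f
p (uh p)`. -/
lemma sub_le_osc {T : Finset Pt} {p q : Pt} (hp : p ∈ hull T ∩ unitSquare) (hq : q ∈ hull T ∩ unitSquare) :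
    |f p (uh p) - f q (uh q)| ≤ osc (fun p => f p (uh p)) (hull T ∩ unitSquare) := by
  obtain ⟨B, hB⟩ := S.adm.bounded 0
  obtain ⟨g, c, -, hpw, -, -⟩ := pw_of_isFE S.fe
  obtain ⟨K, hK⟩ := hpw.exists_lipschitz
  have h2 : ∀ p ∈ unitSquare, |uh p| ≤ K * 3 := by
    intro p hp
    have h0 : (0 : Pt) ∉ unitSquare := by simp [unitSquare]
    have := hK.dist_le_mul p 0
    rw [hpw.zero 0 h0, Set.indicator_of_mem hp, Real.dist_eq, sub_zero, dist_zero_right] at this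
    refine this.trans (mul_le_mul_of_nonneg_left ?_ K.2)
    have h3 := norm_le_abs_add p
    obtain ⟨a, b, c, d⟩ := hp
    rw [abs_of_pos a, abs_of_pos c] at h3
    linarith
  have hL : 0 ≤ L := S.adm.nonneg.trans S.adm.lip_nonneg
  have h3 : ∀ p ∈ unitSquare, |f p (uh p)| ≤ B + L * (K * 3) := by
    intro p hp
    have h1 := hB p hp
    have h4 := S.adm.lipschitz p hp 0 (uh p)
    rw [sub_zero] at h4
    calc |f p (uh p)| = |f p 0 + (f p (uh p) - f p 0)| := by ring_nf
      _ ≤ |f p 0| + |f p (uh p) - f p 0| := abs_add_le _ _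
      _ ≤ B + L * (K * 3) := add_le_add h1 (h4.trans (mul_le_mul_of_nonneg_left (h2 p hp) hL))
  have ha : BddAbove ((fun p => f p (uh p)) '' (hull T ∩ unitSquare)) :=
    ⟨_, by rintro _ ⟨y, hy, rfl⟩; exact (le_abs_self _).trans (h3 y hy.2)⟩
  have hb : BddBelow ((fun p => f p (uh p)) '' (hull T ∩ unitSquare)) :=
    ⟨-(B + L * (K * 3)), by rintro _ ⟨y, hy, rfl⟩; exact (abs_le.1 (h3 y hy.2)).1⟩
  have e1 := le_csSup ha ⟨p, hp, rfl⟩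
  have e2 := le_csSup ha ⟨q, hq, rfl⟩
  have e3 := csInf_le hb ⟨p, hp, rfl⟩
  have e4 := csInf_le hb ⟨q, hq, rfl⟩
  simp only at e1 e2 e3 e4
  rw [abs_le, osc]
  constructor <;> linarith

variable {n : ℕ} {x : ℕ → ℝ} (M : Mesh 𝒯 n x)
include M

/-- The L² term of `errT` has coefficient 1 instead of `Cf`. By C_f + ε² ≥ 1 it is at most (C_f +
ε²)‖e‖² on the strip, and Poincaré turns the ε² part into the gradient term, which is then counted
twice. -/
lemma sum_errT_le {i : ℕ} (hi : vstrip (x (i - 1)) (x (i + 1)) ⊆ unitSquare) :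
    ∑ T ∈ 𝒯.elemsIn (strip x i), errT ε f u gu uh T ≤
      2 * (energySq ε Cf (strip x i) (fun p => uh p - u p) (fun p => gradient uh p - gu p) +
        ∑ T ∈ 𝒯.elemsIn (strip x i), area T * (min 1 (maxEdge T / ε) *
          osc (fun p => f p (uh p)) (hull T ∩ unitSquare)) ^ 2) := by
  have hstrip : strip x i = vstrip (x (i - 1)) (x (i + 1)) := rfl
  have hc := convex_vstrip (x (i - 1)) (x (i + 1))
  have h1 := sum_integral_le M hc hi (F := fun p => ‖gradient uh p - gu p‖ ^ 2)
    S.memLp_grad_err.norm.integrable_sq fun p => sq_nonneg _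
  have h2 := sum_integral_le M hc hi (F := fun p => (uh p - u p) ^ 2)
    S.memLp_err.integrable_sq fun p => sq_nonneg _
  have h3 : ∫ p in strip x i, (uh p - u p) ^ 2 ≤ ∫ p in strip x i, ‖gradient uh p - gu p‖ ^ 2 := by
    have h := poincare S.isH10_err hi
    have hae := ae_restrict_of_ae_restrict_of_subset hi S.ae_eq
    have e1 : ∫ p in strip x i, (unitSquare.indicator uh p - u p) ^ 2 = ∫ p in strip x i, (uh p - u p) ^ 2 :=
      integral_congr_ae (by filter_upwards [hae] with p hp; simp only [hp.1])
    have e2 : ∫ p in strip x i, ‖gradient (unitSquare.indicator uh) p - gu p‖ ^ 2 =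
        ∫ p in strip x i, ‖gradient uh p - gu p‖ ^ 2 :=
      integral_congr_ae (by filter_upwards [hae] with p hp; simp only [hp.2])
    rw [← e1, ← e2]
    exact h
  rw [← hstrip] at h1 h2
  have h4 : 0 ≤ ∑ T ∈ 𝒯.elemsIn (strip x i), area T * (min 1 (maxEdge T / ε) *
      osc (fun p => f p (uh p)) (hull T ∩ unitSquare)) ^ 2 := by
    refine Finset.sum_nonneg fun T _ => ?_
    have : 0 ≤ area T := measureReal_nonneg
    positivity
  have h5 : 0 ≤ ∫ p in strip x i, (uh p - u p) ^ 2 := integral_nonneg fun _ => sq_nonneg _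
  unfold errT energySq
  rw [Finset.sum_add_distrib, Finset.sum_add_distrib, ← Finset.mul_sum]
  have h6 := mul_le_mul_of_nonneg_left h1 (sq_nonneg ε)
  have h7 := mul_le_mul_of_nonneg_left h3 (sq_nonneg ε)
  have h8 := mul_le_mul_of_nonneg_right S.one_le h5
  have h9 := mul_nonneg S.adm.nonneg h5
  nlinarith

/-- The central inequality. The weak equation for `u` rewrites the pairing of ∇u_h with ∇w as an
error term, a Lipschitz term and ∫ f_h w. The first two are Cauchy–Schwarz on each element; the last
sees only the oscillation of f_h because `w` has zero mean there. -/
lemma abs_residual_le {w : Pt → ℝ} {F : Finset Pt → Pt → ℝ} (hw : PW 𝒯 w F) {g : Finset Pt → Pt}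
    (hg : ∀ T ∈ 𝒯.elems, ∀ p ∈ interior (hull T), gradient uh p = g T)
    (h0 : ∀ T ∈ 𝒯.elems, ∫ p in hull T, F T p = 0) {N : Finset Pt → ℝ} (hN : ∀ T ∈ 𝒯.elems, Wts ε T (F T) (N T)) :
    |∑ T ∈ 𝒯.elems, ε ^ 2 * ⟪g T, ∫ p in hull T, gradient (F T) p⟫_ℝ| ≤
      (2 + L) * ∑ T ∈ 𝒯.elems, √(errT ε f u gu uh T) * N T := by
  have hε := S.pos
  have hL : 0 ≤ L := S.adm.nonneg.trans S.adm.lip_nonneg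
  obtain ⟨hwm, hgwm, -⟩ := hw.isH10
  have hfh := S.adm.memLp S.memLp_uh
  have hfu := S.adm.memLp S.weak.1.1
  have hweak := S.weak.2 w _ hw.isH10
  -- Subtracting the weak equation tested with `w` brings in the errors ∇(u_h - u) and f_h - f(·;u),
  -- elementwise.
  have key : ∑ T ∈ 𝒯.elems, ε ^ 2 * ⟪g T, ∫ p in hull T, gradient (F T) p⟫_ℝ =
      ∑ T ∈ 𝒯.elems, (ε ^ 2 * (∫ p in hull T, ⟪gradient uh p - gu p, gradient w p⟫_ℝ) +
        (∫ p in hull T, (f p (uh p) - f p (u p)) * w p) - ∫ p in hull T, f p (uh p) * w p) := by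
    have i1 := integrable_inner_of_memLp S.memLp_grad_err hgwm
    have i2 := integrable_mul_of_memLp (hfh.sub hfu) hwm
    have i3 := integrable_mul_of_memLp hfh hwm
    have i4 := integrable_inner_of_memLp S.memLp_grad hgwm
    have i5 := integrable_inner_of_memLp S.weak.1.2.1 hgwm
    have i6 := integrable_mul_of_memLp hfu hwm
    have e1 : ∑ T ∈ 𝒯.elems, ε ^ 2 * ⟪g T, ∫ p in hull T, gradient (F T) p⟫_ℝ =
        ε ^ 2 * ∫ p in unitSquare, ⟪gradient uh p, gradient w p⟫_ℝ := by
      rw [integral_unitSquare M i4, Finset.mul_sum]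
      refine Finset.sum_congr rfl fun T hT => ?_
      congr 1
      have hi : Integrable (gradient w) (volume.restrict (hull T)) :=
        have : IsFiniteMeasure (volume.restrict (hull T)) := ⟨by simpa using volume_hull_lt_top T⟩
        (memLp_hull hgwm hT).integrable (by norm_num)
      have e : ∫ p in hull T, gradient (F T) p = ∫ p in hull T, gradient w p := by
        refine integral_congr_ae ?_
        filter_upwards [interior_ae T] with p hp
        rw [hw.gradient_eq hT hp]
      rw [e, ← integral_inner hi]
      refine integral_congr_ae ?_
      filter_upwards [interior_ae T] with p hp
      rw [hg T hT p hp]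
    rw [e1, Finset.sum_sub_distrib, Finset.sum_add_distrib, ← Finset.mul_sum, ← integral_unitSquare M i1,
      ← integral_unitSquare M (F := fun p => (f p (uh p) - f p (u p)) * w p) i2, ← integral_unitSquare M i3]
    have e2 : ∫ p in unitSquare, ⟪gradient uh p - gu p, gradient w p⟫_ℝ =
        (∫ p in unitSquare, ⟪gradient uh p, gradient w p⟫_ℝ) - ∫ p in unitSquare, ⟪gu p, gradient w p⟫_ℝ := by
      rw [← integral_sub i4 i5]
      simp only [inner_sub_left]
    have e3 : ∫ p in unitSquare, (f p (uh p) - f p (u p)) * w p =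
        (∫ p in unitSquare, f p (uh p) * w p) - ∫ p in unitSquare, f p (u p) * w p := by
      rw [← integral_sub i3 i6]
      simp only [sub_mul]
    rw [e2, e3]
    linarith
  rw [key, Finset.mul_sum]
  refine (Finset.abs_sum_le_sum_abs _ _).trans (Finset.sum_le_sum fun T hT => ?_)
  set E := errT ε f u gu uh T with hE
  have hEn : 0 ≤ E := errT_nonneg
  have ha : 0 ≤ area T := measureReal_nonneg
  obtain ⟨hNT, h1, h2, h3⟩ := hN T hT
  have hG0 : 0 ≤ ∫ p in hull T, ‖gradient uh p - gu p‖ ^ 2 := integral_nonneg fun _ => sq_nonneg _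
  have he0 : 0 ≤ ∫ p in hull T, (uh p - u p) ^ 2 := integral_nonneg fun _ => sq_nonneg _
  set o := osc (fun p => f p (uh p)) (hull T ∩ unitSquare) with ho
  set lm := min 1 (maxEdge T / ε) with hlm
  have hlm0 : 0 ≤ lm := le_min zero_le_one (div_nonneg Metric.diam_nonneg hε.le)
  have hE1 : ε * √(∫ p in hull T, ‖gradient uh p - gu p‖ ^ 2) ≤ √E := by
    refine Real.le_sqrt_of_sq_le ?_
    rw [mul_pow, Real.sq_sqrt hG0, hE, errT]
    nlinarith [mul_nonneg ha (sq_nonneg (lm * o))]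
  have hE2 : √(∫ p in hull T, (uh p - u p) ^ 2) ≤ √E := by
    refine Real.sqrt_le_sqrt ?_
    rw [hE, errT]
    nlinarith [mul_nonneg ha (sq_nonneg (lm * o)), mul_nonneg (sq_nonneg ε) hG0]
  have hE3 : √(area T) * lm * |o| ≤ √E := by
    refine Real.le_sqrt_of_sq_le ?_
    rw [hE, errT, mul_pow, mul_pow, Real.sq_sqrt ha, sq_abs]
    nlinarith [mul_nonneg (sq_nonneg ε) hG0]
  have hwT := memLp_hull hwm hT
  have hgwT := memLp_hull hgwm hT
  have a1 : |ε ^ 2 * ∫ p in hull T, ⟪gradient uh p - gu p, gradient w p⟫_ℝ| ≤ √E * N T := by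
    have c1 := integral_norm_mul_norm_le (memLp_hull S.memLp_grad_err hT) hgwT
    have c2 : |∫ p in hull T, ⟪gradient uh p - gu p, gradient w p⟫_ℝ| ≤
        ∫ p in hull T, ‖gradient uh p - gu p‖ * ‖gradient w p‖ := by
      rw [← Real.norm_eq_abs]
      refine norm_integral_le_of_norm_le
        (integrable_mul_of_memLp (memLp_hull S.memLp_grad_err hT).norm hgwT.norm) (Eventually.of_forall fun p => ?_)
      exact norm_inner_le_norm (𝕜 := ℝ) _ _
    have c3 : ε * √(∫ p in hull T, ‖gradient w p‖ ^ 2) ≤ N T := by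
      rw [hw.integral_eq hT fun _ _ y => ‖y‖ ^ 2]
      refine (Real.abs_le_sqrt (x := ε * √(∫ p in hull T, ‖gradient (F T) p‖ ^ 2)) (y := N T ^ 2) ?_
        |> (le_abs_self _).trans).trans (by rw [Real.sqrt_sq hNT])
      rw [mul_pow, Real.sq_sqrt (integral_nonneg fun _ => sq_nonneg _)]
      exact h1
    rw [abs_mul, abs_of_nonneg (sq_nonneg ε)]
    calc ε ^ 2 * |∫ p in hull T, ⟪gradient uh p - gu p, gradient w p⟫_ℝ|
        ≤ ε ^ 2 * (√(∫ p in hull T, ‖gradient uh p - gu p‖ ^ 2) * √(∫ p in hull T, ‖gradient w p‖ ^ 2)) :=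
          mul_le_mul_of_nonneg_left (c2.trans c1) (sq_nonneg ε)
      _ = (ε * √(∫ p in hull T, ‖gradient uh p - gu p‖ ^ 2)) *
          (ε * √(∫ p in hull T, ‖gradient w p‖ ^ 2)) := by ring
      _ ≤ √E * N T := mul_le_mul hE1 c3 (by positivity) (Real.sqrt_nonneg _)
  have haeΩ : ∀ᵐ p ∂(volume.restrict (hull T)), p ∈ hull T ∩ unitSquare := by
    have h : ∀ᵐ p ∂(volume.restrict (closure unitSquare)), p ∈ unitSquare := by
      rw [Measure.restrict_congr_set (closure_ae_eq convex_unitSquare)]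
      exact ae_restrict_mem isOpen_unitSquare.measurableSet
    filter_upwards [ae_restrict_of_ae_restrict_of_subset (Mesh.vertex_mem_closure hT) h,
      ae_restrict_mem (measurableSet_hull T)] with p h1 h2 using ⟨h2, h1⟩
  have a2 : |∫ p in hull T, (f p (uh p) - f p (u p)) * w p| ≤ L * (√E * N T) := by
    have c1 := integral_norm_mul_norm_le (memLp_hull S.memLp_err hT) hwT
    have c2 : |∫ p in hull T, (f p (uh p) - f p (u p)) * w p| ≤
        ∫ p in hull T, L * (‖uh p - u p‖ * ‖w p‖) := by
      rw [← Real.norm_eq_abs]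
      refine norm_integral_le_of_norm_le
        ((integrable_mul_of_memLp (memLp_hull S.memLp_err hT).norm hwT.norm).const_mul L) ?_
      filter_upwards [haeΩ] with p hp
      rw [norm_mul, ← mul_assoc]
      exact mul_le_mul_of_nonneg_right (S.adm.lipschitz p hp.2 _ _) (norm_nonneg _)
    have c3 : √(∫ p in hull T, ‖w p‖ ^ 2) ≤ N T := by
      rw [hw.integral_eq hT fun _ y _ => ‖y‖ ^ 2]
      simp only [Real.norm_eq_abs, sq_abs]
      exact (Real.sqrt_le_sqrt h2).trans (by rw [Real.sqrt_sq hNT])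
    rw [integral_const_mul] at c2
    simp only [Real.norm_eq_abs, sq_abs] at c1 c2 c3
    refine c2.trans (mul_le_mul_of_nonneg_left (c1.trans ?_) hL)
    exact mul_le_mul hE2 c3 (Real.sqrt_nonneg _) (Real.sqrt_nonneg _)
  have a3 : |∫ p in hull T, f p (uh p) * w p| ≤ √E * N T := by
    -- A reference point in the open square is needed since `f` is controlled only there; the
    -- element has positive area and almost all of it lies in the square.
    have hne : (hull T ∩ unitSquare).Nonempty := by
      have : volume (hull T) ≠ 0 := by
        obtain ⟨z₁, z₂, a, k, m, rfl, -⟩ := M.elem T hT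
        have := area_pos (M.cr_ne hT)
        intro h
        rw [area, measureReal_def, h] at this
        simp at this
      have hne : (ae (volume.restrict (hull T))).NeBot := by
        rw [ae_neBot]
        simpa using this
      exact (haeΩ.exists).imp fun p hp => hp
    obtain ⟨p₀, hp₀⟩ := hne
    have hfin : IsFiniteMeasure (volume.restrict (hull T)) := ⟨by simpa using volume_hull_lt_top T⟩
    have hw1 : Integrable w (volume.restrict (hull T)) := hwT.integrable (by norm_num)
    have i3 := integrable_mul_of_memLp (memLp_hull hfh hT) hwT
    have e0 : ∫ p in hull T, w p = 0 := by
      rw [hw.integral_eq hT fun _ y _ => y]; exact h0 T hT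
    -- Zero mean of `w` allows the constant value of f_h at `p₀` to be subtracted.
    have e : ∫ p in hull T, f p (uh p) * w p = ∫ p in hull T, (f p (uh p) - f p₀ (uh p₀)) * w p := by
      simp only [sub_mul]
      rw [integral_sub i3 (hw1.const_mul _), integral_const_mul, e0, mul_zero, sub_zero]
    have c2 : |∫ p in hull T, (f p (uh p) - f p₀ (uh p₀)) * w p| ≤ ∫ p in hull T, o * |w p| := by
      rw [← Real.norm_eq_abs]
      refine norm_integral_le_of_norm_le (hw1.abs.const_mul o) ?_
      filter_upwards [haeΩ] with p hp
      rw [norm_mul]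
      exact mul_le_mul_of_nonneg_right (S.sub_le_osc hp hp₀) (norm_nonneg _)
    have c3 : ∫ p in hull T, |w p| ≤ N T * (√(area T) * lm) := by
      rw [hw.integral_eq hT fun _ y _ => |y|]
      exact h3
    have ho0 : 0 ≤ o := (abs_nonneg _).trans (S.sub_le_osc hp₀ hp₀)
    rw [integral_const_mul] at c2
    rw [e]
    refine c2.trans ((mul_le_mul_of_nonneg_left c3 ho0).trans ?_)
    rw [abs_of_nonneg ho0] at hE3
    calc o * (N T * (√(area T) * lm)) = (√(area T) * lm * o) * N T := by ring
      _ ≤ _ := mul_le_mul_of_nonneg_right hE3 hNT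
  calc |_ + _ - _| ≤ _ := abs_sub _ _
    _ ≤ √E * N T + L * (√E * N T) + √E * N T := add_le_add ((abs_add_le _ _).trans (add_le_add a1 a2)) a3
    _ = _ := by ring

end Sol

/-! ### Test functions on a single element -/

lemma HasGradientAt.congr_grad {f : Pt → ℝ} {f' g' x : Pt} (hf : HasGradientAt f f' x) (h : f' = g') :
    HasGradientAt f g' x := h ▸ hf

lemma hasGradientAt_mul {f g : Pt → ℝ} {f' g' x : Pt} (hf : HasGradientAt f f' x)
    (hg : HasGradientAt g g' x) : HasGradientAt (fun y => f y * g y) (f x • g' + g x • f') x := by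
  rw [hasGradientAt_iff_hasFDerivAt] at *
  exact (hf.mul hg).congr_fderiv (by ext y; simp)

lemma hasGradientAt_add {f g : Pt → ℝ} {f' g' x : Pt} (hf : HasGradientAt f f' x)
    (hg : HasGradientAt g g' x) : HasGradientAt (fun y => f y + g y) (f' + g') x := by
  rw [hasGradientAt_iff_hasFDerivAt] at *
  exact (hf.add hg).congr_fderiv (by ext y; simp)

lemma hasGradientAt_const_mul {f : Pt → ℝ} {f' x : Pt} (c : ℝ) (hf : HasGradientAt f f' x) :
    HasGradientAt (fun y => c * f y) (c • f') x := by
  rw [hasGradientAt_iff_hasFDerivAt] at *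
  exact (hf.const_mul c).congr_fderiv (by ext y; simp)

lemma hasGradientAt_comp {k : ℝ → ℝ} {k' : ℝ} {f : Pt → ℝ} {f' x : Pt} (hk : HasDerivAt k k' (f x))
    (hf : HasGradientAt f f' x) : HasGradientAt (fun y => k (f y)) (k' • f') x := by
  rw [hasGradientAt_iff_hasFDerivAt] at *
  exact (hk.comp_hasFDerivAt x hf).congr_fderiv (by ext y; simp)

lemma integrable_hull {E : Type*} [NormedAddCommGroup E] {h : Pt → E} (hh : Continuous h) (T : Finset Pt) :
    IntegrableOn h (hull T) :=
  hh.continuousOn.integrableOn_compact (isCompact_hull T)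

section
variable {p q r : Pt} (hD : cr (q - p) (r - p) ≠ 0)
include hD

lemma integral_le_of_support {τ B : ℝ} (hτ : 0 ≤ τ) (hB : 0 ≤ B) {h : Pt → ℝ}
    (h0 : ∀ x ∈ hull {p, q, r}, 0 ≤ h x) (hb : ∀ x ∈ hull {p, q, r}, h x ≤ B)
    (hz : ∀ x ∈ hull {p, q, r}, τ ≤ bc p q r x → h x ≤ 0) :
    ∫ x in hull {p, q, r}, h x ≤ B * (4 * τ * area {p, q, r}) := by
  set Z := {x : Pt | bc p q r x < τ} with hZ
  have hZm : MeasurableSet Z := (isOpen_lt (continuous_bc p q r) continuous_const).measurableSet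
  have hfin : IsFiniteMeasure (volume.restrict (hull {p, q, r})) := ⟨by simpa using volume_hull_lt_top _⟩
  have h1 : ∫ x in hull {p, q, r}, h x ≤ ∫ x in hull {p, q, r}, Z.indicator (fun _ => B) x := by
    refine integral_mono_of_nonneg ?_ ((integrable_const B).indicator hZm) ?_
    · filter_upwards [ae_restrict_mem (measurableSet_hull _)] with x hx using h0 x hx
    · filter_upwards [ae_restrict_mem (measurableSet_hull _)] with x hx
      by_cases hxZ : x ∈ Z
      · rw [Set.indicator_of_mem hxZ]; exact hb x hx
      · rw [Set.indicator_of_notMem hxZ]; exact hz x hx (not_lt.1 hxZ)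
  refine h1.trans ?_
  rw [integral_indicator_const B hZm, smul_eq_mul, mul_comm, measureReal_restrict_apply hZm]
  refine mul_le_mul_of_nonneg_left (le_trans (le_of_eq ?_) (volume_strip_le hD hτ)) hB
  congr 1
  ext x
  simp [hZ, and_comm]

variable {m m' : ℝ → ℝ} {B τ : ℝ} (P : Prof m m' B) (hτ0 : 0 < τ) (hτ1 : τ ≤ 1 / 2)

/-- The edge bubble on an element: supported near the edge `p q`. -/
def bub (m : ℝ → ℝ) (τ : ℝ) (p q r x : Pt) : ℝ := bc q r p x * bc r p q x * pE m τ 3 (bc p q r x)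

/-- The test function on an element with the edge `p q` in the line of interest. -/
def layer (m : ℝ → ℝ) (τ a b : ℝ) (p q r x : Pt) : ℝ :=
  (a * bc q r p x + b * bc r p q x) * pE m τ 1 (bc p q r x)

/-- The test function on an element with only the vertex `r` in the line of interest. -/
def tip (m : ℝ → ℝ) (τ a : ℝ) (p q r x : Pt) : ℝ := a * m ((1 - bc p q r x) / τ)

include P hτ0 hτ1

omit hD in
-- The integrand is the derivative of pE(s)(1-s)^(n+1). The power kills the end s = 1, and the value
-- at s = 0 is 1: this is the trace on the side `p q`.
lemma integral_deriv_pE (n k : ℕ) :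
    ∫ s in (0 : ℝ)..1, (pD m m' τ k s * (1 - s) ^ (n + 1) - (n + 1) * pE m τ k s * (1 - s) ^ n) = -1 := by
  have hd : ∀ s ∈ Set.uIcc (0 : ℝ) 1, HasDerivAt (fun s => pE m τ k s * (1 - s) ^ (n + 1))
      (pD m m' τ k s * (1 - s) ^ (n + 1) - (n + 1) * pE m τ k s * (1 - s) ^ n) s := by
    intro s _
    have h2 := ((hasDerivAt_id s).const_sub 1).pow (n + 1)
    refine hasDerivAt_of_eq ((hasDerivAt_pE P hτ0 hτ1 k s).mul h2) (fun y => by simp) ?_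
    simp
    ring
  have c1 := continuous_pE P k (τ := τ)
  have c2 := continuous_pD P k (τ := τ)
  rw [intervalIntegral.integral_eq_sub_of_hasDerivAt hd (Continuous.intervalIntegrable (by fun_prop) _ _),
    pE_at_zero P]
  simp

omit hD in
lemma hasGradientAt_bub (x : Pt) : HasGradientAt (bub m τ p q r)
    ((pE m τ 3 (bc p q r x) * bc q r p x) • gbc r p q + (pE m τ 3 (bc p q r x) * bc r p q x) • gbc q r p +
      (pD m m' τ 3 (bc p q r x) * (bc r p q x * bc q r p x)) • gbc p q r) x := by
  have h := hasGradientAt_mul (hasGradientAt_mul (hasGradientAt_bc q r p x) (hasGradientAt_bc r p q x))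
    (hasGradientAt_comp (hasDerivAt_pE P hτ0 hτ1 3 _) (hasGradientAt_bc p q r x))
  exact HasGradientAt.congr_grad h (by module)

omit hD in
lemma hasGradientAt_layer (a b : ℝ) (x : Pt) : HasGradientAt (layer m τ a b p q r)
    (pE m τ 1 (bc p q r x) • (a • gbc q r p + b • gbc r p q) +
      (a • (pD m m' τ 1 (bc p q r x) * bc q r p x) • gbc p q r +
      b • (pD m m' τ 1 (bc p q r x) * bc r p q x) • gbc p q r)) x := by
  have h := hasGradientAt_mul (hasGradientAt_add (hasGradientAt_const_mul a (hasGradientAt_bc q r p x))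
    (hasGradientAt_const_mul b (hasGradientAt_bc r p q x)))
    (hasGradientAt_comp (hasDerivAt_pE P hτ0 hτ1 1 _) (hasGradientAt_bc p q r x))
  exact HasGradientAt.congr_grad h (by module)

omit hD hτ0 hτ1 in
lemma hasGradientAt_tip (a : ℝ) (x : Pt) : HasGradientAt (tip m τ a p q r)
    ((a * -(m' ((1 - bc p q r x) / τ) / τ)) • gbc p q r) x := by
  have hk : HasDerivAt (fun s => m ((1 - s) / τ)) (-(m' ((1 - bc p q r x) / τ) / τ)) (bc p q r x) := by
    have := (P.deriv ((1 - bc p q r x) / τ)).comp (bc p q r x) (((hasDerivAt_id _).const_sub 1).div_const τ)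
    exact hasDerivAt_of_eq this (fun _ => rfl) (by ring)
  have h := hasGradientAt_const_mul a (hasGradientAt_comp hk (hasGradientAt_bc p q r x))
  exact HasGradientAt.congr_grad h (by module)

omit hD in
lemma contDiff_bub : ContDiff ℝ 1 (bub m τ p q r) := by
  have := contDiff_pE P hτ0 hτ1 3
  unfold bub
  fun_prop

omit hD in
lemma contDiff_layer (a b : ℝ) : ContDiff ℝ 1 (layer m τ a b p q r) := by
  have := contDiff_pE P hτ0 hτ1 1
  unfold layer
  fun_prop

omit hD hτ0 hτ1 in
lemma contDiff_tip (a : ℝ) : ContDiff ℝ 1 (tip m τ a p q r) := by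
  have hm : ContDiff ℝ 1 m := by
    rw [contDiff_one_iff_deriv]
    refine ⟨fun s => (P.deriv s).differentiableAt, ?_⟩
    rw [show deriv m = m' from funext fun s => (P.deriv s).deriv]
    exact P.cont
  unfold tip
  fun_prop

/-- Two barycentric factors produce the weight (1-s)³/6, which cancels the denominator of `pE` with
exponent 3 and leaves the zeroth moment of the profile. -/
lemma integral_bub : ∫ x in hull {p, q, r}, bub m τ p q r x = 0 := by
  have c1 := continuous_pE P 3 (τ := τ)
  have e : ∀ x, bub m τ p q r x = pE m τ 3 (bc p q r x) * (bc r p q x * bc q r p x) := fun x => by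
    rw [bub]; ring
  simp only [e]
  rw [integral_triangle_mul hD c1]
  simp only [pE_mul P hτ0 hτ1]
  rw [intervalIntegral.integral_div, P.int τ hτ0 (by linarith)]
  simp

/-- In terms of the divergence theorem: the bubble vanishes on the other two sides and equals λ_p
λ_q on `p q`, whose integral is |pq|/6. The code evaluates the same flux by one-dimensional
integration. -/
lemma integral_gradient_bub :
    ∫ x in hull {p, q, r}, gradient (bub m τ p q r) x = (-(area {p, q, r} / 3)) • gbc p q r := by
  have c1 := continuous_pE P 3 (τ := τ)
  have c2 := continuous_pD P 3 (τ := τ)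
  have e : gradient (bub m τ p q r) = fun x => (pE m τ 3 (bc p q r x) * bc q r p x) • gbc r p q +
      (pE m τ 3 (bc p q r x) * bc r p q x) • gbc q r p +
      (pD m m' τ 3 (bc p q r x) * (bc r p q x * bc q r p x)) • gbc p q r :=
    funext fun x => (hasGradientAt_bub P hτ0 hτ1 x).gradient
  rw [e, integral_add, integral_add, integral_smul_const, integral_smul_const, integral_smul_const,
    integral_triangle_left hD c1, integral_triangle_right hD c1, integral_triangle_mul hD c2, ← smul_add,
    show gbc r p q + gbc q r p = -gbc p q r by rw [eq_neg_iff_add_eq_zero, ← gbc_sum hD]; abel,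
    smul_neg, ← neg_smul, ← add_smul, area_eq hD]
  · congr 1
    have h := integral_deriv_pE P hτ0 hτ1 2 3
    rw [intervalIntegral.integral_sub (Continuous.intervalIntegrable (by fun_prop) _ _)
      (Continuous.intervalIntegrable (by fun_prop) _ _)] at h
    have e1 : ∫ s in (0 : ℝ)..1, pE m τ 3 s * (1 - s) ^ 2 / 2 =
        (∫ s in (0 : ℝ)..1, (((2 : ℕ) : ℝ) + 1) * pE m τ 3 s * (1 - s) ^ 2) / 6 := by
      rw [← intervalIntegral.integral_div]
      congr 1; ext s; push_cast; ring
    have e2 : ∫ s in (0 : ℝ)..1, pD m m' τ 3 s * (1 - s) ^ 3 / 6 =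
        (∫ s in (0 : ℝ)..1, pD m m' τ 3 s * (1 - s) ^ (2 + 1)) / 6 := by
      rw [← intervalIntegral.integral_div]
    rw [e1, e2]
    linear_combination |cr (q - p) (r - p)| / 6 * h
  all_goals exact integrable_hull (by fun_prop) _

end

/-! ### Layer and tip functions: means, fluxes and bounds -/

section
variable {p q r : Pt} (hD : cr (q - p) (r - p) ≠ 0) {m m' : ℝ → ℝ} {B τ : ℝ} (P : Prof m m' B) (hτ0 : 0 < τ)
  (hτ1 : τ ≤ 1 / 2)
include hD P hτ0 hτ1

/-- One factor 1 - s is left after cancelling the denominator of `pE`, so the mean is a combination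
of the moments of order 0 and 1; both must vanish. -/
lemma integral_layer (hm : ∀ τ : ℝ, 0 < τ → τ ≤ 1 → ∫ s in (0 : ℝ)..1, m (s / τ) * s = 0) (a b : ℝ) :
    ∫ x in hull {p, q, r}, layer m τ a b p q r x = 0 := by
  have c1 := continuous_pE P 1 (τ := τ)
  have c0 := P.cont_scale (τ := τ)
  have e : ∀ x, layer m τ a b p q r x = a * (pE m τ 1 (bc p q r x) * bc q r p x) +
      b * (pE m τ 1 (bc p q r x) * bc r p q x) := fun x => by rw [layer]; ring
  simp only [e]
  have h0 : ∫ s in (0 : ℝ)..1, pE m τ 1 s * (1 - s) ^ 2 / 2 = 0 := by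
    have e2 : ∀ s, pE m τ 1 s * (1 - s) ^ 2 / 2 = (m (s / τ) - m (s / τ) * s) / 2 := fun s => by
      rw [← pE_mul P hτ0 hτ1 1 s]; ring
    simp only [e2]
    have hc : Continuous fun s => m (s / τ) * s := c0.mul continuous_id
    rw [intervalIntegral.integral_div, intervalIntegral.integral_sub (c0.intervalIntegrable _ _)
      (hc.intervalIntegrable _ _), P.int τ hτ0 (by linarith), hm τ hτ0 (by linarith)]
    simp
  rw [integral_add (integrable_hull (by fun_prop) _) (integrable_hull (by fun_prop) _), integral_const_mul,
    integral_const_mul, integral_triangle_left hD c1, integral_triangle_right hD c1, h0]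
  simp

/-- On each side through `r` the function is a multiple of m(s/τ), whose integral is zero, so those
sides carry no flux. Only the side `p q`, where the trace is the linear interpolant of `a` and `b`,
contributes. -/
lemma integral_gradient_layer (a b : ℝ) :
    ∫ x in hull {p, q, r}, gradient (layer m τ a b p q r) x = (-((a + b) * area {p, q, r})) • gbc p q r := by
  have c1 := continuous_pE P 1 (τ := τ)
  have c2 := continuous_pD P 1 (τ := τ)
  have e : gradient (layer m τ a b p q r) = fun x => pE m τ 1 (bc p q r x) • (a • gbc q r p + b • gbc r p q) +
      (a • (pD m m' τ 1 (bc p q r x) * bc q r p x) • gbc p q r +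
      b • (pD m m' τ 1 (bc p q r x) * bc r p q x) • gbc p q r) :=
    funext fun x => (hasGradientAt_layer P hτ0 hτ1 a b x).gradient
  have h0 : ∫ s in (0 : ℝ)..1, pE m τ 1 s * (1 - s) = 0 := by
    have e2 : ∀ s, pE m τ 1 s * (1 - s) = m (s / τ) := fun s => by rw [← pE_mul P hτ0 hτ1 1 s]; ring
    simp only [e2]
    exact P.int τ hτ0 (by linarith)
  have h1 : ∫ s in (0 : ℝ)..1, pD m m' τ 1 s * (1 - s) ^ 2 / 2 = -1 / 2 := by
    rw [intervalIntegral.integral_div]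
    have h := integral_deriv_pE P hτ0 hτ1 1 1
    rw [intervalIntegral.integral_sub (Continuous.intervalIntegrable (by fun_prop) _ _)
      (Continuous.intervalIntegrable (by fun_prop) _ _)] at h
    have e1 : ∫ s in (0 : ℝ)..1, (((1 : ℕ) : ℝ) + 1) * pE m τ 1 s * (1 - s) ^ 1 =
        2 * ∫ s in (0 : ℝ)..1, pE m τ 1 s * (1 - s) := by
      rw [← intervalIntegral.integral_const_mul]
      congr 1; ext s; push_cast; ring
    rw [e1, h0] at h
    rw [show (1 + 1 : ℕ) = 2 from rfl] at h
    linear_combination h / 2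
  rw [e, integral_add, integral_add, integral_smul_const, integral_smul, integral_smul, integral_smul_const,
    integral_smul_const, integral_triangle_left hD c2, integral_triangle_right hD c2, integral_triangle_one hD c1,
    h0, h1, area_eq hD]
  · module
  all_goals exact integrable_hull (by fun_prop) _

omit hτ1 in
-- In the reversed variable 1 - λ_r the section length is the variable itself, so the mean is the
-- first moment of the profile.
lemma integral_tip (hτ : τ ≤ 1) (hm : ∀ τ : ℝ, 0 < τ → τ ≤ 1 → ∫ s in (0 : ℝ)..1, m (s / τ) * s = 0) (a : ℝ) :
    ∫ x in hull {p, q, r}, tip m τ a p q r x = 0 := by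
  have c0 := P.cont_scale (τ := τ)
  unfold tip
  rw [integral_const_mul, integral_triangle_one hD (k := fun s => m ((1 - s) / τ))
    (c0.comp (continuous_const.sub continuous_id)),
    intervalIntegral.integral_comp_sub_left (fun s => m (s / τ) * s) (1 : ℝ)]
  simp [hm τ hτ0 hτ]

omit hτ1 in
-- Integration by parts reduces the flux to the zeroth moment, and the boundary term vanishes
-- because the profile is 0 at the side opposite `r`.
lemma integral_gradient_tip (hτ : τ ≤ 1) (a : ℝ) :
    ∫ x in hull {p, q, r}, gradient (tip m τ a p q r) x = 0 := by
  have c0 := P.cont_scale (τ := τ)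
  have c1 : Continuous fun s => -(m' ((1 - s) / τ) / τ) := by have := P.cont; fun_prop
  have e : gradient (tip m τ a p q r) = fun x => a • -(m' ((1 - bc p q r x) / τ) / τ) • gbc p q r :=
    funext fun x => (hasGradientAt_tip P a x).gradient.trans (by module)
  rw [e, integral_smul, integral_smul_const, integral_triangle_one hD c1]
  have h : ∫ s in (0 : ℝ)..1, -(m' ((1 - s) / τ) / τ) * (1 - s) = 0 := by
    rw [intervalIntegral.integral_comp_sub_left (fun s => -(m' (s / τ) / τ) * s) (1 : ℝ)]
    have h1 := intervalIntegral.integral_eq_sub_of_hasDerivAt (a := 0) (b := 1)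
      (fun s _ => (hasDerivAt_scale (τ := τ) (P.deriv (s / τ))).mul (hasDerivAt_id s))
      (Continuous.intervalIntegrable (by
        have := P.cont
        exact ((by fun_prop : Continuous fun s => m' (s / τ) / τ).mul continuous_id).add
          (c0.mul continuous_const)) _ _)
    simp only [id, mul_one] at h1
    rw [intervalIntegral.integral_add (Continuous.intervalIntegrable (by have := P.cont; fun_prop) _ _)
      (c0.intervalIntegrable _ _), P.int τ hτ0 hτ] at h1
    have h3 := (P.zero_of_le hτ0 (s := 1) hτ).1
    rw [one_div] at h3
    simp [Pi.mul_apply, h3] at h1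
    simp [h1]
  rw [h]
  simp

/-- The three integral bounds that the residual estimate asks for. -/
structure Bds (T : Finset Pt) (F : Pt → ℝ) (W D μ : ℝ) : Prop where
  grad : ∫ x in hull T, ‖gradient F x‖ ^ 2 ≤ D ^ 2 * μ
  sq : ∫ x in hull T, F x ^ 2 ≤ W ^ 2 * μ
  abs : ∫ x in hull T, |F x| ≤ W * μ

omit P hτ0 hτ1 in
lemma Bds.of_pointwise {F : Pt → ℝ} {G : Pt → Pt} (hG : ∀ x, HasGradientAt F (G x) x) {τ W D : ℝ} (hτ : 0 ≤ τ)
    (hW : 0 ≤ W) (hFW : ∀ x ∈ hull {p, q, r}, |F x| ≤ W) (hGD : ∀ x ∈ hull {p, q, r}, ‖G x‖ ≤ D)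
    (hz : ∀ x ∈ hull {p, q, r}, τ ≤ bc p q r x → F x = 0 ∧ G x = 0) :
    Bds {p, q, r} F W D (4 * τ * area {p, q, r}) := by
  have e : gradient F = G := funext fun x => (hG x).gradient
  refine ⟨?_, ?_, ?_⟩
  · refine integral_le_of_support hD hτ (sq_nonneg D) (fun _ _ => sq_nonneg _) (fun x hx => ?_) fun x hx h => ?_
    · rw [e]; exact pow_le_pow_left₀ (norm_nonneg _) (hGD x hx) 2
    · rw [e, (hz x hx h).2]; simp
  · refine integral_le_of_support hD hτ (sq_nonneg W) (fun _ _ => sq_nonneg _) (fun x hx => ?_) fun x hx h => ?_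
    · rw [← sq_abs]; exact pow_le_pow_left₀ (abs_nonneg _) (hFW x hx) 2
    · rw [(hz x hx h).1]; simp
  · refine integral_le_of_support hD hτ hW (fun _ _ => abs_nonneg _) hFW fun x hx h => ?_
    rw [(hz x hx h).1]; simp

omit P hτ0 hτ1 in
lemma bc_mem_Icc {x : Pt} (hx : x ∈ hull {p, q, r}) : (0 ≤ bc q r p x ∧ bc q r p x ≤ 1) ∧
    (0 ≤ bc r p q x ∧ bc r p q x ≤ 1) ∧ 0 ≤ bc p q r x ∧ bc p q r x ≤ 1 := by
  obtain ⟨h1, h2, h3⟩ := (hull_nonneg_iff hD x).1 hx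
  have := bc_sum hD x
  refine ⟨⟨h1, ?_⟩, ⟨h2, ?_⟩, h3, ?_⟩ <;> linarith

lemma bub_bds {Γ : ℝ} (hp : ‖gbc q r p‖ ≤ Γ) (hq : ‖gbc r p q‖ ≤ Γ) (hr : ‖gbc p q r‖ ≤ Γ) :
    Bds {p, q, r} (bub m τ p q r) (64 * B) (1000 * B * Γ / τ) (4 * τ * area {p, q, r}) := by
  have hB := P.nonneg
  have hΓ : 0 ≤ Γ := (norm_nonneg _).trans hp
  refine Bds.of_pointwise hD (fun x => hasGradientAt_bub P hτ0 hτ1 x) hτ0.le (by positivity)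
    (fun x hx => ?_) (fun x hx => ?_) fun x hx h => ?_
  · obtain ⟨⟨a0, a1⟩, ⟨b0, b1⟩, c0, c1⟩ := bc_mem_Icc hD hx
    have h := pE_bound P hτ0 3 c0
    rw [bub, abs_mul, abs_mul, abs_of_nonneg a0, abs_of_nonneg b0]
    have : bc q r p x * bc r p q x ≤ 1 := mul_le_one₀ a1 b0 b1
    calc bc q r p x * bc r p q x * |pE m τ 3 (bc p q r x)| ≤ 1 * |pE m τ 3 (bc p q r x)| := by gcongr
      _ ≤ 64 * B := by rw [one_mul]; exact h.trans (le_of_eq (by norm_num))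
  · obtain ⟨⟨a0, a1⟩, ⟨b0, b1⟩, c0, c1⟩ := bc_mem_Icc hD hx
    have h := pE_bound P hτ0 3 c0
    have h' := pD_bound P hτ0 hτ1 3 c0
    have hab : bc r p q x * bc q r p x ≤ 1 := mul_le_one₀ b1 a0 a1
    have hab0 : 0 ≤ bc r p q x * bc q r p x := mul_nonneg b0 a0
    have t1 : ‖(pE m τ 3 (bc p q r x) * bc q r p x) • gbc r p q‖ ≤ 64 * B * 1 * Γ := by
      rw [norm_smul, Real.norm_eq_abs, abs_mul, abs_of_nonneg a0]
      have : |pE m τ 3 (bc p q r x)| ≤ 64 * B := h.trans (le_of_eq (by norm_num))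
      gcongr
    have t2 : ‖(pE m τ 3 (bc p q r x) * bc r p q x) • gbc q r p‖ ≤ 64 * B * 1 * Γ := by
      rw [norm_smul, Real.norm_eq_abs, abs_mul, abs_of_nonneg b0]
      have : |pE m τ 3 (bc p q r x)| ≤ 64 * B := h.trans (le_of_eq (by norm_num))
      gcongr
    have t3 : ‖(pD m m' τ 3 (bc p q r x) * (bc r p q x * bc q r p x)) • gbc p q r‖ ≤ 832 * B / τ * 1 * Γ := by
      rw [norm_smul, Real.norm_eq_abs, abs_mul, abs_of_nonneg hab0]
      have : |pD m m' τ 3 (bc p q r x)| ≤ 832 * B / τ := h'.trans (le_of_eq (by norm_num))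
      gcongr
    refine (norm_add_le _ _).trans ((add_le_add ((norm_add_le _ _).trans (add_le_add t1 t2)) t3).trans ?_)
    -- Since τ ≤ 1/2, the two terms without 1/τ, together 128, count as 64 over τ; the sum 64 + 832
    -- stays below 1000.
    have hBG : B * Γ ≤ B * Γ / τ / 2 := by
      rw [div_div, le_div_iff₀ (by positivity)]
      nlinarith [mul_nonneg hB hΓ]
    have e1 : 832 * B / τ * 1 * Γ = 832 * (B * Γ / τ) := by ring
    have e2 : 1000 * B * Γ / τ = 1000 * (B * Γ / τ) := by ring
    rw [e1, e2]
    have : 0 ≤ B * Γ / τ := by positivity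
    nlinarith
  · rw [bub, pE_zero_of_le P hτ0 3 h, pD_zero_of_le P hτ0 3 h]
    simp

/-- The gradient of a λ_p + b λ_q is (b - a)∇λ_q - a ∇λ_r. The large gradient, of order one over the
short edge, is thus multiplied only by the difference of the nodal values, while the values
themselves meet the gradient across the column. -/
lemma layer_bds {a b δ Y : ℝ} (hδ : |b - a| ≤ δ) {Γ : ℝ} (hq : ‖gbc r p q‖ ≤ Γ) (hr : ‖gbc p q r‖ ≤ Y) :
    Bds {p, q, r} (layer m τ a b p q r) (4 * B * (|a| + |b|)) (4 * B * δ * Γ + 24 * B * (|a| + |b|) * Y / τ)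
      (4 * τ * area {p, q, r}) := by
  have hB := P.nonneg
  have hΓ : 0 ≤ Γ := (norm_nonneg _).trans hq
  have hY : 0 ≤ Y := (norm_nonneg _).trans hr
  have hδ0 : 0 ≤ δ := (abs_nonneg _).trans hδ
  refine Bds.of_pointwise hD (fun x => hasGradientAt_layer P hτ0 hτ1 a b x) hτ0.le (by positivity)
    (fun x hx => ?_) (fun x hx => ?_) fun x hx h => ?_
  · obtain ⟨⟨a0, a1⟩, ⟨b0, b1⟩, c0, c1⟩ := bc_mem_Icc hD hx
    have h : |pE m τ 1 (bc p q r x)| ≤ 4 * B := (pE_bound P hτ0 1 c0).trans (le_of_eq (by norm_num))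
    have h2 : |a * bc q r p x + b * bc r p q x| ≤ |a| + |b| := by
      refine (abs_add_le _ _).trans ?_
      rw [abs_mul, abs_mul, abs_of_nonneg a0, abs_of_nonneg b0]
      nlinarith [abs_nonneg a, abs_nonneg b]
    rw [layer, abs_mul, mul_comm]
    gcongr
  · obtain ⟨⟨a0, a1⟩, ⟨b0, b1⟩, c0, c1⟩ := bc_mem_Icc hD hx
    have h : |pE m τ 1 (bc p q r x)| ≤ 4 * B := (pE_bound P hτ0 1 c0).trans (le_of_eq (by norm_num))
    have h' : |pD m m' τ 1 (bc p q r x)| ≤ 20 * B / τ :=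
      (pD_bound P hτ0 hτ1 1 c0).trans (le_of_eq (by norm_num))
    have e : a • gbc q r p + b • gbc r p q = (b - a) • gbc r p q - a • gbc p q r := by
      have : gbc q r p = -gbc r p q - gbc p q r := by
        rw [← sub_eq_zero, ← gbc_sum hD]; abel
      rw [this]; module
    have t1 : ‖pE m τ 1 (bc p q r x) • (a • gbc q r p + b • gbc r p q)‖ ≤ 4 * B * (δ * Γ + |a| * Y) := by
      rw [e, norm_smul, Real.norm_eq_abs]
      refine mul_le_mul h ((norm_sub_le _ _).trans (add_le_add ?_ ?_)) (norm_nonneg _) (by positivity)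
      · rw [norm_smul, Real.norm_eq_abs]; gcongr
      · rw [norm_smul, Real.norm_eq_abs]; gcongr
    have t2 : ‖a • (pD m m' τ 1 (bc p q r x) * bc q r p x) • gbc p q r‖ ≤ |a| * (20 * B / τ * 1 * Y) := by
      rw [norm_smul, norm_smul, Real.norm_eq_abs, Real.norm_eq_abs, abs_mul, abs_of_nonneg a0]
      gcongr
    have t3 : ‖b • (pD m m' τ 1 (bc p q r x) * bc r p q x) • gbc p q r‖ ≤ |b| * (20 * B / τ * 1 * Y) := by
      rw [norm_smul, norm_smul, Real.norm_eq_abs, Real.norm_eq_abs, abs_mul, abs_of_nonneg b0]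
      gcongr
    refine (norm_add_le _ _).trans ((add_le_add t1 ((norm_add_le _ _).trans (add_le_add t2 t3))).trans ?_)
    have hBG : |a| * (B * Y) ≤ |a| * (B * Y / τ) := by
      refine mul_le_mul_of_nonneg_left ?_ (abs_nonneg a)
      rw [le_div_iff₀ (by positivity)]
      nlinarith [mul_nonneg hB hY]
    have e1 : 24 * B * (|a| + |b|) * Y / τ = 24 * (|a| * (B * Y / τ)) + 24 * (|b| * (B * Y / τ)) := by ring
    have e2 : |a| * (20 * B / τ * 1 * Y) = 20 * (|a| * (B * Y / τ)) := by ring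
    have e3 : |b| * (20 * B / τ * 1 * Y) = 20 * (|b| * (B * Y / τ)) := by ring
    rw [e1, e2, e3]
    have : 0 ≤ |b| * (B * Y / τ) := by positivity
    nlinarith
  · rw [layer, pE_zero_of_le P hτ0 1 h, pD_zero_of_le P hτ0 1 h]
    simp

omit hτ1 in
lemma tip_bds {a Y : ℝ} (hr : ‖gbc p q r‖ ≤ Y) :
    Bds {p, q, r} (tip m τ a p q r) (B * |a|) (B * |a| * Y / τ) (4 * τ * area {p, q, r}) := by
  have hB := P.nonneg
  have hY : 0 ≤ Y := (norm_nonneg _).trans hr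
  -- Near the vertex `r` one has λ_p ≤ 1 - λ_r < τ, so the support lies in a strip along the side `q
  -- r`; the vertices are relabelled accordingly.
  have e : ({p, q, r} : Finset Pt) = {q, r, p} := by ext; simp; tauto
  have hD' : cr (r - q) (p - q) ≠ 0 := cr_rot_ne hD
  rw [e]
  refine Bds.of_pointwise hD' (fun x => hasGradientAt_tip P a x) hτ0.le (by positivity)
    (fun x hx => ?_) (fun x hx => ?_) fun x hx h => ?_
  · rw [← e] at hx
    obtain ⟨⟨a0, a1⟩, ⟨b0, b1⟩, c0, c1⟩ := bc_mem_Icc hD hx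
    have h : |m ((1 - bc p q r x) / τ)| ≤ B := (P.bound _ (div_nonneg (by linarith) hτ0.le)).1
    rw [tip, abs_mul, mul_comm]
    gcongr
  · rw [← e] at hx
    obtain ⟨⟨a0, a1⟩, ⟨b0, b1⟩, c0, c1⟩ := bc_mem_Icc hD hx
    have h : |m' ((1 - bc p q r x) / τ)| ≤ B := (P.bound _ (div_nonneg (by linarith) hτ0.le)).2
    rw [norm_smul, Real.norm_eq_abs, abs_mul, abs_neg, abs_div, abs_of_pos hτ0]
    calc |a| * (|m' ((1 - bc p q r x) / τ)| / τ) * ‖gbc p q r‖ ≤ |a| * (B / τ) * Y := by gcongr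
      _ = _ := by ring
  · rw [← e] at hx
    obtain ⟨⟨a0, a1⟩, ⟨b0, b1⟩, c0, c1⟩ := bc_mem_Icc hD hx
    have hs := bc_sum hD x
    have h2 : τ ≤ 1 - bc p q r x := by linarith
    obtain ⟨z1, z2⟩ := P.zero_of_le hτ0 h2
    rw [tip, z1, z2]
    simp

end

lemma norm_gbc (p q r : Pt) : ‖gbc p q r‖ = dist p q / |cr (q - p) (r - p)| := by
  have h1 : ‖gbc p q r‖ ^ 2 = (dist p q / |cr (q - p) (r - p)|) ^ 2 := by
    rw [norm_sq_eq, div_pow, sq_abs, dist_eq_norm, norm_sub_rev, norm_sq_eq]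
    simp only [gbc, Matrix.cons_val_zero, Matrix.cons_val_one, Matrix.cons_val_fin_one]
    ring
  exact (pow_left_inj₀ (norm_nonneg _) (by positivity) two_ne_zero).1 h1

/-! ### Barycentric gradients and positions in mesh elements -/

section
variable {𝒯 : Triangulation unitSquare} {n : ℕ} {x : ℕ → ℝ} (M : Mesh 𝒯 n x)
include M

lemma Mesh.abs_cr {p q r : Pt} (hT : ({p, q, r} : Finset Pt) ∈ 𝒯.elems) :
    |cr (q - p) (r - p)| = wd {p, q, r} * se {p, q, r} := by
  have h1 := area_eq (M.cr_ne hT)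
  have h2 := M.area_eq_wd_se hT
  linarith

lemma Mesh.norm_gbc_le {C : ℝ} (R : Reg 𝒯 C) {p q r : Pt} (hT : ({p, q, r} : Finset Pt) ∈ 𝒯.elems) :
    ‖gbc p q r‖ ≤ C / se {p, q, r} := by
  have h1 := R.maxEdge_le_wd _ hT
  have hw := M.wd_pos hT
  have hs := M.se_pos hT
  have h2 : dist p q ≤ maxEdge {p, q, r} := dist_le_maxEdge (by simp) (by simp)
  rw [norm_gbc, M.abs_cr hT, div_le_div_iff₀ (by positivity) hs]
  nlinarith

omit M in
/-- Near an interior edge the element lies in the open square. -/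
lemma mem_unitSquare_of_pos {p q r y : Pt} (hD : cr (q - p) (r - p) ≠ 0)
    (hT : ({p, q, r} : Finset Pt) ∈ 𝒯.elems) (hy : y ∈ hull {p, q, r}) (hp : 0 < bc q r p y)
    (hq : 0 < bc r p q y) (hpq : p 0 ≠ q 0) (h : ¬ (p 1 = q 1 ∧ (p 1 = 0 ∨ p 1 = 1))) : y ∈ unitSquare := by
  obtain ⟨⟨a1, a2⟩, a3, a4⟩ := Mesh.vertex_bounds hT (p := p) (by simp)
  obtain ⟨⟨b1, b2⟩, b3, b4⟩ := Mesh.vertex_bounds hT (p := q) (by simp)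
  obtain ⟨⟨c1, c2⟩, c3, c4⟩ := Mesh.vertex_bounds hT (p := r) (by simp)
  obtain ⟨-, -, hr, -⟩ := bc_mem_Icc hD hy
  have hs := bc_sum hD y
  have hc := bc_combo hD y
  set α := bc q r p y
  set β := bc r p q y
  set γ := bc p q r y
  have key : ∀ s t v : ℝ, 0 ≤ s → s ≤ 1 → 0 ≤ t → t ≤ 1 → 0 ≤ v → v ≤ 1 → ¬(s = t ∧ (s = 0 ∨ s = 1)) →
      0 < α * s + β * t + γ * v ∧ α * s + β * t + γ * v < 1 := by
    intro s t v h1 h2 h3 h4 h5 h6 h7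
    have e1 : 0 ≤ α * s := by positivity
    have e2 : 0 ≤ β * t := by positivity
    have e3 : 0 ≤ γ * v := by positivity
    have f1 : 0 ≤ α * (1 - s) := mul_nonneg hp.le (by linarith)
    have f2 : 0 ≤ β * (1 - t) := mul_nonneg hq.le (by linarith)
    have f3 : 0 ≤ γ * (1 - v) := mul_nonneg hr (by linarith)
    constructor <;> by_contra hcon <;> push Not at hcon <;> apply h7
    · have g1 : α * s = 0 := by linarith
      have g2 : β * t = 0 := by linarith
      have g3 : s = 0 := (mul_eq_zero.1 g1).resolve_left hp.ne'
      have g4 : t = 0 := (mul_eq_zero.1 g2).resolve_left hq.ne'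
      exact ⟨by rw [g3, g4], Or.inl g3⟩
    · have g1 : α * (1 - s) = 0 := by linarith
      have g2 : β * (1 - t) = 0 := by linarith
      have g3 : 1 - s = 0 := (mul_eq_zero.1 g1).resolve_left hp.ne'
      have g4 : 1 - t = 0 := (mul_eq_zero.1 g2).resolve_left hq.ne'
      exact ⟨by linarith, Or.inr (by linarith)⟩
  have k0 := key _ _ _ a1 a2 b1 b2 c1 c2 fun h => hpq h.1
  have k1 := key _ _ _ a3 a4 b3 b4 c3 c4 h
  have y0 : y 0 = α * p 0 + β * q 0 + γ * r 0 := by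
    rw [← hc]; simp only [PiLp.add_apply, PiLp.smul_apply, smul_eq_mul]
  have y1 : y 1 = α * p 1 + β * q 1 + γ * r 1 := by
    rw [← hc]; simp only [PiLp.add_apply, PiLp.smul_apply, smul_eq_mul]
  refine ⟨?_, ?_, ?_, ?_⟩
  · rw [y0]; exact k0.1
  · rw [y0]; exact k0.2
  · rw [y1]; exact k1.1
  · rw [y1]; exact k1.2

end

/-- The residual weights of a test function with a boundary layer of relative width `τ`. -/
lemma Bds.weights {T : Finset Pt} {F : Pt → ℝ} {W D₀ τ ε ℓ K : ℝ}
    (h : Bds T F W (D₀ / τ) (4 * τ * area T)) (hτ0 : 0 < τ) (hτ1 : τ ≤ 1) (hℓ : 0 < ℓ) (hε : 0 < ε)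
    (hτℓ : τ * ℓ ≤ min ε ℓ) (hW : 0 ≤ W) (hWD : W ≤ D₀ * ℓ) (hK : 1 ≤ K)
    (hlam : min ε ℓ ≤ K * (ε * min 1 (maxEdge T / ε))) :
    Wts ε T F (4 * K * (ε * D₀ * √(area T / τ))) := by
  have ha : 0 ≤ area T := measureReal_nonneg
  have hD0 : 0 ≤ D₀ := by
    by_contra hneg
    push Not at hneg
    nlinarith
  set lm := min 1 (maxEdge T / ε) with hlm
  have hmin : τ * ℓ ≤ ε := hτℓ.trans (min_le_left _ _)
  have e1 : (4 * K * (ε * D₀ * √(area T / τ))) ^ 2 = 16 * K ^ 2 * (ε ^ 2 * D₀ ^ 2 * (area T / τ)) := by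
    rw [mul_pow, mul_pow, mul_pow, mul_pow, Real.sq_sqrt (by positivity)]; ring
  have hK2 : 1 ≤ K ^ 2 := one_le_pow₀ hK
  have hX : 0 ≤ ε ^ 2 * D₀ ^ 2 * (area T / τ) := by positivity
  -- The layer has thickness τ ℓ ≤ ε, so the bound `W` for the values is at most ε times the bound
  -- D₀/τ for the gradient.
  have hWτ : W * τ ≤ D₀ * ε := by
    calc W * τ ≤ D₀ * ℓ * τ := by gcongr
      _ = D₀ * (τ * ℓ) := by ring
      _ ≤ D₀ * ε := by gcongr
  refine ⟨by positivity, ?_, ?_, ?_⟩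
  · rw [e1]
    calc ε ^ 2 * (∫ x in hull T, ‖gradient F x‖ ^ 2) ≤ ε ^ 2 * ((D₀ / τ) ^ 2 * (4 * τ * area T)) := by
          have := h.grad
          gcongr
      _ = 4 * (ε ^ 2 * D₀ ^ 2 * (area T / τ)) := by field_simp
      _ ≤ _ := by nlinarith
  · rw [e1]
    calc ∫ x in hull T, F x ^ 2 ≤ W ^ 2 * (4 * τ * area T) := h.sq
      _ = 4 * (W * τ) ^ 2 * (area T / τ) := by field_simp
      _ ≤ 4 * (D₀ * ε) ^ 2 * (area T / τ) := by gcongr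
      _ = 4 * (ε ^ 2 * D₀ ^ 2 * (area T / τ)) := by ring
      _ ≤ _ := by nlinarith
  · have hlm0 : 0 ≤ lm := le_min zero_le_one (div_nonneg Metric.diam_nonneg hε.le)
    have hs : √(area T) ≤ √(area T / τ) := by
      apply Real.sqrt_le_sqrt
      rw [le_div_iff₀ hτ0]
      nlinarith
    -- For the L¹ bound the sharper thickness min(ε, ℓ) is kept; it supplies the factor λ_T.
    have h2 : W * τ ≤ D₀ * (K * (ε * lm)) := by
      calc W * τ ≤ D₀ * ℓ * τ := by gcongr
        _ = D₀ * (τ * ℓ) := by ring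
        _ ≤ D₀ * (K * (ε * lm)) := mul_le_mul_of_nonneg_left (hτℓ.trans hlam) hD0
    calc ∫ x in hull T, |F x| ≤ W * (4 * τ * area T) := h.abs
      _ = 4 * (W * τ) * (√(area T) * √(area T)) := by rw [Real.mul_self_sqrt ha]; ring
      _ ≤ 4 * (D₀ * (K * (ε * lm))) * (√(area T / τ) * √(area T)) := by gcongr
      _ = _ := by ring

/-! ### Jumps across long edges -/

/-- The piecewise affine function `uh` has gradient `g T` on the element `T`. -/
structure PA (𝒯 : Triangulation unitSquare) (uh : Pt → ℝ) (g : Finset Pt → Pt) : Prop where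
  affine : ∀ T ∈ 𝒯.elems, ∀ p ∈ hull T, ∀ q ∈ hull T, uh p - uh q = ⟪g T, p - q⟫_ℝ
  gradient : ∀ T ∈ 𝒯.elems, ∀ p ∈ interior (hull T), gradient uh p = g T
  zero : ∀ p ∈ frontier unitSquare, uh p = 0

lemma exists_pa {𝒯 : Triangulation unitSquare} {v : Pt → ℝ} (hv : 𝒯.IsFE v) : ∃ g, PA 𝒯 v g := by
  obtain ⟨g, c, h1, -, -, h2⟩ := pw_of_isFE hv
  refine ⟨g, fun T hT p hp q hq => ?_, h2, hv.2.2⟩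
  rw [h1 T hT p hp, h1 T hT q hq, inner_sub_right]
  ring

lemma min_le_mul_lam {ε s H C : ℝ} (hε : 0 < ε) (hC : 1 ≤ C) (h : s ≤ C * H) :
    min ε s ≤ C * (ε * min 1 (H / ε)) := by
  rcases le_total 1 (H / ε) with h1 | h1
  · rw [min_eq_left h1]
    refine (min_le_left _ _).trans ?_
    nlinarith
  · rw [min_eq_right h1, mul_div_cancel₀ _ hε.ne']
    exact (min_le_right _ _).trans h

lemma Mesh.wd_long {𝒯 : Triangulation unitSquare} {n : ℕ} {x : ℕ → ℝ} (M : Mesh 𝒯 n x) {z z' r : Pt}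
    (hT : ({z, z', r} : Finset Pt) ∈ 𝒯.elems) (hz : z' 0 ≠ z 0) : wd {z, z', r} = |z' 0 - z 0| := by
  rcases M.third_mem hT hz.symm with h | h
  · have e : ({z, z', r} : Finset Pt) = {r, z, z'} := by ext; simp; tauto
    rw [e, wd_eq h, h]
  · have e : ({z, z', r} : Finset Pt) = {r, z', z} := by ext; simp; tauto
    rw [e, wd_eq h, h, abs_sub_comm]

/-- The constant of the long edge estimate. -/
def longConst (C L : ℝ) : ℝ := 12 * 10 ^ 12 * (2 + L) ^ 2 * C ^ 8

section
variable {𝒯 : Triangulation unitSquare} {n : ℕ} {x : ℕ → ℝ} (M : Mesh 𝒯 n x)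
  {ε Cf L C : ℝ} {f : Pt → ℝ → ℝ} {u : Pt → ℝ} {gu : Pt → Pt} {uh : Pt → ℝ}
  (S : Sol 𝒯 ε Cf L f u gu uh) (R : Reg 𝒯 C) {g : Finset Pt → Pt} (A : PA 𝒯 uh g)
include M

/-- Cutting off outside the open square changes nothing: where both endpoint weights are positive
the point is interior, and elsewhere the bubble vanishes. -/
lemma bub_eq {z z' ρ : Pt} {τ : ℝ} {m : ℝ → ℝ} (hT : ({z, z', ρ} : Finset Pt) ∈ 𝒯.elems) (hz : z' 0 ≠ z 0)
    (hb : ¬ (z 1 = z' 1 ∧ (z 1 = 0 ∨ z 1 = 1))) {p : Pt} (hp : p ∈ hull {z, z', ρ}) :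
    unitSquare.indicator (fun p => hat 𝒯 z p * hat 𝒯 z' p * pE m τ 3 (1 - hat 𝒯 z p - hat 𝒯 z' p)) p =
      bub m τ z z' ρ p := by
  have hD := M.cr_ne hT
  obtain ⟨⟨a0, -⟩, ⟨b0, -⟩, -, -⟩ := bc_mem_Icc hD hp
  by_cases hΩ : p ∈ unitSquare
  · have e1 : ({z, z', ρ} : Finset Pt) = {z', ρ, z} := by ext; simp; tauto
    have e2 : ({z, z', ρ} : Finset Pt) = {ρ, z, z'} := by ext; simp; tauto
    have h1 : hat 𝒯 z p = bc z' ρ z p := M.hat_eq (e1 ▸ hT) (e1 ▸ hp)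
    have h2 : hat 𝒯 z' p = bc ρ z z' p := M.hat_eq (e2 ▸ hT) (e2 ▸ hp)
    have hs := bc_sum hD p
    rw [Set.indicator_of_mem hΩ, h1, h2, bub, show 1 - bc z' ρ z p - bc ρ z z' p = bc z z' ρ p by linarith]
  · rw [Set.indicator_of_notMem hΩ, bub]
    rcases a0.eq_or_lt with h | h
    · rw [← h]; simp
    rcases b0.eq_or_lt with h' | h'
    · rw [← h']; simp
    exact absurd (mem_unitSquare_of_pos hD hT hp h h' hz.symm hb) hΩ

omit M in
lemma not_boundary_edge {z z' r r' : Pt} (hT : ({z, z', r} : Finset Pt) ∈ 𝒯.elems)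
    (hT' : ({z, z', r'} : Finset Pt) ∈ 𝒯.elems) (hside : cr (z' - z) (r' - z) * cr (z' - z) (r - z) < 0) :
    ¬ (z 1 = z' 1 ∧ (z 1 = 0 ∨ z 1 = 1)) := by
  rintro ⟨h, h'⟩
  have b1 := (Mesh.vertex_bounds hT (p := r) (by simp)).2
  have b2 := (Mesh.vertex_bounds hT' (p := r') (by simp)).2
  simp only [cr, PiLp.sub_apply, ← h, sub_self, zero_mul, sub_zero] at hside
  have e : (z' 0 - z 0) * (r' 1 - z 1) * ((z' 0 - z 0) * (r 1 - z 1)) =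
    (z' 0 - z 0) ^ 2 * ((r' 1 - z 1) * (r 1 - z 1)) := by ring
  rw [e] at hside
  have : 0 ≤ (r' 1 - z 1) * (r 1 - z 1) := by
    rcases h' with h' | h' <;> rw [h']
    · simp only [sub_zero]; exact mul_nonneg b2.1 b1.1
    · exact mul_nonneg_of_nonpos_of_nonpos (by linarith) (by linarith)
  nlinarith [sq_nonneg (z' 0 - z 0), mul_nonneg (sq_nonneg (z' 0 - z 0)) this]

/-- The family of bubbles for the edge `z z'` shared by `{z, z', r}` and `{z, z', r'}`. -/
def edgeFam (τ : ℝ) (z z' r r' : Pt) (T : Finset Pt) : Pt → ℝ :=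
  open Classical in
  if T = {z, z', r} then bub mq τ z z' r else if T = {z, z', r'} then bub mq τ z z' r' else fun _ => 0

/-- An element containing both endpoints lies on one side of the edge and is therefore one of the
two given ones; in all others one of the two hat functions vanishes. -/
lemma pw_edgeFam {z z' r r' : Pt} {τ : ℝ} (hτ0 : 0 < τ) (hτ1 : τ ≤ 1 / 2)
    (hT : ({z, z', r} : Finset Pt) ∈ 𝒯.elems)
    (hT' : ({z, z', r'} : Finset Pt) ∈ 𝒯.elems) (hz : z' 0 ≠ z 0)
    (hside : cr (z' - z) (r' - z) * cr (z' - z) (r - z) < 0) :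
    PW 𝒯 (unitSquare.indicator fun p => hat 𝒯 z p * hat 𝒯 z' p * pE mq τ 3 (1 - hat 𝒯 z p - hat 𝒯 z' p))
      (edgeFam τ z z' r r') := by
  classical
  have hb := not_boundary_edge hT hT' hside
  have hD₁ := M.cr_ne hT
  refine ⟨fun p hp => Set.indicator_of_notMem hp _, fun T hTe => ?_, fun T hTe p hp => ?_⟩
  · unfold edgeFam
    split_ifs
    · exact contDiff_bub prof_mq hτ0 hτ1
    · exact contDiff_bub prof_mq hτ0 hτ1
    · exact contDiff_const
  · unfold edgeFam
    split_ifs with h1 h2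
    · subst h1; exact bub_eq M hT hz hb hp
    · subst h2; exact bub_eq M hT' hz hb hp
    · by_cases hzT : z ∈ T
      · by_cases hzT' : z' ∈ T
        · obtain ⟨ρ, hρ⟩ := Mesh.exists_third hTe hzT hzT' (fun h => hz (by rw [h]))
          have hTρ : ({z, z', ρ} : Finset Pt) ∈ 𝒯.elems := hρ ▸ hTe
          rcases lt_or_gt_of_ne (mul_ne_zero (M.cr_ne hTρ) hD₁) with h | h
          · have := M.neighbour_unique hT' hTρ (mul_pos_of_mul_neg h hside)
            exact absurd (by rw [hρ, this]) h2
          · have := M.neighbour_unique hT hTρ h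
            exact absurd (by rw [hρ, this]) h1
        · rw [Set.indicator_apply, M.hat_eq_zero hTe hp hzT']; simp
      · rw [Set.indicator_apply, M.hat_eq_zero hTe hp hzT]; simp

include R in
-- Transversally to a long edge the element has size of order `s`, and all three barycentric
-- gradients are at most C²/s. The relative width min(ε, s)/(2s) therefore gives a layer of
-- thickness at most min(ε, s).
lemma bub_weights {z z' ρ : Pt} {s : ℝ} (hε : 0 < ε) (hs0 : 0 < s) (hρ : ({z, z', ρ} : Finset Pt) ∈ 𝒯.elems)
    (hse : s ≤ C * se {z, z', ρ}) :
    Wts ε {z, z', ρ} (bub mq (min ε s / (2 * s)) z z' ρ) (4 * C * (ε * (10 ^ 5 * (C ^ 2 / s)) *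
      √(area {z, z', ρ} / (min ε s / (2 * s))))) := by
  have hC := R.one_le
  set m₀ := min ε s with hm₀
  have hm0 : 0 < m₀ := lt_min hε hs0
  set τ := m₀ / (2 * s) with hτ
  have hτ0 : 0 < τ := by positivity
  have hτ1 : τ ≤ 1 / 2 := by
    rw [hτ, div_le_div_iff₀ (by positivity) (by norm_num)]
    have : m₀ ≤ s := min_le_right _ _
    linarith
  set D₀ := 10 ^ 5 * (C ^ 2 / s) with hD₀
  have hsρ := M.se_pos hρ
  have e1 : ({z, z', ρ} : Finset Pt) = {z', ρ, z} := by ext; simp; tauto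
  have e2 : ({z, z', ρ} : Finset Pt) = {ρ, z, z'} := by ext; simp; tauto
  have hΓ : C / se {z, z', ρ} ≤ C ^ 2 / s := by
    rw [div_le_div_iff₀ hsρ hs0]; nlinarith
  have hp : ‖gbc z' ρ z‖ ≤ C ^ 2 / s := by
    refine le_trans ?_ hΓ; rw [e1]; exact M.norm_gbc_le R (e1 ▸ hρ)
  have hq : ‖gbc ρ z z'‖ ≤ C ^ 2 / s := by
    refine le_trans ?_ hΓ; rw [e2]; exact M.norm_gbc_le R (e2 ▸ hρ)
  have hr : ‖gbc z z' ρ‖ ≤ C ^ 2 / s := (M.norm_gbc_le R hρ).trans hΓ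
  have hbds := bub_bds (M.cr_ne hρ) prof_mq hτ0 hτ1 hp hq hr
  rw [show 1000 * 100 * (C ^ 2 / s) = D₀ by rw [hD₀]; norm_num] at hbds
  refine hbds.weights hτ0 (by linarith) hs0 hε ?_ (by norm_num) ?_ hC ?_
  · rw [hτ]; field_simp; linarith
  · rw [hD₀]; field_simp; nlinarith
  · refine min_le_mul_lam hε hC (hse.trans ?_)
    exact mul_le_mul_of_nonneg_left (M.se_le_maxEdge hρ) (by linarith)

omit M in
-- Squaring and cancelling ε²X/(36 m₀). The number in `longConst` comes from 36 · 16 · 10¹⁰ · 2 ≤ 12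
-- · 10¹².
lemma sq_of_root_bound {X m₀ E y d : ℝ} (hε : 0 < ε) (hX0 : 0 < X) (hm0 : 0 < m₀) (hC : 1 ≤ C) (hL : 0 ≤ L)
    (hE : 0 ≤ E) (hy : y ^ 2 ≤ 2 * E)
    (hmain : ε ^ 2 / 6 * (X * |d|) ≤ (2 + L) * (4 * 10 ^ 5 * C ^ 4 * ε * √(X / m₀)) * y) :
    ε ^ 2 * (X * (m₀ * d ^ 2)) ≤ longConst C L * E := by
  have hsq := pow_le_pow_left₀ (by positivity) hmain 2
  have e1 : ((2 + L) * (4 * 10 ^ 5 * C ^ 4 * ε * √(X / m₀)) * y) ^ 2 =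
      16 * 10 ^ 10 * ((2 + L) ^ 2 * C ^ 8 * (ε ^ 2 * X / m₀) * y ^ 2) := by
    rw [mul_pow, mul_pow, mul_pow, Real.sq_sqrt (by positivity)]; ring
  have e3 : (ε ^ 2 / 6 * (X * |d|)) ^ 2 = (ε ^ 2 * X / (36 * m₀)) * (ε ^ 2 * (X * (m₀ * d ^ 2))) := by
    rw [mul_pow, mul_pow, sq_abs]; field_simp; ring
  have e5 : (2 + L) ^ 2 * C ^ 8 * (ε ^ 2 * X / m₀) * y ^ 2 ≤ (2 + L) ^ 2 * C ^ 8 * (ε ^ 2 * X / m₀) * (2 * E) :=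
    mul_le_mul_of_nonneg_left hy (by positivity)
  have e6 : 0 ≤ (2 + L) ^ 2 * C ^ 8 * (ε ^ 2 * X / m₀) * E := by positivity
  have e4 : (ε ^ 2 * X / (36 * m₀)) * (longConst C L * E) =
      12 * 10 ^ 12 / 36 * ((2 + L) ^ 2 * C ^ 8 * (ε ^ 2 * X / m₀) * E) := by
    rw [longConst]; field_simp
  rw [e1, e3] at hsq
  refine le_of_mul_le_mul_left (hsq.trans ?_) (show 0 < ε ^ 2 * X / (36 * m₀) by positivity)
  rw [e4]
  linarith

omit M in
lemma mul_add_mul_le {a b n₁ n₂ Q : ℝ} (ha : 0 ≤ a) (hb : 0 ≤ b) (h1 : n₁ ≤ Q) (h2 : n₂ ≤ Q) :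
    a * n₁ + b * n₂ ≤ Q * (a + b) := by
  have := mul_le_mul_of_nonneg_left h1 ha
  have := mul_le_mul_of_nonneg_left h2 hb
  linarith

omit M in
-- The two elements lie on opposite sides, so the orientations turn the sum into a difference: up to
-- sign it is one sixth of v₁ - v₂ paired with the rotated edge vector. As v₁ - v₂ is normal to the
-- edge, this pairing dominates |Δx| times its second component.
lemma edge_pairing_ge {z z' r r' v₁ v₂ : Pt} (hz : z' 0 ≠ z 0)
    (hside : cr (z' - z) (r' - z) * cr (z' - z) (r - z) < 0)
    (htan : (v₁ - v₂) 0 * (z' 0 - z 0) + (v₁ - v₂) 1 * (z' 1 - z 1) = 0) :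
    |z' 0 - z 0| * |(v₁ - v₂) 1| / 6 ≤ |⟪v₁, (-(area {z, z', r} / 3)) • gbc z z' r⟫_ℝ +
      ⟪v₂, (-(area {z, z', r'} / 3)) • gbc z z' r'⟫_ℝ| := by
  have hD₁ : cr (z' - z) (r - z) ≠ 0 := fun h => by rw [h, mul_zero] at hside; exact hside.false
  have hD₂ : cr (z' - z) (r' - z) ≠ 0 := fun h => by rw [h, zero_mul] at hside; exact hside.false
  have ha1 : ∀ v : Pt, ∀ ρ, cr (z' - z) (ρ - z) ≠ 0 → ⟪v, (-(area {z, z', ρ} / 3)) • gbc z z' ρ⟫_ℝ =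
      -(|cr (z' - z) (ρ - z)| / cr (z' - z) (ρ - z)) / 6 * (v 1 * (z' 0 - z 0) - v 0 * (z' 1 - z 1)) := by
    intro v ρ hρ
    rw [inner_smul_right, inner_eq, area_eq hρ]
    simp only [gbc, Matrix.cons_val_zero, Matrix.cons_val_one, Matrix.cons_val_fin_one, PiLp.sub_apply]
    field_simp
    ring
  rw [ha1 _ _ hD₁, ha1 _ _ hD₂]
  simp only [PiLp.sub_apply] at htan ⊢
  generalize cr (z' - z) (r - z) = D₁ at *
  generalize cr (z' - z) (r' - z) = D₂ at *
  generalize z' 1 - z 1 = l₁ at *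
  have hl : z' 0 - z 0 ≠ 0 := sub_ne_zero.2 hz
  generalize z' 0 - z 0 = l₀ at *
  generalize v₁ 0 = a at *
  generalize v₁ 1 = b at *
  generalize v₂ 0 = a' at *
  generalize v₂ 1 = b' at *
  have hq : |l₀| * |b - b'| ≤ |(b - b') * l₀ - (a - a') * l₁| := by
    have e : l₀ * ((b - b') * l₀ - (a - a') * l₁) = (l₀ ^ 2 + l₁ ^ 2) * (b - b') := by
      linear_combination (-l₁) * htan
    have e2 := congrArg abs e
    rw [abs_mul, abs_mul, abs_of_nonneg (show 0 ≤ l₀ ^ 2 + l₁ ^ 2 by positivity), ← sq_abs l₀] at e2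
    refine le_of_mul_le_mul_left ?_ (abs_pos.2 hl)
    rw [e2]
    nlinarith [mul_nonneg (sq_nonneg l₁) (abs_nonneg (b - b'))]
  have hfin : |(b - b') * l₀ - (a - a') * l₁| / 6 = |((b - b') * l₀ - (a - a') * l₁) / 6| := by
    rw [abs_div]; norm_num
  refine (div_le_div_of_nonneg_right hq (by norm_num)).trans (hfin ▸ le_of_eq ?_)
  rcases lt_or_gt_of_ne hD₁ with h1 | h1
  · have h2 : 0 < D₂ := by by_contra hc; push Not at hc; nlinarith
    rw [abs_of_neg h1, abs_of_pos h2, div_self h2.ne', neg_div_self h1.ne]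
    congr 1; ring
  · have h2 : D₂ < 0 := by by_contra hc; push Not at hc; nlinarith
    rw [abs_of_pos h1, abs_of_neg h2, div_self h1.ne', neg_div_self h2.ne, ← abs_neg]
    congr 1; ring

set_option maxHeartbeats 1000000 in
include S R A in
-- Tests the residual with the bubble of the edge `z z'` in a layer of thickness about min(ε, s).
-- The pairing is linear in the jump and the weights grow like the root of X/min(ε, s); squaring
-- gives the weight on the left.
lemma long_edge_jump_le {z z' r r' : Pt} (hT : ({z, z', r} : Finset Pt) ∈ 𝒯.elems)
    (hT' : ({z, z', r'} : Finset Pt) ∈ 𝒯.elems) (hz : z' 0 ≠ z 0)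
    (hside : cr (z' - z) (r' - z) * cr (z' - z) (r - z) < 0) :
    ε ^ 2 * (wd {z, z', r} * (min ε (se {z, z', r}) * ((g {z, z', r} - g {z, z', r'}) 1) ^ 2)) ≤
      longConst C L * (errT ε f u gu uh {z, z', r} + errT ε f u gu uh {z, z', r'}) := by
  classical
  have hε := S.pos
  have hL : 0 ≤ L := S.adm.nonneg.trans S.adm.lip_nonneg
  have hC := R.one_le
  have hb := not_boundary_edge hT hT' hside
  set T₁ : Finset Pt := {z, z', r} with hT₁
  set T₂ : Finset Pt := {z, z', r'} with hT₂
  have hD₁ := M.cr_ne hT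
  have hD₂ := M.cr_ne hT'
  have hne : T₁ ≠ T₂ := by
    intro h
    have : r' ∈ T₁ := by rw [h]; simp [hT₂]
    simp only [hT₁, Finset.mem_insert, Finset.mem_singleton] at this
    rcases this with rfl | rfl | rfl
    · simp [cr] at hD₂
    · apply hD₂; simp [cr]; ring
    · nlinarith [mul_self_nonneg (cr (z' - z) (r' - z))]
  set s := se T₁ with hs
  have hs0 : 0 < s := M.se_pos hT
  set m₀ := min ε s with hm₀
  have hm0 : 0 < m₀ := lt_min hε hs0
  set τ := m₀ / (2 * s) with hτ
  have hτ0 : 0 < τ := by positivity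
  have hτ1 : τ ≤ 1 / 2 := by
    rw [hτ, div_le_div_iff₀ (by positivity) (by norm_num)]
    have : m₀ ≤ s := min_le_right _ _
    linarith
  have hz1 : T₁ ∈ 𝒯.elemsAt z := Mesh.mem_elemsAt.2 ⟨hT, by simp [hT₁]⟩
  have hz2 : T₂ ∈ 𝒯.elemsAt z := Mesh.mem_elemsAt.2 ⟨hT', by simp [hT₂]⟩
  set D₀ := 10 ^ 5 * (C ^ 2 / s) with hD₀
  have hw := pw_edgeFam M hτ0 hτ1 hT hT' hz hside
  set N : Finset Pt → ℝ := fun T => if T = T₁ ∨ T = T₂ then 4 * C * (ε * D₀ * √(area T / τ)) else 0 with hN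
  have hse2 : s ≤ C * se T₂ := R.se_le z _ hz1 _ hz2
  have hw1 := bub_weights M R hε hs0 hT (le_mul_of_one_le_left hs0.le hC)
  have hw2 := bub_weights M R hε hs0 hT' hse2
  have f1 : edgeFam τ z z' r r' T₁ = bub mq τ z z' r := by simp [edgeFam, hT₁]
  have f2 : edgeFam τ z z' r r' T₂ = bub mq τ z z' r' := by rw [edgeFam, if_neg hne.symm, if_pos rfl]
  have f0 : ∀ T, T ≠ T₁ → T ≠ T₂ → edgeFam τ z z' r r' T = fun _ => 0 := fun T h1 h2 => by
    rw [edgeFam, if_neg h1, if_neg h2]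
  have n1 : N T₁ = 4 * C * (ε * D₀ * √(area T₁ / τ)) := if_pos (Or.inl rfl)
  have n2 : N T₂ = 4 * C * (ε * D₀ * √(area T₂ / τ)) := if_pos (Or.inr rfl)
  have n0 : ∀ T, T ≠ T₁ → T ≠ T₂ → N T = 0 := fun T h1 h2 => if_neg (by tauto)
  have key := S.abs_residual_le M hw A.gradient (N := N) (fun T _ => ?_) fun T _ => ?_
  rotate_left
  · by_cases h1 : T = T₁
    · rw [h1, f1]; exact integral_bub hD₁ prof_mq hτ0 hτ1
    by_cases h2 : T = T₂
    · rw [h2, f2]; exact integral_bub hD₂ prof_mq hτ0 hτ1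
    · rw [f0 T h1 h2]; simp
  · by_cases h1 : T = T₁
    · rw [h1, f1, n1]; exact hw1
    by_cases h2 : T = T₂
    · rw [h2, f2, n2]; exact hw2
    · rw [f0 T h1 h2, n0 T h1 h2]; exact Wts.zero ε T
  have hsub : ({T₁, T₂} : Finset (Finset Pt)) ⊆ 𝒯.elems := by
    intro T h
    simp only [Finset.mem_insert, Finset.mem_singleton] at h
    rcases h with rfl | rfl
    exacts [hT, hT']
  rw [← Finset.sum_subset hsub, ← Finset.sum_subset hsub, Finset.sum_pair hne, Finset.sum_pair hne] at key
  rotate_left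
  · intro T _ h
    simp only [Finset.mem_insert, Finset.mem_singleton, not_or] at h
    rw [n0 T h.1 h.2, mul_zero]
  · intro T _ h
    simp only [Finset.mem_insert, Finset.mem_singleton, not_or] at h
    rw [f0 T h.1 h.2]; simp
  rw [f1, f2, n1, n2] at key
  rw [integral_gradient_bub hD₁ prof_mq hτ0 hτ1, integral_gradient_bub hD₂ prof_mq hτ0 hτ1] at key
  set E₁ := errT ε f u gu uh T₁ with hE₁
  set E₂ := errT ε f u gu uh T₂ with hE₂
  have hE1 : 0 ≤ E₁ := errT_nonneg
  have hE2 : 0 ≤ E₂ := errT_nonneg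
  set d := g T₁ - g T₂ with hd
  set X := wd T₁ with hX
  have hX0 : 0 < X := M.wd_pos hT
  have hXl : X = |z' 0 - z 0| := M.wd_long hT hz
  have htan : d 0 * (z' 0 - z 0) + d 1 * (z' 1 - z 1) = 0 := by
    have h1 := A.affine T₁ hT z' (Mesh.mem_hull (by simp [hT₁])) z (Mesh.mem_hull (by simp [hT₁]))
    have h2 := A.affine T₂ hT' z' (Mesh.mem_hull (by simp [hT₂])) z (Mesh.mem_hull (by simp [hT₂]))
    rw [inner_eq] at h1 h2
    simp only [PiLp.sub_apply] at h1 h2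
    rw [hd]; simp only [PiLp.sub_apply]
    linarith
  have hlow : ε ^ 2 / 6 * (X * |d 1|) ≤ |ε ^ 2 * ⟪g T₁, (-(area T₁ / 3)) • gbc z z' r⟫_ℝ +
      ε ^ 2 * ⟪g T₂, (-(area T₂ / 3)) • gbc z z' r'⟫_ℝ| := by
    rw [← mul_add, abs_mul, abs_of_nonneg (sq_nonneg ε), hXl]
    have := edge_pairing_ge hz hside htan
    have := mul_le_mul_of_nonneg_left this (sq_nonneg ε)
    rwa [mul_div_assoc', ← div_mul_eq_mul_div] at this
  -- The area is at most of order X s and 1/τ = 2s/m₀, so the root is of order s times √(X/m₀); this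
  -- `s` cancels the one in `D₀`, and both elements are measured by the sizes of `T₁`.
  have hNle : ∀ T ∈ 𝒯.elemsAt z, 4 * C * (ε * D₀ * √(area T / τ)) ≤ 4 * 10 ^ 5 * C ^ 4 * ε * √(X / m₀) := by
    intro T hTz
    have h1 := R.wd_le z T hTz T₁ hz1
    have h2 := R.se_le z T hTz T₁ hz1
    have hTe := (Mesh.mem_elemsAt.1 hTz).1
    have hse := M.se_pos hTe
    have hwd := M.wd_pos hTe
    have h3 : √(area T / τ) ≤ C * s * √(X / m₀) := by
      rw [← Real.sqrt_sq (show 0 ≤ C * s by positivity), ← Real.sqrt_mul (sq_nonneg _)]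
      apply Real.sqrt_le_sqrt
      rw [M.area_eq_wd_se hTe, hτ]
      rw [div_div_eq_mul_div, div_le_iff₀ hm0]
      have : wd T * se T ≤ (C * X) * (C * s) := mul_le_mul h1 h2 hse.le (by positivity)
      calc wd T * se T / 2 * (2 * s) = wd T * se T * s := by ring
        _ ≤ (C * X) * (C * s) * s := by gcongr
        _ = (C * s) ^ 2 * (X / m₀) * m₀ := by field_simp
    calc 4 * C * (ε * D₀ * √(area T / τ)) ≤ 4 * C * (ε * D₀ * (C * s * √(X / m₀))) := by gcongr
      _ = 4 * 10 ^ 5 * C ^ 4 * ε * √(X / m₀) := by rw [hD₀]; field_simp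
  have hmain : ε ^ 2 / 6 * (X * |d 1|) ≤ (2 + L) * (4 * 10 ^ 5 * C ^ 4 * ε * √(X / m₀)) * (√E₁ + √E₂) := by
    refine hlow.trans (key.trans ?_)
    rw [mul_assoc (2 + L)]
    exact mul_le_mul_of_nonneg_left (mul_add_mul_le (Real.sqrt_nonneg _) (Real.sqrt_nonneg _) (hNle _ hz1)
      (hNle _ hz2)) (add_nonneg zero_le_two hL)
  have e2 : (√E₁ + √E₂) ^ 2 ≤ 2 * (E₁ + E₂) := by
    nlinarith [sq_nonneg (√E₁ - √E₂), Real.sq_sqrt hE1, Real.sq_sqrt hE2]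
  exact sq_of_root_bound hε hX0 hm0 hC hL (by positivity) e2 hmain

end

/-! ### Comparison of jumps at a node -/

/-- The constant of the comparison of jumps at a node. -/
def nodeConst (C L : ℝ) : ℝ := 8 * (3 * C + 1) ^ 2 * C ^ 8 * longConst C L

/-- Moves the long-edge estimate from the element where it was proved to a reference element at the
same node, and inserts the slope relation that gains (s/X)². -/
lemma mul_comparison {X X₁ s s₁ C m m₁ d y E K ε : ℝ} (hX : 0 ≤ X) (hC : 0 ≤ C) (hm : 0 ≤ m)
    (hm₁ : 0 ≤ m₁) (hX₁ : 0 ≤ X₁) (hs₁ : 0 ≤ s₁)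
    (h1 : X ≤ C * X₁) (h2 : m ≤ C * m₁) (h3 : s₁ ≤ C * s) (h4 : X₁ * |d| ≤ C * s₁ * |y|)
    (h5 : ε ^ 2 * (X₁ * (m₁ * y ^ 2)) ≤ K * E) :
    ε ^ 2 * X ^ 3 * m * d ^ 2 ≤ K * C ^ 8 * s ^ 2 * E := by
  have e1 : X ^ 3 * m ≤ (C * X₁) ^ 3 * (C * m₁) := by gcongr
  have e2 : (X₁ * |d|) ^ 2 ≤ (C * s₁ * |y|) ^ 2 := by gcongr
  rw [mul_pow, mul_pow, sq_abs, sq_abs] at e2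
  have e3 : s₁ ^ 2 ≤ (C * s) ^ 2 := by gcongr
  calc ε ^ 2 * X ^ 3 * m * d ^ 2 = ε ^ 2 * d ^ 2 * (X ^ 3 * m) := by ring
    _ ≤ ε ^ 2 * d ^ 2 * ((C * X₁) ^ 3 * (C * m₁)) := by gcongr
    _ = C ^ 4 * (ε ^ 2 * X₁ * m₁) * (X₁ ^ 2 * d ^ 2) := by ring
    _ ≤ C ^ 4 * (ε ^ 2 * X₁ * m₁) * ((C * s₁) ^ 2 * y ^ 2) := by gcongr
    _ = C ^ 6 * s₁ ^ 2 * (ε ^ 2 * (X₁ * (m₁ * y ^ 2))) := by ring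
    _ ≤ C ^ 6 * (C * s) ^ 2 * (K * E) := by gcongr
    _ = _ := by ring

section
variable {𝒯 : Triangulation unitSquare} {n : ℕ} {x : ℕ → ℝ} (M : Mesh 𝒯 n x)
  {ε Cf L C : ℝ} {f : Pt → ℝ → ℝ} {u : Pt → ℝ} {gu : Pt → Pt} {uh : Pt → ℝ}
  (S : Sol 𝒯 ε Cf L f u gu uh) (R : Reg 𝒯 C) {g : Finset Pt → Pt} (A : PA 𝒯 uh g)

/-- The sum of the local errors at a node. -/
def errN (𝒯 : Triangulation unitSquare) (ε : ℝ) (f : Pt → ℝ → ℝ) (u : Pt → ℝ) (gu : Pt → Pt) (uh : Pt → ℝ)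
    (z : Pt) : ℝ := ∑ T ∈ 𝒯.elemsAt z, errT ε f u gu uh T

lemma errN_nonneg {z : Pt} : 0 ≤ errN 𝒯 ε f u gu uh z := Finset.sum_nonneg fun _ _ => errT_nonneg

lemma errT_le_errN {z : Pt} {T : Finset Pt} (hT : T ∈ 𝒯.elemsAt z) :
    errT ε f u gu uh T ≤ errN 𝒯 ε f u gu uh z :=
  Finset.single_le_sum (f := fun T => errT ε f u gu uh T) (fun _ _ => errT_nonneg) hT

/-- A bound for the change of the `x`-derivative across a long edge at `z`. -/
def stepBd (𝒯 : Triangulation unitSquare) (C L ε : ℝ) (f : Pt → ℝ → ℝ) (u : Pt → ℝ) (gu : Pt → Pt)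
    (uh : Pt → ℝ) (z : Pt) (X s : ℝ) : ℝ :=
  √(longConst C L * C ^ 8 * s ^ 2 * (2 * errN 𝒯 ε f u gu uh z) / (ε ^ 2 * X ^ 3 * min ε s))

include M S R A in
-- Tangential continuity makes the gradient difference orthogonal to the common edge, so its
-- x-component is minus the slope times its y-component, and the slope is at most C s/X.
lemma step_le {z z' r r' : Pt} {T₀ : Finset Pt} (hT₀ : T₀ ∈ 𝒯.elemsAt z)
    (hT : ({z, z', r} : Finset Pt) ∈ 𝒯.elems) (hT' : ({z, z', r'} : Finset Pt) ∈ 𝒯.elems) (hz : z' 0 ≠ z 0)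
    (hside : cr (z' - z) (r' - z) * cr (z' - z) (r - z) < 0) :
    |g {z, z', r'} 0 - g {z, z', r} 0| ≤ stepBd 𝒯 C L ε f u gu uh z (wd T₀) (se T₀) := by
  have hε := S.pos
  have hC := R.one_le
  have hL : 0 ≤ L := S.adm.nonneg.trans S.adm.lip_nonneg
  have hT₀e := (Mesh.mem_elemsAt.1 hT₀).1
  have hX := M.wd_pos hT₀e
  have hs := M.se_pos hT₀e
  have hz1 : ({z, z', r} : Finset Pt) ∈ 𝒯.elemsAt z := Mesh.mem_elemsAt.2 ⟨hT, by simp⟩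
  have hz2 : ({z, z', r'} : Finset Pt) ∈ 𝒯.elemsAt z := Mesh.mem_elemsAt.2 ⟨hT', by simp⟩
  have hX₁ := M.wd_pos hT
  have hs₁ := M.se_pos hT
  have hjump := long_edge_jump_le M S R A hT hT' hz hside
  have hE := add_le_add (errT_le_errN (ε := ε) (f := f) (u := u) (gu := gu) (uh := uh) hz1)
    (errT_le_errN (ε := ε) (f := f) (u := u) (gu := gu) (uh := uh) hz2)
  have hK : 0 ≤ longConst C L := by unfold longConst; positivity
  have hslope := R.slope z z' r hT hz
  have hwl := M.wd_long hT hz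
  have htan : (g {z, z', r} - g {z, z', r'}) 0 * (z' 0 - z 0) + (g {z, z', r} - g {z, z', r'}) 1 * (z' 1 - z 1) = 0 := by
    have h1 := A.affine _ hT z' (Mesh.mem_hull (by simp)) z (Mesh.mem_hull (by simp))
    have h2 := A.affine _ hT' z' (Mesh.mem_hull (by simp)) z (Mesh.mem_hull (by simp))
    rw [inner_eq] at h1 h2
    simp only [PiLp.sub_apply] at h1 h2 ⊢
    linarith
  have h4 : wd {z, z', r} * |(g {z, z', r} - g {z, z', r'}) 0| ≤
      C * se {z, z', r} * |(g {z, z', r} - g {z, z', r'}) 1| := by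
    rw [hwl, ← abs_mul, mul_comm (z' 0 - z 0), show (g {z, z', r} - g {z, z', r'}) 0 * (z' 0 - z 0) =
      -((z' 1 - z 1) * (g {z, z', r} - g {z, z', r'}) 1) by linarith, abs_neg, abs_mul]
    gcongr
  have hm : min ε (se T₀) ≤ C * min ε (se {z, z', r}) := by
    rcases le_total ε (se {z, z', r}) with h | h
    · rw [min_eq_left h]; exact (min_le_left _ _).trans (le_mul_of_one_le_left hε.le hC)
    · rw [min_eq_right h]; exact (min_le_right _ _).trans (R.se_le z _ hT₀ _ hz1)
  have key := mul_comparison hX.le (by linarith) (le_min hε.le hs.le) (le_min hε.le hs₁.le) hX₁.le hs₁.le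
    (R.wd_le z _ hT₀ _ hz1) hm (R.se_le z _ hz1 _ hT₀) h4
    (hjump.trans (mul_le_mul_of_nonneg_left (hE.trans (le_of_eq (two_mul _).symm)) hK))
  refine Real.abs_le_sqrt ?_
  have hm0 : 0 < min ε (se T₀) := lt_min hε hs
  rw [le_div_iff₀ (by positivity)]
  calc (g {z, z', r'} 0 - g {z, z', r} 0) ^ 2 * (ε ^ 2 * wd T₀ ^ 3 * min ε (se T₀)) =
      ε ^ 2 * wd T₀ ^ 3 * min ε (se T₀) * ((g {z, z', r} - g {z, z', r'}) 0) ^ 2 := by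
        simp only [PiLp.sub_apply]; ring
    _ ≤ _ := key

lemma stepBd_nonneg {z : Pt} {X s : ℝ} : 0 ≤ stepBd 𝒯 C L ε f u gu uh z X s := Real.sqrt_nonneg _

include M in
lemma vertical_ne {z r b : Pt} (hT : ({z, r, b} : Finset Pt) ∈ 𝒯.elems) (hr : r 0 = z 0) :
    r 1 - z 1 ≠ 0 ∧ b 0 - z 0 ≠ 0 := by
  have h := M.cr_ne hT
  simp only [cr, PiLp.sub_apply, hr, sub_self, zero_mul, zero_sub, ne_eq, neg_eq_zero, mul_eq_zero,
    not_or] at h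
  exact h

include M S R A in
-- If the two vertical edges at `z` point the same way they coincide and nothing is to be shown.
-- Otherwise a walk inside the column leads from one to the other; its at most 3C steps and the
-- final crossing each cost `stepBd`.
lemma side_chain {z r r' b b' : Pt} {T₀ : Finset Pt} (hT₀ : T₀ ∈ 𝒯.elemsAt z)
    (hT : ({z, r, b} : Finset Pt) ∈ 𝒯.elems) (hr : r 0 = z 0) (hT' : ({z, r', b'} : Finset Pt) ∈ 𝒯.elems)
    (hr' : r' 0 = z 0) (hb : b' 0 = b 0) :
    |g {z, r, b} 0 - g {z, r', b'} 0| ≤ stepBd 𝒯 C L ε f u gu uh z (wd T₀) (se T₀) * (3 * C + 1) := by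
  have hC := R.one_le
  obtain ⟨n1, n2⟩ := vertical_ne M hT hr
  obtain ⟨n1', n2'⟩ := vertical_ne M hT' hr'
  have e : ({z, r, b} : Finset Pt) = {z, b, r} := by ext; simp; tauto
  have e' : ({z, r', b'} : Finset Pt) = {z, b', r'} := by ext; simp; tauto
  set β := stepBd 𝒯 C L ε f u gu uh z (wd T₀) (se T₀) with hβ
  have hβ0 : 0 ≤ β := stepBd_nonneg
  rcases lt_or_gt_of_ne (mul_ne_zero n1 n1') with hdir | hdir
  · have hcr : cr (b - z) (r - z) = (b 0 - z 0) * (r 1 - z 1) := by simp [cr, hr]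
    obtain ⟨z₁, r₁, h1, h2, h3, h4, h5⟩ := M.walk (z := z) (ξ := b 0) (s := -((b 0 - z 0) * (r 1 - z 1)))
      (fun h => n2 (by rw [h]; ring)) hβ0 (fun T _ => g T 0)
      (fun z' ρ ρ' a1 a2 a3 _ a5 => step_le M S R A hT₀ a1 a2 (by rw [a3]; exact sub_ne_zero.1 n2) a5)
      (e ▸ hT) rfl (by
        rw [hcr]
        have := mul_self_pos.2 (mul_ne_zero n2 n1)
        linarith)
    have hz₁ : z₁ 0 ≠ z 0 := by rw [h2]; exact sub_ne_zero.1 n2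
    -- One edge at `z` goes up and the other down, so `z` is not on y = 0 or y = 1 and the walk
    -- cannot stop at the boundary.
    rcases h5 with ⟨-, h5⟩ | ⟨r'', k1, k2, k3, k4⟩
    · exfalso
      have v1 := (Mesh.vertex_bounds hT (p := r) (by simp)).2
      have v2 := (Mesh.vertex_bounds hT' (p := r') (by simp)).2
      rcases h5 with h5 | h5 <;> rw [h5] at hdir
      · nlinarith [mul_nonneg v1.1 v2.1]
      · nlinarith [mul_nonneg (sub_nonneg.2 v1.2) (sub_nonneg.2 v2.2)]
    · have hrr : r'' = r' := by
        refine M.vertical_unique k1 (e' ▸ hT') k2 hr' hz₁ (sub_ne_zero.1 n2') ?_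
        have k3' : (b 0 - z 0) ^ 2 * ((r 1 - z 1) * (r'' 1 - z 1)) < 0 := by nlinarith
        have k5 : (r 1 - z 1) * (r'' 1 - z 1) < 0 := by
          by_contra hc
          push Not at hc
          nlinarith [mul_nonneg (sq_nonneg (b 0 - z 0)) hc]
        exact mul_pos_of_mul_neg (a := r 1 - z 1) (by linarith) (by linarith)
      subst hrr
      have hzb : z₁ = b' := by
        refine M.neighbour_unique hT' (r' := z₁) ?_ ?_
        · have : ({z, r'', z₁} : Finset Pt) = {z, z₁, r''} := by ext; simp; tauto
          rwa [this]
        · simp only [cr, PiLp.sub_apply, hr', h2, hb]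
          have := mul_self_pos.2 (mul_ne_zero n1' n2)
          nlinarith
      subst hzb
      have h6 := step_le M S R A hT₀ h1 k1 hz₁ k4
      rw [← e] at h4
      rw [← e', ← hβ] at h6
      have hcard := R.card_le z
      simp only at h4
      have h7 : β * (3 * ((𝒯.elemsAt z).card : ℝ)) ≤ β * (3 * C) := by gcongr
      rw [abs_le] at h4 h6 ⊢
      constructor <;> linarith
  · have hrr : r = r' := M.vertical_unique (e ▸ hT) (e' ▸ hT') hr hr' (sub_ne_zero.1 n2)
      (sub_ne_zero.1 n2') (by linarith)
    subst hrr
    have hbb : b' = b := by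
      refine M.neighbour_unique hT hT' ?_
      simp only [cr, PiLp.sub_apply, hr, hb]
      have := mul_self_pos.2 (mul_ne_zero n1 n2)
      nlinarith
    subst hbb
    rw [sub_self, abs_zero]
    positivity

include M S R A in
-- The walk towards the boundary ends at a horizontal edge with `uh` = 0 at both endpoints, so the
-- x-derivative in the last element is zero. It cannot end at a second vertical edge, which would
-- leave the square.
lemma side_boundary {z r b : Pt} {T₀ : Finset Pt} (hT₀ : T₀ ∈ 𝒯.elemsAt z)
    (hT : ({z, r, b} : Finset Pt) ∈ 𝒯.elems) (hr : r 0 = z 0) (hz : z 1 = 0 ∨ z 1 = 1) :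
    |g {z, r, b} 0| ≤ stepBd 𝒯 C L ε f u gu uh z (wd T₀) (se T₀) * (3 * C + 1) := by
  have hC := R.one_le
  obtain ⟨n1, n2⟩ := vertical_ne M hT hr
  have e : ({z, r, b} : Finset Pt) = {z, b, r} := by ext; simp; tauto
  set β := stepBd 𝒯 C L ε f u gu uh z (wd T₀) (se T₀) with hβ
  have hβ0 : 0 ≤ β := stepBd_nonneg
  have hcr : cr (b - z) (r - z) = (b 0 - z 0) * (r 1 - z 1) := by simp [cr, hr]
  obtain ⟨z₁, r₁, h1, h2, h3, h4, h5⟩ := M.walk (z := z) (ξ := b 0) (s := -((b 0 - z 0) * (r 1 - z 1)))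
    (fun h => n2 (by rw [h]; ring)) hβ0 (fun T _ => g T 0)
    (fun z' ρ ρ' a1 a2 a3 _ a5 => step_le M S R A hT₀ a1 a2 (by rw [a3]; exact sub_ne_zero.1 n2) a5)
    (e ▸ hT) rfl (by
      rw [hcr]
      have := mul_self_pos.2 (mul_ne_zero n2 n1)
      linarith)
  rcases h5 with ⟨h5, h6⟩ | ⟨r'', k1, k2, k3, k4⟩
  · have hfr : ∀ p ∈ ({z, z₁, r₁} : Finset Pt), p 1 = 0 ∨ p 1 = 1 → uh p = 0 := by
      intro p hp hp1
      refine A.zero p ⟨Mesh.vertex_mem_closure h1 (Mesh.mem_hull hp), fun h => ?_⟩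
      obtain ⟨-, -, c1, c2⟩ := interior_subset h
      rcases hp1 with h | h <;> rw [h] at c1 c2
      · exact lt_irrefl _ c1
      · exact lt_irrefl _ c2
    have ha := A.affine _ h1 z₁ (Mesh.mem_hull (by simp)) z (Mesh.mem_hull (by simp))
    rw [hfr z₁ (by simp) (h5 ▸ h6), hfr z (by simp) h6, inner_eq] at ha
    simp only [PiLp.sub_apply, h5, h2, sub_self, mul_zero, add_zero] at ha
    have hg : g {z, z₁, r₁} 0 = 0 := (mul_eq_zero.1 ha.symm).resolve_right n2
    simp only at h4
    rw [← e, hg] at h4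
    have hcard := R.card_le z
    have h7 : β * (3 * ((𝒯.elemsAt z).card : ℝ)) ≤ β * (3 * C) := by gcongr
    rw [abs_le] at h4 ⊢
    constructor <;> linarith
  · exfalso
    have v1 := (Mesh.vertex_bounds hT (p := r) (by simp)).2
    have v2 := (Mesh.vertex_bounds k1 (p := r'') (by simp)).2
    have k3' : (b 0 - z 0) ^ 2 * ((r 1 - z 1) * (r'' 1 - z 1)) < 0 := by nlinarith
    have k5 : 0 ≤ (r 1 - z 1) * (r'' 1 - z 1) := by
      rcases hz with h | h <;> rw [h]
      · nlinarith [mul_nonneg v1.1 v2.1]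
      · nlinarith [mul_nonneg (sub_nonneg.2 v1.2) (sub_nonneg.2 v2.2)]
    nlinarith [mul_nonneg (sq_nonneg (b 0 - z 0)) k5]

include M S in
lemma sq_le_of_stepBd {z : Pt} {T₀ : Finset Pt} (hT₀ : T₀ ∈ 𝒯.elemsAt z) {j : ℝ} (hC : 0 ≤ C)
    (hj : |j| ≤ 2 * (stepBd 𝒯 C L ε f u gu uh z (wd T₀) (se T₀) * (3 * C + 1))) :
    ε ^ 2 * wd T₀ ^ 3 * min ε (se T₀) * j ^ 2 ≤ nodeConst C L * se T₀ ^ 2 * errN 𝒯 ε f u gu uh z := by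
  have hε := S.pos
  have hL : 0 ≤ L := S.adm.nonneg.trans S.adm.lip_nonneg
  have hT₀e := (Mesh.mem_elemsAt.1 hT₀).1
  have hX := M.wd_pos hT₀e
  have hs := M.se_pos hT₀e
  have hm0 : 0 < min ε (se T₀) := lt_min hε hs
  have hK : 0 ≤ longConst C L := by unfold longConst; positivity
  have hE : 0 ≤ errN 𝒯 ε f u gu uh z := errN_nonneg
  have h := pow_le_pow_left₀ (abs_nonneg _) hj 2
  rw [sq_abs, mul_pow, mul_pow, stepBd, Real.sq_sqrt (by positivity)] at h
  calc _ ≤ ε ^ 2 * wd T₀ ^ 3 * min ε (se T₀) * _ := mul_le_mul_of_nonneg_left h (by positivity)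
    _ = _ := by rw [nodeConst]; field_simp; ring

end

/-! ### Short edges on a vertical mesh line -/

section
variable {𝒯 : Triangulation unitSquare} {n : ℕ} {x : ℕ → ℝ} (M : Mesh 𝒯 n x) {i : ℕ} (hi : 0 < i) (hin : i < n)

include M in
lemma Mesh.col_third {p q r : Pt} (hT : ({p, q, r} : Finset Pt) ∈ 𝒯.elems) (hin : i ≤ n) (hp : p 0 = x i)
    (hq : q 0 = x i) : (r 0 = x (i + 1) ∧ i + 1 ≤ n) ∨ (r 0 = x (i - 1) ∧ 0 < i) := by
  obtain ⟨z₁, z₂, a, k, m, hE, hk, hm, hkm, h1, h2, ha, -⟩ := M.elem _ hT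
  have hne : x k ≠ x m := fun h => by have := M.injOn hk hm h; omega
  have hmem : ∀ y, y = p ∨ y = q ∨ y = r ↔ y = z₁ ∨ y = z₂ ∨ y = a := fun y => by
    have : y ∈ ({p, q, r} : Finset Pt) ↔ y ∈ ({z₁, z₂, a} : Finset Pt) := by rw [hE]
    simpa using this
  obtain ⟨hpq, -, -⟩ := Mesh.ne_of_elem hT
  have har : a = r := by
    rcases (hmem a).2 (Or.inr (Or.inr rfl)) with h | h | h
    · subst h
      rcases (hmem q).1 (Or.inr (Or.inl rfl)) with h | h | h
      · exact absurd (by rw [← h1, ← h, hq, ← hp, ha]) hne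
      · exact absurd (by rw [← h2, ← h, hq, ← hp, ha]) hne
      · exact absurd h.symm hpq
    · subst h
      rcases (hmem p).1 (Or.inl rfl) with h | h | h
      · exact absurd (by rw [← h1, ← h, hp, ← hq, ha]) hne
      · exact absurd (by rw [← h2, ← h, hp, ← hq, ha]) hne
      · exact absurd h hpq
    · exact h
  subst har
  have hki : x k = x i := by
    rcases (hmem p).1 (Or.inl rfl) with h | h | h
    · rw [← h1, ← h, hp]
    · rw [← h2, ← h, hp]
    · exact absurd (by rw [h] : a = p).symm (Mesh.ne_of_elem hT).2.1
  have := M.injOn hk hin hki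
  subst this
  rcases hkm with rfl | h
  · exact Or.inl ⟨ha, hm⟩
  · have : m = k - 1 := by omega
    subst this
    exact Or.inr ⟨ha, by omega⟩

include M hi hin

lemma Mesh.lt_cols : x (i - 1) < x i ∧ x i < x (i + 1) := by
  have h1 := M.x_mono (i - 1) (by omega)
  rw [Nat.sub_add_cancel hi] at h1
  exact ⟨h1, M.x_mono i hin⟩

omit M hi hin in
lemma mem_edgesOn {S : Finset Pt} {t : ℝ} : S ∈ 𝒯.edgesOn t ↔
    (∃ T ∈ 𝒯.elems, S ⊆ T ∧ S.card = 2) ∧ ∀ p ∈ S, p 0 = t := by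
  simp [Triangulation.edgesOn, Triangulation.edges, Finset.mem_powersetCard]

/-- Since 0 < x i < 1 the midpoint of the edge is interior, so there is an element on either side;
`a` names the left and `b` the right apex. -/
lemma edge_at {S : Finset Pt} (hS : S ∈ 𝒯.edgesOn (x i)) {z : Pt} (hz : z ∈ S) :
    ∃ r a b : Pt, S = {z, r} ∧ r ≠ z ∧ z 0 = x i ∧ r 0 = x i ∧ ({z, r, a} : Finset Pt) ∈ 𝒯.elems ∧
      ({z, r, b} : Finset Pt) ∈ 𝒯.elems ∧ a 0 = x (i - 1) ∧ b 0 = x (i + 1) := by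
  obtain ⟨⟨T, hT, hST, hcard⟩, hcol⟩ := mem_edgesOn.1 hS
  obtain ⟨r, hr⟩ := Finset.card_eq_one.1 (by rw [Finset.card_erase_of_mem hz, hcard] : (S.erase z).card = 1)
  have hSe : S = {z, r} := by rw [← Finset.insert_erase hz, hr]
  have hrS : r ∈ S := by rw [hSe]; simp
  have hrz : r ≠ z := by
    have : r ∈ S.erase z := by rw [hr]; simp
    exact (Finset.mem_erase.1 this).1
  have hz0 := hcol z hz
  have hr0 := hcol r hrS
  obtain ⟨a, ha⟩ := Mesh.exists_third hT (hST hz) (hST hrS) hrz.symm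
  rw [ha] at hT
  have v1 := (Mesh.vertex_bounds hT (p := z) (by simp)).2
  have v2 := (Mesh.vertex_bounds hT (p := r) (by simp)).2
  have hy : r 1 ≠ z 1 := fun h => hrz (pt_ext (by rw [hr0, hz0]) h)
  have hmid : (1 / 2 : ℝ) • z + (1 / 2 : ℝ) • r ∈ unitSquare := by
    have h1 := M.x_pos hi hin
    have h2 := M.x_lt_one hin
    refine ⟨?_, ?_, ?_, ?_⟩ <;> simp only [PiLp.add_apply, PiLp.smul_apply, smul_eq_mul, hz0, hr0]
    · linarith
    · linarith
    · rcases lt_or_gt_of_ne hy with h | h <;> linarith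
    · rcases lt_or_gt_of_ne hy with h | h <;> linarith
  obtain ⟨b, hb, hside⟩ := M.exists_neighbour hT hmid
  obtain ⟨c1, c2⟩ := M.lt_cols hi hin
  simp only [cr, PiLp.sub_apply, hz0, hr0, sub_self, zero_mul, zero_sub] at hside
  have hside' : 0 < (r 1 - z 1) ^ 2 * -((b 0 - x i) * (a 0 - x i)) := by linarith
  have hopp : (b 0 - x i) * (a 0 - x i) < 0 := by
    by_contra hc
    push Not at hc
    nlinarith [mul_nonneg (sq_nonneg (r 1 - z 1)) hc]
  rcases M.col_third hT hin.le hz0 hr0 with ⟨h, -⟩ | ⟨h, -⟩ <;>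
    rcases M.col_third hb hin.le hz0 hr0 with ⟨h', -⟩ | ⟨h', -⟩
  · rw [h, h'] at hopp; nlinarith
  · exact ⟨r, b, a, hSe, hrz, hz0, hr0, hb, hT, h', h⟩
  · exact ⟨r, a, b, hSe, hrz, hz0, hr0, hT, hb, h, h'⟩
  · rw [h, h'] at hopp; nlinarith

omit hi hin in
lemma elemsAtEdge_eq {z r a b : Pt} (h0 : r 0 = z 0) (hrz : r ≠ z) (ha : ({z, r, a} : Finset Pt) ∈ 𝒯.elems)
    (hb : ({z, r, b} : Finset Pt) ∈ 𝒯.elems) (ha0 : a 0 < z 0) (hb0 : z 0 < b 0) :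
    𝒯.elemsAtEdge {z, r} = {{z, r, a}, {z, r, b}} := by
  classical
  ext T
  simp only [Triangulation.elemsAtEdge, Finset.mem_filter, Finset.mem_insert, Finset.mem_singleton]
  constructor
  · rintro ⟨hT, hs⟩
    obtain ⟨c, rfl⟩ := Mesh.exists_third hT (hs (by simp)) (hs (by simp)) hrz.symm
    have hc := (vertical_ne M hT h0).2
    have hy := (vertical_ne M hT h0).1
    have key : ∀ d : Pt, 0 < (c 0 - z 0) * (d 0 - z 0) → 0 < cr (r - z) (c - z) * cr (r - z) (d - z) := by
      intro d hd
      simp only [cr, PiLp.sub_apply, h0, sub_self, zero_mul, zero_sub]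
      have := mul_pos (mul_self_pos.2 hy) hd
      nlinarith
    rcases lt_or_gt_of_ne hc with h | h
    · left; rw [M.neighbour_unique ha hT (key a (by nlinarith))]
    · right; rw [M.neighbour_unique hb hT (key b (by nlinarith))]
  · rintro (rfl | rfl)
    · exact ⟨ha, by intro y; simp; tauto⟩
    · exact ⟨hb, by intro y; simp; tauto⟩

/-- The orientation of an element with respect to the vertical line `x = ξ`. -/
def sg (ξ : ℝ) (T : Finset Pt) : ℝ :=
  open Classical in if ∃ p ∈ T, p 0 < ξ then 1 else -1

omit M hi hin in
lemma outwardNormal_eq {z r c : Pt} {σ : ℝ} (h0 : r 0 = z 0) (hrz : r ≠ z) (hc : c ∉ ({z, r} : Finset Pt))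
    (hσ : σ = 1 ∨ σ = -1) (hs : σ * (c 0 - z 0) < 0) :
    outwardNormal {z, r, c} {z, r} = WithLp.toLp 2 ![σ, 0] := by
  have hy : r 1 - z 1 ≠ 0 := fun h => hrz (pt_ext h0 (sub_eq_zero.1 h))
  have hex : IsOutwardNormal {z, r, c} {z, r} (WithLp.toLp 2 ![σ, 0]) := by
    refine ⟨?_, ?_, ?_⟩
    · rw [← pow_left_inj₀ (norm_nonneg _) zero_le_one two_ne_zero, norm_sq_eq]
      rcases hσ with rfl | rfl <;> simp
    · intro p hp q hq
      simp only [Finset.mem_insert, Finset.mem_singleton] at hp hq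
      rw [inner_eq]
      rcases hp with rfl | rfl <;> rcases hq with rfl | rfl <;> simp [h0]
    · intro p hp q hq hqS
      have hqc : q = c := by
        simp only [Finset.mem_insert, Finset.mem_singleton] at hq hqS
        tauto
      subst hqc
      simp only [Finset.mem_insert, Finset.mem_singleton] at hp
      rw [inner_eq]
      rcases hp with rfl | rfl
      · simpa using hs
      · simpa [h0] using hs
  have h : ∃ ν, IsOutwardNormal {z, r, c} {z, r} ν := ⟨_, hex⟩
  rw [outwardNormal, dif_pos h]
  obtain ⟨k1, k2, k3⟩ := h.choose_spec
  set ν := h.choose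
  have e1 := k2 z (by simp) r (by simp)
  rw [inner_eq] at e1
  simp only [PiLp.sub_apply, h0, sub_self, mul_zero, zero_add] at e1
  have hν1 : ν 1 = 0 := (mul_eq_zero.1 e1).resolve_right hy
  have e2 := k3 z (by simp) c (by simp) hc
  rw [inner_eq, hν1] at e2
  simp only [PiLp.sub_apply, zero_mul, add_zero] at e2
  have e3 := norm_sq_eq ν
  rw [k1, hν1] at e3
  have e4 : (ν 0 - σ) * (ν 0 + σ) = 0 := by
    have : σ ^ 2 = 1 := by rcases hσ with rfl | rfl <;> norm_num
    nlinarith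
  have hν0 : ν 0 = σ := by
    rcases mul_eq_zero.1 e4 with h | h
    · linarith
    · have : ν 0 = -σ := by linarith
      rw [this] at e2
      linarith
  refine pt_ext ?_ ?_
  · simpa using hν0
  · simpa using hν1

omit hi hin in
-- The barycentre has all weights 1/3 and hence is an interior point of the element.
lemma gradOn_eq {uh : Pt → ℝ} {g : Finset Pt → Pt} (A : PA 𝒯 uh g) {T : Finset Pt} (hT : T ∈ 𝒯.elems) :
    Triangulation.gradOn uh T = g T := by
  obtain ⟨p, q, r, -, -, rfl, -⟩ := M.elem T hT
  obtain ⟨h1, h2, h3⟩ := Mesh.ne_of_elem hT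
  have hD := M.cr_ne hT
  have hsum : ∑ y ∈ ({p, q, r} : Finset Pt), y = p + q + r := by
    rw [Finset.sum_insert (by simp [h1, h2]), Finset.sum_pair h3]; abel
  refine A.gradient _ hT _ ?_
  rw [hsum]
  have key : ∀ p q r : Pt, cr (q - p) (r - p) ≠ 0 → bc p q r ((3 : ℝ)⁻¹ • (p + q + r)) = 1 / 3 := by
    intro p q r hD
    rw [bc, div_eq_iff hD]
    simp only [cr, PiLp.sub_apply, PiLp.smul_apply, PiLp.add_apply, smul_eq_mul]
    ring
  refine mem_interior_of_pos hD ?_ ?_ ?_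
  · rw [show p + q + r = q + r + p by abel, key q r p (cr_rot_ne hD)]; norm_num
  · rw [show p + q + r = r + p + q by abel, key r p q (cr_rot_ne' hD)]; norm_num
  · rw [key p q r hD]; norm_num

omit hi hin in
lemma outwardNormal_sg {S T : Finset Pt} {ξ : ℝ} (hT : T ∈ 𝒯.elems) (hST : S ⊆ T) (hS : S.card = 2)
    (hcol : ∀ p ∈ S, p 0 = ξ) : outwardNormal T S = WithLp.toLp 2 ![sg ξ T, 0] := by
  classical
  obtain ⟨z, r, hzr, rfl⟩ := Finset.card_eq_two.1 hS
  obtain ⟨c, rfl⟩ := Mesh.exists_third hT (hST (by simp)) (hST (by simp)) hzr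
  have hz := hcol z (by simp)
  have hr := hcol r (by simp)
  have h0 : r 0 = z 0 := by rw [hz, hr]
  obtain ⟨n1, n2⟩ := vertical_ne M hT h0
  obtain ⟨-, h2, h3⟩ := Mesh.ne_of_elem hT
  rw [hz] at n2
  refine outwardNormal_eq h0 hzr.symm (by simp [h2.symm, h3.symm]) ?_ ?_
  · unfold sg; split_ifs <;> simp
  · unfold sg
    rw [hz]
    split_ifs with h
    · obtain ⟨p, hp, hp'⟩ := h
      simp only [Finset.mem_insert, Finset.mem_singleton] at hp
      rcases hp with rfl | rfl | rfl <;> linarith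
    · push Not at h
      have := h c (by simp)
      have : 0 < c 0 - ξ := lt_of_le_of_ne (by linarith) n2.symm
      linarith

omit hi hin in
lemma jump_eq_sum {uh : Pt → ℝ} {g : Finset Pt → Pt} (A : PA 𝒯 uh g) {S : Finset Pt} {ξ : ℝ}
    (hS : S ∈ 𝒯.edgesOn ξ) : 𝒯.jump uh S = ∑ T ∈ 𝒯.elemsAtEdge S, sg ξ T * g T 0 := by
  classical
  obtain ⟨⟨-, -, -, hcard⟩, hcol⟩ := mem_edgesOn.1 hS
  refine Finset.sum_congr rfl fun T hT => ?_
  simp only [Triangulation.elemsAtEdge, Finset.mem_filter] at hT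
  rw [gradOn_eq M A hT.1, outwardNormal_sg M hT.1 hT.2 hcard hcol, inner_eq]
  simp [mul_comm]

omit M hi hin in
lemma sg_of_lt {ξ : ℝ} {T : Finset Pt} {p : Pt} (hp : p ∈ T) (h : p 0 < ξ) : sg ξ T = 1 := by
  unfold sg; exact if_pos ⟨p, hp, h⟩

omit M hi hin in
lemma sg_of_ge {ξ : ℝ} {T : Finset Pt} (h : ∀ p ∈ T, ξ ≤ p 0) : sg ξ T = -1 := by
  unfold sg
  rw [if_neg]
  rintro ⟨p, hp, h'⟩
  exact absurd h' (not_lt.2 (h p hp))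

lemma jump_eq {uh : Pt → ℝ} {g : Finset Pt → Pt} (A : PA 𝒯 uh g) {z r a b : Pt}
    (hS : ({z, r} : Finset Pt) ∈ 𝒯.edgesOn (x i)) (hrz : r ≠ z) (hz : z 0 = x i) (hr : r 0 = x i)
    (hTa : ({z, r, a} : Finset Pt) ∈ 𝒯.elems) (hTb : ({z, r, b} : Finset Pt) ∈ 𝒯.elems) (ha : a 0 = x (i - 1))
    (hb : b 0 = x (i + 1)) : 𝒯.jump uh {z, r} = g {z, r, a} 0 - g {z, r, b} 0 := by
  classical
  obtain ⟨c1, c2⟩ := M.lt_cols hi hin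
  have hab : ({z, r, a} : Finset Pt) ≠ {z, r, b} := by
    intro h
    have hm : a ∈ ({z, r, b} : Finset Pt) := by rw [← h]; simp
    simp only [Finset.mem_insert, Finset.mem_singleton] at hm
    rcases hm with rfl | rfl | rfl <;> linarith
  rw [jump_eq_sum M A hS, elemsAtEdge_eq M (by rw [hr, hz]) hrz hTa hTb (by linarith) (by linarith),
    Finset.sum_pair hab, sg_of_lt (p := a) (by simp) (by linarith), sg_of_ge]
  · ring
  · intro p hp
    simp only [Finset.mem_insert, Finset.mem_singleton] at hp
    rcases hp with rfl | rfl | rfl <;> linarith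

/-- The nodal values of the test function built from the jumps `J`. -/
def nodeVal (𝒯 : Triangulation unitSquare) (ξ : ℝ) (J : Finset Pt → ℝ) (z : Pt) : ℝ :=
  open Classical in
  if z 1 = 0 ∨ z 1 = 1 then 0 else if h : ∃ S ∈ 𝒯.edgesOn ξ, z ∈ S then J h.choose else 0

variable {ε Cf L C : ℝ} {f : Pt → ℝ → ℝ} {u : Pt → ℝ} {gu : Pt → Pt} {uh : Pt → ℝ}
  (Sl : Sol 𝒯 ε Cf L f u gu uh) (R : Reg 𝒯 C) {g : Finset Pt → Pt} (A : PA 𝒯 uh g)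
include Sl R A

/-- The jump is the left minus the right x-derivative. Each side is compared separately, by
`side_chain` with the edge selected in `nodeVal`, or by `side_boundary` with zero; this explains the
factor 2 in `sq_le_of_stepBd`. -/
lemma jump_sub_nodeVal {S : Finset Pt} (hS : S ∈ 𝒯.edgesOn (x i)) {z : Pt} (hz : z ∈ S) {T₀ : Finset Pt}
    (hT₀ : T₀ ∈ 𝒯.elemsAt z) :
    ε ^ 2 * wd T₀ ^ 3 * min ε (se T₀) * (𝒯.jump uh S - nodeVal 𝒯 (x i) (𝒯.jump uh) z) ^ 2 ≤
      nodeConst C L * se T₀ ^ 2 * errN 𝒯 ε f u gu uh z := by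
  have hC := R.one_le
  refine sq_le_of_stepBd M Sl hT₀ (by linarith) ?_
  obtain ⟨r, a, b, hSe, hrz, hz0, hr0, hTa, hTb, ha, hb⟩ := edge_at M hi hin hS hz
  have hJ := jump_eq M hi hin A (hSe ▸ hS) hrz hz0 hr0 hTa hTb ha hb
  rw [hSe, hJ]
  by_cases hbd : z 1 = 0 ∨ z 1 = 1
  · rw [nodeVal, if_pos hbd, sub_zero]
    have h1 := side_boundary M Sl R A hT₀ hTa (by rw [hr0, hz0]) hbd
    have h2 := side_boundary M Sl R A hT₀ hTb (by rw [hr0, hz0]) hbd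
    rw [abs_le] at h1 h2 ⊢
    constructor <;> linarith
  · have hex : ∃ S ∈ 𝒯.edgesOn (x i), z ∈ S := ⟨S, hS, hz⟩
    rw [nodeVal, if_neg hbd, dif_pos hex]
    obtain ⟨hS', hz'⟩ := hex.choose_spec
    set S' := hex.choose
    obtain ⟨r', a', b', hSe', hrz', -, hr0', hTa', hTb', ha', hb'⟩ := edge_at M hi hin hS' hz'
    have hJ' := jump_eq M hi hin A (hSe' ▸ hS') hrz' hz0 hr0' hTa' hTb' ha' hb'
    rw [hSe', hJ']
    have h1 := side_chain M Sl R A hT₀ hTa (by rw [hr0, hz0]) hTa' (by rw [hr0', hz0]) (by rw [ha, ha'])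
    have h2 := side_chain M Sl R A hT₀ hTb (by rw [hr0, hz0]) hTb' (by rw [hr0', hz0]) (by rw [hb, hb'])
    rw [abs_le] at h1 h2 ⊢
    constructor <;> linarith

end

/-! ### The test function supported near a vertical mesh line -/

/-- The nodes on the line `x = ξ`. -/
def colNodes (𝒯 : Triangulation unitSquare) (ξ : ℝ) : Finset Pt :=
  open Classical in 𝒯.nodes.filter fun z => z 0 = ξ

/-- The vertices of `T` on the line `x = ξ`. -/
def colVerts (ξ : ℝ) (T : Finset Pt) : Finset Pt := open Classical in T.filter fun z => z 0 = ξ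

/-- The interpolant of nodal values on the line `x = ξ`. -/
def colSum (𝒯 : Triangulation unitSquare) (ξ : ℝ) (V : Pt → ℝ) (p : Pt) : ℝ :=
  ∑ z ∈ colNodes 𝒯 ξ, V z * hat 𝒯 z p

/-- The interpolant of the values `V` times a profile of relative width `σ`. -/
def stripTest (𝒯 : Triangulation unitSquare) (ξ : ℝ) (V : Pt → ℝ) (σ : ℝ) : Pt → ℝ :=
  unitSquare.indicator fun p => colSum 𝒯 ξ V p * pE mM σ 1 (1 - colSum 𝒯 ξ (fun _ => 1) p)

/-- The constant in the bound for the residual weights of the strip test function. -/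
def testConst (C K : ℝ) : ℝ := 16 * C ^ 8 * (80000 * K + 24000000)

lemma mem_colVerts {ξ : ℝ} {T : Finset Pt} {z : Pt} : z ∈ colVerts ξ T ↔ z ∈ T ∧ z 0 = ξ := by
  simp [colVerts]

/-- Splits the squared gradient bound into the nodal difference over the short edge, paid for by
`η₁` through the node comparison, and the nodal values over the column width, paid for by `α₁`. The
numbers 80000 and 23040000 are 2 · 200² and 4 · 2400². -/
lemma layer_weight_aux {C K X X₀ s θ ε δ a b m η₁ α₁ N D₀ : ℝ} (hC : 1 ≤ C) (hK : 0 ≤ K) (hX : 0 < X) (hX₀ : 0 < X₀)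
    (hs : 0 < s) (hθ : 0 < θ) (hη : 0 ≤ η₁) (hα : 0 ≤ α₁)
    (hXX : X ≤ C * X₀) (hθ3 : θ ^ 3 * s ≤ C ^ 3 * X ^ 3 * m)
    (h1 : ε ^ 2 * X ^ 3 * m * δ ^ 2 ≤ K * s ^ 2 * η₁) (h2 : ε ^ 2 * θ * s * (a ^ 2 + b ^ 2) ≤ C * α₁)
    (hD : D₀ = (θ / (2 * X₀)) * (4 * 100 * δ * (C / s)) + 24 * 100 * (|a| + |b|) * (C / X₀))
    (hN : N ^ 2 = 16 * C ^ 2 * ε ^ 2 * D₀ ^ 2 * (X * s / 2 / (θ / (2 * X₀)))) :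
    N ^ 2 * θ ^ 2 ≤ testConst C K * (α₁ + η₁) := by
  have hCp : 0 < C := by linarith
  have e1 : D₀ = (C / X₀) * (200 * θ * δ / s + 2400 * (|a| + |b|)) := by rw [hD]; field_simp; ring
  have e2 : (200 * θ * δ / s + 2400 * (|a| + |b|)) ^ 2 ≤
      80000 * (θ ^ 2 * δ ^ 2 / s ^ 2) + 23040000 * (a ^ 2 + b ^ 2) := by
    have f1 := sq_nonneg (200 * θ * δ / s - 2400 * (|a| + |b|))
    have f2 := sq_nonneg (|a| - |b|)
    have f3 : (200 * θ * δ / s) ^ 2 = 40000 * (θ ^ 2 * δ ^ 2 / s ^ 2) := by ring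
    nlinarith [sq_abs a, sq_abs b]
  have e3 : X * s / 2 / (θ / (2 * X₀)) = X * s * X₀ / θ := by field_simp
  have hδ : ε ^ 2 * θ ^ 3 * δ ^ 2 / s ≤ K * C ^ 3 * η₁ := by
    rw [div_le_iff₀ hs]
    have f1 : ε ^ 2 * δ ^ 2 * (θ ^ 3 * s) ≤ ε ^ 2 * δ ^ 2 * (C ^ 3 * X ^ 3 * m) :=
      mul_le_mul_of_nonneg_left hθ3 (by positivity)
    have f2 : C ^ 3 * (ε ^ 2 * X ^ 3 * m * δ ^ 2) ≤ C ^ 3 * (K * s ^ 2 * η₁) :=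
      mul_le_mul_of_nonneg_left h1 (by positivity)
    have f3 : (ε ^ 2 * θ ^ 3 * δ ^ 2) * s ≤ (K * C ^ 3 * η₁ * s) * s := by nlinarith
    exact le_of_mul_le_mul_right f3 hs
  have hC3 : C ≤ C ^ 3 := by nlinarith [mul_self_nonneg (C - 1), sq_nonneg C]
  have hC8 : C ^ 5 * C ^ 3 = C ^ 8 := by ring
  rw [hN, e1, e3]
  calc 16 * C ^ 2 * ε ^ 2 * ((C / X₀) * (200 * θ * δ / s + 2400 * (|a| + |b|))) ^ 2 * (X * s * X₀ / θ) * θ ^ 2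
      = 16 * C ^ 4 * ε ^ 2 * (X * s / X₀ * θ) * (200 * θ * δ / s + 2400 * (|a| + |b|)) ^ 2 := by
        field_simp
    _ ≤ 16 * C ^ 4 * ε ^ 2 * (C * X₀ * s / X₀ * θ) *
        (80000 * (θ ^ 2 * δ ^ 2 / s ^ 2) + 23040000 * (a ^ 2 + b ^ 2)) := by gcongr
    _ = 16 * C ^ 5 * (80000 * (ε ^ 2 * θ ^ 3 * δ ^ 2 / s) + 23040000 * (ε ^ 2 * θ * s * (a ^ 2 + b ^ 2))) := by
        field_simp
    _ ≤ 16 * C ^ 5 * (80000 * (K * C ^ 3 * η₁) + 23040000 * (C * α₁)) := by gcongr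
    _ ≤ 16 * C ^ 5 * (80000 * (K * C ^ 3 * (α₁ + η₁)) + 24000000 * (C ^ 3 * (α₁ + η₁))) := by
        gcongr
        · linarith
        · norm_num
        · linarith
    _ = testConst C K * (α₁ + η₁) := by rw [testConst, ← hC8]; ring

lemma tip_weight_aux {C K X X₀ s θ ε a η₁ α₁ N D₀ : ℝ} (hC : 1 ≤ C) (hK : 0 ≤ K) (hX : 0 < X) (hX₀ : 0 < X₀)
    (hs : 0 < s) (hθ : 0 < θ) (hη : 0 ≤ η₁) (hα : 0 ≤ α₁)
    (hXX : X ≤ C * X₀) (h2 : ε ^ 2 * θ * s * a ^ 2 ≤ C * α₁)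
    (hD : D₀ = 100 * |a| * (C / X₀))
    (hN : N ^ 2 = 16 * C ^ 2 * ε ^ 2 * D₀ ^ 2 * (X * s / 2 / (θ / (2 * X₀)))) :
    N ^ 2 * θ ^ 2 ≤ testConst C K * (α₁ + η₁) := by
  have hCp : 0 < C := by linarith
  have e3 : X * s / 2 / (θ / (2 * X₀)) = X * s * X₀ / θ := by field_simp
  have hC6 : C ^ 6 ≤ C ^ 8 := pow_le_pow_right₀ hC (by norm_num)
  rw [hN, hD, e3]
  calc 16 * C ^ 2 * ε ^ 2 * (100 * |a| * (C / X₀)) ^ 2 * (X * s * X₀ / θ) * θ ^ 2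
      = 160000 * C ^ 4 * ε ^ 2 * (X * s / X₀ * θ) * a ^ 2 := by
        rw [mul_pow, mul_pow, sq_abs]; field_simp; ring
    _ ≤ 160000 * C ^ 4 * ε ^ 2 * (C * X₀ * s / X₀ * θ) * a ^ 2 := by gcongr
    _ = 160000 * C ^ 5 * (ε ^ 2 * θ * s * a ^ 2) := by field_simp
    _ ≤ 160000 * C ^ 5 * (C * α₁) := by gcongr
    _ = 160000 * C ^ 6 * α₁ := by ring
    _ ≤ 16 * 24000000 * C ^ 8 * (α₁ + η₁) := by gcongr <;> linarith
    _ ≤ testConst C K * (α₁ + η₁) := by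
        rw [testConst]
        have : 0 ≤ C ^ 8 * (80000 * K) * (α₁ + η₁) := by positivity
        nlinarith

/-! ### Elementwise form of the strip function -/

section
variable {𝒯 : Triangulation unitSquare} {n : ℕ} {x : ℕ → ℝ} (M : Mesh 𝒯 n x) {ξ : ℝ} {V : Pt → ℝ}

include M in
lemma colSum_eq {T : Finset Pt} (hT : T ∈ 𝒯.elems) {y : Pt} (hy : y ∈ hull T) (V : Pt → ℝ) :
    colSum 𝒯 ξ V y = ∑ z ∈ colVerts ξ T, V z * hat 𝒯 z y := by
  classical
  refine (Finset.sum_subset (fun z hz => ?_) fun z _ hz => ?_).symm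
  · obtain ⟨h1, h2⟩ := mem_colVerts.1 hz
    simp only [colNodes, Finset.mem_filter, Triangulation.nodes, Finset.mem_biUnion, id]
    exact ⟨⟨T, hT, h1⟩, h2⟩
  · by_cases hzT : z ∈ T
    · rename_i h
      simp only [colNodes, Finset.mem_filter] at h
      exact absurd (mem_colVerts.2 ⟨hzT, h.2⟩) hz
    · rw [M.hat_eq_zero hT hy hzT, mul_zero]

/-- A node with nonzero value lies strictly inside the square, and a positive weight at such a
vertex would put `y` into the open square. So the cut-off by the indicator is consistent. -/
lemma val_mul_bc_eq_zero {p q r y : Pt} (hD : cr (q - p) (r - p) ≠ 0) (hT : ({p, q, r} : Finset Pt) ∈ 𝒯.elems)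
    (hy : y ∈ hull {p, q, r}) (hyΩ : y ∉ unitSquare) (hr0 : 0 < r 0) (hr1 : r 0 < 1)
    (hV : ∀ z : Pt, z 1 = 0 ∨ z 1 = 1 → V z = 0) : V r * bc p q r y = 0 := by
  by_contra hne
  have hVr : V r ≠ 0 := left_ne_zero_of_mul hne
  obtain ⟨⟨ha, -⟩, ⟨hb, -⟩, hc, -⟩ := bc_mem_Icc hD hy
  have hc' : 0 < bc p q r y := lt_of_le_of_ne hc (right_ne_zero_of_mul hne).symm
  obtain ⟨⟨a1, a2⟩, a3, a4⟩ := Mesh.vertex_bounds hT (p := p) (by simp)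
  obtain ⟨⟨b1, b2⟩, b3, b4⟩ := Mesh.vertex_bounds hT (p := q) (by simp)
  obtain ⟨-, c3, c4⟩ := Mesh.vertex_bounds hT (p := r) (by simp)
  have c3' : 0 < r 1 := lt_of_le_of_ne c3 fun h => hVr (hV r (Or.inl h.symm))
  have c4' : r 1 < 1 := lt_of_le_of_ne c4 fun h => hVr (hV r (Or.inr h))
  have hs := bc_sum hD y
  have hcb := bc_combo hD y
  set α := bc q r p y
  set β := bc r p q y
  set γ := bc p q r y
  have key : ∀ s t v : ℝ, 0 ≤ s → s ≤ 1 → 0 ≤ t → t ≤ 1 → 0 < v → v < 1 →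
      0 < α * s + β * t + γ * v ∧ α * s + β * t + γ * v < 1 := by
    intro s t v h1 h2 h3 h4 h5 h6
    have e3 : 0 < γ * v := by positivity
    have f1 : 0 ≤ α * (1 - s) := mul_nonneg ha (by linarith)
    have f2 : 0 ≤ β * (1 - t) := mul_nonneg hb (by linarith)
    have f3 : 0 < γ * (1 - v) := mul_pos hc' (by linarith)
    constructor
    · positivity
    · linarith
  have y0 : y 0 = α * p 0 + β * q 0 + γ * r 0 := by
    rw [← hcb]; simp only [PiLp.add_apply, PiLp.smul_apply, smul_eq_mul]
  have y1 : y 1 = α * p 1 + β * q 1 + γ * r 1 := by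
    rw [← hcb]; simp only [PiLp.add_apply, PiLp.smul_apply, smul_eq_mul]
  have k0 := key _ _ _ a1 a2 b1 b2 hr0 hr1
  have k1 := key _ _ _ a3 a4 b3 b4 c3' c4'
  rw [← y0] at k0
  rw [← y1] at k1
  exact hyΩ ⟨k0.1, k0.2, k1.1, k1.2⟩

include M

/-- On an element with an edge on the line, 1 minus the sum of the hat functions of the line is the
weight of the third vertex. -/
lemma stripTest_layer {p q r y : Pt} {σ : ℝ} (hT : ({p, q, r} : Finset Pt) ∈ 𝒯.elems) (hp : p 0 = ξ)
    (hq : q 0 = ξ) (hr : r 0 ≠ ξ) (hξ0 : 0 < ξ) (hξ1 : ξ < 1) (hV : ∀ z : Pt, z 1 = 0 ∨ z 1 = 1 → V z = 0)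
    (hy : y ∈ hull {p, q, r}) : stripTest 𝒯 ξ V σ y = layer mM σ (V p) (V q) p q r y := by
  classical
  have hD := M.cr_ne hT
  have e1 : ({p, q, r} : Finset Pt) = {q, r, p} := by ext; simp; tauto
  have e2 : ({p, q, r} : Finset Pt) = {r, p, q} := by ext; simp; tauto
  by_cases hyΩ : y ∈ unitSquare
  · obtain ⟨hpq, -, -⟩ := Mesh.ne_of_elem hT
    have hcv : colVerts ξ {p, q, r} = {p, q} := by
      ext z
      simp only [mem_colVerts, Finset.mem_insert, Finset.mem_singleton]
      constructor
      · rintro ⟨rfl | rfl | rfl, h⟩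
        exacts [Or.inl rfl, Or.inr rfl, absurd h hr]
      · rintro (rfl | rfl)
        exacts [⟨by simp, hp⟩, ⟨by simp, hq⟩]
    have hs := bc_sum hD y
    rw [stripTest, Set.indicator_of_mem hyΩ, colSum_eq M hT hy, colSum_eq M hT hy, hcv, Finset.sum_pair hpq,
      Finset.sum_pair hpq, M.hat_eq (r := p) (e1 ▸ hT) (e1 ▸ hy), M.hat_eq (r := q) (e2 ▸ hT) (e2 ▸ hy), layer,
      show 1 - (1 * bc q r p y + 1 * bc r p q y) = bc p q r y by linarith]
  · rw [stripTest, Set.indicator_of_notMem hyΩ, layer]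
    have h1 := val_mul_bc_eq_zero (V := V) (cr_rot_ne hD) (e1 ▸ hT) (e1 ▸ hy) hyΩ (by linarith) (by linarith) hV
    have h2 := val_mul_bc_eq_zero (V := V) (cr_rot_ne' hD) (e2 ▸ hT) (e2 ▸ hy) hyΩ (by linarith) (by linarith) hV
    rw [h1, h2]; simp

/-- With a single vertex on the line the interpolant is V(r) λ_r, and the factor λ_r is exactly the
denominator of `pE` at 1 - λ_r; only the bare profile remains. This is why one formula serves both
kinds of elements. -/
lemma stripTest_tip {p q r y : Pt} {σ : ℝ} (hσ0 : 0 < σ) (hσ1 : σ ≤ 1 / 2)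
    (hT : ({p, q, r} : Finset Pt) ∈ 𝒯.elems) (hp : p 0 ≠ ξ)
    (hq : q 0 ≠ ξ) (hr : r 0 = ξ) (hξ0 : 0 < ξ) (hξ1 : ξ < 1) (hV : ∀ z : Pt, z 1 = 0 ∨ z 1 = 1 → V z = 0)
    (hy : y ∈ hull {p, q, r}) : stripTest 𝒯 ξ V σ y = tip mM σ (V r) p q r y := by
  classical
  have hD := M.cr_ne hT
  by_cases hyΩ : y ∈ unitSquare
  · have hcv : colVerts ξ {p, q, r} = {r} := by
      ext z
      simp only [mem_colVerts, Finset.mem_insert, Finset.mem_singleton]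
      constructor
      · rintro ⟨rfl | rfl | rfl, h⟩
        exacts [absurd h hp, absurd h hq, rfl]
      · rintro rfl
        exact ⟨by simp, hr⟩
    have h := pE_mul prof_mM hσ0 hσ1 1 (1 - bc p q r y)
    rw [stripTest, Set.indicator_of_mem hyΩ, colSum_eq M hT hy, colSum_eq M hT hy, hcv, Finset.sum_singleton,
      Finset.sum_singleton, M.hat_eq hT hy, tip, one_mul, ← h]
    ring
  · rw [stripTest, Set.indicator_of_notMem hyΩ, tip]
    rcases mul_eq_zero.1 (val_mul_bc_eq_zero (V := V) hD hT hy hyΩ (by linarith) (by linarith) hV) with h | h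
    · rw [h, zero_mul]
    · rw [h, sub_zero, (prof_mM.zero_of_le hσ0 (by linarith)).1, mul_zero]

lemma stripTest_zero {T : Finset Pt} (hT : T ∈ 𝒯.elems) (h0 : ∀ p ∈ T, p 0 ≠ ξ) {σ : ℝ} {y : Pt}
    (hy : y ∈ hull T) : stripTest 𝒯 ξ V σ y = 0 := by
  classical
  have hcv : colVerts ξ T = ∅ := by
    ext z
    simp only [mem_colVerts, Finset.notMem_empty, iff_false, not_and]
    exact h0 z
  rw [stripTest, Set.indicator_apply, colSum_eq M hT hy V, hcv]
  simp

omit M in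
lemma edgesOn_filter_empty {T : Finset Pt} (h : (colVerts ξ T).card ≤ 1) :
    open Classical in (𝒯.edgesOn ξ).filter (fun S => S ⊆ T) = ∅ := by
  classical
  refine Finset.filter_eq_empty_iff.2 fun S hS hST => ?_
  obtain ⟨⟨-, -, -, hcard⟩, hcol⟩ := mem_edgesOn.1 hS
  have : S ⊆ colVerts ξ T := fun z hz => mem_colVerts.2 ⟨hST hz, hcol z hz⟩
  have := Finset.card_le_card this
  omega

omit M in
lemma edgesOn_filter_pair {p q r : Pt} (hT : ({p, q, r} : Finset Pt) ∈ 𝒯.elems) (hp : p 0 = ξ)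
    (hq : q 0 = ξ) (hr : r 0 ≠ ξ) :
    open Classical in (𝒯.edgesOn ξ).filter (fun S => S ⊆ ({p, q, r} : Finset Pt)) = {{p, q}} := by
  classical
  obtain ⟨hpq, -, -⟩ := Mesh.ne_of_elem hT
  ext S
  simp only [Finset.mem_filter, Finset.mem_singleton, mem_edgesOn]
  constructor
  · rintro ⟨⟨⟨-, -, -, hcard⟩, hcol⟩, hST⟩
    refine Finset.eq_of_subset_of_card_le (fun z hz => ?_) (by rw [hcard, Finset.card_pair hpq])
    have := hST hz
    simp only [Finset.mem_insert, Finset.mem_singleton] at this ⊢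
    rcases this with rfl | rfl | rfl
    exacts [Or.inl rfl, Or.inr rfl, absurd (hcol _ hz) hr]
  · rintro rfl
    have hsub : ({p, q} : Finset Pt) ⊆ {p, q, r} := by intro z; simp; tauto
    refine ⟨⟨⟨_, hT, hsub, Finset.card_pair hpq⟩, ?_⟩, hsub⟩
    intro z hz
    simp only [Finset.mem_insert, Finset.mem_singleton] at hz
    rcases hz with rfl | rfl <;> assumption

/-- The contribution of the element `T` to the residual of the strip test function. -/
def resT (𝒯 : Triangulation unitSquare) (ξ ε : ℝ) (V : Pt → ℝ) (g : Finset Pt → Pt) (T : Finset Pt) : ℝ :=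
  open Classical in ∑ S ∈ (𝒯.edgesOn ξ).filter (fun S => S ⊆ T),
    ε ^ 2 * ((∑ z ∈ S, V z) * (edgeLength S / 2) * (sg ξ T * g T 0))

omit M in
lemma edgeLength_vertical {p q : Pt} (h : p 0 = q 0) : edgeLength {p, q} = |q 1 - p 1| := by
  rw [edgeLength, Finset.coe_insert, Finset.coe_singleton, Metric.diam_pair, dist_eq_norm,
    ← pow_left_inj₀ (norm_nonneg _) (abs_nonneg _) two_ne_zero, norm_sq_eq, sq_abs]
  simp only [PiLp.sub_apply, h]
  ring

/-- The edge on the line is vertical, so the barycentric gradient is horizontal and only the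
x-derivative enters, with the sign of the outward normal. -/
lemma inner_gradient_layer {p q r v : Pt} {a b : ℝ} (hT : ({p, q, r} : Finset Pt) ∈ 𝒯.elems) (hp : p 0 = ξ)
    (hq : q 0 = ξ) (hpq : p 1 < q 1) (hr : r 0 ≠ ξ) :
    ⟪v, (-((a + b) * area {p, q, r})) • gbc p q r⟫_ℝ =
      (a + b) * (edgeLength {p, q} / 2) * (sg ξ {p, q, r} * v 0) := by
  have hD : cr (q - p) (r - p) = -((q 1 - p 1) * (r 0 - ξ)) := by
    simp only [cr, PiLp.sub_apply, hp, hq]; ring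
  have hr' : r 0 - ξ ≠ 0 := sub_ne_zero.2 hr
  have hy : 0 < q 1 - p 1 := by linarith
  rw [edgeLength_vertical (by rw [hp, hq]), abs_of_pos hy, inner_smul_right, inner_eq, area_eq (M.cr_ne hT)]
  simp only [gbc, Matrix.cons_val_zero, Matrix.cons_val_one, Matrix.cons_val_fin_one, hD, abs_neg, abs_mul,
    abs_of_pos hy, PiLp.sub_apply, hp, hq, sub_self, zero_div, mul_zero, add_zero]
  rcases lt_or_gt_of_ne hr with h | h
  · rw [sg_of_lt (p := r) (by simp) h, abs_of_neg (by linarith)]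
    field_simp
  · rw [sg_of_ge, abs_of_pos (by linarith)]
    · field_simp
    · intro z hz
      simp only [Finset.mem_insert, Finset.mem_singleton] at hz
      rcases hz with rfl | rfl | rfl <;> linarith

lemma norm_gbc_vertical {p q r : Pt} (hT : ({p, q, r} : Finset Pt) ∈ 𝒯.elems) (h : p 0 = q 0) :
    ‖gbc p q r‖ = 1 / wd {p, q, r} := by
  obtain ⟨n1, n2⟩ := vertical_ne M hT h.symm
  have hse : se {p, q, r} = |q 1 - p 1| := se_eq h (fun h => n1 (by rw [h]; ring)) (sub_ne_zero.1 n2)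
  have hl := edgeLength_vertical h
  rw [edgeLength, Finset.coe_insert, Finset.coe_singleton, Metric.diam_pair] at hl
  have hs := M.se_pos hT
  have hw := M.wd_pos hT
  rw [norm_gbc, M.abs_cr hT, hl, ← hse]
  field_simp

end

/-- Assumptions on the nodal values `V` on the line `x = ξ`, with majorants `α` (for the values) and `η` (for
their differences). -/
structure ColData (𝒯 : Triangulation unitSquare) (C K ξ ε X₀ : ℝ) (V α η : Pt → ℝ) : Prop where
  pos : 0 < ξ
  lt_one : ξ < 1
  width_pos : 0 < X₀
  eps_pos : 0 < ε
  const_nonneg : 0 ≤ K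
  bdry : ∀ z : Pt, z 1 = 0 ∨ z 1 = 1 → V z = 0
  width : ∀ z : Pt, z 0 = ξ → ∀ T ∈ 𝒯.elemsAt z, wd T ≤ C * X₀ ∧ X₀ ≤ C * wd T
  α_nonneg : ∀ z, 0 ≤ α z
  η_nonneg : ∀ z, 0 ≤ η z
  val : ∀ z : Pt, z 0 = ξ → ∀ T ∈ 𝒯.elemsAt z, ε ^ 2 * min ε X₀ * se T * V z ^ 2 ≤ C * α z
  diff : ∀ p q r : Pt, ({p, q, r} : Finset Pt) ∈ 𝒯.elems → p 0 = ξ → q 0 = ξ →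
    ε ^ 2 * wd {p, q, r} ^ 3 * min ε (se {p, q, r}) * (V q - V p) ^ 2 ≤ K * se {p, q, r} ^ 2 * (η p + η q)

/-- The properties of the strip test function on one element. -/
structure ElemTest (𝒯 : Triangulation unitSquare) (C K ξ ε X₀ : ℝ) (V α η : Pt → ℝ) (g : Finset Pt → Pt)
    (T : Finset Pt) (F : Pt → ℝ) (N : ℝ) : Prop where
  smooth : ContDiff ℝ 1 F
  eq : ∀ y ∈ hull T, stripTest 𝒯 ξ V (min ε X₀ / (2 * X₀)) y = F y
  int : ∫ y in hull T, F y = 0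
  wts : Wts ε T F N
  res : ε ^ 2 * ⟪g T, ∫ y in hull T, gradient F y⟫_ℝ = resT 𝒯 ξ ε V g T
  bound : N ^ 2 * min ε X₀ ^ 2 ≤ testConst C K * ∑ z ∈ colVerts ξ T, (α z + η z)

/-- Translates between the layer thickness min(ε, X₀) of the strip and min(ε, s) of the long edges.
Both X₀ and `s` are at most C X; the two cases are ε ≤ s and s ≤ ε. -/
lemma cube_mul_le {C X X₀ ε s : ℝ} (hX₀ : 0 < X₀) (hε : 0 < ε) (hs : 0 < s)
    (h1 : X₀ ≤ C * X) (h2 : s ≤ C * X) : min ε X₀ ^ 3 * s ≤ C ^ 3 * X ^ 3 * min ε s ∧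
      min ε X₀ * s ^ 3 ≤ C ^ 3 * X ^ 3 * min ε s := by
  have hθ0 : 0 < min ε X₀ := lt_min hε hX₀
  have hθX : min ε X₀ ≤ C * X := (min_le_right _ _).trans h1
  have hθε : min ε X₀ ≤ ε := min_le_left _ _
  have hCX : 0 ≤ C * X := hθ0.le.trans hθX
  rw [← mul_pow]
  rcases le_total ε s with h | h
  · rw [min_eq_left h]
    constructor
    · calc min ε X₀ ^ 3 * s = min ε X₀ ^ 2 * s * min ε X₀ := by ring
        _ ≤ (C * X) ^ 2 * (C * X) * ε := by gcongr
        _ = _ := by ring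
    · calc min ε X₀ * s ^ 3 ≤ ε * (C * X) ^ 3 := by gcongr
        _ = _ := by ring
  · rw [min_eq_right h]
    constructor
    · gcongr
    · calc min ε X₀ * s ^ 3 = min ε X₀ * s ^ 2 * s := by ring
        _ ≤ C * X * (C * X) ^ 2 * s := by gcongr
        _ = _ := by ring

/-! ### Weights of the strip function, element by element -/

section
variable {𝒯 : Triangulation unitSquare} {n : ℕ} {x : ℕ → ℝ} (M : Mesh 𝒯 n x) {C K ξ ε X₀ : ℝ} {V α η : Pt → ℝ}
  (R : Reg 𝒯 C) (D : ColData 𝒯 C K ξ ε X₀ V α η) (g : Finset Pt → Pt)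
include M R D

omit M R in
lemma ColData.sigma : 0 < min ε X₀ / (2 * X₀) ∧ min ε X₀ / (2 * X₀) ≤ 1 / 2 ∧
    min ε X₀ / (2 * X₀) * X₀ ≤ min ε X₀ := by
  have h1 := D.width_pos
  have h2 : 0 < min ε X₀ := lt_min D.eps_pos h1
  have h3 : min ε X₀ ≤ X₀ := min_le_right _ _
  refine ⟨by positivity, ?_, ?_⟩
  · rw [div_le_div_iff₀ (by positivity) (by norm_num)]; linarith
  · rw [div_mul_eq_mul_div, div_le_iff₀ (by positivity)]; nlinarith

omit R D in
lemma sq_weight {T : Finset Pt} (hT : T ∈ 𝒯.elems) (D₀ σ : ℝ) (hσ : 0 < σ) :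
    (4 * C * (ε * D₀ * √(area T / σ))) ^ 2 = 16 * C ^ 2 * ε ^ 2 * D₀ ^ 2 * (wd T * se T / 2 / σ) := by
  have ha : 0 ≤ area T := measureReal_nonneg
  rw [mul_pow, mul_pow, mul_pow, mul_pow, Real.sq_sqrt (by positivity), M.area_eq_wd_se hT]
  ring

lemma elemTest_layer {p q r : Pt} (hT : ({p, q, r} : Finset Pt) ∈ 𝒯.elems) (hp : p 0 = ξ) (hq : q 0 = ξ)
    (hpq : p 1 < q 1) (hr : r 0 ≠ ξ) : ∃ F N, ElemTest 𝒯 C K ξ ε X₀ V α η g {p, q, r} F N := by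
  classical
  obtain ⟨hσ0, hσ1, hσX⟩ := D.sigma
  have hC := R.one_le
  have hD := M.cr_ne hT
  have hε := D.eps_pos
  have hX₀ := D.width_pos
  have hX := M.wd_pos hT
  have hs := M.se_pos hT
  have hzp : ({p, q, r} : Finset Pt) ∈ 𝒯.elemsAt p := Mesh.mem_elemsAt.2 ⟨hT, by simp⟩
  have hzq : ({p, q, r} : Finset Pt) ∈ 𝒯.elemsAt q := Mesh.mem_elemsAt.2 ⟨hT, by simp⟩
  obtain ⟨w1, w2⟩ := D.width p hp _ hzp
  obtain ⟨hne, -, -⟩ := Mesh.ne_of_elem hT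
  have hcv : colVerts ξ {p, q, r} = {p, q} := by
    ext z
    simp only [mem_colVerts, Finset.mem_insert, Finset.mem_singleton]
    constructor
    · rintro ⟨rfl | rfl | rfl, h⟩
      exacts [Or.inl rfl, Or.inr rfl, absurd h hr]
    · rintro (rfl | rfl)
      exacts [⟨by simp, hp⟩, ⟨by simp, hq⟩]
  set σ := min ε X₀ / (2 * X₀) with hσ
  -- `D₀` is σ times the gradient bound of `layer_bds`: the difference of the nodal values acts
  -- along the layer without a factor 1/σ and is therefore multiplied by σ here.
  set D₀ := σ * (4 * 100 * |V q - V p| * (C / se {p, q, r})) + 24 * 100 * (|V p| + |V q|) * (C / X₀) with hD₀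
  have hΓ : ‖gbc r p q‖ ≤ C / se {p, q, r} := by
    have e : ({p, q, r} : Finset Pt) = {r, p, q} := by ext; simp; tauto
    rw [e]; exact M.norm_gbc_le R (e ▸ hT)
  have hY : ‖gbc p q r‖ ≤ C / X₀ := by
    rw [norm_gbc_vertical M hT (by rw [hp, hq]), div_le_div_iff₀ hX hX₀]; linarith
  have hB := layer_bds hD prof_mM hσ0 hσ1 (a := V p) (b := V q) le_rfl hΓ hY
  have hB' : Bds {p, q, r} (layer mM σ (V p) (V q) p q r) (4 * 100 * (|V p| + |V q|)) (D₀ / σ)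
      (4 * σ * area {p, q, r}) := by
    convert hB using 1
    rw [hD₀]; field_simp
  have hW := hB'.weights (ε := ε) (ℓ := X₀) (K := C) hσ0 (by linarith) hX₀ hε hσX (by positivity) ?_ hC
    (min_le_mul_lam hε hC (w2.trans (mul_le_mul_of_nonneg_left (M.wd_le_maxEdge hT) (by linarith))))
  rotate_left
  · have e1 : 24 * 100 * (|V p| + |V q|) * (C / X₀) * X₀ = 2400 * C * (|V p| + |V q|) := by field_simp; ring
    have e2 : 0 ≤ σ * (4 * 100 * |V q - V p| * (C / se {p, q, r})) * X₀ := by positivity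
    have e3 : 0 ≤ |V p| + |V q| := by positivity
    rw [hD₀, add_mul, e1]
    nlinarith
  refine ⟨_, _, contDiff_layer prof_mM hσ0 hσ1 (V p) (V q),
    fun y hy => stripTest_layer M hT hp hq hr D.pos D.lt_one D.bdry hy,
    integral_layer hD prof_mM hσ0 hσ1 (fun τ h0 h1 => int_mM_mul h0 h1) _ _, hW, ?_, ?_⟩
  · rw [integral_gradient_layer hD prof_mM hσ0 hσ1, inner_gradient_layer M hT hp hq hpq hr, resT,
      edgesOn_filter_pair hT hp hq hr, Finset.sum_singleton, Finset.sum_pair hne]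
  · rw [hcv, Finset.sum_pair hne]
    have hv1 := D.val p hp _ hzp
    have hv2 := D.val q hq _ hzq
    have hd := D.diff p q r hT hp hq
    rw [← sq_abs (V q - V p)] at hd
    have key := layer_weight_aux (C := C) (K := K) (X₀ := X₀) (θ := min ε X₀) (ε := ε) (δ := |V q - V p|) (a := V p)
      (b := V q) (m := min ε (se {p, q, r})) (η₁ := η p + η q) (α₁ := α p + α q) hC D.const_nonneg hX hX₀ hs
      (lt_min hε hX₀) (add_nonneg (D.η_nonneg _) (D.η_nonneg _)) (add_nonneg (D.α_nonneg _) (D.α_nonneg _)) w1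
      (cube_mul_le hX₀ hε hs w2 (R.se_le_wd _ hT)).1 hd (by linarith) hD₀ (sq_weight M hT D₀ σ hσ0)
    refine key.trans (le_of_eq ?_)
    ring

lemma elemTest_tip {p q r : Pt} (hT : ({p, q, r} : Finset Pt) ∈ 𝒯.elems) (hpq : p 0 = q 0) (hp : p 0 ≠ ξ)
    (hr : r 0 = ξ) : ∃ F N, ElemTest 𝒯 C K ξ ε X₀ V α η g {p, q, r} F N := by
  classical
  obtain ⟨hσ0, hσ1, hσX⟩ := D.sigma
  have hC := R.one_le
  have hD := M.cr_ne hT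
  have hε := D.eps_pos
  have hX₀ := D.width_pos
  have hX := M.wd_pos hT
  have hs := M.se_pos hT
  have hzr : ({p, q, r} : Finset Pt) ∈ 𝒯.elemsAt r := Mesh.mem_elemsAt.2 ⟨hT, by simp⟩
  obtain ⟨w1, w2⟩ := D.width r hr _ hzr
  have hq : q 0 ≠ ξ := hpq ▸ hp
  have hcv : colVerts ξ {p, q, r} = {r} := by
    ext z
    simp only [mem_colVerts, Finset.mem_insert, Finset.mem_singleton]
    constructor
    · rintro ⟨rfl | rfl | rfl, h⟩
      exacts [absurd h hp, absurd h hq, rfl]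
    · rintro rfl
      exact ⟨by simp, hr⟩
  set σ := min ε X₀ / (2 * X₀) with hσ
  set D₀ := 100 * |V r| * (C / X₀) with hD₀
  have hY : ‖gbc p q r‖ ≤ C / X₀ := by
    rw [norm_gbc_vertical M hT hpq, div_le_div_iff₀ hX hX₀]; linarith
  have hB : Bds {p, q, r} (tip mM σ (V r) p q r) (100 * |V r|) (D₀ / σ) (4 * σ * area {p, q, r}) :=
    tip_bds hD prof_mM hσ0 (a := V r) hY
  have hW := hB.weights (ε := ε) (ℓ := X₀) (K := C) hσ0 (by linarith) hX₀ hε hσX (by positivity) ?_ hC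
    (min_le_mul_lam hε hC (w2.trans (mul_le_mul_of_nonneg_left (M.wd_le_maxEdge hT) (by linarith))))
  rotate_left
  · have e1 : 100 * |V r| * (C / X₀) * X₀ = 100 * C * |V r| := by field_simp
    rw [hD₀, e1]
    nlinarith [abs_nonneg (V r)]
  refine ⟨_, _, contDiff_tip prof_mM (V r),
    fun y hy => stripTest_tip M hσ0 hσ1 hT hp hq hr D.pos D.lt_one D.bdry hy,
    integral_tip hD prof_mM hσ0 (by linarith) (fun τ h0 h1 => int_mM_mul h0 h1) _, hW, ?_, ?_⟩
  · rw [integral_gradient_tip hD prof_mM hσ0 (by linarith), resT, edgesOn_filter_empty (by rw [hcv]; simp)]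
    simp
  · rw [hcv, Finset.sum_singleton]
    exact tip_weight_aux hC D.const_nonneg hX hX₀ hs (lt_min hε hX₀) (D.η_nonneg _) (D.α_nonneg _) w1
      (D.val r hr _ hzr) hD₀ (sq_weight M hT D₀ σ hσ0)

lemma exists_elemTest {T : Finset Pt} (hT : T ∈ 𝒯.elems) : ∃ F N, ElemTest 𝒯 C K ξ ε X₀ V α η g T F N := by
  classical
  obtain ⟨p, q, r, rfl, hpq, hrp, hlt, -⟩ := M.elem' hT
  by_cases hp : p 0 = ξ
  · exact elemTest_layer M R D g hT hp (by rw [← hpq, hp]) hlt (by rwa [hp] at hrp)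
  by_cases hr : r 0 = ξ
  · exact elemTest_tip M R D g hT hpq hp hr
  have h0 : ∀ z ∈ ({p, q, r} : Finset Pt), z 0 ≠ ξ := by
    intro z hz
    simp only [Finset.mem_insert, Finset.mem_singleton] at hz
    rcases hz with rfl | rfl | rfl
    exacts [hp, hpq ▸ hp, hr]
  have hcv : colVerts ξ {p, q, r} = ∅ := by
    ext z
    simp only [mem_colVerts, Finset.notMem_empty, iff_false, not_and]
    exact h0 z
  refine ⟨fun _ => 0, 0, contDiff_const, fun y hy => stripTest_zero M hT h0 hy, by simp, Wts.zero _ _, ?_, ?_⟩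
  · rw [resT, edgesOn_filter_empty (by rw [hcv]; simp)]
    simp
  · rw [hcv]; simp

end

/-! ### Summation over a vertical mesh line -/

section
variable {𝒯 : Triangulation unitSquare} {n : ℕ} {x : ℕ → ℝ} (M : Mesh 𝒯 n x) {ξ : ℝ}

lemma sum_colNodes (φ : Pt → Finset Pt → ℝ) :
    ∑ z ∈ colNodes 𝒯 ξ, ∑ T ∈ 𝒯.elemsAt z, φ z T = ∑ T ∈ 𝒯.elems, ∑ z ∈ colVerts ξ T, φ z T := by
  classical
  refine Finset.sum_comm' fun z T => ?_
  simp only [colNodes, Finset.mem_filter, Triangulation.nodes, Finset.mem_biUnion, id, Mesh.mem_elemsAt,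
    mem_colVerts]
  exact ⟨fun ⟨⟨_, h⟩, h1, h2⟩ => ⟨⟨h2, h⟩, h1⟩, fun ⟨⟨h2, h⟩, h1⟩ => ⟨⟨⟨T, h1, h2⟩, h⟩, h1, h2⟩⟩

include M in
lemma colVerts_eq_of_edge {S T : Finset Pt} (hT : T ∈ 𝒯.elems) (hS : S ∈ 𝒯.edgesOn ξ) (hST : S ⊆ T) :
    colVerts ξ T = S := by
  classical
  obtain ⟨⟨-, -, -, hcard⟩, hcol⟩ := mem_edgesOn.1 hS
  refine (Finset.eq_of_subset_of_card_le (fun z hz => mem_colVerts.2 ⟨hST hz, hcol z hz⟩) ?_).symm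
  rw [hcard]
  by_contra! h
  have h3 : colVerts ξ T = T := by
    refine Finset.eq_of_subset_of_card_le (fun z hz => (mem_colVerts.1 hz).1) ?_
    rw [𝒯.card_eq T hT]; omega
  obtain ⟨z₁, z₂, a, rfl, h12, ha, -⟩ := M.elem' hT
  have m1 := (mem_colVerts.1 (h3.symm ▸ (by simp : z₁ ∈ ({z₁, z₂, a} : Finset Pt)))).2
  have m2 := (mem_colVerts.1 (h3.symm ▸ (by simp : a ∈ ({z₁, z₂, a} : Finset Pt)))).2
  exact ha (m2.trans m1.symm)

include M in
-- An edge on the line is recovered from any element containing it as the set of its vertices on the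
-- line, so there are no more such edges at `z` than elements.
lemma card_edges_at_le {C : ℝ} (R : Reg 𝒯 C) (z : Pt) :
    open Classical in (((𝒯.edgesOn ξ).filter fun S => z ∈ S).card : ℝ) ≤ C := by
  classical
  refine le_trans ?_ (R.card_le z)
  have : (𝒯.edgesOn ξ).filter (fun S => z ∈ S) ⊆ (𝒯.elemsAt z).image (colVerts ξ) := by
    intro S hS
    obtain ⟨hS, hz⟩ := Finset.mem_filter.1 hS
    obtain ⟨⟨T, hT, hST, -⟩, -⟩ := mem_edgesOn.1 hS
    exact Finset.mem_image.2 ⟨T, Mesh.mem_elemsAt.2 ⟨hT, hST hz⟩, colVerts_eq_of_edge M hT hS hST⟩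
  exact_mod_cast (Finset.card_le_card this).trans Finset.card_image_le

/-- Double sums over edges on a vertical line and their endpoints. -/
lemma sum_edgesOn (φ : Pt → Finset Pt → ℝ) :
    open Classical in ∑ S ∈ 𝒯.edgesOn ξ, ∑ z ∈ S, φ z S =
      ∑ z ∈ colNodes 𝒯 ξ, ∑ S ∈ (𝒯.edgesOn ξ).filter (fun S => z ∈ S), φ z S := by
  classical
  refine Finset.sum_comm' fun S z => ?_
  simp only [colNodes, Finset.mem_filter, Triangulation.nodes, Finset.mem_biUnion, id]
  constructor
  · rintro ⟨hS, hz⟩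
    obtain ⟨⟨T, hT, hST, -⟩, hcol⟩ := mem_edgesOn.1 hS
    exact ⟨⟨hS, hz⟩, ⟨T, hT, hST hz⟩, hcol z hz⟩
  · rintro ⟨h, -⟩; exact h

lemma sum_resT {uh : Pt → ℝ} {g : Finset Pt → Pt} (M : Mesh 𝒯 n x) (A : PA 𝒯 uh g) (ε : ℝ) (V : Pt → ℝ) :
    ∑ T ∈ 𝒯.elems, resT 𝒯 ξ ε V g T =
      ∑ S ∈ 𝒯.edgesOn ξ, ε ^ 2 * ((∑ z ∈ S, V z) * (edgeLength S / 2) * 𝒯.jump uh S) := by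
  classical
  unfold resT
  rw [Finset.sum_comm' (t' := 𝒯.edgesOn ξ) (s' := fun S => 𝒯.elemsAtEdge S)]
  · refine Finset.sum_congr rfl fun S hS => ?_
    rw [jump_eq_sum M A hS, ← Finset.mul_sum, ← Finset.mul_sum]
  · intro T S
    simp only [Triangulation.elemsAtEdge, Finset.mem_filter]
    tauto

variable {i : ℕ} (hi : 0 < i) (hin : i < n)
include M hi hin

lemma wd_col {z : Pt} {T : Finset Pt} (hz : z 0 = x i) (hT : T ∈ 𝒯.elemsAt z) :
    wd T = x i - x (i - 1) ∨ wd T = x (i + 1) - x i := by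
  obtain ⟨hT, hzT⟩ := Mesh.mem_elemsAt.1 hT
  obtain ⟨c1, c2⟩ := M.lt_cols hi hin
  obtain ⟨z₁, z₂, a, k, m, rfl, hk, hm, hkm, h1, h2, ha, -⟩ := M.elem _ hT
  rw [wd_eq (by rw [h1, h2]), ha, h1]
  have key : k = i ∨ m = i := by
    simp only [Finset.mem_insert, Finset.mem_singleton] at hzT
    rcases hzT with rfl | rfl | rfl
    · exact Or.inl (M.injOn hk hin.le (h1.symm.trans hz))
    · exact Or.inl (M.injOn hk hin.le (h2.symm.trans hz))
    · exact Or.inr (M.injOn hm hin.le (ha.symm.trans hz))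
  rcases key with rfl | rfl
  · rcases hkm with rfl | rfl
    · right; rw [abs_of_pos (by linarith)]
    · left; rw [Nat.add_sub_cancel] at c1 ⊢; rw [abs_of_neg (by linarith)]; ring
  · rcases hkm with rfl | rfl
    · left; rw [Nat.add_sub_cancel] at c1 ⊢; rw [abs_of_pos (by linarith)]
    · right; rw [abs_of_neg (by linarith)]; ring

/-- An element with a vertex on x = x_i has all its vertices between the neighbouring lines. Each
vertex is a limit of points on the segment to (x_i, 1/2), which lie in the open strip. -/
lemma colVerts_eq_empty {T : Finset Pt} (hT : T ∈ 𝒯.elems) (hs : T ∉ 𝒯.elemsIn (strip x i)) :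
    colVerts (x i) T = ∅ := by
  rw [Finset.eq_empty_iff_forall_notMem]
  intro z hz
  obtain ⟨hzT, hz0⟩ := mem_colVerts.1 hz
  refine hs (mem_elemsIn.2 ⟨hT, convexHull_min (fun p hp => ?_) (convex_vstrip _ _).closure⟩)
  obtain ⟨c1, c2⟩ := M.lt_cols hi hin
  have hp0 : x (i - 1) ≤ p 0 ∧ p 0 ≤ x (i + 1) := by
    obtain ⟨z₁, z₂, a, k, m, rfl, hk, hm, hkm, h1, h2, ha, -⟩ := M.elem _ hT
    have key : k = i ∨ m = i := by
      simp only [Finset.mem_insert, Finset.mem_singleton] at hzT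
      rcases hzT with rfl | rfl | rfl
      · exact Or.inl (M.injOn hk hin.le (h1.symm.trans hz0))
      · exact Or.inl (M.injOn hk hin.le (h2.symm.trans hz0))
      · exact Or.inr (M.injOn hm hin.le (ha.symm.trans hz0))
    have h : ∃ j, (j = i - 1 ∨ j = i ∨ j = i + 1) ∧ p 0 = x j := by
      simp only [Finset.coe_insert, Finset.coe_singleton, Set.mem_insert_iff, Set.mem_singleton_iff] at hp
      rcases hp with rfl | rfl | rfl
      exacts [⟨k, by omega, h1⟩, ⟨k, by omega, h2⟩, ⟨m, by omega, ha⟩]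
    obtain ⟨j, rfl | rfl | rfl, h⟩ := h <;> rw [h] <;> constructor <;> linarith
  obtain ⟨-, hp1, hp2⟩ := Mesh.vertex_bounds hT hp
  refine closure_mono (fun y hy => ?_)
    (segment_subset_closure_openSegment (𝕜 := ℝ) (left_mem_segment ℝ p (WithLp.toLp 2 ![x i, 1 / 2])))
  obtain ⟨s, t, hs0, ht0, hst, rfl⟩ := hy
  have hs1 : s = 1 - t := by linarith
  subst hs1
  refine ⟨?_, ?_, ?_, ?_⟩ <;> simp only [PiLp.add_apply, PiLp.smul_apply, smul_eq_mul, Matrix.cons_val_zero,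
    Matrix.cons_val_one, Matrix.cons_val_fin_one]
  · nlinarith [mul_nonneg hs0.le (sub_nonneg.2 hp0.1), mul_pos ht0 (sub_pos.2 c1)]
  · nlinarith [mul_nonneg hs0.le (sub_nonneg.2 hp0.2), mul_pos ht0 (sub_pos.2 c2)]
  · nlinarith [mul_nonneg hs0.le hp1]
  · nlinarith [mul_nonneg hs0.le (sub_nonneg.2 hp2)]

lemma edge_data {S : Finset Pt} (hS : S ∈ 𝒯.edgesOn (x i)) {z : Pt} (hz : z ∈ S) :
    ∃ T ∈ 𝒯.elemsAt z, ∃ T' ∈ 𝒯.elemsAt z, se T = edgeLength S ∧ se T' = edgeLength S ∧ wd T = x i - x (i - 1) ∧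
      wd T' = x (i + 1) - x i ∧ 𝒯.elemsAtEdge S = {T, T'} ∧ T ≠ T' := by
  obtain ⟨r, a, b, rfl, hrz, hz0, hr0, hTa, hTb, ha, hb⟩ := edge_at M hi hin hS hz
  obtain ⟨c1, c2⟩ := M.lt_cols hi hin
  have h0 : z 0 = r 0 := by rw [hz0, hr0]
  have hy : z 1 ≠ r 1 := fun h => hrz (pt_ext h0 h).symm
  have hab : ({z, r, a} : Finset Pt) ≠ {z, r, b} := by
    intro h
    have hm : a ∈ ({z, r, b} : Finset Pt) := by rw [← h]; simp
    simp only [Finset.mem_insert, Finset.mem_singleton] at hm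
    rcases hm with rfl | rfl | rfl <;> linarith
  refine ⟨_, Mesh.mem_elemsAt.2 ⟨hTa, by simp⟩, _, Mesh.mem_elemsAt.2 ⟨hTb, by simp⟩, ?_, ?_, ?_, ?_,
    elemsAtEdge_eq M h0.symm hrz hTa hTb (by linarith) (by linarith), hab⟩
  · rw [se_eq h0 hy (by linarith), edgeLength_vertical h0]
  · rw [se_eq h0 hy (by linarith), edgeLength_vertical h0]
  · rw [wd_eq h0, ha, hz0, abs_of_neg (by linarith)]; ring
  · rw [wd_eq h0, hb, hz0, abs_of_pos (by linarith)]

lemma col_width {C : ℝ} (R : Reg 𝒯 C) (hne : (𝒯.edgesOn (x i)).Nonempty) :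
    x (i + 1) - x i ≤ C * (x i - x (i - 1)) ∧ x i - x (i - 1) ≤ C * (x (i + 1) - x i) := by
  obtain ⟨S, hS⟩ := hne
  obtain ⟨⟨-, -, -, hcard⟩, -⟩ := mem_edgesOn.1 hS
  obtain ⟨z, hz⟩ := Finset.card_pos.1 (by rw [hcard]; norm_num : 0 < S.card)
  obtain ⟨T, hT, T', hT', -, -, e1, e2, -⟩ := edge_data M hi hin hS hz
  rw [← e1, ← e2]
  exact ⟨R.wd_le z _ hT' _ hT, R.wd_le z _ hT _ hT'⟩

/-- The weighted square of the jump on `S`. -/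
def edgeSq (𝒯 : Triangulation unitSquare) (ε X₀ : ℝ) (uh : Pt → ℝ) (S : Finset Pt) : ℝ :=
  ε ^ 2 * min ε X₀ * edgeLength S * 𝒯.jump uh S ^ 2

/-- The sum of the weighted squares of the jumps on the edges at `z` on the line `x = ξ`. -/
def edgeSqAt (𝒯 : Triangulation unitSquare) (ξ ε X₀ : ℝ) (uh : Pt → ℝ) (z : Pt) : ℝ :=
  open Classical in ∑ S ∈ (𝒯.edgesOn ξ).filter (fun S => z ∈ S), edgeSq 𝒯 ε X₀ uh S

omit M hi hin in
lemma edgeSq_nonneg {ε X₀ : ℝ} (hε : 0 < ε) (hX₀ : 0 < X₀) {uh : Pt → ℝ} {S : Finset Pt} :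
    0 ≤ edgeSq 𝒯 ε X₀ uh S := by
  have h1 : 0 < min ε X₀ := lt_min hε hX₀
  have h2 : 0 ≤ edgeLength S := Metric.diam_nonneg
  unfold edgeSq; positivity

variable {ε Cf L C : ℝ} {f : Pt → ℝ → ℝ} {u : Pt → ℝ} {gu : Pt → Pt} {uh : Pt → ℝ}
  (Sl : Sol 𝒯 ε Cf L f u gu uh) (R : Reg 𝒯 C) {g : Finset Pt → Pt} (A : PA 𝒯 uh g)
include Sl R

include A in
-- The value at a node is the jump on one of its edges, hence controlled by `edgeSqAt`. Values at
-- the two ends of an edge are compared through the jump on that edge, which gives the factor 2 in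
-- the constant.
lemma colData (hne : (𝒯.edgesOn (x i)).Nonempty) : ColData 𝒯 C (2 * nodeConst C L) (x i) ε (x i - x (i - 1))
    (nodeVal 𝒯 (x i) (𝒯.jump uh)) (edgeSqAt 𝒯 (x i) ε (x i - x (i - 1)) uh) (errN 𝒯 ε f u gu uh) := by
  classical
  obtain ⟨c1, c2⟩ := M.lt_cols hi hin
  obtain ⟨w1, w2⟩ := col_width M hi hin R hne
  have hC := R.one_le
  have hε := Sl.pos
  have hX₀ : 0 < x i - x (i - 1) := by linarith
  have hL : 0 ≤ L := Sl.adm.nonneg.trans Sl.adm.lip_nonneg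
  have hα : ∀ z, 0 ≤ edgeSqAt 𝒯 (x i) ε (x i - x (i - 1)) uh z := fun z =>
    Finset.sum_nonneg fun _ _ => edgeSq_nonneg hε hX₀
  have hθ : 0 < min ε (x i - x (i - 1)) := lt_min hε hX₀
  refine ⟨M.x_pos hi hin, M.x_lt_one hin, hX₀, hε, ?_, fun z hz => ?_, fun z hz T hT => ?_, hα, fun z => errN_nonneg,
    fun z hz T hT => ?_, fun p q r hT hp hq => ?_⟩
  · unfold nodeConst longConst; positivity
  · rw [nodeVal, if_pos hz]
  · rcases wd_col M hi hin hz hT with h | h <;> rw [h]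
    · constructor <;> nlinarith
    · exact ⟨w1, w2⟩
  · have hs := M.se_pos (Mesh.mem_elemsAt.1 hT).1
    unfold nodeVal
    split_ifs with h1 h2
    · have := hα z; simp; positivity
    · obtain ⟨hS, hzS⟩ := h2.choose_spec
      set S := h2.choose
      obtain ⟨T', hT', -, -, e, -⟩ := edge_data M hi hin hS hzS
      have h3 : edgeSq 𝒯 ε (x i - x (i - 1)) uh S ≤ edgeSqAt 𝒯 (x i) ε (x i - x (i - 1)) uh z :=
        Finset.single_le_sum (f := edgeSq 𝒯 ε (x i - x (i - 1)) uh) (fun _ _ => edgeSq_nonneg hε hX₀)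
          (Finset.mem_filter.2 ⟨hS, hzS⟩)
      have h4 := R.se_le z _ hT _ hT'
      rw [e] at h4
      calc ε ^ 2 * min ε (x i - x (i - 1)) * se T * 𝒯.jump uh S ^ 2
          ≤ ε ^ 2 * min ε (x i - x (i - 1)) * (C * edgeLength S) * 𝒯.jump uh S ^ 2 := by gcongr
        _ = C * edgeSq 𝒯 ε (x i - x (i - 1)) uh S := by rw [edgeSq]; ring
        _ ≤ _ := by gcongr
    · have := hα z; simp; positivity
  · have hpq := (Mesh.ne_of_elem hT).1
    have hS : ({p, q} : Finset Pt) ∈ 𝒯.edgesOn (x i) := by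
      refine mem_edgesOn.2 ⟨⟨_, hT, by intro z; simp; tauto, Finset.card_pair hpq⟩, ?_⟩
      intro z hz
      simp only [Finset.mem_insert, Finset.mem_singleton] at hz
      rcases hz with rfl | rfl <;> assumption
    have h1 := jump_sub_nodeVal M hi hin Sl R A hS (z := p) (by simp) (Mesh.mem_elemsAt.2 ⟨hT, by simp⟩)
    have h2 := jump_sub_nodeVal M hi hin Sl R A hS (z := q) (by simp) (Mesh.mem_elemsAt.2 ⟨hT, by simp⟩)
    set Vp := nodeVal 𝒯 (x i) (𝒯.jump uh) p
    set Vq := nodeVal 𝒯 (x i) (𝒯.jump uh) q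
    set J := 𝒯.jump uh {p, q}
    have hs := M.se_pos hT
    have hX := M.wd_pos hT
    have hm : 0 < min ε (se {p, q, r}) := lt_min hε hs
    have h3 : (Vq - Vp) ^ 2 ≤ 2 * ((J - Vp) ^ 2 + (J - Vq) ^ 2) := by nlinarith [sq_nonneg (J - Vp + (J - Vq))]
    calc _ ≤ ε ^ 2 * wd {p, q, r} ^ 3 * min ε (se {p, q, r}) * (2 * ((J - Vp) ^ 2 + (J - Vq) ^ 2)) := by gcongr
      _ ≤ _ := by linarith

omit R Sl in
lemma sum_errN_le : ∑ z ∈ colNodes 𝒯 (x i), errN 𝒯 ε f u gu uh z ≤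
    3 * ∑ T ∈ 𝒯.elemsIn (strip x i), errT ε f u gu uh T := by
  classical
  unfold errN
  rw [sum_colNodes fun _ T => errT ε f u gu uh T, Finset.mul_sum]
  rw [← Finset.sum_subset (s₁ := 𝒯.elemsIn (strip x i)) fun T hT => (mem_elemsIn.1 hT).1]
  · refine Finset.sum_le_sum fun T hT => ?_
    rw [Finset.sum_const, nsmul_eq_mul]
    refine mul_le_mul_of_nonneg_right ?_ errT_nonneg
    have h : (colVerts (x i) T).card ≤ T.card := Finset.card_le_card fun z hz => (mem_colVerts.1 hz).1
    rw [𝒯.card_eq T (mem_elemsIn.1 hT).1] at h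
    exact_mod_cast h
  · intro T hT hs
    rw [colVerts_eq_empty M hi hin hT hs, Finset.sum_empty]

include A in
-- The node comparison is weighted with wd³ · min(ε, se)/se² and the sum with min(ε, X₀) · se; the
-- second half of `cube_mul_le` converts one into the other. Then each node is counted at most C
-- times.
lemma sum_deviation_le (hne : (𝒯.edgesOn (x i)).Nonempty) :
    ∑ S ∈ 𝒯.edgesOn (x i), ∑ z ∈ S, ε ^ 2 * min ε (x i - x (i - 1)) * edgeLength S *
        (𝒯.jump uh S - nodeVal 𝒯 (x i) (𝒯.jump uh) z) ^ 2 ≤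
      nodeConst C L * C ^ 3 * (C * (3 * ∑ T ∈ 𝒯.elemsIn (strip x i), errT ε f u gu uh T)) := by
  classical
  obtain ⟨c1, c2⟩ := M.lt_cols hi hin
  obtain ⟨w1, w2⟩ := col_width M hi hin R hne
  have hC := R.one_le
  have hε := Sl.pos
  have hX₀ : 0 < x i - x (i - 1) := by linarith
  have hL : 0 ≤ L := Sl.adm.nonneg.trans Sl.adm.lip_nonneg
  have hN : 0 ≤ nodeConst C L := by unfold nodeConst longConst; positivity
  have h1 : ∀ S ∈ 𝒯.edgesOn (x i), ∀ z ∈ S, ε ^ 2 * min ε (x i - x (i - 1)) * edgeLength S *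
        (𝒯.jump uh S - nodeVal 𝒯 (x i) (𝒯.jump uh) z) ^ 2 ≤ nodeConst C L * C ^ 3 * errN 𝒯 ε f u gu uh z := by
    intro S hS z hz
    obtain ⟨T, hT, -, -, e, -, ew, -⟩ := edge_data M hi hin hS hz
    have hTe := (Mesh.mem_elemsAt.1 hT).1
    have h := jump_sub_nodeVal M hi hin Sl R A hS hz hT
    have hs := M.se_pos hTe
    have hc := (cube_mul_le (C := C) (X := wd T) hX₀ hε hs (by rw [ew]; nlinarith) (R.se_le_wd _ hTe)).2
    rw [← e]
    set D := (𝒯.jump uh S - nodeVal 𝒯 (x i) (𝒯.jump uh) z) ^ 2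
    have hD : 0 ≤ D := sq_nonneg _
    refine le_of_mul_le_mul_right ?_ (pow_pos hs 2)
    calc ε ^ 2 * min ε (x i - x (i - 1)) * se T * D * se T ^ 2
        = ε ^ 2 * D * (min ε (x i - x (i - 1)) * se T ^ 3) := by ring
      _ ≤ ε ^ 2 * D * (C ^ 3 * wd T ^ 3 * min ε (se T)) := by gcongr
      _ = C ^ 3 * (ε ^ 2 * wd T ^ 3 * min ε (se T) * D) := by ring
      _ ≤ C ^ 3 * (nodeConst C L * se T ^ 2 * errN 𝒯 ε f u gu uh z) := by gcongr
      _ = _ := by ring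
  calc _ ≤ ∑ S ∈ 𝒯.edgesOn (x i), ∑ z ∈ S, nodeConst C L * C ^ 3 * errN 𝒯 ε f u gu uh z :=
        Finset.sum_le_sum fun S hS => Finset.sum_le_sum fun z hz => h1 S hS z hz
    _ = nodeConst C L * C ^ 3 * ∑ z ∈ colNodes 𝒯 (x i),
          (((𝒯.edgesOn (x i)).filter fun S => z ∈ S).card : ℝ) * errN 𝒯 ε f u gu uh z := by
        rw [sum_edgesOn fun z _ => nodeConst C L * C ^ 3 * errN 𝒯 ε f u gu uh z, Finset.mul_sum]
        refine Finset.sum_congr rfl fun z _ => ?_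
        rw [Finset.sum_const, nsmul_eq_mul]; ring
    _ ≤ nodeConst C L * C ^ 3 * (C * ∑ z ∈ colNodes 𝒯 (x i), errN 𝒯 ε f u gu uh z) := by
        rw [Finset.mul_sum (colNodes 𝒯 (x i)) _ C]
        refine mul_le_mul_of_nonneg_left (Finset.sum_le_sum fun z _ => ?_) (by positivity)
        exact mul_le_mul_of_nonneg_right (card_edges_at_le M R z) errN_nonneg
    _ ≤ _ := by exact mul_le_mul_of_nonneg_left (mul_le_mul_of_nonneg_left (sum_errN_le M hi hin) (by linarith)) (by positivity)

omit M hi hin Sl R in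
lemma sum_edgeSqAt {X₀ : ℝ} : ∑ z ∈ colNodes 𝒯 ξ, edgeSqAt 𝒯 ξ ε X₀ uh z =
    2 * ∑ S ∈ 𝒯.edgesOn ξ, edgeSq 𝒯 ε X₀ uh S := by
  classical
  unfold edgeSqAt
  rw [← sum_edgesOn fun _ S => edgeSq 𝒯 ε X₀ uh S, Finset.mul_sum]
  refine Finset.sum_congr rfl fun S hS => ?_
  obtain ⟨⟨-, -, -, hcard⟩, -⟩ := mem_edgesOn.1 hS
  rw [Finset.sum_const, hcard]; simp

include A

/-- The weighted jumps are controlled by the local errors in the strip. -/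
lemma sum_edgeSq_le (hne : (𝒯.edgesOn (x i)).Nonempty) :
    ∑ S ∈ 𝒯.edgesOn (x i), edgeSq 𝒯 ε (x i - x (i - 1)) uh S ≤
      (3 * nodeConst C L * C ^ 4 + 8 * ((2 + L) ^ 2 * (testConst C (2 * nodeConst C L) * C)) + 2) *
        ∑ T ∈ 𝒯.elemsIn (strip x i), errT ε f u gu uh T := by
  classical
  have D := colData M hi hin Sl R A hne
  have hdev := sum_deviation_le M hi hin Sl R A hne
  have hA0 : 0 ≤ ∑ S ∈ 𝒯.edgesOn (x i), edgeSq 𝒯 ε (x i - x (i - 1)) uh S :=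
    Finset.sum_nonneg fun _ _ => edgeSq_nonneg Sl.pos D.width_pos
  have hR0 : 0 ≤ ∑ T ∈ 𝒯.elemsIn (strip x i), errT ε f u gu uh T := Finset.sum_nonneg fun _ _ => errT_nonneg
  have hAt := sum_edgeSqAt (𝒯 := 𝒯) (ξ := x i) (ε := ε) (X₀ := x i - x (i - 1)) (uh := uh)
  have hEN := sum_errN_le M hi hin (ε := ε) (f := f) (u := u) (gu := gu) (uh := uh)
  set X₀ := x i - x (i - 1)
  set V := nodeVal 𝒯 (x i) (𝒯.jump uh)
  set α := edgeSqAt 𝒯 (x i) ε X₀ uh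
  set η := errN 𝒯 ε f u gu uh
  set K := 2 * nodeConst C L
  set As := ∑ S ∈ 𝒯.edgesOn (x i), edgeSq 𝒯 ε X₀ uh S with hAs
  set Rs := ∑ T ∈ 𝒯.elemsIn (strip x i), errT ε f u gu uh T
  have hC := R.one_le
  have hε := Sl.pos
  have hL : 0 ≤ L := Sl.adm.nonneg.trans Sl.adm.lip_nonneg
  have hθ : 0 < min ε X₀ := lt_min hε D.width_pos
  have hK : 0 ≤ K := D.const_nonneg
  have hN0 : 0 ≤ nodeConst C L := by simpa [K] using hK
  set θ := min ε X₀ with hθd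
  have hex : ∀ T : Finset Pt, ∃ F N, T ∈ 𝒯.elems → ElemTest 𝒯 C K (x i) ε X₀ V α η g T F N := fun T => by
    by_cases hT : T ∈ 𝒯.elems
    · obtain ⟨F, N, h⟩ := exists_elemTest M R D g hT
      exact ⟨F, N, fun _ => h⟩
    · exact ⟨0, 0, fun h => absurd h hT⟩
  choose F N hFN using hex
  have hpw : PW 𝒯 (stripTest 𝒯 (x i) V (θ / (2 * X₀))) F :=
    ⟨fun p hp => Set.indicator_of_notMem hp _, fun T hT => (hFN T hT).smooth, fun T hT => (hFN T hT).eq⟩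
  have hres := Sl.abs_residual_le M hpw A.gradient (fun T hT => (hFN T hT).int) fun T hT => (hFN T hT).wts
  rw [Finset.sum_congr rfl fun T hT => (hFN T hT).res, sum_resT M A] at hres
  set P := ∑ S ∈ 𝒯.edgesOn (x i), ε ^ 2 * ((∑ z ∈ S, V z) * (edgeLength S / 2) * 𝒯.jump uh S)
  have hW : ∑ T ∈ 𝒯.elems, ∑ z ∈ colVerts (x i) T, (α z + η z) ≤ C * (2 * As + 3 * Rs) := by
    rw [← sum_colNodes fun z _ => α z + η z]
    calc ∑ z ∈ colNodes 𝒯 (x i), ∑ T ∈ 𝒯.elemsAt z, (α z + η z)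
        ≤ ∑ z ∈ colNodes 𝒯 (x i), C * (α z + η z) := by
          refine Finset.sum_le_sum fun z _ => ?_
          rw [Finset.sum_const, nsmul_eq_mul]
          exact mul_le_mul_of_nonneg_right (R.card_le z) (add_nonneg (D.α_nonneg z) (D.η_nonneg z))
      _ = C * (∑ z ∈ colNodes 𝒯 (x i), α z + ∑ z ∈ colNodes 𝒯 (x i), η z) := by
          rw [← Finset.mul_sum, Finset.sum_add_distrib]
      _ ≤ _ := mul_le_mul_of_nonneg_left (by linarith) (by linarith)
  -- Cauchy–Schwarz over the elements of the strip only: elsewhere the bound on the weight is an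
  -- empty sum, so the weight vanishes.
  have hCS : (∑ T ∈ 𝒯.elems, √(errT ε f u gu uh T) * N T) ^ 2 * θ ^ 2 ≤
      Rs * (testConst C K * (C * (2 * As + 3 * Rs))) := by
    have hz : ∀ T ∈ 𝒯.elems, T ∉ 𝒯.elemsIn (strip x i) → N T = 0 := fun T hT hs => by
      have h := (hFN T hT).bound
      rw [colVerts_eq_empty M hi hin hT hs, Finset.sum_empty, mul_zero] at h
      by_contra h0
      have : 0 < N T ^ 2 * θ ^ 2 := by positivity
      linarith
    rw [← Finset.sum_subset (s₁ := 𝒯.elemsIn (strip x i)) (fun T hT => (mem_elemsIn.1 hT).1)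
      fun T hT hs => by rw [hz T hT hs, mul_zero]]
    have ht : 0 ≤ testConst C K := by unfold testConst; positivity
    have hb : (∑ T ∈ 𝒯.elemsIn (strip x i), N T ^ 2) * θ ^ 2 ≤ testConst C K * (C * (2 * As + 3 * Rs)) := by
      rw [Finset.sum_mul]
      calc _ ≤ ∑ T ∈ 𝒯.elemsIn (strip x i), testConst C K * ∑ z ∈ colVerts (x i) T, (α z + η z) :=
            Finset.sum_le_sum fun T hT => (hFN T (mem_elemsIn.1 hT).1).bound
        _ ≤ ∑ T ∈ 𝒯.elems, testConst C K * ∑ z ∈ colVerts (x i) T, (α z + η z) :=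
            Finset.sum_le_sum_of_subset_of_nonneg (fun T hT => (mem_elemsIn.1 hT).1) fun T _ _ =>
              mul_nonneg ht (Finset.sum_nonneg fun z _ => add_nonneg (D.α_nonneg z) (D.η_nonneg z))
        _ ≤ _ := by rw [← Finset.mul_sum]; exact mul_le_mul_of_nonneg_left hW ht
    have h := Finset.sum_mul_sq_le_sq_mul_sq (𝒯.elemsIn (strip x i)) (fun T => √(errT ε f u gu uh T)) N
    rw [Finset.sum_congr rfl fun T _ => Real.sq_sqrt (errT_nonneg (ε := ε) (f := f) (u := u) (gu := gu) (uh := uh)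
      (T := T))] at h
    calc _ ≤ Rs * (∑ T ∈ 𝒯.elemsIn (strip x i), N T ^ 2) * θ ^ 2 := mul_le_mul_of_nonneg_right h (sq_nonneg _)
      _ = Rs * ((∑ T ∈ 𝒯.elemsIn (strip x i), N T ^ 2) * θ ^ 2) := by ring
      _ ≤ _ := mul_le_mul_of_nonneg_left hb hR0
  -- From 2 V J = V² + J² - (J - V)² at both endpoints of each edge, with the squares of V dropped.
  have hlow : As / 2 - (nodeConst C L * C ^ 3 * (C * (3 * Rs))) / 4 ≤ θ * P := by
    have h : As / 2 - (∑ S ∈ 𝒯.edgesOn (x i), ∑ z ∈ S, ε ^ 2 * θ * edgeLength S * (𝒯.jump uh S - V z) ^ 2) / 4 ≤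
        θ * P := by
      rw [hAs, Finset.sum_div, Finset.sum_div, ← Finset.sum_sub_distrib, Finset.mul_sum]
      refine Finset.sum_le_sum fun S hS => ?_
      obtain ⟨⟨-, -, -, hcard⟩, -⟩ := mem_edgesOn.1 hS
      obtain ⟨p, q, hpq, rfl⟩ := Finset.card_eq_two.1 hcard
      rw [Finset.sum_pair hpq, Finset.sum_pair hpq, edgeSq]
      have hl : 0 ≤ edgeLength {p, q} := Metric.diam_nonneg
      have : 0 ≤ ε ^ 2 * θ * edgeLength {p, q} * (V p ^ 2 + V q ^ 2) := by positivity
      nlinarith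
    linarith
  set Z := ∑ T ∈ 𝒯.elems, √(errT ε f u gu uh T) * N T
  set Q := (2 + L) ^ 2 * (testConst C K * C)
  have hPZ : θ * P ≤ (2 + L) * Z * θ := by
    have := (le_abs_self P).trans hres
    nlinarith
  have hY : ((2 + L) * Z * θ) ^ 2 ≤ Q * Rs * (2 * As + 3 * Rs) := by
    calc ((2 + L) * Z * θ) ^ 2 = (2 + L) ^ 2 * (Z ^ 2 * θ ^ 2) := by ring
      _ ≤ (2 + L) ^ 2 * (Rs * (testConst C K * (C * (2 * As + 3 * Rs)))) :=
          mul_le_mul_of_nonneg_left hCS (sq_nonneg _)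
      _ = _ := by ring
  have hQ0 : 0 ≤ Q := by
    have ht : 0 ≤ testConst C K := by unfold testConst; positivity
    positivity
  -- Young's inequality with the weight 1/8 chosen so that only As/4 appears on the right; it is
  -- absorbed by As/2 on the left, which leads to the factor 8 in the result.
  have hYle : (2 + L) * Z * θ ≤ 2 * (Q * Rs) + (2 * As + 3 * Rs) / 8 := by
    refine abs_le_of_sq_le_sq' ?_ (by positivity) |>.2
    nlinarith [sq_nonneg (2 * (Q * Rs) - (2 * As + 3 * Rs) / 8)]
  nlinarith

end

/-! ### The final estimate -/

section
variable {𝒯 : Triangulation unitSquare} {n : ℕ} {x : ℕ → ℝ} (M : Mesh 𝒯 n x) {i : ℕ} (hi : 0 < i) (hin : i < n)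
include M hi hin

lemma strip_subset_unitSquare : vstrip (x (i - 1)) (x (i + 1)) ⊆ unitSquare := by
  have h0 : 0 ≤ x (i - 1) := by
    rcases Nat.eq_zero_or_pos (i - 1) with h | h
    · rw [h, M.x_zero]
    · exact (M.x_pos h (by omega)).le
  have h1 : x (i + 1) ≤ 1 := by
    rcases Nat.lt_or_ge (i + 1) n with h | h
    · exact (M.x_lt_one h).le
    · rw [show i + 1 = n by omega, M.x_last]
  rintro p ⟨h2, h3, h4⟩
  exact ⟨by linarith, by linarith, h4⟩

/-- The patch of a short edge has area about X₀|S|, so the weight of the theorem is at most C min(ε,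
X₀)|S|. -/
lemma min_mul_jump_le {ε C : ℝ} (hε : 0 < ε) (R : Reg 𝒯 C) {uh : Pt → ℝ} {S : Finset Pt} (hS : S ∈ 𝒯.edgesOn (x i)) :
    min (ε * edgeLength S) (𝒯.edgePatchArea S) * (ε * 𝒯.jump uh S) ^ 2 ≤
      C * edgeSq 𝒯 ε (x i - x (i - 1)) uh S := by
  obtain ⟨⟨-, -, -, hcard⟩, -⟩ := mem_edgesOn.1 hS
  obtain ⟨z, hz⟩ := Finset.card_pos.1 (by rw [hcard]; norm_num : 0 < S.card)
  obtain ⟨T, hT, T', hT', s1, s2, w1, w2, he, hne⟩ := edge_data M hi hin hS hz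
  obtain ⟨c1, c2⟩ := col_width M hi hin R ⟨S, hS⟩
  obtain ⟨c3, c4⟩ := M.lt_cols hi hin
  have hC := R.one_le
  have hl : 0 ≤ edgeLength S := Metric.diam_nonneg
  have hX₀ : 0 < x i - x (i - 1) := by linarith
  have hp : 𝒯.edgePatchArea S ≤ C * (x i - x (i - 1)) * edgeLength S := by
    rw [Triangulation.edgePatchArea, he, Finset.sum_pair hne, M.area_eq_wd_se (Mesh.mem_elemsAt.1 hT).1,
      M.area_eq_wd_se (Mesh.mem_elemsAt.1 hT').1, s1, s2, w1, w2]
    have h1 := mul_le_mul_of_nonneg_right c1 hl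
    have h2 := mul_le_mul_of_nonneg_right (le_mul_of_one_le_left hX₀.le hC) hl
    linarith
  have hm : min (ε * edgeLength S) (𝒯.edgePatchArea S) ≤ C * (min ε (x i - x (i - 1)) * edgeLength S) := by
    rcases le_total ε (x i - x (i - 1)) with h | h
    · rw [min_eq_left h]
      refine (min_le_left _ _).trans ?_
      have : 0 ≤ ε * edgeLength S := by positivity
      nlinarith
    · rw [min_eq_right h]
      exact (min_le_right _ _).trans (by linarith)
  calc _ ≤ C * (min ε (x i - x (i - 1)) * edgeLength S) * (ε * 𝒯.jump uh S) ^ 2 :=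
        mul_le_mul_of_nonneg_right hm (sq_nonneg _)
    _ = _ := by rw [edgeSq]; ring

end

lemma Shape.nonneg {𝒯 : Triangulation unitSquare} {n : ℕ} {x : ℕ → ℝ} (M : Mesh 𝒯 n x) {N κ Λ : ℝ}
    (S : Shape 𝒯 N κ Λ) {T : Finset Pt} (hT : T ∈ 𝒯.elems) : 0 ≤ κ := by
  obtain ⟨p, q, r, rfl, -⟩ := M.elem' hT
  have h := S.altitude_le p _ (Mesh.mem_elemsAt.2 ⟨hT, by simp⟩) _ (Mesh.mem_elemsAt.2 ⟨hT, by simp⟩)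
  have hpos : 0 < altitude {p, q, r} := by
    have h1 := area_pos (M.cr_ne hT)
    have h2 := (M.wd_pos hT).trans_le (M.wd_le_maxEdge hT)
    unfold altitude; positivity
  by_contra! hκ
  nlinarith

lemma energySq_nonneg {ε Cf : ℝ} (hCf : 0 ≤ Cf) {D : Set Pt} {e : Pt → ℝ} {g : Pt → Pt} : 0 ≤ energySq ε Cf D e g := by
  have h1 : 0 ≤ ∫ p in D, ‖g p‖ ^ 2 := integral_nonneg fun _ => sq_nonneg _
  have h2 : 0 ≤ ∫ p in D, e p ^ 2 := integral_nonneg fun _ => sq_nonneg _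
  unfold energySq; positivity

/-- The mesh regularity constant. -/
def meshConst (κ lam1 N : ℝ) : ℝ :=
  5 + 9 * (|lam1| * |κ|) + (5 + 9 * (|lam1| * |κ|)) * |κ| +
    (5 + 9 * (|lam1| * |κ|)) * |κ| * (3 * N + |lam1| * |κ|) + N

/-- The constant in the sum over the edges on a mesh line. -/
def colConst (C L : ℝ) : ℝ :=
  3 * nodeConst C L * C ^ 4 + 8 * ((2 + L) ^ 2 * (testConst C (2 * nodeConst C L) * C)) + 2

lemma colConst_pos {C L : ℝ} (hC : 0 < C) (hL : 0 ≤ L) : 0 < colConst C L := by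
  have h1 : 0 ≤ nodeConst C L := by unfold nodeConst longConst; positivity
  have h2 : 0 ≤ testConst C (2 * nodeConst C L) := by unfold testConst; positivity
  unfold colConst; positivity

end AnisoFEM

end

theorem theorem9p1 (lam0 c₀ κ lam1 L : ℝ) (N₀ : ℕ) (hlam0 : lam0 < Real.pi) :
    ∃ C : ℝ, 0 < C ∧
      ∀ (ε Cf : ℝ) (f : Pt → ℝ → ℝ) (n : ℕ) (x : ℕ → ℝ)
        (𝒯 : Triangulation unitSquare) (apex : Finset Pt → Pt)
        (u : Pt → ℝ) (gu : Pt → Pt) (uh : Pt → ℝ) (Qh : (Pt → ℝ) → ℝ) (i : ℕ),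
        -- the equation
        0 < ε → ε ≤ 1 → 1 ≤ Cf + ε ^ 2 → IsAdmissible unitSquare f Cf L →
        -- the mesh
        x 0 = 0 → x n = 1 → (∀ k < n, x k < x (k + 1)) → 𝒯.IsAligned n x apex →
        𝒯.MaxAngle lam0 → (∀ z ∈ 𝒯.nodes, (𝒯.elemsAt z).card ≤ N₀) →
        (∀ z ∈ 𝒯.nodes, 𝒯.IsAnisotropicNode c₀ κ z) →
        (∀ z ∈ 𝒯.nodes, 𝒯.QuasiNonObtuseAt lam1 z) →
        -- the exact and the computed solutions
        IsWeakSolution unitSquare ε f u gu →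
        IsDiscreteSolution 𝒯 ε Qh uh →
        0 < i → i < n →
        -- the quadrature
        (NoQuadratureIn 𝒯 (strip x i) Qh (fun p => f p (uh p)) ∨
          (ContinuousOn (fun q : Pt × ℝ => f q.1 q.2) (closure unitSquare ×ˢ Set.univ) ∧
            ∃ Tstar : Finset (Finset Pt),
              (∀ vh : Pt → ℝ, 𝒯.IsFE vh →
                Qh vh = 𝒯.quadForm apex Tstar (fun p => f p (uh p)) vh) ∧
              ((∀ T ∈ 𝒯.elemsIn (strip x i), T ∈ Tstar) ∨
                (∀ T ∈ 𝒯.elemsIn (strip x i), T ∉ Tstar)))) →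
        ∑ S ∈ 𝒯.edgesOn (x i),
            min (ε * edgeLength S) (𝒯.edgePatchArea S) * (ε * 𝒯.jump uh S) ^ 2
          ≤ C * (energySq ε Cf (strip x i) (fun p => uh p - u p) (fun p => gradient uh p - gu p)
              + ∑ T ∈ 𝒯.elemsIn (strip x i),
                  area T * (min 1 (maxEdge T / ε) *
                    osc (fun p => f p (uh p)) (hull T ∩ unitSquare)) ^ 2) := by
  have hc0 : 0 < meshConst κ lam1 N₀ := by unfold meshConst; positivity
  have hk0 := colConst_pos hc0 (abs_nonneg L)
  -- Three factors: the change of weight on the left, the summation over the line, and the 2 from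
  -- the Poincaré step. Absolute values keep the constant positive before the signs of κ and L are
  -- known.
  refine ⟨meshConst κ lam1 N₀ * (colConst (meshConst κ lam1 N₀) |L| * 2), by positivity, ?_⟩
  intro ε Cf f n x 𝒯 apex u gu uh Qh i hε _ hCf hf hx0 hxn hmono hal _ hN hA hQ hu huh hi hin _
  have M : Mesh 𝒯 n x := Mesh.of_isAligned hx0 hxn hmono hal
  have S : Shape 𝒯 N₀ κ (|lam1| * κ) := Shape.of_hyps hN hA hQ
  -- Without an edge on the line the left side is 0. Otherwise an edge supplies the comparison of
  -- the two columns and an element from which κ ≥ 0 follows.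
  rcases (𝒯.edgesOn (x i)).eq_empty_or_nonempty with he | hne
  · rw [he, Finset.sum_empty]
    refine mul_nonneg (by positivity) (add_nonneg (energySq_nonneg hf.nonneg) (Finset.sum_nonneg fun T _ => ?_))
    exact mul_nonneg measureReal_nonneg (sq_nonneg _)
  have hκ : 0 ≤ κ := by
    obtain ⟨E, hE⟩ := hne
    obtain ⟨⟨T, hT, -⟩, -⟩ := mem_edgesOn.1 hE
    exact S.nonneg M hT
  obtain ⟨C, hC, R⟩ := M.reg S (by positivity) hκ
  have hCm : C = meshConst κ lam1 N₀ := by rw [hC, meshConst, abs_of_nonneg hκ]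
  have hL : |L| = L := abs_of_nonneg (hf.nonneg.trans hf.lip_nonneg)
  rw [← hCm, hL] at hk0 ⊢
  rw [← hCm] at hc0
  have Sl : Sol 𝒯 ε Cf L f u gu uh := ⟨hε, hCf, hf, hu, huh.1⟩
  obtain ⟨g, A⟩ := exists_pa huh.1
  have h1 := sum_edgeSq_le M hi hin Sl R A hne
  have h2 := Sl.sum_errT_le M (strip_subset_unitSquare M hi hin)
  rw [← colConst] at h1
  calc _ ≤ ∑ E ∈ 𝒯.edgesOn (x i), C * edgeSq 𝒯 ε (x i - x (i - 1)) uh E :=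
        Finset.sum_le_sum fun E hE => min_mul_jump_le M hi hin hε R hE
    _ = C * ∑ E ∈ 𝒯.edgesOn (x i), edgeSq 𝒯 ε (x i - x (i - 1)) uh E := by rw [Finset.mul_sum]
    _ ≤ C * (colConst C L * ∑ T ∈ 𝒯.elemsIn (strip x i), errT ε f u gu uh T) :=
        mul_le_mul_of_nonneg_left h1 hc0.le
    _ ≤ C * (colConst C L * (2 * _)) :=
        mul_le_mul_of_nonneg_left (mul_le_mul_of_nonneg_left h2 hk0.le) hc0.le
    _ = _ := by ring
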